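/- Let $p\ge 3$ be a prime. A frame $\underline S=(S,\sigma,\tau)$ is a commutative $\mathbb Z$-graded ring $S=\bigoplus_n S_n$ with ring homomorphisms $\sigma,\tau:S\to S_0$ such that $\tau|_{S_0}=\mathrm{id}$, $\tau:S_{-n}\to S_0$ is bijective for $n\ge 1$, $\sigma|_{S_0}$ is a lift of the $p$-Frobenius of $S_0/p$, $\sigma(t)=p$ for the unique $t\in S_{-1}$ with $\tau(t)=1$, and $p$ lies in the Jacobson radical of $S_0$; put $R=S_0/tS_1$, and let $\rho:S\to R$ be the ring homomorphism that extends $S_0\to R$ by zero on $S_n$ for $n\ne 0$. The frame is $p$-adic if every $S_n$ is $p$-adically complete and separated and $p$ is nilpotent in $R$. Homomorphisms of frames are homomorphisms of graded rings that commute with $\sigma$ and $\tau$. For a ring homomorphism $u$ with source $S$, write $M^u$ for the base change of an $S$-module $M$ along $u$. A display over $\underline S$ is a finite projective graded $S$-module $M$ with a $\sigma$-linear map $F:M\to M^\tau$ whose linearization $M^\sigma\to M^\tau$ is bijective. An orthogonal display is a display with a perfect symmetric $S$-bilinear form $\beta:M\times M\to S$ of degree zero such that $\sigma(\beta(x,y))=\beta^\tau(F(x),F(y))$;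 morphisms are homomorphisms of graded modules that commute with $F$ and preserve $\beta$. Let $\mu=(\mu_1\ge\dots\ge\mu_n)\in\mathbb Z^n$ be an orthogonal type, i.e. $\mu_i+\mu_{n+1-i}=0$ for all $i$. A display has type $\mu$ if for all $i\in\mathbb Z$ the degree-$i$ component of $M^\rho$ has constant rank over $R$ equal to the multiplicity of $i$ in $\mu$. Let $J$ be the antidiagonal $n\times n$ matrix with entries $1$, let $\psi(x,y)=x^tJy$, and let $G=\mathrm O(\psi)=\{g\in\mathrm{GL}_n\mid g^tJg=J\}$, with cocharacter $\mu(\lambda)=\mathrm{diag}(\lambda^{\mu_1},\dots,\lambda^{\mu_n})$. The display group $G(S)_\mu\subseteq G(S)$ is the group of $\mathbb G_m$-equivariant morphisms $\operatorname{Spec}S\to G$, where $\mathbb G_m$ acts on $\operatorname{Spec}S$ through the grading and on $G$ by $g*\lambda=\mu(\lambda)^{-1}g\mu(\lambda)$. Let $\underline S$ be a $p$-adic frame. Then there is an étale base change of $\underline S$, that is, a functor $R'\mapsto\underline{\mathbf S}(R')$ from étale $R$-algebras to frames, with compatible homomorphisms $\underline S\to\underline{\mathbf S}(R')$, such that $\underline{\mathbf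 S}(R')$ is a $p$-adic frame for $R'$ (naturally in $R'$ and compatibly with $R\to R'$), $S_0/p^i\to\mathbf S(R')_0/p^i$ is étale, $R\otimes_{S_0}\mathbf S(R')_0=R'$, and $S/p^i\otimes_{S_0}\mathbf S(R')_0=\mathbf S(R')/p^i$ for all $i$. An $\mathrm O(\psi)$-display of type $\mu$ over $\underline S$ is a pair $(Q,\alpha)$ where $Q$ is an étale (right) $G(\mathbf S)_\mu$-torsor over $\operatorname{Spec}R$ and $\alpha:Q\to G(\mathbf S_0)$ is a map of sheaves with $\alpha(qh)=\tau(h)^{-1}\alpha(q)\sigma(h)$; morphisms are equivariant maps of torsors that commute with $\alpha$. For every étale base change $\underline{\mathbf S}$ of $\underline S$, the category of orthogonal displays of type $\mu$ over $\underline S$ is equivalent to the category (groupoid) of $\mathrm O(\psi)$-displays of type $\mu$ over $\underline S$. -/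

import Mathlib

universe u

open CategoryTheory TensorProduct
open scoped LaurentPolynomial

noncomputable section

namespace Displays

/-! ### Base change of modules along a ring homomorphism -/

section BaseChange

variable {A : Type u} {B : Type u} [CommRing A] [CommRing B]

/-- For a ring homomorphism `f : A → B` and an `A`-module `M`, the `B`-module `B ⊗_{f, A} M`. -/
def BC (f : A →+* B) (M : Type u) [AddCommGroup M] [Module A M] : Type u :=
  letI := f.toAlgebra
  B ⊗[A] M

namespace BC

variable (f : A →+* B) {M N : Type u} [AddCommGroup M] [Module A M] [AddCommGroup N] [Module A N]

instance : AddCommGroup (BC f M) :=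
  letI := f.toAlgebra
  (inferInstance : AddCommGroup (B ⊗[A] M))

instance : Module B (BC f M) :=
  letI := f.toAlgebra
  (inferInstance : Module B (B ⊗[A] M))

/-- The pure tensor `b ⊗ m`. -/
def mk (b : B) (m : M) : BC f M :=
  letI := f.toAlgebra
  b ⊗ₜ[A] m

/-- The map `id ⊗ g` induced by a linear map `g`. -/
def map (g : M →ₗ[A] N) : BC f M →ₗ[B] BC f N :=
  letI := f.toAlgebra
  LinearMap.baseChange B g

/-- The `B`-bilinear form on `B ⊗_{f, A} M` induced by an `A`-bilinear form on `M`. -/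
def bilin (b : LinearMap.BilinForm A M) : LinearMap.BilinForm B (BC f M) :=
  letI := f.toAlgebra
  LinearMap.BilinForm.baseChange B b

/-- The `B`-linear map `B ⊗_{f, A} M → P`, `b ⊗ m ↦ b • g m`, corresponding to an `f`-linear map
`g : M → P`. -/
def lift {f : A →+* B} {P : Type u} [AddCommGroup P] [Module B P] (g : M →ₛₗ[f] P) :
    BC f M →ₗ[B] P :=
  letI := f.toAlgebra
  letI : Module A P := Module.compHom P f
  haveI : IsScalarTower A B P := ⟨fun a b x => by
    change (f a * b) • x = f a • (b • x)
    rw [mul_smul]⟩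
  LinearMap.liftBaseChange B
    ({ toFun := g, map_add' := g.map_add, map_smul' := fun a m => g.map_smulₛₗ a m } : M →ₗ[A] P)

theorem lift_mk {f : A →+* B} {P : Type u} [AddCommGroup P] [Module B P] (g : M →ₛₗ[f] P)
    (b : B) (m : M) : lift g (mk f b m) = b • g m := by
  let := f.toAlgebra
  let : Module A P := Module.compHom P f
  have : IsScalarTower A B P := ⟨fun a b x => by
    change (f a * b) • x = f a • (b • x)
    rw [mul_smul]⟩
  exact LinearMap.liftBaseChange_tmul (R := A) (A := B) (M := M) (N := P) _ _ _

theorem map_mk (g : M →ₗ[A] N) (b : B) (m : M) : map f g (mk f b m) = mk f b (g m) := by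
  let := f.toAlgebra
  exact LinearMap.baseChange_tmul (R := A) (A := B) (M := M) (N := N) _ _ _

theorem bilin_mk (β : LinearMap.BilinForm A M) (b c : B) (m n : M) :
    bilin f β (mk f b m) (mk f c n) = f (β m n) * (b * c) := by
  let := f.toAlgebra
  exact LinearMap.BilinForm.baseChange_tmul _ _ _ _ _

theorem map_id : map f (LinearMap.id : M →ₗ[A] M) = LinearMap.id := by
  let := f.toAlgebra
  exact LinearMap.baseChange_id

theorem map_comp {P : Type u} [AddCommGroup P] [Module A P] (h : N →ₗ[A] P) (g : M →ₗ[A] N) :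
    map f (h ∘ₗ g) = map f h ∘ₗ map f g := by
  let := f.toAlgebra
  exact LinearMap.baseChange_comp (R := A) (A := B) (f := g) h

end BC

end BaseChange

/-! ### Frames -/

/-- A (higher) frame: a `ℤ`-graded ring `S` with ring homomorphisms `σ, τ : S → S₀` such that
`τ₀ = id`, `τ₋ₙ` is bijective for `n ≥ 1`, `σ₀` is a Frobenius lift, `σ(t) = p` for the element
`t ∈ S₋₁` with `τ(t) = 1`, and `p` lies in the Jacobson radical of `S₀`. -/
structure Frame (p : ℕ) where
  carrier : Type u
  [commRing : CommRing carrier]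
  grading : ℤ → AddSubgroup carrier
  [gradedRing : GradedRing grading]
  sigma : carrier →+* grading 0
  tau : carrier →+* grading 0
  tau_zero : ∀ a : grading 0, tau a = a
  tau_neg : ∀ n : ℕ, 1 ≤ n → Function.Bijective fun x : grading (-(n : ℤ)) => tau x
  sigma_zero : ∀ a : grading 0, ∃ b : grading 0, sigma a = a ^ p + p * b
  sigma_t : ∀ x ∈ grading (-1), tau x = 1 → sigma x = p
  p_mem_jacobson : (p : grading 0) ∈ (⊥ : Ideal (grading 0)).jacobson

attribute [instance] Frame.commRing Frame.gradedRing

namespace Frame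

variable {p : ℕ} (S : Frame.{u} p)

theorem exists_t : ∃ t : S.carrier, t ∈ S.grading (-1) ∧ S.tau t = 1 := by
  obtain ⟨x, hx⟩ := (S.tau_neg 1 le_rfl).2 1
  exact ⟨x, x.2, hx⟩

/-- The element `t ∈ S₋₁` with `τ(t) = 1`. -/
def t : S.carrier := S.exists_t.choose

theorem t_mem : S.t ∈ S.grading (-1) := S.exists_t.choose_spec.1

theorem tau_t : S.tau S.t = 1 := S.exists_t.choose_spec.2

theorem tau_injOn (n : ℕ) (hn : 1 ≤ n) {x y : S.carrier} (hx : x ∈ S.grading (-(n : ℤ)))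
    (hy : y ∈ S.grading (-(n : ℤ))) (h : S.tau x = S.tau y) : x = y :=
  congrArg Subtype.val ((S.tau_neg n hn).1 (a₁ := ⟨x, hx⟩) (a₂ := ⟨y, hy⟩) h)

/-- The ideal `t S₁` of `S₀`. -/
def tIdeal : Ideal (S.grading 0) where
  carrier := {x | ∃ s ∈ S.grading 1, (x : S.carrier) = S.t * s}
  add_mem' := by
    rintro a b ⟨s, hs, ha⟩ ⟨s', hs', hb⟩
    refine ⟨s + s', add_mem hs hs', ?_⟩
    push_cast
    rw [ha, hb, mul_add]
  zero_mem' := ⟨0, zero_mem _, by simp⟩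
  smul_mem' := by
    rintro c x ⟨s, hs, hx⟩
    refine ⟨c * s, by simpa using SetLike.mul_mem_graded c.2 hs, ?_⟩
    change (c : S.carrier) * x = _
    rw [hx]
    ring

/-- The ring `R = S₀ / t S₁`; one says that `S` is a frame for `R`. -/
def residue : Type u := S.grading 0 ⧸ S.tIdeal

instance : CommRing S.residue := inferInstanceAs (CommRing (S.grading 0 ⧸ S.tIdeal))

/-- The projection `S₀ → R`. -/
def toResidue : S.grading 0 →+* S.residue := Ideal.Quotient.mk S.tIdeal

theorem toResidue_eq_zero {x : S.grading 0} : S.toResidue x = 0 ↔ x ∈ S.tIdeal :=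
  Ideal.Quotient.eq_zero_iff_mem

theorem toResidue_surjective : Function.Surjective S.toResidue :=
  Ideal.Quotient.mk_surjective

theorem eq_t_pow_mul (n : ℕ) (hn : 1 ≤ n) {x : S.carrier} (hx : x ∈ S.grading (-(n : ℤ))) :
    x = S.t ^ n * (S.tau x : S.carrier) := by
  refine S.tau_injOn n hn hx ?_ ?_
  · have h1 := SetLike.pow_mem_graded n S.t_mem
    have h2 := SetLike.mul_mem_graded h1 (S.tau x).2
    simpa using h2
  · rw [map_mul, map_pow, tau_t, one_pow, one_mul, tau_zero]

theorem mul_mem_tIdeal_aux (n : ℕ) (hn : 1 ≤ n) {x y : S.carrier}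
    (hx : x ∈ S.grading (-(n : ℤ))) (hy : y ∈ S.grading n) (h : x * y ∈ S.grading 0) :
    (⟨x * y, h⟩ : S.grading 0) ∈ S.tIdeal := by
  obtain ⟨m, rfl⟩ : ∃ m, n = m + 1 := ⟨n - 1, by omega⟩
  refine ⟨S.t ^ m * (S.tau x : S.carrier) * y, ?_, ?_⟩
  · have h1 := SetLike.pow_mem_graded m S.t_mem
    have h2 := SetLike.mul_mem_graded (SetLike.mul_mem_graded h1 (S.tau x).2) hy
    convert h2 using 2
    simp
  · change x * y = _
    conv_lhs => rw [S.eq_t_pow_mul (m + 1) hn hx]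
    ring

theorem mul_mem_tIdeal {i j : ℤ} (hi : i ≠ 0) (hij : i + j = 0) {x y : S.carrier}
    (hx : x ∈ S.grading i) (hy : y ∈ S.grading j) (h : x * y ∈ S.grading 0) :
    (⟨x * y, h⟩ : S.grading 0) ∈ S.tIdeal := by
  rcases lt_or_gt_of_ne hi with h0 | h0
  · obtain ⟨n, rfl⟩ : ∃ n : ℕ, i = -(n : ℤ) := ⟨i.natAbs, by omega⟩
    obtain rfl : j = n := by omega
    exact S.mul_mem_tIdeal_aux n (by omega) hx hy h
  · obtain ⟨n, rfl⟩ : ∃ n : ℕ, i = (n : ℤ) := ⟨i.natAbs, by omega⟩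
    obtain rfl : j = -(n : ℤ) := by omega
    have h' : y * x ∈ S.grading 0 := by rwa [mul_comm]
    have := S.mul_mem_tIdeal_aux n (by omega) hy hx h'
    convert this using 2
    exact mul_comm _ _

/-- The component of degree `i` of `ρ`. -/
def rhoComp (i : ℤ) : S.grading i →+ S.residue :=
  if h : i = 0 then
    S.toResidue.toAddMonoidHom.comp
      { toFun := fun x => (⟨x, h ▸ x.2⟩ : S.grading 0)
        map_zero' := rfl
        map_add' := fun _ _ => rfl }
  else 0

theorem rhoComp_zero (x : S.grading 0) : S.rhoComp 0 x = S.toResidue x := by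
  simp [rhoComp]

theorem rhoComp_ne {i : ℤ} (h : i ≠ 0) (x : S.grading i) : S.rhoComp i x = 0 := by
  simp [rhoComp, h]

/-- The ring homomorphism `ρ : S → R` which extends the projection `S₀ → R` by zero on all `Sₙ`
with `n ≠ 0`. -/
def rho : S.carrier →+* S.residue :=
  (DirectSum.toSemiring S.rhoComp
    (by
      change S.rhoComp 0 (1 : S.grading 0) = 1
      rw [rhoComp_zero, map_one])
    (by
      intro i j a b
      by_cases hi : i = 0
      · subst hi
        by_cases hj : j = 0
        · subst hj
          rw [rhoComp_zero, rhoComp_zero, ← map_mul]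
          have : (0 : ℤ) + 0 = 0 := rfl
          exact S.rhoComp_zero _
        · rw [S.rhoComp_ne hj, S.rhoComp_ne (by simpa using hj), mul_zero]
      · rw [S.rhoComp_ne hi, zero_mul]
        by_cases hij : i + j = 0
        · simp only [rhoComp, hij, dif_pos]
          exact S.toResidue_eq_zero.2 (S.mul_mem_tIdeal hi hij a.2 b.2 _)
        · exact S.rhoComp_ne hij _)).comp
    (DirectSum.decomposeRingEquiv S.grading).toRingHom

theorem rho_of_mem_zero (x : S.grading 0) : S.rho (x : S.carrier) = S.toResidue x := by
  have h : (DirectSum.decomposeRingEquiv S.grading).toRingHom (x : S.carrier) =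
    DirectSum.decompose S.grading (x : S.carrier) := rfl
  rw [rho, RingHom.comp_apply, h, DirectSum.decompose_coe, DirectSum.toSemiring_of, rhoComp_zero]

theorem rho_of_mem_ne {i : ℤ} (hi : i ≠ 0) {x : S.carrier} (hx : x ∈ S.grading i) :
    S.rho x = 0 := by
  have h : (DirectSum.decomposeRingEquiv S.grading).toRingHom x =
    DirectSum.decompose S.grading x := rfl
  rw [rho, RingHom.comp_apply, h, DirectSum.decompose_of_mem _ hx, DirectSum.toSemiring_of, S.rhoComp_ne hi]

/-- A frame is `p`-adic if each `Sₙ` is a `p`-adically complete and separated abelian group and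
`p` is nilpotent in `R`. -/
structure IsPAdic : Prop where
  complete : ∀ n : ℤ, IsAdicComplete (Ideal.span {(p : ℤ)}) (S.grading n)
  nilpotent : IsNilpotent (p : S.residue)

/-- A homomorphism of frames: a homomorphism of graded rings that commutes with `σ` and `τ`. -/
@[ext]
structure Hom (S S' : Frame.{u} p) where
  toRingHom : S.carrier →+* S'.carrier
  map_mem : ∀ (n : ℤ) (x : S.carrier), x ∈ S.grading n → toRingHom x ∈ S'.grading n
  map_sigma : ∀ x : S.carrier, toRingHom (S.sigma x) = S'.sigma (toRingHom x)
  map_tau : ∀ x : S.carrier, toRingHom (S.tau x) = S'.tau (toRingHom x)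

instance : Category (Frame.{u} p) where
  Hom S S' := Hom S S'
  id S :=
    { toRingHom := RingHom.id _
      map_mem := fun _ _ h => h
      map_sigma := fun _ => rfl
      map_tau := fun _ => rfl }
  comp f g :=
    { toRingHom := g.toRingHom.comp f.toRingHom
      map_mem := fun n x h => g.map_mem n _ (f.map_mem n x h)
      map_sigma := fun x => by
        rw [RingHom.comp_apply, f.map_sigma, g.map_sigma, RingHom.comp_apply]
      map_tau := fun x => by
        rw [RingHom.comp_apply, f.map_tau, g.map_tau, RingHom.comp_apply] }

namespace Hom

variable {S} {S' : Frame.{u} p}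

/-- The map `S₀ → S'₀` induced by a homomorphism of frames. -/
def zero (f : S ⟶ S') : S.grading 0 →+* S'.grading 0 where
  toFun x := ⟨f.toRingHom x, f.map_mem 0 x x.2⟩
  map_one' := Subtype.ext (map_one f.toRingHom)
  map_mul' x y := Subtype.ext (map_mul f.toRingHom (x : S.carrier) y)
  map_zero' := Subtype.ext (map_zero f.toRingHom)
  map_add' x y := Subtype.ext (map_add f.toRingHom (x : S.carrier) y)

theorem map_t (f : S ⟶ S') : f.toRingHom S.t = S'.t := by
  refine S'.tau_injOn 1 le_rfl ?_ ?_ ?_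
  · exact f.map_mem _ _ (by simpa using S.t_mem)
  · simpa using S'.t_mem
  · rw [tau_t]
    apply Subtype.ext
    rw [← f.map_tau, tau_t]
    exact map_one f.toRingHom

/-- The map `R → R'` induced by a homomorphism of frames. -/
def residue (f : S ⟶ S') : S.residue →+* S'.residue :=
  Ideal.quotientMap S'.tIdeal (zero f) (by
    rintro x ⟨s, hs, hx⟩
    refine ⟨f.toRingHom s, f.map_mem 1 s hs, ?_⟩
    change f.toRingHom x = _
    rw [hx, map_mul, map_t])

end Hom

end Frame

/-! ### The étale site and the sheaf of frames associated to a `p`-adic frame -/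

section Site

/-- The category of étale `R`-algebras, i.e. the opposite of the category of affine étale
`R`-schemes. -/
abbrev EtAlg (R : Type u) [CommRing R] : Type (u + 1) :=
  ObjectProperty.FullSubcategory fun A : CommAlgCat.{u} R => Algebra.Etale R A

variable {R : Type u} [CommRing R]

/-- The algebra homomorphism underlying a morphism of étale `R`-algebras. -/
def EtAlg.algHom {A B : EtAlg R} (f : A ⟶ B) : A.obj →ₐ[R] B.obj := f.hom.hom

variable (R) in
/-- `R` as an étale `R`-algebra. -/
def EtAlg.self : EtAlg R := ⟨CommAlgCat.of R R, inferInstanceAs (Algebra.Etale R R)⟩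

/-- A finite family of homomorphisms `A → Bᵢ` of étale `R`-algebras is an étale covering
if the family `Spec Bᵢ → Spec A` is jointly surjective. -/
def IsEtaleCover {A : EtAlg R} {ι : Type} (B : ι → EtAlg R) (f : ∀ i, A ⟶ B i) : Prop :=
  Finite ι ∧ ∀ q : PrimeSpectrum A.obj, ∃ (i : ι) (q' : PrimeSpectrum (B i).obj),
    PrimeSpectrum.comap (EtAlg.algHom (f i)).toRingHom q' = q

/-- The sheaf condition for the étale topology on affine étale `R`-schemes. -/
def IsEtaleSheaf (Q : EtAlg R ⥤ Type u) : Prop :=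
  ∀ ⦃A : EtAlg R⦄ ⦃ι : Type⦄ (B : ι → EtAlg R) (f : ∀ i, A ⟶ B i), IsEtaleCover B f →
    ∀ x : ∀ i, Q.obj (B i),
      (∀ (i j : ι) (C : EtAlg R) (g : B i ⟶ C) (h : B j ⟶ C), f i ≫ g = f j ≫ h →
        Q.map g (x i) = Q.map h (x j)) →
      ∃! y : Q.obj A, ∀ i, Q.map (f i) y = x i

/-- A (right) torsor for the étale topology on `Spec R` under a presheaf of groups on affine
étale `R`-schemes. -/
structure EtaleTorsor (H : EtAlg R ⥤ GrpCat.{u}) where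
  sheaf : EtAlg R ⥤ Type u
  isSheaf : IsEtaleSheaf sheaf
  act : ∀ A : EtAlg R, sheaf.obj A → H.obj A → sheaf.obj A
  act_one : ∀ A q, act A q 1 = q
  act_mul : ∀ A q g h, act A q (g * h) = act A (act A q g) h
  act_map : ∀ {A B : EtAlg R} (f : A ⟶ B) q h,
    sheaf.map f (act A q h) = act B (sheaf.map f q) ((H.map f).hom h)
  simply_transitive : ∀ A q q', ∃! h, act A q h = q'
  locally_nonempty : ∃ (ι : Type) (B : ι → EtAlg R) (f : ∀ i, EtAlg.self R ⟶ B i),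
    IsEtaleCover B f ∧ ∀ i, Nonempty (sheaf.obj (B i))

end Site

/-- Reduction modulo `p ^ i`. -/
abbrev ModPow (A : Type u) [CommRing A] (p i : ℕ) : Type u := A ⧸ Ideal.span {(p : A) ^ i}

/-- The map `A / p ^ i → B / p ^ i` induced by a ring homomorphism. -/
def ModPow.map {A B : Type u} [CommRing A] [CommRing B] (f : A →+* B) (p i : ℕ) :
    ModPow A p i →+* ModPow B p i :=
  Ideal.quotientMap _ f (by
    rw [Ideal.span_le, Set.singleton_subset_iff]
    change f ((p : A) ^ i) ∈ Ideal.span {(p : B) ^ i}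
    rw [map_pow, map_natCast]
    exact Ideal.mem_span_singleton_self _)

/-- The étale base change of a frame `S` for `R`: a functor `R' ↦ 𝐒(R')` from étale `R`-algebras
to frames, with frame homomorphisms `S → 𝐒(R')`, such that `𝐒(R')` is a `p`-adic frame for `R'`,
`S₀/pⁱ → 𝐒(R')₀/pⁱ` is étale, `R ⊗_{S₀} 𝐒(R')₀ = R'` and `S/pⁱ ⊗_{S₀} 𝐒(R')₀ = 𝐒(R')/pⁱ`. (For
commutative rings, tensor products are pushouts.) -/
structure EtaleBaseChange {p : ℕ} (S : Frame.{u} p) where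
  frame : EtAlg S.residue ⥤ Frame.{u} p
  unit : ∀ A : EtAlg S.residue, S ⟶ frame.obj A
  unit_map : ∀ {A B : EtAlg S.residue} (f : A ⟶ B), unit A ≫ frame.map f = unit B
  residueEquiv : ∀ A : EtAlg S.residue, (frame.obj A).residue ≃+* A.obj
  residueEquiv_unit : ∀ (A : EtAlg S.residue) (r : S.residue),
    residueEquiv A (Frame.Hom.residue (unit A) r) = algebraMap S.residue A.obj r
  residueEquiv_map : ∀ {A B : EtAlg S.residue} (f : A ⟶ B) (r : (frame.obj A).residue),
    residueEquiv B (Frame.Hom.residue (frame.map f) r) = EtAlg.algHom f (residueEquiv A r)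
  isPAdic : ∀ A : EtAlg S.residue, (frame.obj A).IsPAdic
  etale : ∀ (A : EtAlg S.residue) (i : ℕ), (ModPow.map (Frame.Hom.zero (unit A)) p i).Etale
  residue_pushout : ∀ A : EtAlg S.residue,
    IsPushout (CommRingCat.ofHom S.toResidue) (CommRingCat.ofHom (Frame.Hom.zero (unit A)))
      (CommRingCat.ofHom (Frame.Hom.residue (unit A)))
      (CommRingCat.ofHom (frame.obj A).toResidue)
  mod_pushout : ∀ (A : EtAlg S.residue) (i : ℕ),
    IsPushout
      (CommRingCat.ofHom ((Ideal.Quotient.mk (Ideal.span {(p : S.carrier) ^ i})).comp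
        (algebraMap (S.grading 0) S.carrier)))
      (CommRingCat.ofHom (Frame.Hom.zero (unit A)))
      (CommRingCat.ofHom (ModPow.map (unit A).toRingHom p i))
      (CommRingCat.ofHom
        ((Ideal.Quotient.mk (Ideal.span {(p : (frame.obj A).carrier) ^ i})).comp
          (algebraMap ((frame.obj A).grading 0) (frame.obj A).carrier)))

/-! ### Orthogonal displays -/

section OrthogonalDisplays

variable {p : ℕ}

/-- A finite projective graded module over (the graded ring of) a frame. -/
structure GrMod (S : Frame.{u} p) where
  carrier : Type u
  [addCommGroup : AddCommGroup carrier]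
  [module : Module S.carrier carrier]
  grading : ℤ → AddSubgroup carrier
  [decomposition : DirectSum.Decomposition grading]
  [gradedSMul : SetLike.GradedSMul S.grading grading]
  [finite : Module.Finite S.carrier carrier]
  [projective : Module.Projective S.carrier carrier]

attribute [instance] GrMod.addCommGroup GrMod.module GrMod.decomposition GrMod.gradedSMul
  GrMod.finite GrMod.projective

/-- The degree `i` component of the graded `R`-module `M ⊗_{S, ρ} R`. -/
def GrMod.redPiece {S : Frame.{u} p} (M : GrMod S) (i : ℤ) :
    Submodule S.residue (BC S.rho M.carrier) :=
  Submodule.span S.residue {x | ∃ m ∈ M.grading i, x = BC.mk S.rho 1 m}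

/-- `M` has type `μ` if for each `i` the rank of the degree `i` component of `M ⊗_{S, ρ} R` is
equal to the multiplicity of `i` in `μ`, at every point of `Spec R`. -/
def GrMod.HasType {S : Frame.{u} p} (M : GrMod S) {n : ℕ} (μ : Fin n → ℤ) : Prop :=
  ∀ (i : ℤ) (q : PrimeSpectrum S.residue),
    Module.rankAtStalk (R := S.residue) (M.redPiece i) q = Fintype.card {j : Fin n // μ j = i}

/-- A display over `S`: a finite projective graded `S`-module `M` with a `σ`-linear isomorphism
`F : M → M^τ`. -/
structure Display (S : Frame.{u} p) extends GrMod S where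
  F : carrier →ₛₗ[S.sigma] BC S.tau carrier
  F_bijective : Function.Bijective (BC.lift F)

/-- An orthogonal display: a display with a perfect symmetric bilinear form with values in
the unit display `(S, σ)`. -/
structure OrthDisplay (S : Frame.{u} p) extends Display S where
  form : LinearMap.BilinForm S.carrier carrier
  form_symm : ∀ x y, form x y = form y x
  form_mem : ∀ (i j : ℤ) (x y : carrier), x ∈ grading i → y ∈ grading j →
    form x y ∈ S.grading (i + j)
  form_perfect : Function.Bijective form
  form_F : ∀ x y, S.sigma (form x y) = BC.bilin S.tau form (F x) (F y)

/-- A homomorphism of orthogonal displays: a homomorphism of graded modules that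
commutes with `F` and preserves the bilinear forms. -/
@[ext]
structure OrthDisplay.Hom {S : Frame.{u} p} (M N : OrthDisplay S) where
  toLinearMap : M.carrier →ₗ[S.carrier] N.carrier
  map_mem : ∀ (i : ℤ) (x : M.carrier), x ∈ M.grading i → toLinearMap x ∈ N.grading i
  map_F : ∀ x : M.carrier, N.F (toLinearMap x) = BC.map S.tau toLinearMap (M.F x)
  map_form : ∀ x y : M.carrier, N.form (toLinearMap x) (toLinearMap y) = M.form x y

instance {S : Frame.{u} p} : Category (OrthDisplay S) where
  Hom M N := OrthDisplay.Hom M N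
  id M :=
    { toLinearMap := LinearMap.id
      map_mem := fun _ _ h => h
      map_F := fun x => by rw [BC.map_id]; rfl
      map_form := fun _ _ => rfl }
  comp f g :=
    { toLinearMap := g.toLinearMap ∘ₗ f.toLinearMap
      map_mem := fun i x h => g.map_mem i _ (f.map_mem i x h)
      map_F := fun x => by
        rw [BC.map_comp, LinearMap.comp_apply, LinearMap.comp_apply, g.map_F, f.map_F]
      map_form := fun x y => by
        rw [LinearMap.comp_apply, LinearMap.comp_apply, g.map_form, f.map_form] }

/-- The category of orthogonal displays of type `μ` over `S`. -/
abbrev OrthDisplayOfType (S : Frame.{u} p) {n : ℕ} (μ : Fin n → ℤ) : Type (u + 1) :=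
  ObjectProperty.FullSubcategory fun M : OrthDisplay S => M.toGrMod.HasType μ

/-- An orthogonal type: `μ₁ ≥ … ≥ μₙ` and `μᵢ + μₙ₊₁₋ᵢ = 0` for all `i`. -/
def IsOrthogonalType {n : ℕ} (μ : Fin n → ℤ) : Prop :=
  Antitone μ ∧ ∀ i, μ i + μ (Fin.rev i) = 0

end OrthogonalDisplays

/-! ### The orthogonal group and the display group -/

section Groups

open Matrix

/-- The matrix `J` with entries `1` on the antidiagonal and `0` elsewhere. -/
def antidiag (n : ℕ) (A : Type u) [CommRing A] : Matrix (Fin n) (Fin n) A :=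
  Matrix.of fun i j => if j = Fin.rev i then 1 else 0

/-- The group `O(ψ)(A) = {g ∈ GLₙ(A) | gᵗ J g = J}`. -/
def orthGroup (n : ℕ) (A : Type u) [CommRing A] : Subgroup (GL (Fin n) A) where
  carrier := {g | (g : Matrix (Fin n) (Fin n) A)ᵀ * antidiag n A * g = antidiag n A}
  one_mem' := by simp
  mul_mem' := by
    intro a b ha hb
    simp only [Set.mem_ofPred_eq, Units.val_mul, transpose_mul] at ha hb ⊢
    calc _ = (b : Matrix (Fin n) (Fin n) A)ᵀ * ((a : Matrix (Fin n) (Fin n) A)ᵀ * antidiag n A * a)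
          * b := by simp only [Matrix.mul_assoc]
      _ = _ := by rw [ha, hb]
  inv_mem' := by
    intro a ha
    simp only [Set.mem_ofPred_eq] at ha ⊢
    have h1 : (a : Matrix (Fin n) (Fin n) A) * (a⁻¹ : GL (Fin n) A) = 1 := by
      rw [← Units.val_mul, mul_inv_cancel, Units.val_one]
    have h2 : ((a⁻¹ : GL (Fin n) A) : Matrix (Fin n) (Fin n) A)ᵀ *
        (a : Matrix (Fin n) (Fin n) A)ᵀ = 1 := by
      rw [← transpose_mul, h1, transpose_one]
    calc _ = ((a⁻¹ : GL (Fin n) A) : Matrix (Fin n) (Fin n) A)ᵀ *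
          ((a : Matrix (Fin n) (Fin n) A)ᵀ * antidiag n A * a) * (a⁻¹ : GL (Fin n) A) := by rw [ha]
      _ = (((a⁻¹ : GL (Fin n) A) : Matrix (Fin n) (Fin n) A)ᵀ *
          (a : Matrix (Fin n) (Fin n) A)ᵀ) * antidiag n A *
          ((a : Matrix (Fin n) (Fin n) A) * (a⁻¹ : GL (Fin n) A)) := by
        simp only [Matrix.mul_assoc]
      _ = _ := by rw [h1, h2, Matrix.one_mul, Matrix.mul_one]

variable {n : ℕ}

theorem antidiag_map {A B : Type u} [CommRing A] [CommRing B] (f : A →+* B) :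
    (antidiag n A).map f = antidiag n B := by
  ext i j
  simp only [antidiag, Matrix.map_apply, Matrix.of_apply]
  split_ifs <;> simp

theorem map_mem_orthGroup {A B : Type u} [CommRing A] [CommRing B] (f : A →+* B)
    {g : GL (Fin n) A} (hg : g ∈ orthGroup n A) :
    Matrix.GeneralLinearGroup.map f g ∈ orthGroup n B := by
  change ((g : Matrix (Fin n) (Fin n) A).map f)ᵀ * antidiag n B *
    (g : Matrix (Fin n) (Fin n) A).map f = antidiag n B
  rw [← antidiag_map f, ← transpose_map, ← Matrix.map_mul, ← Matrix.map_mul]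
  exact congrArg (fun M : Matrix (Fin n) (Fin n) A => M.map f) hg

/-- The functoriality of `O(ψ)(A)` in `A`. -/
def orthGroup.map {A B : Type u} [CommRing A] [CommRing B] (f : A →+* B) :
    orthGroup n A →* orthGroup n B :=
  ((Matrix.GeneralLinearGroup.map f).comp (orthGroup n A).subtype).codRestrict _
    fun g => map_mem_orthGroup f g.2

/-- The cocharacter `x ↦ diag(x ^ μ₁, …, x ^ μₙ)` of `GLₙ`, on `A`-valued points. -/
def cochar {A : Type u} [CommRing A] (μ : Fin n → ℤ) (x : Aˣ) : GL (Fin n) A :=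
  Units.map (Matrix.diagonalRingHom (Fin n) A).toMonoidHom
    (MulEquiv.piUnits.symm fun i => x ^ μ i)

theorem map_cochar {A B : Type u} [CommRing A] [CommRing B] (f : A →+* B) (μ : Fin n → ℤ)
    (x : Aˣ) : Matrix.GeneralLinearGroup.map f (cochar μ x) =
      cochar μ (Units.map f.toMonoidHom x) := by
  ext i j
  change f (Matrix.diagonal (fun k => ((x ^ μ k : Aˣ) : A)) i j) =
    Matrix.diagonal (fun k => ((Units.map f.toMonoidHom x ^ μ k : Bˣ) : B)) i j
  simp only [Matrix.diagonal_apply]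
  split_ifs
  · rw [← map_zpow]; rfl
  · exact map_zero f

/-- The variable `T` as a unit of `A[T, T⁻¹]`, i.e. the universal point of `𝔾ₘ` over `A`. -/
def laurentUnit (A : Type u) [CommRing A] : A[T;T⁻¹]ˣ where
  val := LaurentPolynomial.T 1
  inv := LaurentPolynomial.T (-1)
  val_inv := by rw [← LaurentPolynomial.T_add]; simp
  inv_val := by rw [← LaurentPolynomial.T_add]; simp

/-- The map `A[T, T⁻¹] → B[T, T⁻¹]` induced by a ring homomorphism. -/
def laurentMap {A B : Type u} [CommRing A] [CommRing B] (f : A →+* B) : A[T;T⁻¹] →+* B[T;T⁻¹] :=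
  AddMonoidAlgebra.mapRingHom ℤ f

variable {p : ℕ}

/-- The map `S_d → S[T, T⁻¹]`, `s ↦ s Tᵈ`. -/
def Frame.coactionComp (S : Frame.{u} p) (d : ℤ) : S.grading d →+ S.carrier[T;T⁻¹] :=
  (AddMonoidAlgebra.singleAddHom d).comp (S.grading d).subtype

theorem Frame.coactionComp_one (S : Frame.{u} p) :
    S.coactionComp 0 (GradedMonoid.GOne.one (A := fun i => S.grading i)) = 1 :=
  (AddMonoidAlgebra.one_def (R := S.carrier) (M := ℤ)).symm

theorem Frame.coactionComp_mul (S : Frame.{u} p) {i j : ℤ} (a : S.grading i) (b : S.grading j) :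
    S.coactionComp (i + j) (GradedMonoid.GMul.mul (A := fun i => S.grading i) a b) =
      S.coactionComp i a * S.coactionComp j b :=
  (AddMonoidAlgebra.single_mul_single i j (a : S.carrier) b).symm

/-- The ring homomorphism `S → S[T, T⁻¹]`, `s ↦ s Tᵈ` for `s ∈ S_d`, which describes the action of
`𝔾ₘ` on `Spec S` given by the grading. -/
def Frame.coaction (S : Frame.{u} p) : S.carrier →+* S.carrier[T;T⁻¹] :=
  (DirectSum.toSemiring S.coactionComp S.coactionComp_one S.coactionComp_mul).comp
    (DirectSum.decomposeRingEquiv S.grading).toRingHom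

theorem Frame.coaction_of_mem (S : Frame.{u} p) {d : ℤ} {s : S.carrier} (hs : s ∈ S.grading d) :
    S.coaction s = LaurentPolynomial.C s * LaurentPolynomial.T d := by
  have h : (DirectSum.decomposeRingEquiv S.grading).toRingHom s =
    DirectSum.decompose S.grading s := rfl
  rw [coaction, RingHom.comp_apply, h, DirectSum.decompose_of_mem _ hs, DirectSum.toSemiring_of,
    ← LaurentPolynomial.single_eq_C_mul_T]
  rfl

/-- The display group `G(S)_μ` for `G = O(ψ)`: the group of those `g ∈ O(ψ)(S)` that are
`𝔾ₘ`-equivariant as morphisms `Spec S → O(ψ)`, where `λ ∈ 𝔾ₘ` acts on `O(ψ)` by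
`g ↦ μ(λ)⁻¹ g μ(λ)`. -/
def dispGroup (S : Frame.{u} p) (μ : Fin n → ℤ) : Subgroup (GL (Fin n) S.carrier) :=
  orthGroup n S.carrier ⊓
    MonoidHom.eqLocus (Matrix.GeneralLinearGroup.map S.coaction)
      ((MulAut.conj (cochar μ (laurentUnit S.carrier))⁻¹).toMonoidHom.comp
        (Matrix.GeneralLinearGroup.map LaurentPolynomial.C))

theorem mem_dispGroup_iff (S : Frame.{u} p) (μ : Fin n → ℤ) (g : GL (Fin n) S.carrier) :
    g ∈ dispGroup S μ ↔ g ∈ orthGroup n S.carrier ∧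
      Matrix.GeneralLinearGroup.map S.coaction g =
        (cochar μ (laurentUnit S.carrier))⁻¹ * Matrix.GeneralLinearGroup.map LaurentPolynomial.C g *
          cochar μ (laurentUnit S.carrier) := by
  rw [dispGroup, Subgroup.mem_inf]
  refine and_congr Iff.rfl ?_
  change _ = MulAut.conj _ _ ↔ _
  rw [MulAut.conj_apply, inv_inv]

theorem laurentMap_coaction {S S' : Frame.{u} p} (f : S ⟶ S') (s : S.carrier) :
    laurentMap f.toRingHom (S.coaction s) = S'.coaction (f.toRingHom s) := by
  induction s using DirectSum.Decomposition.inductionOn S.grading with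
  | zero => simp
  | @homogeneous i x =>
    rw [S.coaction_of_mem x.2, S'.coaction_of_mem (f.map_mem i x x.2),
      ← LaurentPolynomial.single_eq_C_mul_T, ← LaurentPolynomial.single_eq_C_mul_T, laurentMap]
    exact AddMonoidAlgebra.mapRingHom_single _ _ _
  | add a b ha hb => simp only [map_add, ha, hb]

theorem map_mem_dispGroup {S S' : Frame.{u} p} (f : S ⟶ S') (μ : Fin n → ℤ)
    {g : GL (Fin n) S.carrier} (hg : g ∈ dispGroup S μ) :
    Matrix.GeneralLinearGroup.map f.toRingHom g ∈ dispGroup S' μ := by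
  rw [mem_dispGroup_iff] at hg ⊢
  refine ⟨map_mem_orthGroup _ hg.1, ?_⟩
  have h := congrArg (Matrix.GeneralLinearGroup.map (laurentMap f.toRingHom)) hg.2
  rw [map_mul, map_mul, map_inv, map_cochar] at h
  have hT : Units.map (laurentMap f.toRingHom).toMonoidHom (laurentUnit S.carrier) =
      laurentUnit S'.carrier := by
    ext1
    change laurentMap f.toRingHom (AddMonoidAlgebra.single 1 1) = AddMonoidAlgebra.single 1 1
    rw [laurentMap, AddMonoidAlgebra.mapRingHom_single, map_one]
  rw [hT] at h
  have h1 : Matrix.GeneralLinearGroup.map (laurentMap f.toRingHom)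
      (Matrix.GeneralLinearGroup.map S.coaction g) =
      Matrix.GeneralLinearGroup.map S'.coaction
        (Matrix.GeneralLinearGroup.map f.toRingHom g) := by
    refine Units.ext (Matrix.ext fun i j => ?_)
    exact congrFun (congrArg DFunLike.coe
      (RingHom.ext (laurentMap_coaction f) :
        (laurentMap f.toRingHom).comp S.coaction = S'.coaction.comp f.toRingHom)) (g i j)
  have h2 : Matrix.GeneralLinearGroup.map (laurentMap f.toRingHom)
      (Matrix.GeneralLinearGroup.map LaurentPolynomial.C g) =
      Matrix.GeneralLinearGroup.map LaurentPolynomial.C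
        (Matrix.GeneralLinearGroup.map f.toRingHom g) := by
    refine Units.ext (Matrix.ext fun i j => ?_)
    change laurentMap f.toRingHom (AddMonoidAlgebra.single 0 (g i j)) =
      AddMonoidAlgebra.single 0 (f.toRingHom (g i j))
    rw [laurentMap, AddMonoidAlgebra.mapRingHom_single]
  rw [h1, h2] at h
  exact h

/-- The functoriality of the display group. -/
def dispGroup.map {S S' : Frame.{u} p} (f : S ⟶ S') (μ : Fin n → ℤ) :
    dispGroup S μ →* dispGroup S' μ :=
  ((Matrix.GeneralLinearGroup.map f.toRingHom).comp (dispGroup S μ).subtype).codRestrict _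
    fun g => map_mem_dispGroup f μ g.2

/-- The group homomorphism `G(S)_μ → G(S₀)` induced by a ring homomorphism `S → S₀`
(in practice, `σ` or `τ`). -/
def dispGroup.toZero (S : Frame.{u} p) (μ : Fin n → ℤ) (f : S.carrier →+* S.grading 0) :
    dispGroup S μ →* orthGroup n (S.grading 0) :=
  (orthGroup.map f).comp (Subgroup.inclusion inf_le_left)

end Groups

/-! ### `O(ψ)`-displays -/

section GDisplays

variable {p : ℕ} {S : Frame.{u} p} (E : EtaleBaseChange S) {n : ℕ} (μ : Fin n → ℤ)

/-- The presheaf of groups `G(𝐒)_μ` on affine étale `R`-schemes, for `G = O(ψ)`. -/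
def dispGroupSheaf : EtAlg S.residue ⥤ GrpCat.{u} where
  obj A := GrpCat.of (dispGroup (E.frame.obj A) μ)
  map f := GrpCat.ofHom (dispGroup.map (E.frame.map f) μ)
  map_id A := by
    rw [E.frame.map_id]
    rfl
  map_comp f g := by
    rw [E.frame.map_comp]
    rfl

/-- The `O(ψ)`-displays of type `μ` over `S`: an étale `G(𝐒)_μ`-torsor `Q` over
`Spec R` with a `G(𝐒)_μ`-equivariant map `α : Q → G(𝐒₀)`, where `h ∈ G(𝐒)_μ` acts on `G(𝐒₀)` by
`x ↦ τ(h)⁻¹ x σ(h)`. -/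
structure OrthGroupDisplay extends EtaleTorsor (dispGroupSheaf E μ) where
  alpha : ∀ A : EtAlg S.residue, sheaf.obj A → orthGroup n ((E.frame.obj A).grading 0)
  alpha_map : ∀ {A B : EtAlg S.residue} (f : A ⟶ B) (q : sheaf.obj A),
    alpha B (sheaf.map f q) = orthGroup.map (Frame.Hom.zero (E.frame.map f)) (alpha A q)
  alpha_act : ∀ (A : EtAlg S.residue) (q : sheaf.obj A) (h : dispGroup (E.frame.obj A) μ),
    alpha A (act A q h) =
      (dispGroup.toZero (E.frame.obj A) μ (E.frame.obj A).tau h)⁻¹ * alpha A q *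
        dispGroup.toZero (E.frame.obj A) μ (E.frame.obj A).sigma h

variable {E μ}

/-- A morphism of `O(ψ)`-displays: an equivariant map of torsors that commutes with the maps
to `G(𝐒₀)`. -/
@[ext]
structure OrthGroupDisplay.Hom (P Q : OrthGroupDisplay E μ) where
  hom : P.sheaf ⟶ Q.sheaf
  hom_act : ∀ (A : EtAlg S.residue) (q : P.sheaf.obj A) (h : dispGroup (E.frame.obj A) μ),
    hom.app A (P.act A q h) = Q.act A (hom.app A q) h
  hom_alpha : ∀ (A : EtAlg S.residue) (q : P.sheaf.obj A),
    Q.alpha A (hom.app A q) = P.alpha A q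

instance : Category (OrthGroupDisplay E μ) where
  Hom P Q := OrthGroupDisplay.Hom P Q
  id P :=
    { hom := 𝟙 P.sheaf
      hom_act := fun _ _ _ => rfl
      hom_alpha := fun _ _ => rfl }
  comp f g :=
    { hom := f.hom ≫ g.hom
      hom_act := fun A q h => by
        change g.hom.app A (f.hom.app A _) = _
        rw [f.hom_act, g.hom_act]
        rfl
      hom_alpha := fun A q => by
        rw [← f.hom_alpha, ← g.hom_alpha]
        rfl }

end GDisplays

end Displays

end

noncomputable section

namespace Displays

/-! ### Étale algebras: lifting along nil ideals and along surjections -/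

section EtaleLifting

variable {R A B : Type u} [CommRing R] [CommRing A] [CommRing B] [Algebra R A] [Algebra R B]

/-- Homomorphisms from an étale algebra lift uniquely along nil ideals. -/
theorem etale_comp_bijective_of_nil [Algebra.Etale R A] (I : Ideal B)
    (hI : ∀ x ∈ I, IsNilpotent x) :
    Function.Bijective ((Ideal.Quotient.mkₐ R I).comp : (A →ₐ[R] B) → A →ₐ[R] B ⧸ I) := by
  have nilp : ∀ s : Finset B, (∀ x ∈ s, x ∈ I) → IsNilpotent (Ideal.span (s : Set B)) := by
    intro s hs
    have h : ∀ x ∈ s, IsNilpotent (Ideal.span {x}) := fun x hx => by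
      obtain ⟨n, hn⟩ := hI x (hs x hx)
      exact ⟨n, by rw [Ideal.span_singleton_pow, hn]; simp⟩
    refine (Ideal.FG.isNilpotent_iff_le_nilradical ⟨s, rfl⟩).2 ?_
    exact Ideal.span_le.2 fun x hx => hI x (hs x hx)
  constructor
  · intro f g hfg
    obtain ⟨s, hs⟩ := (Algebra.FiniteType.out : (⊤ : Subalgebra R A).FG)
    classical
    let J : Ideal B := Ideal.span ((s.image fun a => f a - g a : Finset B) : Set B)
    have hJ : IsNilpotent J := nilp _ fun x hx => by
      obtain ⟨a, -, rfl⟩ := Finset.mem_image.1 hx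
      exact Ideal.Quotient.eq.1 (AlgHom.congr_fun hfg a)
    refine Algebra.FormallyUnramified.ext J hJ fun x => ?_
    have : (Ideal.Quotient.mkₐ R J).comp f = (Ideal.Quotient.mkₐ R J).comp g :=
      AlgHom.ext_of_adjoin_eq_top hs fun a ha => Ideal.Quotient.eq.2
        (Ideal.subset_span (Finset.mem_coe.2 (Finset.mem_image_of_mem _ ha)))
    exact AlgHom.congr_fun this x
  · intro f
    obtain ⟨n, k, hk, hker⟩ := Algebra.FinitePresentation.out (R := R) (A := A)
    obtain ⟨s, hs⟩ := hker
    choose v hv using fun i => Ideal.Quotient.mk_surjective (f (k (MvPolynomial.X i)))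
    have hkv : ∀ P, Ideal.Quotient.mk I (MvPolynomial.aeval v P) = f (k P) := fun P => by
      have : (Ideal.Quotient.mkₐ R I).comp (MvPolynomial.aeval v) = f.comp k := by
        ext i
        simp [hv]
      exact AlgHom.congr_fun this P
    classical
    let J : Ideal B := Ideal.span ((s.image (MvPolynomial.aeval v) : Finset B) : Set B)
    have hJI : J ≤ I := Ideal.span_le.2 fun x hx => by
      obtain ⟨P, hP, rfl⟩ := Finset.mem_image.1 (Finset.mem_coe.1 hx)
      have hP' : k P = 0 := by
        have : P ∈ RingHom.ker k.toRingHom := hs ▸ Ideal.subset_span hP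
        exact this
      exact Ideal.Quotient.eq_zero_iff_mem.1 (by rw [hkv, hP', map_zero])
    have hJ : IsNilpotent J := nilp _ fun x hx => hJI (Ideal.subset_span (Finset.mem_coe.2 hx))
    let g₁ : MvPolynomial (Fin n) R →ₐ[R] B ⧸ J :=
      (Ideal.Quotient.mkₐ R J).comp (MvPolynomial.aeval v)
    have hg₁ : ∀ P, k P = 0 → g₁ P = 0 := fun P hP => by
      have hP' : P ∈ Ideal.span (s : Set (MvPolynomial (Fin n) R)) := by
        rw [show Ideal.span (s : Set (MvPolynomial (Fin n) R)) = RingHom.ker k.toRingHom from hs]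
        exact hP
      have : Ideal.span (s : Set (MvPolynomial (Fin n) R)) ≤ RingHom.ker g₁ :=
        Ideal.span_le.2 fun Q hQ => Ideal.Quotient.eq_zero_iff_mem.2
          (Ideal.subset_span (Finset.mem_coe.2 (Finset.mem_image_of_mem _ hQ)))
      exact this hP'
    let f₁ : A →ₐ[R] B ⧸ J := AlgHom.liftOfSurjective k hk g₁ hg₁
    have hf₁ : ∀ P, f₁ (k P) = g₁ P := fun P => AlgHom.liftOfSurjective_apply ..
    obtain ⟨F, hF⟩ := Algebra.FormallySmooth.exists_lift (R := R) (A := A) J hJ f₁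
    refine ⟨F, AlgHom.ext fun a => ?_⟩
    obtain ⟨P, rfl⟩ := hk a
    have h1 : Ideal.Quotient.mk J (F (k P)) = Ideal.Quotient.mk J (MvPolynomial.aeval v P) :=
      (AlgHom.congr_fun hF (k P)).trans (hf₁ P)
    exact (Ideal.Quotient.eq.2 (hJI (Ideal.Quotient.eq.1 h1))).trans (hkv P)

end EtaleLifting

section EtaleModel

variable {R₀ R A : Type u} [CommRing R₀] [CommRing R] [CommRing A] [Algebra R₀ R] [Algebra R A]
  [Algebra R₀ A] [IsScalarTower R₀ R A]

/-- An étale algebra over a quotient `R` of `R₀` lifts to an étale algebra over `R₀`. -/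
theorem exists_etale_lift [Algebra.Etale R A]
    (hR : Function.Surjective (algebraMap R₀ R)) :
    ∃ (A₀ : Type u) (_ : CommRing A₀) (_ : Algebra R₀ A₀), Algebra.Etale R₀ A₀ ∧
      ∃ f : A₀ →ₐ[R₀] A, Function.Surjective f ∧
        RingHom.ker f = (RingHom.ker (algebraMap R₀ R)).map (algebraMap R₀ A₀) := by
  obtain ⟨ι, σ, _, _, P, hP⟩ :=
    (Algebra.Etale.iff_isStandardSmoothOfRelativeDimension_zero (R := R) (S := A)).1
      inferInstance |>.out
  classical
  cases nonempty_fintype σ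
  have : P.toPresentation.HasCoeffs R₀ := ⟨fun x _ => hR x⟩
  let P₀ := P.toPreSubmersivePresentation.ofHasCoeffs R₀
  let M := P.toPresentation.ModelOfHasCoeffs R₀
  let f₀ : M →ₐ[R₀] A := Ideal.Quotient.liftₐ _ (MvPolynomial.aeval P.val) (by
    intro a ha
    have : Ideal.span (Set.range (P.toPresentation.relationOfHasCoeffs R₀)) ≤
        RingHom.ker (MvPolynomial.aeval (R := R₀) P.val) := by
      rw [Ideal.span_le]
      rintro a ⟨i, rfl⟩
      simp
    exact this ha)
  have hf₀ : ∀ x : MvPolynomial ι R₀, f₀ (Ideal.Quotient.mk _ x) = MvPolynomial.aeval P.val x :=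
    fun x => rfl
  have hsurj : Function.Surjective f₀ := fun a => by
    obtain ⟨x, rfl⟩ := P.algebraMap_surjective a
    obtain ⟨x, rfl⟩ := MvPolynomial.map_surjective _ hR x
    exact ⟨Ideal.Quotient.mk _ x, by
      rw [hf₀, P.algebraMap_apply, MvPolynomial.aeval_map_algebraMap]⟩
  have hker : ∀ m, f₀ m = 0 → m ∈ (RingHom.ker (algebraMap R₀ R)).map (algebraMap R₀ M) := by
    intro m hm
    obtain ⟨x, rfl⟩ := Ideal.Quotient.mk_surjective m
    rw [hf₀, ← MvPolynomial.aeval_map_algebraMap R] at hm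
    have h1 : MvPolynomial.map (algebraMap R₀ R) x ∈ Ideal.span (Set.range P.relation) := by
      rw [P.span_range_relation_eq_ker]
      change algebraMap P.Ring A _ = 0
      rw [P.algebraMap_apply]
      exact hm
    have h2 : ∃ y ∈ Ideal.span (Set.range (P.toPresentation.relationOfHasCoeffs R₀)),
        MvPolynomial.map (algebraMap R₀ R) y = MvPolynomial.map (algebraMap R₀ R) x := by
      have : (Ideal.span (Set.range (P.toPresentation.relationOfHasCoeffs R₀))).map
          (MvPolynomial.map (algebraMap R₀ R)) = Ideal.span (Set.range P.relation) := by
        rw [Ideal.map_span, ← Set.range_comp]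
        congr 2
        funext i
        exact P.toPresentation.map_relationOfHasCoeffs R₀ i
      rw [← this] at h1
      exact (Ideal.mem_map_iff_of_surjective _ (MvPolynomial.map_surjective _ hR)).1 h1
    obtain ⟨y, hy, hxy⟩ := h2
    have h3 : x - y ∈ (RingHom.ker (algebraMap R₀ R)).map MvPolynomial.C := by
      rw [← MvPolynomial.ker_map, RingHom.mem_ker, map_sub, hxy, sub_self]
    have h4 : Ideal.Quotient.mk (Ideal.span (Set.range (P.toPresentation.relationOfHasCoeffs R₀))) x
        = Ideal.Quotient.mk _ (x - y) := by
      rw [map_sub, Ideal.Quotient.eq_zero_iff_mem.2 hy, sub_zero]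
    rw [h4]
    have h5 := Ideal.mem_map_of_mem
      (Ideal.Quotient.mk (Ideal.span (Set.range (P.toPresentation.relationOfHasCoeffs R₀)))) h3
    rw [Ideal.map_map] at h5
    exact h5
  have hjac : f₀ P₀.jacobian = P.jacobian := by
    rw [P₀.jacobian_eq_jacobiMatrix_det, P.jacobian_eq_jacobiMatrix_det]
    have e1 : f₀ (algebraMap P₀.Ring M P₀.jacobiMatrix.det) =
        algebraMap P.Ring A (MvPolynomial.map (algebraMap R₀ R) P₀.jacobiMatrix.det) := by
      rw [P.algebraMap_apply, MvPolynomial.aeval_map_algebraMap, P₀.algebraMap_apply]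
      have : f₀.comp (MvPolynomial.aeval P₀.val) = MvPolynomial.aeval P.val := by
        ext i
        simp only [AlgHom.comp_apply, MvPolynomial.aeval_X]
        exact (hf₀ (MvPolynomial.X i)).trans (by simp)
      exact AlgHom.congr_fun this _
    rw [e1]
    congr 1
    have e2 := RingHom.map_det (MvPolynomial.map (σ := ι) (algebraMap R₀ R)) P₀.jacobiMatrix
    refine e2.trans (congrArg Matrix.det ?_)
    ext1 i j
    rw [RingHom.mapMatrix_apply, Matrix.map_apply, P₀.jacobiMatrix_apply, P.jacobiMatrix_apply,
      ← MvPolynomial.pderiv_map]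
    congr 1
    exact P.toPresentation.map_relationOfHasCoeffs R₀ j
  let L := Localization.Away P₀.jacobian
  let f : L →ₐ[R₀] A := IsLocalization.liftAlgHom (M := Submonoid.powers P₀.jacobian) (f := f₀)
    (by
      rintro ⟨_, k, rfl⟩
      change IsUnit (f₀ (P₀.jacobian ^ k))
      rw [map_pow, hjac]
      exact P.jacobian_isUnit.pow k)
  have hf : ∀ m, f (algebraMap M L m) = f₀ m := fun m => by
    rw [IsLocalization.liftAlgHom_apply]
    exact IsLocalization.lift_eq _ _
  let Q : Algebra.SubmersivePresentation R₀ L (Unit ⊕ ι) (Unit ⊕ σ) :=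
    { (Algebra.SubmersivePresentation.localizationAway (R := M) L
        P₀.jacobian).toPreSubmersivePresentation.comp P₀ with
      jacobian_isUnit := by
        rw [Algebra.PreSubmersivePresentation.comp_jacobian_eq_jacobian_smul_jacobian,
          Algebra.smul_def]
        exact (IsLocalization.Away.algebraMap_isUnit P₀.jacobian).mul
          (Algebra.SubmersivePresentation.localizationAway (R := M) L
            P₀.jacobian).jacobian_isUnit }
  have hQ : Algebra.IsStandardSmoothOfRelativeDimension 0 R₀ L := by
    refine Q.isStandardSmoothOfRelativeDimension ?_
    have h1 : P.dimension = Nat.card ι - Nat.card σ := rfl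
    have h2 : Q.dimension = Nat.card (Unit ⊕ ι) - Nat.card (Unit ⊕ σ) := rfl
    rw [h2, Nat.card_sum, Nat.card_sum]
    omega
  refine ⟨L, inferInstance, inferInstance,
    Algebra.Etale.iff_isStandardSmoothOfRelativeDimension_zero.2 hQ, f, ?_, ?_⟩
  · intro a
    obtain ⟨m, rfl⟩ := hsurj a
    exact ⟨algebraMap M L m, hf m⟩
  · apply le_antisymm
    · intro y hy
      obtain ⟨⟨m, s⟩, hms⟩ := IsLocalization.surj (Submonoid.powers P₀.jacobian) y
      have h1 : f₀ m = 0 := by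
        rw [← hf, ← hms, map_mul, (RingHom.mem_ker).1 hy, zero_mul]
      have h2 := Ideal.mem_map_of_mem (algebraMap M L) (hker m h1)
      rw [Ideal.map_map, ← IsScalarTower.algebraMap_eq, ← hms] at h2
      exact (Ideal.mul_unit_mem_iff_mem _ (IsLocalization.map_units L s)).1 h2
    · rw [Ideal.map_le_iff_le_comap]
      intro r hr
      rw [Ideal.mem_comap, RingHom.mem_ker, AlgHom.commutes, IsScalarTower.algebraMap_apply R₀ R A,
        (RingHom.mem_ker).1 hr, map_zero]

end EtaleModel

/-! ### `p`-adic completeness of abelian groups and of rings -/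

/-- `p`-adically complete and separated abelian groups, in elementary terms. -/
structure PComplete (p : ℕ) (G : Type*) [AddCommGroup G] : Prop where
  sep : ∀ x : G, (∀ i, ∃ y : G, x = p ^ i • y) → x = 0
  lim : ∀ f : ℕ → G, (∀ i, ∃ y : G, f (i + 1) - f i = p ^ i • y) →
    ∃ L : G, ∀ i, ∃ y : G, L - f i = p ^ i • y

section PComplete

variable {p : ℕ}

theorem mem_span_pow_smul_top_iff {A M : Type*} [CommRing A] [AddCommGroup M] [Module A M] (i : ℕ)
    (x : M) : x ∈ (Ideal.span {(p : A)} ^ i • ⊤ : Submodule A M) ↔ ∃ y : M, x = p ^ i • y := by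
  rw [Ideal.span_singleton_pow, Submodule.ideal_span_singleton_smul,
    Submodule.mem_smul_pointwise_iff_exists]
  have h : ∀ y : M, (p : A) ^ i • y = p ^ i • y := fun y => by
    rw [← Nat.cast_pow, Nat.cast_smul_eq_nsmul]
  constructor
  · rintro ⟨y, -, rfl⟩
    exact ⟨y, h y⟩
  · rintro ⟨y, rfl⟩
    exact ⟨y, trivial, h y⟩

theorem pComplete_iff {A M : Type*} [CommRing A] [AddCommGroup M] [Module A M] :
    PComplete p M ↔ IsAdicComplete (Ideal.span {(p : A)}) M := by
  have key : ∀ (i : ℕ) (x y : M), x ≡ y [SMOD (Ideal.span {(p : A)} ^ i • ⊤ : Submodule A M)] ↔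
      ∃ z : M, x - y = p ^ i • z := fun i x y => by
    rw [SModEq.sub_mem, mem_span_pow_smul_top_iff]
  constructor
  · intro h
    refine { haus' := fun x hx => h.sep x fun i => ?_, prec' := fun f hf => ?_ }
    · simpa using (key i x 0).1 (hx i)
    · obtain ⟨L, hL⟩ := h.lim f fun i => (key _ _ _).1 (hf i.le_succ).symm
      exact ⟨L, fun n => SModEq.symm ((key _ _ _).2 (hL n))⟩
  · intro h
    refine ⟨fun x hx => h.haus' x fun i => (key _ _ _).2 (by simpa using hx i), fun f hf => ?_⟩
    obtain ⟨L, hL⟩ := h.prec' f fun {m n} hmn => by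
      induction n, hmn using Nat.le_induction with
      | base => exact SModEq.rfl
      | succ n hmn ih =>
        refine ih.trans (SModEq.symm ((key _ _ _).2 ?_))
        obtain ⟨y, hy⟩ := hf n
        refine ⟨p ^ (n - m) • y, ?_⟩
        rw [hy, smul_smul, ← pow_add, Nat.add_sub_cancel' hmn]
    exact ⟨L, fun i => (key _ _ _).1 (hL i).symm⟩

theorem Frame.IsPAdic.pComplete {S : Frame.{u} p} (hS : S.IsPAdic) (n : ℤ) :
    PComplete p (S.grading n) :=
  pComplete_iff.2 (hS.complete n)

end PComplete

/-! ### Lifting homomorphisms from étale algebras to `p`-adically complete rings -/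

section EtaleComplete

variable {R A B C : Type u} [CommRing R] [CommRing A] [CommRing B] [CommRing C]
  [Algebra R A] [Algebra R B] [Algebra R C]

theorem etale_comp_bijective_of_surjective [Algebra.Etale R A] (π : B →ₐ[R] C)
    (hπ : Function.Surjective π) (hker : ∀ x, π x = 0 → IsNilpotent x) :
    Function.Bijective (π.comp : (A →ₐ[R] B) → A →ₐ[R] C) := by
  have h := etale_comp_bijective_of_nil (R := R) (A := A) (RingHom.ker π) fun x hx => hker x hx
  let e := Ideal.quotientKerAlgEquivOfSurjective hπ
  have he : ∀ f : A →ₐ[R] B, e.toAlgHom.comp ((Ideal.Quotient.mkₐ R (RingHom.ker π)).comp f) =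
      π.comp f := fun f => AlgHom.ext fun a => rfl
  constructor
  · intro f g hfg
    apply h.1
    have := (he f).trans (hfg.trans (he g).symm)
    exact AlgHom.ext fun a => e.injective (AlgHom.congr_fun this a)
  · intro f
    obtain ⟨g, hg⟩ := h.2 (e.symm.toAlgHom.comp f)
    refine ⟨g, ?_⟩
    rw [← he, hg]
    ext a
    simp

/-- Homomorphisms from an étale algebra to a `p`-adically complete ring `T` are the same as
homomorphisms to `T / K` if `pᵏ ∈ K ⊆ √(p)`. -/
theorem etale_comp_bijective_of_pComplete {p : ℕ} [Algebra.Etale R A] (hB : PComplete p B)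
    (π : B →ₐ[R] C) (hπ : Function.Surjective π)
    (hker : ∀ x, π x = 0 → ∃ (m : ℕ) (y : B), x ^ m = p * y) (hp : IsNilpotent (p : C)) :
    Function.Bijective (π.comp : (A →ₐ[R] B) → A →ₐ[R] C) := by
  obtain ⟨k, hk⟩ := hp
  let I : Ideal B := Ideal.span {(p : B)}
  have hI : IsAdicComplete I B := pComplete_iff.1 hB
  have hIπ : ∀ i, ∀ a ∈ I ^ (i + k), π a = 0 := fun i a ha => by
    rw [Ideal.span_singleton_pow, Ideal.mem_span_singleton] at ha
    obtain ⟨b, rfl⟩ := ha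
    rw [map_mul, map_pow, map_natCast, pow_add, hk, mul_zero, zero_mul]
  let ϖ : ∀ i : ℕ, B ⧸ I ^ (i + k) →ₐ[R] C := fun i =>
    Ideal.Quotient.liftₐ (I ^ (i + k)) π (hIπ i)
  have hϖ : ∀ i b, ϖ i (Ideal.Quotient.mk _ b) = π b := fun i b => rfl
  have hbij : ∀ i, Function.Bijective ((ϖ i).comp : (A →ₐ[R] B ⧸ I ^ (i + k)) → A →ₐ[R] C) := by
    intro i
    refine etale_comp_bijective_of_surjective _ (fun c => ?_) fun x hx => ?_
    · obtain ⟨b, rfl⟩ := hπ c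
      exact ⟨Ideal.Quotient.mk _ b, rfl⟩
    · obtain ⟨b, rfl⟩ := Ideal.Quotient.mk_surjective x
      obtain ⟨m, y, hm⟩ := hker b hx
      refine ⟨m * (i + k), ?_⟩
      rw [← map_pow, Ideal.Quotient.eq_zero_iff_mem, pow_mul, hm, mul_pow]
      exact Ideal.mul_mem_right _ _ (Ideal.pow_mem_pow (Ideal.mem_span_singleton_self _) _)
  constructor
  · intro f g hfg
    refine AlgHom.ext fun a => sub_eq_zero.1 (hB.sep _ fun i => ?_)
    have h1 : (Ideal.Quotient.mkₐ R (I ^ (i + k))).comp f =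
        (Ideal.Quotient.mkₐ R (I ^ (i + k))).comp g := (hbij i).1 hfg
    have h2 := Ideal.pow_le_pow_right (Nat.le_add_right i k)
      (Ideal.Quotient.eq.1 (AlgHom.congr_fun h1 a))
    rw [Ideal.span_singleton_pow, Ideal.mem_span_singleton] at h2
    obtain ⟨y, hy⟩ := h2
    exact ⟨y, by rw [nsmul_eq_mul, Nat.cast_pow]; exact hy⟩
  · intro f
    choose F hF using fun i => (hbij i).2 f
    let G : ∀ i : ℕ, A →ₐ[R] B ⧸ I ^ i := fun i =>
      (Ideal.Quotient.factorₐ R (Ideal.pow_le_pow_right (Nat.le_add_right i k))).comp (F i)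
    have hG : ∀ {m n : ℕ} (hle : m ≤ n),
        (Ideal.Quotient.factorₐ R (Ideal.pow_le_pow_right hle)).comp (G n) = G m := by
      intro m n hmn
      have h1 : (Ideal.Quotient.factorₐ R (Ideal.pow_le_pow_right (I := I)
          (Nat.add_le_add_right hmn k))).comp (F n) = F m := by
        apply (hbij m).1
        refine Eq.trans ?_ ((hF n).trans (hF m).symm)
        refine AlgHom.ext fun a => ?_
        change ϖ m (Ideal.Quotient.factorₐ R (Ideal.pow_le_pow_right (I := I)
          (Nat.add_le_add_right hmn k)) (F n a)) = ϖ n (F n a)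
        obtain ⟨b, hb⟩ := Ideal.Quotient.mk_surjective (F n a)
        rw [← hb]
        rfl
      change _ = (Ideal.Quotient.factorₐ R _).comp (F m)
      rw [← h1]
      refine AlgHom.ext fun a => ?_
      simp only [G, AlgHom.comp_apply]
      obtain ⟨b, hb⟩ := Ideal.Quotient.mk_surjective (F n a)
      rw [← hb]
      rfl
    let H := IsAdicComplete.liftAlgHom I G hG
    refine ⟨H, AlgHom.ext fun a => ?_⟩
    have h1 : Ideal.Quotient.mk (I ^ (0 + k)) (H a) = G (0 + k) a :=
      IsAdicComplete.mk_liftAlgHom I G hG _ a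
    have h2 : G (0 + k) a = F 0 a := by
      have h3 : (Ideal.Quotient.factorₐ R (Ideal.pow_le_pow_right (I := I)
          (Nat.le_add_right (0 + k) k))).comp (F (0 + k)) = F 0 := by
        apply (hbij 0).1
        refine Eq.trans ?_ ((hF (0 + k)).trans (hF 0).symm)
        refine AlgHom.ext fun a => ?_
        change ϖ 0 (Ideal.Quotient.factorₐ R (Ideal.pow_le_pow_right (I := I)
          (Nat.le_add_right (0 + k) k)) (F (0 + k) a)) = ϖ (0 + k) (F (0 + k) a)
        obtain ⟨b, hb⟩ := Ideal.Quotient.mk_surjective (F (0 + k) a)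
        rw [← hb]
        rfl
      exact AlgHom.congr_fun h3 a
    change π (H a) = f a
    rw [← hϖ 0, h1, h2]
    exact AlgHom.congr_fun (hF 0) a

end EtaleComplete

section EtaleComplete

/-- The version of `etale_comp_bijective_of_pComplete` for ring homomorphisms. -/
theorem existsUnique_etale_lift {p : ℕ} {R A B C : Type u} [CommRing R] [CommRing A] [CommRing B]
    [CommRing C] {f : R →+* A} (hf : f.Etale) (hB : PComplete p B) {π : B →+* C}
    (hπ : Function.Surjective π) (hker : ∀ x, π x = 0 → ∃ (m : ℕ) (y : B), x ^ m = p * y)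
    (hp : IsNilpotent (p : C)) (j : R →+* B) (g : A →+* C) (h : g.comp f = π.comp j) :
    ∃! G : A →+* B, G.comp f = j ∧ π.comp G = g := by
  algebraize [f, j, π.comp j]
  have : Algebra.Etale R A := hf
  have hb := etale_comp_bijective_of_pComplete (R := R) (A := A) hB
    ({ π with commutes' := fun r => rfl } : B →ₐ[R] C) hπ hker hp
  let g' : A →ₐ[R] C := { g with commutes' := fun r => RingHom.congr_fun h r }
  obtain ⟨G, hG⟩ := hb.2 g'
  refine ⟨G.toRingHom, ⟨?_, ?_⟩, ?_⟩
  · ext r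
    exact G.commutes r
  · ext a
    exact AlgHom.congr_fun hG a
  · rintro G' ⟨h1, h2⟩
    let G'' : A →ₐ[R] B := { G' with commutes' := fun r => RingHom.congr_fun h1 r }
    have : G'' = G := hb.1 (by
      rw [hG]
      ext a
      exact RingHom.congr_fun h2 a)
    rw [← this]

end EtaleComplete

/-! ### Extension of additive maps to completions -/

section Extension

variable {p : ℕ} {C D G : Type u} [AddCommGroup C] [AddCommGroup D] [AddCommGroup G]

/-- `ι : C → D` exhibits `D` as the `p`-adic completion of `C`. -/
structure IsPCompletion (p : ℕ) (ι : C →+ D) : Prop where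
  complete : PComplete p D
  dense : ∀ (x : D) (i : ℕ), ∃ (c : C) (y : D), x = ι c + p ^ i • y
  strict : ∀ (c : C) (i : ℕ) (y : D), ι c = p ^ i • y → ∃ c', c = p ^ i • c'

theorem IsPCompletion.hom_ext {ι : C →+ D} (hι : IsPCompletion p ι) (hG : PComplete p G)
    {f g : D →+ G} (h : ∀ c, f (ι c) = g (ι c)) : f = g := by
  ext x
  refine sub_eq_zero.1 (hG.sep _ fun i => ?_)
  obtain ⟨c, y, rfl⟩ := hι.dense x i
  refine ⟨f y - g y, ?_⟩
  rw [map_add, map_add, h, map_nsmul, map_nsmul, smul_sub]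
  abel

theorem IsPCompletion.exists_extension {ι : C →+ D} (hι : IsPCompletion p ι) (hG : PComplete p G)
    (f : C →+ G) : ∃ F : D →+ G, ∀ c, F (ι c) = f c := by
  have h1 : ∀ x : D, ∃ L : G, ∀ (i : ℕ) (c : C) (y : D), x = ι c + p ^ i • y →
      ∃ z, L - f c = p ^ i • z := by
    intro x
    choose c y hc using hι.dense x
    have h2 : ∀ (i : ℕ) (c₁ c₂ : C) (y₁ y₂ : D), x = ι c₁ + p ^ i • y₁ → x = ι c₂ + p ^ i • y₂ →
        ∃ z, f c₁ - f c₂ = p ^ i • z := by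
      intro i c₁ c₂ y₁ y₂ e₁ e₂
      obtain ⟨c', hc'⟩ := hι.strict (c₁ - c₂) i (y₂ - y₁) (by
        rw [map_sub, smul_sub, sub_eq_sub_iff_add_eq_add, ← e₁, add_comm, ← e₂])
      exact ⟨f c', by rw [← map_sub, hc', map_nsmul]⟩
    obtain ⟨L, hL⟩ := hG.lim (fun i => f (c i)) fun i =>
      h2 i (c (i + 1)) (c i) (p • y (i + 1)) (y i)
        (by rw [smul_smul, ← pow_succ]; exact hc (i + 1)) (hc i)
    refine ⟨L, fun i c₁ y₁ e₁ => ?_⟩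
    obtain ⟨z, hz⟩ := hL i
    obtain ⟨w, hw⟩ := h2 i (c i) c₁ (y i) y₁ (hc i) e₁
    exact ⟨z + w, by rw [smul_add, ← hz, ← hw]; abel⟩
  choose F hF using h1
  refine ⟨{ toFun := F, map_zero' := ?_, map_add' := ?_ }, fun c => ?_⟩
  · refine hG.sep _ fun i => ?_
    obtain ⟨z, hz⟩ := hF 0 i 0 0 (by simp)
    exact ⟨z, by simpa using hz⟩
  · intro x y
    refine sub_eq_zero.1 (hG.sep _ fun i => ?_)
    obtain ⟨c, x', hx⟩ := hι.dense x i
    obtain ⟨d, y', hy⟩ := hι.dense y i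
    obtain ⟨z₁, h₁⟩ := hF x i c x' hx
    obtain ⟨z₂, h₂⟩ := hF y i d y' hy
    obtain ⟨z₃, h₃⟩ := hF (x + y) i (c + d) (x' + y') (by
      rw [map_add, smul_add, add_add_add_comm, ← hx, ← hy])
    refine ⟨z₃ - z₁ - z₂, ?_⟩
    rw [smul_sub, smul_sub, ← h₁, ← h₂, ← h₃, map_add]
    abel
  · refine sub_eq_zero.1 (hG.sep _ fun i => ?_)
    exact hF (ι c) i c 0 (by simp)

/-- The extension of an additive map to the `p`-adic completion. -/
def IsPCompletion.ext {ι : C →+ D} (hι : IsPCompletion p ι) (hG : PComplete p G)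
    (f : C →+ G) : D →+ G := (hι.exists_extension hG f).choose

theorem IsPCompletion.ext_apply {ι : C →+ D} (hι : IsPCompletion p ι) (hG : PComplete p G)
    (f : C →+ G) (c : C) : hι.ext hG f (ι c) = f c := (hι.exists_extension hG f).choose_spec c

end Extension

section RingExtension

variable {p : ℕ} {C D G : Type u} [CommRing C] [CommRing D] [CommRing G]

theorem IsPCompletion.bilin_ext {C D G : Type u} [AddCommGroup C] [AddCommGroup D] [AddCommGroup G]
    {ι : C →+ D} (hι : IsPCompletion p ι) (hG : PComplete p G)
    {f g : D →+ D →+ G} (h : ∀ c c', f (ι c) (ι c') = g (ι c) (ι c')) (x y : D) :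
    f x y = g x y := by
  have h1 : ∀ c, f (ι c) = g (ι c) := fun c => hι.hom_ext hG (h c)
  have h2 : f.flip y = g.flip y := hι.hom_ext hG fun c => by
    rw [AddMonoidHom.flip_apply, AddMonoidHom.flip_apply, h1]
  exact DFunLike.congr_fun h2 x

/-- The extension of a ring homomorphism to the `p`-adic completion. -/
def IsPCompletion.ringExt {ι : C →+* D} (hι : IsPCompletion p ι.toAddMonoidHom)
    (hG : PComplete p G) (f : C →+* G) : D →+* G :=
  { hι.ext hG f.toAddMonoidHom with
    map_one' := by
      have h := hι.ext_apply hG f.toAddMonoidHom 1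
      rw [show ι.toAddMonoidHom 1 = 1 from map_one ι] at h
      exact h.trans (map_one f)
    map_mul' := fun x y => by
      have h := hι.bilin_ext hG
        (f := (AddMonoidHom.compHom (hι.ext hG f.toAddMonoidHom)).comp AddMonoidHom.mul)
        (g := (AddMonoidHom.mul.comp (hι.ext hG f.toAddMonoidHom)).flip.comp
            (hι.ext hG f.toAddMonoidHom) |>.flip)
        (fun c c' => by
          have h1 := hι.ext_apply hG f.toAddMonoidHom (c * c')
          have h2 := hι.ext_apply hG f.toAddMonoidHom c
          have h3 := hι.ext_apply hG f.toAddMonoidHom c'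
          change hι.ext hG f.toAddMonoidHom (ι c * ι c') =
            hι.ext hG f.toAddMonoidHom (ι c) * hι.ext hG f.toAddMonoidHom (ι c')
          change hι.ext hG f.toAddMonoidHom (ι (c * c')) = f (c * c') at h1
          change hι.ext hG f.toAddMonoidHom (ι c) = f c at h2
          change hι.ext hG f.toAddMonoidHom (ι c') = f c' at h3
          rw [h2, h3, ← map_mul, h1, map_mul]) x y
      exact h }

theorem IsPCompletion.ringExt_apply {ι : C →+* D} (hι : IsPCompletion p ι.toAddMonoidHom)
    (hG : PComplete p G) (f : C →+* G) (c : C) : hι.ringExt hG f (ι c) = f c :=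
  hι.ext_apply hG f.toAddMonoidHom c

theorem isPCompletion_adicCompletion (p : ℕ) (C : Type u) [CommRing C] :
    IsPCompletion p (algebraMap C (AdicCompletion (Ideal.span {(p : C)}) C)).toAddMonoidHom := by
  have hfg : (Ideal.span {(p : C)}).FG := ⟨{(p : C)}, by simp⟩
  have hker : ∀ (i : ℕ) (x : AdicCompletion (Ideal.span {(p : C)}) C),
      AdicCompletion.eval (Ideal.span {(p : C)}) C i x = 0 → ∃ y, x = p ^ i • y := by
    intro i x hx
    have : x ∈ (AdicCompletion.eval (Ideal.span {(p : C)}) C i).ker := hx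
    rw [← AdicCompletion.pow_smul_top_eq_ker_eval hfg] at this
    exact (mem_span_pow_smul_top_iff i x).1 this
  have hof : ∀ c, algebraMap C (AdicCompletion (Ideal.span {(p : C)}) C) c =
      AdicCompletion.of (Ideal.span {(p : C)}) C c := fun c => rfl
  refine ⟨pComplete_iff.2 (AdicCompletion.isAdicComplete hfg), fun x i => ?_, fun c i y h => ?_⟩
  · obtain ⟨c, hc⟩ := Submodule.mkQ_surjective _ (AdicCompletion.eval (Ideal.span {(p : C)}) C i x)
    obtain ⟨y, hy⟩ := hker i (x - algebraMap C _ c) (by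
      rw [map_sub, hof, AdicCompletion.eval_of, hc, sub_self])
    exact ⟨c, y, by rw [← hy]; exact (add_sub_cancel _ _).symm⟩
  · have h1 : AdicCompletion.eval (Ideal.span {(p : C)}) C i (algebraMap C _ c) = 0 := by
      have h2 : algebraMap C (AdicCompletion (Ideal.span {(p : C)}) C) c ∈
          (AdicCompletion.eval (Ideal.span {(p : C)}) C i).ker := by
        rw [← AdicCompletion.pow_smul_top_eq_ker_eval hfg]
        exact (mem_span_pow_smul_top_iff i _).2 ⟨y, h⟩
      exact h2
    rw [hof, AdicCompletion.eval_of] at h1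
    exact (mem_span_pow_smul_top_iff i c).1 ((Submodule.Quotient.mk_eq_zero _).1 h1)

end RingExtension

/-! ### The graded ring attached to a family of projectors -/

section Projectors

/-- A family of additive projectors of a commutative ring which behaves like the projections onto
the homogeneous components of a grading. -/
class IsGradedProj {D : Type u} [CommRing D] (π : ℤ → D →+ D) : Prop where
  same : ∀ d x, π d (π d x) = π d x
  ne : ∀ d e x, d ≠ e → π d (π e x) = 0
  mul : ∀ d e x y, π (d + e) (π d x * π e y) = π d x * π e y
  one : π 0 1 = 1

variable {D : Type u} [CommRing D] (π : ℤ → D →+ D)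

/-- The elements of degree `d`. -/
def piece (d : ℤ) : AddSubgroup D := (π d - AddMonoidHom.id D).ker

theorem mem_piece {d : ℤ} {x : D} : x ∈ piece π d ↔ π d x = x := by
  rw [piece, AddMonoidHom.mem_ker, AddMonoidHom.sub_apply, AddMonoidHom.id_apply, sub_eq_zero]

variable [h : IsGradedProj π]

theorem proj_mem_piece (d : ℤ) (x : D) : π d x ∈ piece π d := (mem_piece π).2 (h.same d x)

theorem proj_of_mem_ne {d e : ℤ} (hde : d ≠ e) {x : D} (hx : x ∈ piece π e) : π d x = 0 := by
  rw [← (mem_piece π).1 hx, h.ne d e x hde]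

instance : SetLike.GradedMonoid (piece π) where
  one_mem := (mem_piece π).2 h.one
  mul_mem d e x y hx hy := by
    have := h.mul d e x y
    rw [(mem_piece π).1 hx, (mem_piece π).1 hy] at this
    exact (mem_piece π).2 this

/-- The subring of the elements with finitely many homogeneous components. -/
def finRing : Subring D := (DirectSum.coeRingHom (piece π)).range

theorem piece_le_finRing {d : ℤ} {x : D} (hx : x ∈ piece π d) : x ∈ finRing π :=
  ⟨DirectSum.of (fun d => piece π d) d ⟨x, hx⟩, DirectSum.coeRingHom_of _ _ _⟩

/-- The homogeneous elements of degree `d` in `finRing π`. -/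
def finGrading (d : ℤ) : AddSubgroup (finRing π) :=
  (piece π d).comap (finRing π).subtype.toAddMonoidHom

theorem mem_finGrading {d : ℤ} {x : finRing π} : x ∈ finGrading π d ↔ (x : D) ∈ piece π d :=
  Iff.rfl

theorem proj_finGrading {d : ℤ} (x : finGrading π d) :
    π d ((x : finRing π) : D) = ((x : finRing π) : D) := (mem_piece π).1 x.2

instance : SetLike.GradedMonoid (finGrading π) where
  one_mem := SetLike.GradedOne.one_mem (A := piece π)
  mul_mem _ _ _ _ hx hy := SetLike.GradedMul.mul_mem (A := piece π) hx hy

theorem isInternal_finGrading : DirectSum.IsInternal (finGrading π) := by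
  classical
  constructor
  · rw [injective_iff_map_eq_zero]
    intro x hx
    have key : ∀ (e : ℤ) (x : DirectSum ℤ fun d => finGrading π d),
        π e (DirectSum.coeAddMonoidHom (finGrading π) x : finRing π) = ((x e : finRing π) : D) := by
      intro e x
      induction x using DirectSum.induction_on with
      | zero => simp
      | of d y =>
        rw [DirectSum.coeAddMonoidHom_of]
        by_cases hde : e = d
        · subst hde
          rw [DirectSum.of_eq_same]
          exact (mem_piece π).1 y.2
        · rw [DirectSum.of_eq_of_ne _ _ _ hde]
          exact proj_of_mem_ne π hde y.2
      | add x y hx hy =>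
        rw [map_add, Subring.coe_add, map_add, hx, hy, DirectSum.add_apply]
        rfl
    refine DFinsupp.ext fun e => Subtype.ext (Subtype.ext ?_)
    rw [← key e x, hx]
    simp
  · rintro ⟨_, x, rfl⟩
    induction x using DirectSum.induction_on with
    | zero => exact ⟨0, Subtype.ext (by simp)⟩
    | of d y =>
      refine ⟨DirectSum.of (fun d => finGrading π d) d
        ⟨⟨y, piece_le_finRing π y.2⟩, y.2⟩, Subtype.ext ?_⟩
      rw [DirectSum.coeAddMonoidHom_of]
      exact (DirectSum.coeRingHom_of (piece π) d y).symm
    | add x y hx hy =>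
      obtain ⟨a, ha⟩ := hx
      obtain ⟨b, hb⟩ := hy
      refine ⟨a + b, ?_⟩
      rw [map_add, ha, hb]
      exact Subtype.ext (map_add (DirectSum.coeRingHom (piece π)) x y).symm

instance : GradedRing (finGrading π) :=
  { (inferInstance : SetLike.GradedMonoid (finGrading π)),
    (isInternal_finGrading π).chooseDecomposition with }

theorem pComplete_finGrading {p : ℕ} (hD : PComplete p D) (d : ℤ) :
    PComplete p (finGrading π d) := by
  have hdiv : ∀ (x : finGrading π d) (i : ℕ) (y : D), ((x : finRing π) : D) = p ^ i • y →
      ∃ z : finGrading π d, x = p ^ i • z := by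
    intro x i y hxy
    refine ⟨⟨⟨π d y, piece_le_finRing π (proj_mem_piece π d y)⟩,
      (mem_finGrading π).2 (proj_mem_piece π d y)⟩, ?_⟩
    refine Subtype.ext (Subtype.ext ?_)
    rw [← proj_finGrading π x, hxy, map_nsmul]
    rfl
  constructor
  · intro x hx
    refine Subtype.ext (Subtype.ext (hD.sep _ fun i => ?_))
    obtain ⟨y, hy⟩ := hx i
    exact ⟨((y : finRing π) : D), congrArg (fun z : finGrading π d => ((z : finRing π) : D)) hy⟩
  · intro f hf
    obtain ⟨L, hL⟩ := hD.lim (fun i => ((f i : finRing π) : D)) fun i => by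
      obtain ⟨y, hy⟩ := hf i
      exact ⟨((y : finRing π) : D), congrArg (fun z : finGrading π d => ((z : finRing π) : D)) hy⟩
    have hLd : L ∈ piece π d := (mem_piece π).2 (sub_eq_zero.1 (hD.sep _ fun i => by
      obtain ⟨y, hy⟩ := hL i
      refine ⟨π d y - y, ?_⟩
      have h1 := congrArg (π d) hy
      rw [map_sub, proj_finGrading π (f i), map_nsmul] at h1
      rw [smul_sub, ← h1, ← hy]
      abel))
    refine ⟨⟨⟨L, piece_le_finRing π hLd⟩, hLd⟩, fun i => ?_⟩
    obtain ⟨y, hy⟩ := hL i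
    exact hdiv _ i y hy

end Projectors

section

variable {p : ℕ} {G : Type u} [AddCommGroup G]

theorem PComplete.addHom_ext {C D : Type u} [AddCommGroup D] (hG : PComplete p G)
    {ι : C → D} (dense : ∀ (x : D) (i : ℕ), ∃ (c : C) (y : D), x = ι c + p ^ i • y)
    {f g : D →+ G} (h : ∀ c, f (ι c) = g (ι c)) : f = g := by
  ext x
  refine sub_eq_zero.1 (hG.sep _ fun i => ?_)
  obtain ⟨c, y, rfl⟩ := dense x i
  refine ⟨f y - g y, ?_⟩
  rw [map_add, map_add, h, map_nsmul, map_nsmul, smul_sub]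
  abel

end

/-! ### The completed base change of a frame along an étale `S₀`-algebra -/

section TensorLift

variable {B A C X : Type u} [CommRing B] [CommRing A] [CommRing C] [CommRing X] [Algebra B A]
  [Algebra B C]

/-- The ring homomorphism `a ⊗ c ↦ f(a) g(c)`. -/
def tensorLift (f : A →+* X) (g : C →+* X)
    (h : ∀ b : B, f (algebraMap B A b) = g (algebraMap B C b)) : A ⊗[B] C →+* X :=
  letI := (f.comp (algebraMap B A)).toAlgebra
  (Algebra.TensorProduct.lift
    ({ f with commutes' := fun _ => rfl } : A →ₐ[B] X)
    ({ g with commutes' := fun s => (h s).symm } : C →ₐ[B] X)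
    fun _ _ => Commute.all _ _).toRingHom

theorem tensorLift_tmul (f : A →+* X) (g : C →+* X)
    (h : ∀ b : B, f (algebraMap B A b) = g (algebraMap B C b)) (a : A) (c : C) :
    tensorLift f g h (a ⊗ₜ c) = f a * g c := by
  let := (f.comp (algebraMap B A)).toAlgebra
  exact Algebra.TensorProduct.lift_tmul _ _ _ _ _

theorem algebraMap_mul_tmul (b : B) (a : A) (c : C) :
    (algebraMap B A b * a) ⊗ₜ[B] c = a ⊗ₜ[B] (algebraMap B C b * c) := by
  rw [← Algebra.smul_def, ← Algebra.smul_def, smul_tmul]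

end TensorLift

section EtaleFrame

variable {p : ℕ} (S : Frame.{u} p)

/-- The projection of `S` onto its component of degree `d`, as an `S₀`-linear map. -/
def Frame.proj (d : ℤ) : S.carrier →ₗ[S.grading 0] S.carrier where
  toFun x := DirectSum.decompose S.grading x d
  map_add' x y := by rw [DirectSum.decompose_add]; rfl
  map_smul' a x := by
    change (DirectSum.decompose S.grading ((a : S.carrier) * x) d : S.carrier) = a * _
    rw [DirectSum.coe_decompose_mul_of_left_mem_zero S.grading a.2]

variable {S} in
theorem Frame.proj_of_mem {d : ℤ} {x : S.carrier} (hx : x ∈ S.grading d) : S.proj d x = x :=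
  DirectSum.decompose_of_mem_same _ hx

variable {S} in
theorem Frame.proj_of_mem_ne {d e : ℤ} {x : S.carrier} (hx : x ∈ S.grading e) (h : e ≠ d) :
    S.proj d x = 0 :=
  DirectSum.decompose_of_mem_ne _ hx h

theorem Frame.proj_mem (d : ℤ) (x : S.carrier) : S.proj d x ∈ S.grading d := SetLike.coe_mem _

variable (A₀ : Type u) [CommRing A₀] [Algebra (S.grading 0) A₀]

namespace EtFrame

/-- The ring `A₀ ⊗_{S₀} S`. -/
abbrev Tens : Type u := A₀ ⊗[S.grading 0] S.carrier

/-- The projection of `A₀ ⊗_{S₀} S` onto the component of degree `d`. -/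
def projC (d : ℤ) : Tens S A₀ →+ Tens S A₀ := ((S.proj d).lTensor A₀).toAddMonoidHom

theorem projC_tmul (d : ℤ) (a : A₀) (s : S.carrier) :
    projC S A₀ d (a ⊗ₜ s) = a ⊗ₜ S.proj d s := rfl

/-- The `p`-adic completion of `A₀ ⊗_{S₀} S`. -/
def Comp : Type u := AdicCompletion (Ideal.span {(p : Tens S A₀)}) (Tens S A₀)

instance : CommRing (Comp S A₀) :=
  inferInstanceAs (CommRing (AdicCompletion (Ideal.span {(p : Tens S A₀)}) (Tens S A₀)))

/-- The canonical map to the completion. -/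
def toComp : Tens S A₀ →+* Comp S A₀ :=
  algebraMap (Tens S A₀) (AdicCompletion (Ideal.span {(p : Tens S A₀)}) (Tens S A₀))

theorem isPCompletion : IsPCompletion p (toComp S A₀).toAddMonoidHom :=
  isPCompletion_adicCompletion p (Tens S A₀)

/-- The projection onto the component of degree `d`, extended to the completion. -/
def projH (d : ℤ) : Comp S A₀ →+ Comp S A₀ :=
  (isPCompletion S A₀).ext (isPCompletion S A₀).complete
    ((toComp S A₀).toAddMonoidHom.comp (projC S A₀ d))

theorem projH_toComp (d : ℤ) (c : Tens S A₀) :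
    projH S A₀ d (toComp S A₀ c) = toComp S A₀ (projC S A₀ d c) :=
  (isPCompletion S A₀).ext_apply _ _ c

theorem projC_projC (d e : ℤ) (c : Tens S A₀) :
    projC S A₀ d (projC S A₀ e c) = if d = e then projC S A₀ d c else 0 := by
  induction c using TensorProduct.induction_on with
  | zero => simp
  | tmul a s =>
    rw [projC_tmul, projC_tmul, projC_tmul]
    split_ifs with h
    · subst h
      rw [Frame.proj_of_mem (S.proj_mem d s)]
    · rw [Frame.proj_of_mem_ne (S.proj_mem e s) (Ne.symm h), tmul_zero]
  | add x y hx hy =>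
    simp only [map_add, hx, hy]
    split_ifs <;> simp

theorem projC_mul (d e : ℤ) (x y : Tens S A₀) :
    projC S A₀ (d + e) (projC S A₀ d x * projC S A₀ e y) = projC S A₀ d x * projC S A₀ e y := by
  induction x using TensorProduct.induction_on with
  | zero => simp
  | tmul a s =>
    induction y using TensorProduct.induction_on with
    | zero => simp
    | tmul b s' =>
      rw [projC_tmul, projC_tmul, Algebra.TensorProduct.tmul_mul_tmul, projC_tmul,
        Frame.proj_of_mem (SetLike.mul_mem_graded (S.proj_mem d s) (S.proj_mem e s'))]
    | add x y hx hy => simp only [map_add, mul_add, hx, hy]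
  | add x y hx hy => simp only [map_add, add_mul, hx, hy]

instance : IsGradedProj (projH S A₀) where
  same d x := by
    have := (isPCompletion S A₀).hom_ext (isPCompletion S A₀).complete
      (f := (projH S A₀ d).comp (projH S A₀ d)) (g := projH S A₀ d) (fun c => by
        change projH S A₀ d (projH S A₀ d (toComp S A₀ c)) = projH S A₀ d (toComp S A₀ c)
        rw [projH_toComp, projH_toComp, projC_projC, if_pos rfl])
    exact DFunLike.congr_fun this x
  ne d e x hde := by
    have := (isPCompletion S A₀).hom_ext (isPCompletion S A₀).complete
      (f := (projH S A₀ d).comp (projH S A₀ e)) (g := 0) (fun c => by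
        change projH S A₀ d (projH S A₀ e (toComp S A₀ c)) = 0
        rw [projH_toComp, projH_toComp, projC_projC, if_neg hde, map_zero])
    exact DFunLike.congr_fun this x
  mul d e x y := by
    refine (isPCompletion S A₀).bilin_ext (isPCompletion S A₀).complete
      (f := ((AddMonoidHom.compHom (projH S A₀ (d + e))).comp
        ((AddMonoidHom.mul.comp (projH S A₀ d)).flip.comp (projH S A₀ e)).flip))
      (g := ((AddMonoidHom.mul.comp (projH S A₀ d)).flip.comp (projH S A₀ e)).flip)
      (fun c c' => ?_) x y
    change projH S A₀ (d + e) (projH S A₀ d (toComp S A₀ c) * projH S A₀ e (toComp S A₀ c')) =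
      projH S A₀ d (toComp S A₀ c) * projH S A₀ e (toComp S A₀ c')
    rw [projH_toComp, projH_toComp, ← map_mul, projH_toComp, projC_mul]
  one := by
    rw [← map_one (toComp S A₀), projH_toComp, Algebra.TensorProduct.one_def, projC_tmul,
      Frame.proj_of_mem (SetLike.GradedOne.one_mem)]

/-- The underlying ring of the completed base change. -/
abbrev Ring' : Type u := finRing (projH S A₀)

/-- The grading of the completed base change. -/
abbrev Gr (d : ℤ) : AddSubgroup (Ring' S A₀) := finGrading (projH S A₀) d

theorem pComplete_gr (d : ℤ) : PComplete p (Gr S A₀ d) :=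
  pComplete_finGrading _ (isPCompletion S A₀).complete d

theorem toComp_mem_piece {d : ℤ} {c : Tens S A₀} (hc : projC S A₀ d c = c) :
    toComp S A₀ c ∈ piece (projH S A₀) d := by
  rw [mem_piece, projH_toComp, hc]

theorem tmul_mem_piece {d : ℤ} (a : A₀) {s : S.carrier} (hs : s ∈ S.grading d) :
    toComp S A₀ (a ⊗ₜ s) ∈ piece (projH S A₀) d :=
  toComp_mem_piece S A₀ (by rw [projC_tmul, Frame.proj_of_mem hs])

theorem toComp_mem_finRing (c : Tens S A₀) : toComp S A₀ c ∈ finRing (projH S A₀) := by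
  induction c using TensorProduct.induction_on with
  | zero => rw [map_zero]; exact zero_mem _
  | tmul a s =>
    induction s using DirectSum.Decomposition.inductionOn S.grading with
    | zero => rw [tmul_zero, map_zero]; exact zero_mem _
    | @homogeneous i x => exact piece_le_finRing _ (tmul_mem_piece S A₀ a x.2)
    | add x y hx hy => rw [tmul_add, map_add]; exact add_mem hx hy
  | add x y hx hy => rw [map_add]; exact add_mem hx hy

/-- The canonical map from `A₀ ⊗_{S₀} S` to the completed base change. -/
def ofTens : Tens S A₀ →+* Ring' S A₀ :=
  (toComp S A₀).codRestrict _ (toComp_mem_finRing S A₀)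

theorem ofTens_mem {d : ℤ} (a : A₀) {s : S.carrier} (hs : s ∈ S.grading d) :
    ofTens S A₀ (a ⊗ₜ s) ∈ Gr S A₀ d := tmul_mem_piece S A₀ a hs

/-- The canonical map `A₀ → 𝐒₀`. -/
def base : A₀ →+* Gr S A₀ 0 where
  toFun a := ⟨ofTens S A₀ (a ⊗ₜ 1), ofTens_mem S A₀ a (SetLike.GradedOne.one_mem)⟩
  map_one' := Subtype.ext (map_one (ofTens S A₀))
  map_mul' a b := Subtype.ext (by
    change ofTens S A₀ _ = ofTens S A₀ _ * ofTens S A₀ _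
    rw [← map_mul, Algebra.TensorProduct.tmul_mul_tmul, mul_one])
  map_zero' := Subtype.ext (by
    change ofTens S A₀ _ = 0
    rw [zero_tmul, map_zero])
  map_add' a b := Subtype.ext (by
    change ofTens S A₀ _ = ofTens S A₀ _ + ofTens S A₀ _
    rw [← map_add, add_tmul])

theorem coe_base (a : A₀) : (base S A₀ a : Ring' S A₀) = ofTens S A₀ (a ⊗ₜ 1) := rfl

/-- The canonical map `S → 𝐒`. -/
def unit : S.carrier →+* Ring' S A₀ :=
  (ofTens S A₀).comp (Algebra.TensorProduct.includeRight (R := S.grading 0) (A := A₀)).toRingHom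

theorem unit_apply (s : S.carrier) : unit S A₀ s = ofTens S A₀ (1 ⊗ₜ s) := rfl

theorem unit_mem {d : ℤ} {s : S.carrier} (hs : s ∈ S.grading d) : unit S A₀ s ∈ Gr S A₀ d :=
  ofTens_mem S A₀ 1 hs

theorem ofTens_tmul (a : A₀) (s : S.carrier) :
    ofTens S A₀ (a ⊗ₜ s) = (base S A₀ a : Ring' S A₀) * unit S A₀ s := by
  rw [coe_base, unit_apply, ← map_mul, Algebra.TensorProduct.tmul_mul_tmul, mul_one, one_mul]

/-- The canonical map `S₀ → 𝐒₀`. -/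
def unitZero : S.grading 0 →+* Gr S A₀ 0 where
  toFun s := ⟨unit S A₀ s, unit_mem S A₀ s.2⟩
  map_one' := Subtype.ext (map_one (unit S A₀))
  map_mul' a b := Subtype.ext (map_mul (unit S A₀) (a : S.carrier) b)
  map_zero' := Subtype.ext (map_zero (unit S A₀))
  map_add' a b := Subtype.ext (map_add (unit S A₀) (a : S.carrier) b)

theorem base_algebraMap (s : S.grading 0) :
    base S A₀ (algebraMap (S.grading 0) A₀ s) = unitZero S A₀ s := by
  refine Subtype.ext ?_
  change ofTens S A₀ _ = ofTens S A₀ _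
  have h := algebraMap_mul_tmul s (1 : A₀) (1 : S.carrier)
  rw [mul_one, mul_one] at h
  exact congrArg (ofTens S A₀) h

/-- Elements of degree `d` can be approximated by elements of `A₀ ⊗_{S₀} S` of degree `d`. -/
theorem gr_dense (d : ℤ) (x : Gr S A₀ d) (i : ℕ) :
    ∃ (c : {c : Tens S A₀ // projC S A₀ d c = c}) (y : Gr S A₀ d),
      x = ⟨ofTens S A₀ c, toComp_mem_piece S A₀ c.2⟩ + p ^ i • y := by
  obtain ⟨c, y, hcy⟩ := (isPCompletion S A₀).dense ((x : Ring' S A₀) : Comp S A₀) i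
  refine ⟨⟨projC S A₀ d c, by rw [projC_projC, if_pos rfl]⟩,
    ⟨⟨projH S A₀ d y, piece_le_finRing _ (proj_mem_piece _ d y)⟩,
      (mem_finGrading _).2 (proj_mem_piece _ d y)⟩, Subtype.ext (Subtype.ext ?_)⟩
  rw [← proj_finGrading _ x, hcy, map_add, map_nsmul]
  exact congrArg (· + p ^ i • projH S A₀ d y) (projH_toComp S A₀ d c)

theorem tens_induction (d : ℤ) {P : Tens S A₀ → Prop}
    (h0 : P 0) (hadd : ∀ x y, P x → P y → P (x + y))
    (h : ∀ (a : A₀) (s : S.carrier), s ∈ S.grading d → P (a ⊗ₜ s)) (c : Tens S A₀)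
    (hc : projC S A₀ d c = c) : P c := by
  rw [← hc]
  clear hc
  induction c using TensorProduct.induction_on with
  | zero => rw [map_zero]; exact h0
  | tmul a s => exact h a _ (S.proj_mem d s)
  | add x y hx hy => rw [map_add]; exact hadd _ _ hx hy

/-- Additive maps on `𝐒_d` are determined by their values on the products `a s` with `a ∈ A₀` and
`s ∈ S_d`. -/
theorem gr_hom_ext {d : ℤ} {G : Type u} [AddCommGroup G] (hG : PComplete p G)
    {f g : Gr S A₀ d →+ G}
    (h : ∀ (a : A₀) (s : S.carrier) (hs : s ∈ S.grading d),
      f ⟨ofTens S A₀ (a ⊗ₜ s), ofTens_mem S A₀ a hs⟩ =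
        g ⟨ofTens S A₀ (a ⊗ₜ s), ofTens_mem S A₀ a hs⟩) : f = g := by
  refine hG.addHom_ext (gr_dense S A₀ d) fun c => ?_
  have key : ∀ c : Tens S A₀, projC S A₀ d c = c →
      ∃ hc : ofTens S A₀ c ∈ Gr S A₀ d, f ⟨ofTens S A₀ c, hc⟩ = g ⟨ofTens S A₀ c, hc⟩ := by
    refine tens_induction S A₀ d ⟨by rw [map_zero]; exact zero_mem _, ?_⟩ ?_ fun a s hs => ⟨_,
        h a s hs⟩
    · have : (⟨ofTens S A₀ 0, by rw [map_zero]; exact zero_mem _⟩ : Gr S A₀ d) = 0 :=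
        Subtype.ext (map_zero _)
      rw [this, map_zero, map_zero]
    · rintro x y ⟨hx, hx'⟩ ⟨hy, hy'⟩
      refine ⟨by rw [map_add]; exact add_mem hx hy, ?_⟩
      have : (⟨ofTens S A₀ (x + y), by rw [map_add]; exact add_mem hx hy⟩ : Gr S A₀ d) =
        ⟨ofTens S A₀ x, hx⟩ + ⟨ofTens S A₀ y, hy⟩ := Subtype.ext (map_add _ _ _)
      rw [this, map_add, map_add, hx', hy']
  exact (key c c.2).2

/-- Every element of `𝐒₀` is congruent to an element of `A₀` modulo `pⁱ`. -/
theorem zero_dense (x : Gr S A₀ 0) (i : ℕ) :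
    ∃ (a : A₀) (y : Gr S A₀ 0), x = base S A₀ a + p ^ i • y := by
  obtain ⟨⟨c, hc⟩, y, rfl⟩ := gr_dense S A₀ 0 x i
  have key : ∀ c : Tens S A₀, projC S A₀ 0 c = c → ∃ a : A₀, c = a ⊗ₜ 1 := by
    refine tens_induction S A₀ 0 ⟨0, by rw [zero_tmul]⟩ ?_ fun a s hs => ?_
    · rintro _ _ ⟨a, rfl⟩ ⟨b, rfl⟩
      exact ⟨a + b, (add_tmul _ _ _).symm⟩
    · refine ⟨algebraMap (S.grading 0) A₀ ⟨s, hs⟩ * a, ?_⟩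
      have h := algebraMap_mul_tmul (⟨s, hs⟩ : S.grading 0) a (1 : S.carrier)
      rw [mul_one] at h
      exact h.symm
  obtain ⟨a, rfl⟩ := key c hc
  exact ⟨a, y, rfl⟩

theorem zero_hom_ext {G : Type u} [AddCommGroup G] (hG : PComplete p G)
    {f g : Gr S A₀ 0 →+ G} (h : ∀ a : A₀, f (base S A₀ a) = g (base S A₀ a)) : f = g :=
  hG.addHom_ext (zero_dense S A₀) h

variable {S A₀} in
/-- The ring homomorphism `a ⊗ s ↦ f(a) g(s)`. -/
def tensLift {X : Type u} [CommRing X] (f : A₀ →+* X) (g : S.carrier →+* X)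
    (h : ∀ s : S.grading 0, f (algebraMap (S.grading 0) A₀ s) = g s) : Tens S A₀ →+* X :=
  tensorLift f g h

variable {S A₀} in
theorem tensLift_tmul {X : Type u} [CommRing X] (f : A₀ →+* X) (g : S.carrier →+* X)
    (h : ∀ s : S.grading 0, f (algebraMap (S.grading 0) A₀ s) = g s) (a : A₀) (s : S.carrier) :
    tensLift f g h (a ⊗ₜ s) = f a * g s :=
  tensorLift_tmul f g h a s

end EtFrame

end EtaleFrame

/-- The Frobenius endomorphism of `B / p`. -/
def frobModP (p : ℕ) [Fact p.Prime] (B : Type u) [CommRing B] :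
    B ⧸ Ideal.span {(p : B)} →+* B ⧸ Ideal.span {(p : B)} where
  toFun x := x ^ p
  map_one' := one_pow p
  map_mul' x y := mul_pow x y p
  map_zero' := zero_pow (Fact.out : p.Prime).ne_zero
  map_add' x y := by
    obtain ⟨r, hr⟩ := exists_add_pow_prime_eq (Fact.out : p.Prime) x y
    have h : ((p : ℕ) : B ⧸ Ideal.span {(p : B)}) = 0 := by
      rw [← map_natCast (Ideal.Quotient.mk (Ideal.span {(p : B)}))]
      exact Ideal.Quotient.eq_zero_iff_mem.2 (Ideal.mem_span_singleton_self _)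
    rw [hr, h, zero_mul, zero_mul, zero_mul, add_zero]

theorem mk_modP_eq_iff {p : ℕ} {B : Type u} [CommRing B] (x y : B) :
    Ideal.Quotient.mk (Ideal.span {(p : B)}) x = Ideal.Quotient.mk _ y ↔ ∃ b, x = y + p * b := by
  rw [Ideal.Quotient.eq, Ideal.mem_span_singleton]
  constructor
  · rintro ⟨b, hb⟩
    exact ⟨b, by rw [← hb]; ring⟩
  · rintro ⟨b, rfl⟩
    exact ⟨b, by ring⟩

/-- A Frobenius lift extends uniquely along an étale homomorphism to a `p`-adically complete
ring. -/
theorem existsUnique_frobenius_lift {p : ℕ} [Fact p.Prime] {R A B : Type u} [CommRing R]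
    [CommRing A] [CommRing B] {f : R →+* A} (hf : f.Etale) (hB : PComplete p B) (g : A →+* B)
    (j : R →+* B) (hj : ∀ r, ∃ b, j r = g (f r) ^ p + p * b) :
    ∃! G : A →+* B, G.comp f = j ∧ ∀ a, ∃ b, G a = g a ^ p + p * b := by
  have h := existsUnique_etale_lift hf hB (π := Ideal.Quotient.mk (Ideal.span {(p : B)}))
    Ideal.Quotient.mk_surjective (fun x hx => ⟨1, by
      rw [Ideal.Quotient.eq_zero_iff_mem, Ideal.mem_span_singleton] at hx
      obtain ⟨y, hy⟩ := hx
      exact ⟨y, by rw [pow_one, hy]⟩⟩) ⟨1, by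
      rw [pow_one, ← map_natCast (Ideal.Quotient.mk (Ideal.span {(p : B)}))]
      exact Ideal.Quotient.eq_zero_iff_mem.2 (Ideal.mem_span_singleton_self _)⟩ j
    ((frobModP p B).comp ((Ideal.Quotient.mk _).comp g)) (by
      ext r
      obtain ⟨b, hb⟩ := hj r
      exact (map_pow _ _ _).symm.trans ((mk_modP_eq_iff _ _).2 ⟨b, hb⟩).symm)
  have key : ∀ G : A →+* B, (Ideal.Quotient.mk (Ideal.span {(p : B)})).comp G =
      (frobModP p B).comp ((Ideal.Quotient.mk _).comp g) ↔
        ∀ a, ∃ b, G a = g a ^ p + p * b := by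
    intro G
    rw [RingHom.ext_iff]
    refine forall_congr' fun a => ?_
    rw [← mk_modP_eq_iff, map_pow]
    rfl
  simp only [key] at h
  exact h

namespace EtFrame

section Tau

variable {p : ℕ} (S : Frame.{u} p) (A₀ : Type u) [CommRing A₀] [Algebra (S.grading 0) A₀]

theorem pComplete_zero : PComplete p (Gr S A₀ 0) := pComplete_gr S A₀ 0

theorem tau_compat (s : S.grading 0) : base S A₀ (algebraMap (S.grading 0) A₀ s) =
    ((unitZero S A₀).comp S.tau) s := by
  rw [base_algebraMap, RingHom.comp_apply, S.tau_zero]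

/-- The map `τ` of the completed base change. -/
def tau' : Ring' S A₀ →+* Gr S A₀ 0 :=
  ((isPCompletion S A₀).ringExt (pComplete_zero S A₀)
    (tensLift (base S A₀) ((unitZero S A₀).comp S.tau) (tau_compat S A₀))).comp
      (finRing (projH S A₀)).subtype

theorem tau'_tmul (a : A₀) (s : S.carrier) :
    tau' S A₀ (ofTens S A₀ (a ⊗ₜ s)) = base S A₀ a * unitZero S A₀ (S.tau s) :=
  ((isPCompletion S A₀).ringExt_apply (pComplete_zero S A₀) _ (a ⊗ₜ s)).trans
    (tensLift_tmul _ _ _ a s)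

theorem tau'_unit (s : S.carrier) : tau' S A₀ (unit S A₀ s) = unitZero S A₀ (S.tau s) := by
  rw [unit_apply, tau'_tmul, map_one, one_mul]

theorem tau'_zero (x : Gr S A₀ 0) : tau' S A₀ x = x := by
  have := zero_hom_ext S A₀ (pComplete_zero S A₀)
    (f := (tau' S A₀).toAddMonoidHom.comp (Gr S A₀ 0).subtype) (g := AddMonoidHom.id _)
    (fun a => by
      change tau' S A₀ (ofTens S A₀ (a ⊗ₜ 1)) = base S A₀ a
      rw [tau'_tmul, map_one, map_one, mul_one])
  exact DFunLike.congr_fun this x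

/-- An element of degree `-n` is determined by its image under `τ`. -/
theorem eq_unit_t_pow_mul (n : ℕ) (hn : 1 ≤ n) (x : Gr S A₀ (-(n : ℤ))) :
    (x : Ring' S A₀) = unit S A₀ S.t ^ n * (tau' S A₀ x : Ring' S A₀) := by
  have hmem : ∀ y : Gr S A₀ 0, unit S A₀ S.t ^ n * (y : Ring' S A₀) ∈ Gr S A₀ (-(n : ℤ)) := by
    intro y
    have h1 := SetLike.pow_mem_graded n (unit_mem S A₀ S.t_mem)
    have h2 := SetLike.mul_mem_graded h1 y.2
    simpa using h2
  let f : Gr S A₀ 0 →+ Gr S A₀ (-(n : ℤ)) :=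
    { toFun := fun y => ⟨_, hmem y⟩
      map_zero' := Subtype.ext (mul_zero _)
      map_add' := fun y z => Subtype.ext (mul_add _ _ _) }
  have := gr_hom_ext S A₀ (d := -(n : ℤ)) (pComplete_gr S A₀ _) (f := AddMonoidHom.id _)
    (g := f.comp ((tau' S A₀).toAddMonoidHom.comp (Gr S A₀ (-(n : ℤ))).subtype))
    (fun a s hs => by
      refine Subtype.ext ?_
      change ofTens S A₀ (a ⊗ₜ s) = unit S A₀ S.t ^ n *
        (tau' S A₀ (ofTens S A₀ (a ⊗ₜ s)) : Ring' S A₀)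
      rw [tau'_tmul, ofTens_tmul]
      conv_lhs => rw [S.eq_t_pow_mul n hn hs, map_mul, map_pow]
      change _ = _ * ((base S A₀ a : Ring' S A₀) * (unit S A₀ (S.tau s)))
      ring)
  exact congrArg Subtype.val (DFunLike.congr_fun this x)

end Tau

variable {p : ℕ} [Fact p.Prime] (S : Frame.{u} p) (A₀ : Type u) [CommRing A₀]
  [Algebra (S.grading 0) A₀] [hA : Algebra.Etale (S.grading 0) A₀]

theorem existsUnique_sigmaBase : ∃! G : A₀ →+* Gr S A₀ 0,
    G.comp (algebraMap (S.grading 0) A₀) =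
      (unitZero S A₀).comp (S.sigma.comp (algebraMap (S.grading 0) S.carrier)) ∧
    ∀ a, ∃ b, G a = base S A₀ a ^ p + p * b := by
  refine existsUnique_frobenius_lift (RingHom.etale_algebraMap.2 hA) (pComplete_zero S A₀)
    (base S A₀) _ fun s => ?_
  obtain ⟨b, hb⟩ := S.sigma_zero s
  refine ⟨unitZero S A₀ b, ?_⟩
  have h1 : ((unitZero S A₀).comp (S.sigma.comp (algebraMap (S.grading 0) S.carrier))) s =
    unitZero S A₀ (S.sigma s) := rfl
  rw [h1, base_algebraMap, hb, map_add, map_mul, map_pow, map_natCast]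

/-- The extension of `σ` to `A₀`. -/
def sigmaBase : A₀ →+* Gr S A₀ 0 := (existsUnique_sigmaBase S A₀).choose

theorem sigmaBase_algebraMap (s : S.grading 0) :
    sigmaBase S A₀ (algebraMap (S.grading 0) A₀ s) = unitZero S A₀ (S.sigma s) :=
  RingHom.congr_fun (existsUnique_sigmaBase S A₀).choose_spec.1.1 s

theorem sigmaBase_frob (a : A₀) : ∃ b, sigmaBase S A₀ a = base S A₀ a ^ p + p * b :=
  (existsUnique_sigmaBase S A₀).choose_spec.1.2 a

/-- The Frobenius lift of the completed base change. -/
def sigma' : Ring' S A₀ →+* Gr S A₀ 0 :=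
  ((isPCompletion S A₀).ringExt (pComplete_zero S A₀)
    (tensLift (sigmaBase S A₀) ((unitZero S A₀).comp S.sigma)
      (sigmaBase_algebraMap S A₀))).comp (finRing (projH S A₀)).subtype

theorem sigma'_tmul (a : A₀) (s : S.carrier) :
    sigma' S A₀ (ofTens S A₀ (a ⊗ₜ s)) = sigmaBase S A₀ a * unitZero S A₀ (S.sigma s) :=
  ((isPCompletion S A₀).ringExt_apply (pComplete_zero S A₀) _ (a ⊗ₜ s)).trans
    (tensLift_tmul _ _ _ a s)

theorem sigma'_base (a : A₀) : sigma' S A₀ (base S A₀ a) = sigmaBase S A₀ a := by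
  rw [coe_base, sigma'_tmul, map_one, map_one, mul_one]

theorem sigma'_unit (s : S.carrier) : sigma' S A₀ (unit S A₀ s) = unitZero S A₀ (S.sigma s) := by
  rw [unit_apply, sigma'_tmul, map_one, one_mul]

theorem sigma'_frob (x : Gr S A₀ 0) : ∃ b, sigma' S A₀ x = x ^ p + p * b := by
  obtain ⟨a, y, rfl⟩ := zero_dense S A₀ x 1
  rw [← mk_modP_eq_iff]
  have h1 : Ideal.Quotient.mk (Ideal.span {(p : Gr S A₀ 0)}) (base S A₀ a + p ^ 1 • y) =
      Ideal.Quotient.mk _ (base S A₀ a) :=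
    (mk_modP_eq_iff _ _).2 ⟨y, by rw [pow_one, nsmul_eq_mul]⟩
  rw [map_pow, h1, ← map_pow]
  refine ((mk_modP_eq_iff _ _).2 ⟨sigma' S A₀ y, ?_⟩).trans
    ((mk_modP_eq_iff _ _).2 (sigmaBase_frob S A₀ a))
  have h2 : ((base S A₀ a + p ^ 1 • y : Gr S A₀ 0) : Ring' S A₀) =
    (base S A₀ a : Ring' S A₀) + p * (y : Ring' S A₀) := by
    rw [pow_one, nsmul_eq_mul]
    rfl
  rw [h2, map_add, map_mul, map_natCast, sigma'_base]

end EtFrame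

open EtFrame in
/-- The completed base change of a frame along an étale `S₀`-algebra. -/
abbrev etFrame {p : ℕ} [Fact p.Prime] (S : Frame.{u} p) (A₀ : Type u) [CommRing A₀]
    [Algebra (S.grading 0) A₀] [Algebra.Etale (S.grading 0) A₀] : Frame.{u} p where
  carrier := Ring' S A₀
  grading := Gr S A₀
  sigma := sigma' S A₀
  tau := tau' S A₀
  tau_zero := tau'_zero S A₀
  tau_neg n hn := by
    constructor
    · intro x y hxy
      refine Subtype.ext ?_
      rw [eq_unit_t_pow_mul S A₀ n hn x, eq_unit_t_pow_mul S A₀ n hn y]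
      exact congrArg (fun z : Gr S A₀ 0 => unit S A₀ S.t ^ n * (z : Ring' S A₀)) hxy
    · intro y
      have h1 := SetLike.pow_mem_graded n (unit_mem S A₀ S.t_mem)
      have h2 := SetLike.mul_mem_graded h1 y.2
      refine ⟨⟨unit S A₀ S.t ^ n * (y : Ring' S A₀), by simpa using h2⟩, ?_⟩
      change tau' S A₀ (unit S A₀ S.t ^ n * (y : Ring' S A₀)) = y
      rw [map_mul, map_pow, tau'_unit, S.tau_t, map_one, one_pow, one_mul, tau'_zero]
  sigma_zero := sigma'_frob S A₀
  sigma_t x hx h := by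
    have h1 := eq_unit_t_pow_mul S A₀ 1 le_rfl ⟨x, hx⟩
    rw [pow_one] at h1
    change x = unit S A₀ S.t * (tau' S A₀ x : Ring' S A₀) at h1
    rw [h1, h]
    change sigma' S A₀ (unit S A₀ S.t * 1) = _
    rw [mul_one, sigma'_unit, S.sigma_t S.t S.t_mem S.tau_t, map_natCast]
  p_mem_jacobson := by
    have h := (pComplete_iff (A := Gr S A₀ 0)).1 (pComplete_zero S A₀)
    exact IsAdicComplete.le_jacobson_bot _ (Ideal.mem_span_singleton_self _)

open EtFrame in
/-- The canonical homomorphism to the completed base change. -/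
def etUnit {p : ℕ} [Fact p.Prime] (S : Frame.{u} p) (A₀ : Type u) [CommRing A₀]
    [Algebra (S.grading 0) A₀] [Algebra.Etale (S.grading 0) A₀] : S ⟶ etFrame S A₀ where
  toRingHom := EtFrame.unit S A₀
  map_mem _ _ h := unit_mem S A₀ h
  map_sigma x := congrArg Subtype.val (sigma'_unit S A₀ x).symm
  map_tau x := congrArg Subtype.val (tau'_unit S A₀ x).symm

/-! ### Pushouts of commutative rings -/

section Pushout

variable {A B C D : Type u} [CommRing A] [CommRing B] [CommRing C] [CommRing D]
  {f : A →+* B} {g : A →+* C} {h : B →+* D} {k : C →+* D}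

/-- The universal property of a pushout of commutative rings. -/
structure RingPushout (f : A →+* B) (g : A →+* C) (h : B →+* D) (k : C →+* D) : Prop where
  comm : h.comp f = k.comp g
  exists_desc : ∀ (X : Type u) [CommRing X] (u : B →+* X) (v : C →+* X), u.comp f = v.comp g →
    ∃ w : D →+* X, w.comp h = u ∧ w.comp k = v
  hom_ext : ∀ (X : Type u) [CommRing X] (w w' : D →+* X), w.comp h = w'.comp h →
    w.comp k = w'.comp k → w = w'

theorem ringPushout_iff : RingPushout f g h k ↔ IsPushout (CommRingCat.ofHom f)
    (CommRingCat.ofHom g) (CommRingCat.ofHom h) (CommRingCat.ofHom k) := by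
  constructor
  · intro H
    have comm : CommRingCat.ofHom f ≫ CommRingCat.ofHom h =
        CommRingCat.ofHom g ≫ CommRingCat.ofHom k := by
      rw [← CommRingCat.ofHom_comp, ← CommRingCat.ofHom_comp, H.comm]
    have key : ∀ s : Limits.PushoutCocone (CommRingCat.ofHom f) (CommRingCat.ofHom g),
        ∃ w : D →+* s.pt, w.comp h = s.inl.hom ∧ w.comp k = s.inr.hom := fun s =>
      H.exists_desc s.pt s.inl.hom s.inr.hom (congrArg CommRingCat.Hom.hom s.condition)
    refine ⟨⟨comm⟩, ⟨Limits.PushoutCocone.IsColimit.mk comm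
      (fun s => CommRingCat.ofHom (key s).choose) (fun s => ?_) (fun s => ?_) fun s m h1 h2 => ?_⟩⟩
    · exact CommRingCat.hom_ext (key s).choose_spec.1
    · exact CommRingCat.hom_ext (key s).choose_spec.2
    · refine CommRingCat.hom_ext (H.hom_ext s.pt _ _ ?_ ?_)
      · rw [CommRingCat.hom_ofHom, (key s).choose_spec.1]
        exact congrArg CommRingCat.Hom.hom h1
      · rw [CommRingCat.hom_ofHom, (key s).choose_spec.2]
        exact congrArg CommRingCat.Hom.hom h2
  · intro H
    refine ⟨congrArg CommRingCat.Hom.hom H.w, fun X _ u v huv => ?_, fun X _ w w' h1 h2 => ?_⟩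
    · have e : CommRingCat.ofHom f ≫ CommRingCat.ofHom u =
          CommRingCat.ofHom g ≫ CommRingCat.ofHom v := by
        rw [← CommRingCat.ofHom_comp, ← CommRingCat.ofHom_comp, huv]
      exact ⟨(H.desc _ _ e).hom, congrArg CommRingCat.Hom.hom (H.inl_desc _ _ e),
        congrArg CommRingCat.Hom.hom (H.inr_desc _ _ e)⟩
    · have := H.hom_ext (k := CommRingCat.ofHom w) (l := CommRingCat.ofHom w')
        (CommRingCat.hom_ext h1) (CommRingCat.hom_ext h2)
      exact congrArg CommRingCat.Hom.hom this

theorem RingPushout.etale (H : RingPushout f g h k) (hg : g.Etale) : h.Etale := by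
  have e := ringPushout_iff.1 H
  algebraize [f, g, h, k, h.comp f]
  have : IsScalarTower A C D := IsScalarTower.of_algebraMap_eq' H.comm
  have hp : Algebra.IsPushout A B C D := CommRingCat.isPushout_iff_isPushout.1 e
  have : Algebra.Etale A C := hg
  exact Algebra.Etale.of_equiv (Algebra.IsPushout.equiv A B C D)

theorem ringPushout_modPow (f : A →+* B) (p i : ℕ) :
    RingPushout (Ideal.Quotient.mk (Ideal.span {(p : A) ^ i})) f (ModPow.map f p i)
      (Ideal.Quotient.mk (Ideal.span {(p : B) ^ i})) := by
  refine ⟨rfl, fun X _ u v huv => ?_, fun X _ w w' _ h2 => Ideal.Quotient.ringHom_ext h2⟩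
  refine ⟨Ideal.Quotient.lift _ v fun x hx => ?_, Ideal.Quotient.ringHom_ext ?_, ?_⟩
  · rw [Ideal.mem_span_singleton] at hx
    obtain ⟨y, rfl⟩ := hx
    have h1 := RingHom.congr_fun huv ((p : A) ^ i)
    rw [RingHom.comp_apply, RingHom.comp_apply, Ideal.Quotient.eq_zero_iff_mem.2
      (Ideal.mem_span_singleton_self _), map_zero, map_pow, map_pow, map_natCast, map_natCast] at h1
    rw [map_mul, map_pow, map_natCast, ← h1, zero_mul]
  · exact huv.symm
  · rfl

end Pushout

theorem pComplete_of_isNilpotent {p : ℕ} {X : Type u} [CommRing X] (h : IsNilpotent (p : X)) :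
    PComplete p X := by
  obtain ⟨k, hk⟩ := h
  have h0 : ∀ (i : ℕ) (y : X), k ≤ i → p ^ i • y = 0 := fun i y hi => by
    rw [nsmul_eq_mul, Nat.cast_pow, pow_eq_zero_of_le hi hk, zero_mul]
  constructor
  · intro x hx
    obtain ⟨y, rfl⟩ := hx k
    exact h0 k y le_rfl
  · intro f hf
    have hc : ∀ i j, ∃ y, f (i + j) - f i = p ^ i • y := by
      intro i j
      induction j with
      | zero => exact ⟨0, by simp⟩
      | succ j ih =>
        obtain ⟨y, hy⟩ := ih
        obtain ⟨z, hz⟩ := hf (i + j)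
        refine ⟨y + p ^ j • z, ?_⟩
        rw [smul_add, ← hy, smul_smul, ← pow_add, ← hz, ← add_assoc]
        abel
    refine ⟨f k, fun i => ?_⟩
    rcases le_total k i with hi | hi
    · obtain ⟨j, rfl⟩ := Nat.exists_eq_add_of_le hi
      obtain ⟨y, hy⟩ := hc k j
      rw [h0 k y le_rfl, sub_eq_zero] at hy
      exact ⟨0, by rw [hy, sub_self, smul_zero]⟩
    · obtain ⟨j, rfl⟩ := Nat.exists_eq_add_of_le hi
      exact hc i j

theorem isNilpotent_modPow_cast (A : Type u) [CommRing A] (p i : ℕ) :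
    IsNilpotent (p : ModPow A p i) := by
  refine ⟨i, ?_⟩
  rw [← map_natCast (Ideal.Quotient.mk (Ideal.span {(p : A) ^ i})), ← map_pow]
  exact Ideal.Quotient.eq_zero_iff_mem.2 (Ideal.mem_span_singleton_self _)

namespace EtFrame

section

variable {p : ℕ} (S : Frame.{u} p) (A₀ : Type u) [CommRing A₀] [Algebra (S.grading 0) A₀]

theorem addHom_ext {G : Type u} [AddCommGroup G] (hG : PComplete p G) {f g : Ring' S A₀ →+ G}
    (h : ∀ (a : A₀) (s : S.carrier), f (ofTens S A₀ (a ⊗ₜ s)) = g (ofTens S A₀ (a ⊗ₜ s))) :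
    f = g := by
  ext x
  induction x using DirectSum.Decomposition.inductionOn (Gr S A₀) with
  | zero => rw [map_zero, map_zero]
  | @homogeneous d x =>
    have := gr_hom_ext S A₀ hG (d := d) (f := f.comp (Gr S A₀ d).subtype)
      (g := g.comp (Gr S A₀ d).subtype) (fun a s _ => h a s)
    exact DFunLike.congr_fun this x
  | add x y hx hy => rw [map_add, map_add, hx, hy]

theorem ringHom_ext {X : Type u} [CommRing X] (hX : PComplete p X) {f g : Ring' S A₀ →+* X}
    (h1 : ∀ a, f (base S A₀ a) = g (base S A₀ a)) (h2 : ∀ s, f (unit S A₀ s) = g (unit S A₀ s)) :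
    f = g := by
  have := addHom_ext S A₀ hX (f := f.toAddMonoidHom) (g := g.toAddMonoidHom) fun a s => by
    change f _ = g _
    rw [ofTens_tmul, map_mul, map_mul, h1, h2]
  exact RingHom.ext fun x => DFunLike.congr_fun this x

theorem exists_base_eq {a : A₀} {i : ℕ} {y : Gr S A₀ 0} (h : base S A₀ a = p ^ i • y) :
    ∃ b, a = p ^ i • b := by
  have h1 : toComp S A₀ (a ⊗ₜ 1) = p ^ i • (((y : Ring' S A₀)) : Comp S A₀) :=
    congrArg (fun x : Gr S A₀ 0 => ((x : Ring' S A₀) : Comp S A₀)) h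
  obtain ⟨c, hc⟩ := (isPCompletion S A₀).strict (a ⊗ₜ 1) i _ h1
  let r := tensLift (RingHom.id A₀) ((algebraMap (S.grading 0) A₀).comp S.tau) (fun s => by
    rw [RingHom.comp_apply, S.tau_zero]; rfl)
  refine ⟨r c, ?_⟩
  rw [← map_nsmul, ← hc, tensLift_tmul, map_one, mul_one]
  rfl

end

section Map

variable {p : ℕ} {S : Frame.{u} p} {A₀ B₀ : Type u} [CommRing A₀] [Algebra (S.grading 0) A₀]
  [CommRing B₀] [Algebra (S.grading 0) B₀] (g : A₀ →+* Gr S B₀ 0)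
  (hg : ∀ s, g (algebraMap (S.grading 0) A₀ s) = unitZero S B₀ s)

/-- The map of completions induced by a map `A₀ → 𝐒₀`. -/
def mapComp : Comp S A₀ →+* Comp S B₀ :=
  (isPCompletion S A₀).ringExt (isPCompletion S B₀).complete
    ((finRing (projH S B₀)).subtype.comp (tensLift ((algebraMap (Gr S B₀ 0) (Ring' S B₀)).comp g)
      (unit S B₀) fun s => congrArg (algebraMap (Gr S B₀ 0) (Ring' S B₀)) (hg s)))

theorem mapComp_tmul (a : A₀) (s : S.carrier) : mapComp g hg (toComp S A₀ (a ⊗ₜ s)) =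
    (((g a : Ring' S B₀) * unit S B₀ s : Ring' S B₀) : Comp S B₀) :=
  ((isPCompletion S A₀).ringExt_apply (isPCompletion S B₀).complete _ (a ⊗ₜ s)).trans
    (congrArg Subtype.val (tensLift_tmul _ _ _ a s))

theorem projH_mapComp (d : ℤ) (x : Comp S A₀) :
    projH S B₀ d (mapComp g hg x) = mapComp g hg (projH S A₀ d x) := by
  have := (isPCompletion S A₀).hom_ext (isPCompletion S B₀).complete
    (f := (projH S B₀ d).comp (mapComp g hg).toAddMonoidHom)
    (g := (mapComp g hg).toAddMonoidHom.comp (projH S A₀ d)) (fun c => by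
      change projH S B₀ d (mapComp g hg (toComp S A₀ c)) =
        mapComp g hg (projH S A₀ d (toComp S A₀ c))
      rw [projH_toComp]
      induction c using TensorProduct.induction_on with
      | zero => simp only [map_zero]
      | add x y hx hy => simp only [map_add, hx, hy]
      | tmul a s =>
        rw [projC_tmul, mapComp_tmul, mapComp_tmul]
        induction s using DirectSum.Decomposition.inductionOn S.grading with
        | zero => simp only [map_zero, mul_zero, Subring.coe_zero]
        | add x y hx hy => simp only [map_add, mul_add, Subring.coe_add, hx, hy]
        | @homogeneous e s =>
          have h1 := SetLike.mul_mem_graded (g a).2 (unit_mem S B₀ s.2)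
          rw [zero_add] at h1
          by_cases hed : e = d
          · subst hed
            rw [Frame.proj_of_mem s.2]
            exact (mem_piece _).1 h1
          · rw [Frame.proj_of_mem_ne s.2 hed, map_zero, mul_zero]
            exact proj_of_mem_ne _ (Ne.symm hed) h1)
  exact DFunLike.congr_fun this x

theorem mapComp_mem_piece {d : ℤ} {x : Comp S A₀} (hx : x ∈ piece (projH S A₀) d) :
    mapComp g hg x ∈ piece (projH S B₀) d := by
  rw [mem_piece] at hx ⊢
  rw [projH_mapComp, hx]

theorem mapComp_mem_finRing (x : Ring' S A₀) :
    mapComp g hg (x : Comp S A₀) ∈ finRing (projH S B₀) := by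
  induction x using DirectSum.Decomposition.inductionOn (Gr S A₀) with
  | zero => rw [Subring.coe_zero, map_zero]; exact zero_mem _
  | @homogeneous d x => exact piece_le_finRing _ (mapComp_mem_piece g hg x.2)
  | add x y hx hy => rw [Subring.coe_add, map_add]; exact add_mem hx hy

/-- The map of completed base changes induced by a map `A₀ → 𝐒₀`. -/
def mapRing : Ring' S A₀ →+* Ring' S B₀ :=
  ((mapComp g hg).comp (finRing (projH S A₀)).subtype).codRestrict _ (mapComp_mem_finRing g hg)

theorem mapRing_base (a : A₀) : mapRing g hg (base S A₀ a) = g a := by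
  refine Subtype.ext ((mapComp_tmul g hg a 1).trans ?_)
  rw [map_one, mul_one]

theorem mapRing_unit (s : S.carrier) : mapRing g hg (unit S A₀ s) = unit S B₀ s := by
  refine Subtype.ext ((mapComp_tmul g hg 1 s).trans ?_)
  rw [map_one]
  exact congrArg Subtype.val (one_mul (unit S B₀ s))

theorem mapRing_mem {d : ℤ} {x : Ring' S A₀} (hx : x ∈ Gr S A₀ d) :
    mapRing g hg x ∈ Gr S B₀ d := mapComp_mem_piece g hg hx

end Map

end EtFrame

open EtFrame in
/-- The homomorphism of completed base changes induced by a map `A₀ → 𝐒₀`. -/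
def etMap {p : ℕ} [Fact p.Prime] {S : Frame.{u} p} {A₀ B₀ : Type u} [CommRing A₀]
    [Algebra (S.grading 0) A₀] [hA : Algebra.Etale (S.grading 0) A₀] [CommRing B₀]
    [Algebra (S.grading 0) B₀] [Algebra.Etale (S.grading 0) B₀] (g : A₀ →+* Gr S B₀ 0)
    (hg : ∀ s, g (algebraMap (S.grading 0) A₀ s) = unitZero S B₀ s) :
    etFrame S A₀ ⟶ etFrame S B₀ :=
  let g0 : Gr S A₀ 0 →+* Gr S B₀ 0 :=
    { toFun := fun x => ⟨mapRing g hg x, mapRing_mem g hg x.2⟩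
      map_one' := Subtype.ext (map_one (mapRing g hg))
      map_mul' := fun x y => Subtype.ext (map_mul (mapRing g hg) (x : Ring' S A₀) y)
      map_zero' := Subtype.ext (map_zero (mapRing g hg))
      map_add' := fun x y => Subtype.ext (map_add (mapRing g hg) (x : Ring' S A₀) y) }
  have hb : ∀ a, g0 (base S A₀ a) = g a := fun a => Subtype.ext (mapRing_base g hg a)
  have hu : ∀ s, g0 (unitZero S A₀ s) = unitZero S B₀ s := fun s =>
    Subtype.ext (mapRing_unit g hg s)
  { toRingHom := mapRing g hg
    map_mem := fun _ _ h => mapRing_mem g hg h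
    map_sigma := fun x => by
      have := EtFrame.ringHom_ext S A₀ (pComplete_zero S B₀) (f := g0.comp (sigma' S A₀))
        (g := (sigma' S B₀).comp (mapRing g hg)) (fun a => by
          rw [RingHom.comp_apply, RingHom.comp_apply, sigma'_base, mapRing_base]
          have hu := existsUnique_frobenius_lift (RingHom.etale_algebraMap.2 hA)
            (pComplete_zero S B₀) g
            ((sigma' S B₀).comp ((algebraMap (Gr S B₀ 0) (Ring' S B₀)).comp
              (g.comp (algebraMap (S.grading 0) A₀)))) fun r => sigma'_frob S B₀ _
          refine RingHom.congr_fun (hu.unique (y₁ := g0.comp (sigmaBase S A₀))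
            (y₂ := (sigma' S B₀).comp ((algebraMap (Gr S B₀ 0) (Ring' S B₀)).comp g))
            ⟨RingHom.ext fun s => ?_, fun a => ?_⟩ ⟨rfl, fun a => sigma'_frob S B₀ _⟩) a
          · change g0 (sigmaBase S A₀ (algebraMap _ _ s)) =
              sigma' S B₀ (g (algebraMap _ _ s) : Ring' S B₀)
            rw [sigmaBase_algebraMap, hg]
            exact (Subtype.ext (mapRing_unit g hg _)).trans (sigma'_unit S B₀ s).symm
          · obtain ⟨b, hb'⟩ := sigmaBase_frob S A₀ a
            refine ⟨g0 b, ?_⟩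
            rw [RingHom.comp_apply, hb', map_add, map_mul, map_pow, map_natCast, hb])
        (fun s => by
          rw [RingHom.comp_apply, RingHom.comp_apply, sigma'_unit, mapRing_unit, sigma'_unit, hu])
      exact congrArg Subtype.val (RingHom.congr_fun this x)
    map_tau := fun x => by
      have := EtFrame.ringHom_ext S A₀ (pComplete_zero S B₀) (f := g0.comp (tau' S A₀))
        (g := (tau' S B₀).comp (mapRing g hg)) (fun a => by
          rw [RingHom.comp_apply, RingHom.comp_apply, mapRing_base, tau'_zero, tau'_zero, hb])
        (fun s => by
          rw [RingHom.comp_apply, RingHom.comp_apply, tau'_unit, mapRing_unit, tau'_unit, hu])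
      exact congrArg Subtype.val (RingHom.congr_fun this x) }

variable {p : ℕ}

theorem Frame.Hom.zero_mem_tIdeal {S S' : Frame.{u} p} (f : S ⟶ S') {x : S.grading 0}
    (hx : x ∈ S.tIdeal) : Frame.Hom.zero f x ∈ S'.tIdeal := by
  obtain ⟨s, hs, hx⟩ := hx
  refine ⟨f.toRingHom s, f.map_mem 1 s hs, ?_⟩
  change f.toRingHom x = _
  rw [hx, map_mul, Frame.Hom.map_t]

/-- Elements of `t S₁` have `p`-th power divisible by `p`. -/
theorem Frame.exists_pow_eq (S : Frame.{u} p) {x : S.grading 0} (hx : x ∈ S.tIdeal) :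
    ∃ y, x ^ p = p * y := by
  obtain ⟨s, hs, hx⟩ := hx
  obtain ⟨b, hb⟩ := S.sigma_zero x
  refine ⟨S.sigma s - b, ?_⟩
  rw [hx, map_mul, S.sigma_t S.t S.t_mem S.tau_t] at hb
  rw [mul_sub, hb]
  ring

section Lift

variable (S : Frame.{u} p)

/-- A lift of an étale `R`-algebra to an étale `S₀`-algebra. -/
structure EtLift (A : EtAlg S.residue) where
  ring : Type u
  [commRing : CommRing ring]
  [algebra : Algebra (S.grading 0) ring]
  [etale : Algebra.Etale (S.grading 0) ring]
  toAlg : ring →+* A.obj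
  surj : Function.Surjective toAlg
  ker : RingHom.ker toAlg = S.tIdeal.map (algebraMap (S.grading 0) ring)
  toAlg_algebraMap : ∀ s, toAlg (algebraMap (S.grading 0) ring s) =
    algebraMap S.residue A.obj (S.toResidue s)

attribute [instance] EtLift.commRing EtLift.algebra EtLift.etale

theorem nonempty_etLift (A : EtAlg S.residue) : Nonempty (EtLift S A) := by
  algebraize [S.toResidue, (algebraMap S.residue A.obj).comp S.toResidue]
  have := A.property
  obtain ⟨A₀, _, _, h, f, hf, hk⟩ := exists_etale_lift (R₀ := S.grading 0) (R := S.residue)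
    (A := A.obj) S.toResidue_surjective
  refine ⟨⟨A₀, f.toRingHom, hf, ?_, fun s => f.commutes s⟩⟩
  refine hk.trans (congrArg _ ?_)
  ext x
  exact S.toResidue_eq_zero

variable {S} {A : EtAlg S.residue} (L : EtLift S A) (hS : S.IsPAdic)

theorem EtAlg.isNilpotent_p (hS : S.IsPAdic) (A : EtAlg S.residue) : IsNilpotent (p : A.obj) := by
  have := hS.nilpotent.map (algebraMap S.residue A.obj)
  rwa [map_natCast] at this

open EtFrame

namespace EtLift

/-- The map `ρ` of the completed base change. -/
def rho : Ring' S L.ring →+* A.obj :=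
  ((isPCompletion S L.ring).ringExt (pComplete_of_isNilpotent (EtAlg.isNilpotent_p hS A))
    (tensLift L.toAlg ((algebraMap S.residue A.obj).comp S.rho) (fun s => by
      rw [L.toAlg_algebraMap, RingHom.comp_apply, S.rho_of_mem_zero]))).comp
      (finRing (projH S L.ring)).subtype

theorem rho_tmul (a : L.ring) (s : S.carrier) : L.rho hS (ofTens S L.ring (a ⊗ₜ s)) =
    L.toAlg a * algebraMap S.residue A.obj (S.rho s) :=
  ((isPCompletion S L.ring).ringExt_apply (pComplete_of_isNilpotent (EtAlg.isNilpotent_p hS A)) _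
    (a ⊗ₜ s)).trans (tensLift_tmul _ _ _ a s)

theorem rho_base (a : L.ring) : L.rho hS (base S L.ring a) = L.toAlg a := by
  rw [coe_base, rho_tmul, map_one, map_one, mul_one]

theorem rho_unit (s : S.carrier) :
    L.rho hS (unit S L.ring s) = algebraMap S.residue A.obj (S.rho s) := by
  rw [unit_apply, rho_tmul, map_one, one_mul]

/-- The projection `𝐒₀ → A`. -/
def res : Gr S L.ring 0 →+* A.obj := (L.rho hS).comp (algebraMap (Gr S L.ring 0) (Ring' S L.ring))

theorem res_base (a : L.ring) : L.res hS (base S L.ring a) = L.toAlg a := L.rho_base hS a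

theorem res_unitZero (s : S.grading 0) : L.res hS (unitZero S L.ring s) =
    algebraMap S.residue A.obj (S.toResidue s) := by
  rw [← S.rho_of_mem_zero]
  exact L.rho_unit hS s

theorem res_surjective : Function.Surjective (L.res hS) := fun x => by
  obtain ⟨a, rfl⟩ := L.surj x
  exact ⟨_, L.res_base hS a⟩

theorem mem_map_of_res_eq_zero (hS : S.IsPAdic) {x : Gr S L.ring 0} (hx : L.res hS x = 0) :
    x ∈ S.tIdeal.map (unitZero S L.ring) := by
  obtain ⟨k, hk⟩ := hS.nilpotent
  obtain ⟨a, y, rfl⟩ := zero_dense S L.ring x k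
  have h1 : ((p : S.grading 0) ^ k) ∈ S.tIdeal := by
    rw [← S.toResidue_eq_zero, map_pow, map_natCast, hk]
  have h2 : (p : Gr S L.ring 0) ^ k * y ∈ S.tIdeal.map (unitZero S L.ring) := by
    have := Ideal.mem_map_of_mem (unitZero S L.ring) h1
    rw [map_pow, map_natCast] at this
    exact Ideal.mul_mem_right _ _ this
  rw [nsmul_eq_mul, Nat.cast_pow] at hx ⊢
  refine add_mem ?_ h2
  have h3 : L.toAlg a = 0 := by
    have h4 : (p : A.obj) ^ k = 0 := by
      have := congrArg (algebraMap S.residue A.obj) hk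
      rwa [map_pow, map_natCast, map_zero] at this
    rwa [map_add, map_mul, map_pow, map_natCast, h4, zero_mul, add_zero, res_base] at hx
  have h5 : a ∈ RingHom.ker L.toAlg := h3
  rw [L.ker] at h5
  have h6 := Ideal.mem_map_of_mem (base S L.ring) h5
  rw [Ideal.map_map] at h6
  have h7 : (base S L.ring).comp (algebraMap (S.grading 0) L.ring) = unitZero S L.ring :=
    RingHom.ext (base_algebraMap S L.ring)
  rwa [h7] at h6

theorem base_modPow_bijective (i : ℕ) :
    Function.Bijective (ModPow.map (base S L.ring) p i) := by
  constructor
  · rw [injective_iff_map_eq_zero]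
    intro x hx
    obtain ⟨a, rfl⟩ := Ideal.Quotient.mk_surjective x
    have h1 : Ideal.Quotient.mk (Ideal.span {(p : Gr S L.ring 0) ^ i}) (base S L.ring a) = 0 := hx
    rw [Ideal.Quotient.eq_zero_iff_mem, Ideal.mem_span_singleton] at h1
    obtain ⟨y, hy⟩ := h1
    obtain ⟨b, rfl⟩ := exists_base_eq S L.ring (a := a) (i := i) (y := y) (by
      rw [hy, nsmul_eq_mul, Nat.cast_pow])
    rw [Ideal.Quotient.eq_zero_iff_mem, nsmul_eq_mul, Nat.cast_pow]
    exact Ideal.mul_mem_right _ _ (Ideal.mem_span_singleton_self _)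
  · intro x
    obtain ⟨x, rfl⟩ := Ideal.Quotient.mk_surjective x
    obtain ⟨a, y, rfl⟩ := zero_dense S L.ring x i
    refine ⟨Ideal.Quotient.mk _ a, ?_⟩
    change Ideal.Quotient.mk (Ideal.span {(p : Gr S L.ring 0) ^ i}) (base S L.ring a) = _
    rw [Ideal.Quotient.eq, nsmul_eq_mul, Nat.cast_pow, Ideal.mem_span_singleton]
    exact ⟨-y, by ring⟩

variable [Fact p.Prime]

theorem res_eq_zero_iff {x : Gr S L.ring 0} :
    L.res hS x = 0 ↔ x ∈ (etFrame S L.ring).tIdeal := by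
  constructor
  · intro h
    have h1 := L.mem_map_of_res_eq_zero hS h
    refine Ideal.map_le_iff_le_comap.2 ?_ h1
    intro s hs
    exact Frame.Hom.zero_mem_tIdeal (etUnit S L.ring) hs
  · rintro ⟨s, _, hx⟩
    change L.rho hS x = 0
    rw [hx, ← Frame.Hom.map_t (etUnit S L.ring)]
    change L.rho hS (unit S L.ring S.t * s) = 0
    rw [map_mul, rho_unit, S.rho_of_mem_ne (by decide) S.t_mem, map_zero, zero_mul]

theorem tIdeal_eq_map (hS : S.IsPAdic) : (etFrame S L.ring).tIdeal = S.tIdeal.map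
    (unitZero S L.ring) := by
  refine le_antisymm (fun x hx => ?_) (Ideal.map_le_iff_le_comap.2 fun s hs => ?_)
  · exact L.mem_map_of_res_eq_zero hS ((L.res_eq_zero_iff hS).2 hx)
  · exact Frame.Hom.zero_mem_tIdeal (etUnit S L.ring) hs

/-- The residue ring of the completed base change. -/
def residueEquiv : (etFrame S L.ring).residue ≃+* A.obj :=
  RingEquiv.ofBijective (Ideal.Quotient.lift (etFrame S L.ring).tIdeal (L.res hS) fun _ hx =>
    (L.res_eq_zero_iff hS).2 hx) ⟨by
      refine (injective_iff_map_eq_zero _).2 fun x hx => ?_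
      obtain ⟨x, rfl⟩ := Ideal.Quotient.mk_surjective x
      exact Ideal.Quotient.eq_zero_iff_mem.2 ((L.res_eq_zero_iff hS).1 hx),
      Ideal.Quotient.lift_surjective_of_surjective _ _ (L.res_surjective hS)⟩

theorem isPAdic (hS : S.IsPAdic) : (etFrame S L.ring).IsPAdic where
  complete n := pComplete_iff.1 (pComplete_gr S L.ring n)
  nilpotent := by
    have := (EtAlg.isNilpotent_p hS A).map (L.residueEquiv hS).symm.toRingHom
    rwa [map_natCast] at this

theorem etale_modPow (i : ℕ) : (ModPow.map (Frame.Hom.zero (etUnit S L.ring)) p i).Etale := by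
  have h1 : ModPow.map (Frame.Hom.zero (etUnit S L.ring)) p i =
      (ModPow.map (base S L.ring) p i).comp
        (ModPow.map (algebraMap (S.grading 0) L.ring) p i) := by
    refine Ideal.Quotient.ringHom_ext (RingHom.ext fun s => ?_)
    exact congrArg (Ideal.Quotient.mk (Ideal.span {(p : Gr S L.ring 0) ^ i}))
      (base_algebraMap S L.ring s).symm
  rw [h1]
  exact RingHom.Etale.stableUnderComposition _ _
    ((ringPushout_modPow (algebraMap (S.grading 0) L.ring) p i).etale
      (RingHom.etale_algebraMap.2 L.etale))
    (RingHom.Etale.of_bijective (L.base_modPow_bijective i))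

theorem residue_pushout (hS : S.IsPAdic) : RingPushout S.toResidue (Frame.Hom.zero
    (etUnit S L.ring))
    (Frame.Hom.residue (etUnit S L.ring)) (etFrame S L.ring).toResidue := by
  refine ⟨rfl, fun X _ u v huv => ?_, fun X _ w w' _ h2 => Ideal.Quotient.ringHom_ext h2⟩
  refine ⟨Ideal.Quotient.lift (etFrame S L.ring).tIdeal v fun x hx => ?_,
    Ideal.Quotient.ringHom_ext huv.symm, rfl⟩
  rw [L.tIdeal_eq_map hS] at hx
  have : S.tIdeal.map (unitZero S L.ring) ≤ RingHom.ker v := by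
    refine Ideal.map_le_iff_le_comap.2 fun s hs => ?_
    have h1 := RingHom.congr_fun huv s
    rw [RingHom.comp_apply, S.toResidue_eq_zero.2 hs, map_zero] at h1
    exact h1.symm
  exact this hx

theorem mod_pushout (i : ℕ) : RingPushout
      ((Ideal.Quotient.mk (Ideal.span {(p : S.carrier) ^ i})).comp
        (algebraMap (S.grading 0) S.carrier))
      (Frame.Hom.zero (etUnit S L.ring))
      (ModPow.map (etUnit S L.ring).toRingHom p i)
      ((Ideal.Quotient.mk (Ideal.span {(p : (etFrame S L.ring).carrier) ^ i})).comp
        (algebraMap ((etFrame S L.ring).grading 0) (etFrame S L.ring).carrier)) := by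
  refine ⟨rfl, fun X _ u v huv => ?_, fun X _ w w' h1 h2 => ?_⟩
  · have hX0 : (p : X) ^ i = 0 := by
      have h1 : (p : ModPow S.carrier p i) ^ i = 0 := by
        rw [← map_natCast (Ideal.Quotient.mk (Ideal.span {(p : S.carrier) ^ i})), ← map_pow]
        exact Ideal.Quotient.eq_zero_iff_mem.2 (Ideal.mem_span_singleton_self _)
      have := congrArg u h1
      rwa [map_pow, map_natCast, map_zero] at this
    have hX : PComplete p X := pComplete_of_isNilpotent ⟨i, hX0⟩
    let u' : S.carrier →+* X := u.comp (Ideal.Quotient.mk (Ideal.span {(p : S.carrier) ^ i}))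
    let r0 := tensLift (v.comp (base S L.ring)) u' (fun s => by
        rw [RingHom.comp_apply, base_algebraMap]
        exact (RingHom.congr_fun huv s).symm)
    let r : Ring' S L.ring →+* X :=
      ((isPCompletion S L.ring).ringExt hX r0).comp (finRing (projH S L.ring)).subtype
    have hr : ∀ a s, r (ofTens S L.ring (a ⊗ₜ s)) = v (base S L.ring a) * u' s := fun a s =>
      ((isPCompletion S L.ring).ringExt_apply hX r0 (a ⊗ₜ s)).trans (tensLift_tmul _ _ _ a s)
    refine ⟨Ideal.Quotient.lift _ r fun x hx => ?_, Ideal.Quotient.ringHom_ext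
      (RingHom.ext fun s => ?_), ?_⟩
    · rw [Ideal.mem_span_singleton] at hx
      obtain ⟨y, rfl⟩ := hx
      rw [map_mul, map_pow, map_natCast, hX0, zero_mul]
    · change r (ofTens S L.ring (1 ⊗ₜ s)) = u' s
      rw [hr, map_one, map_one, one_mul]
    · have := zero_hom_ext S L.ring hX (f := r.toAddMonoidHom.comp (Gr S L.ring 0).subtype)
        (g := v.toAddMonoidHom) (fun a => by
          change r (ofTens S L.ring (a ⊗ₜ 1)) = v _
          rw [hr, map_one, mul_one])
      exact RingHom.ext fun x => DFunLike.congr_fun this x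
  · have hX : PComplete p X := by
      have := (isNilpotent_modPow_cast (etFrame S L.ring).carrier p i).map w
      rw [map_natCast] at this
      exact pComplete_of_isNilpotent this
    refine Ideal.Quotient.ringHom_ext (EtFrame.ringHom_ext S L.ring hX (fun a => ?_) fun s => ?_)
    · exact RingHom.congr_fun h2 (base S L.ring a)
    · exact RingHom.congr_fun h1 (Ideal.Quotient.mk _ s)

end EtLift

variable [Fact p.Prime] {B : EtAlg S.residue} (L' : EtLift S B)

namespace EtLift

theorem existsUnique_lift (φ : A ⟶ B) : ∃! g : L.ring →+* Gr S L'.ring 0,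
    g.comp (algebraMap (S.grading 0) L.ring) = unitZero S L'.ring ∧
      (L'.res hS).comp g = (EtAlg.algHom φ).toRingHom.comp L.toAlg := by
  refine existsUnique_etale_lift (RingHom.etale_algebraMap.2 L.etale) (pComplete_zero S L'.ring)
    (L'.res_surjective hS) (fun x hx => ⟨p, ?_⟩) (EtAlg.isNilpotent_p hS B) _ _
    (RingHom.ext fun s => ?_)
  · exact (etFrame S L'.ring).exists_pow_eq ((L'.res_eq_zero_iff hS).1 hx)
  · change EtAlg.algHom φ (L.toAlg (algebraMap _ _ s)) = L'.res hS (unitZero S L'.ring s)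
    rw [L.toAlg_algebraMap, res_unitZero, AlgHom.commutes]

/-- The lift of a homomorphism of étale `R`-algebras. -/
def lift (φ : A ⟶ B) : L.ring →+* Gr S L'.ring 0 := (L.existsUnique_lift hS L' φ).choose

theorem lift_algebraMap (φ : A ⟶ B) (s : S.grading 0) :
    L.lift hS L' φ (algebraMap _ _ s) = unitZero S L'.ring s :=
  RingHom.congr_fun (L.existsUnique_lift hS L' φ).choose_spec.1.1 s

theorem res_lift (φ : A ⟶ B) (a : L.ring) :
    L'.res hS (L.lift hS L' φ a) = EtAlg.algHom φ (L.toAlg a) :=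
  RingHom.congr_fun (L.existsUnique_lift hS L' φ).choose_spec.1.2 a

/-- The homomorphism of frames associated to a homomorphism of étale `R`-algebras. -/
def map (φ : A ⟶ B) : etFrame S L.ring ⟶ etFrame S L'.ring :=
  etMap (L.lift hS L' φ) (L.lift_algebraMap hS L' φ)

theorem unit_map (φ : A ⟶ B) : etUnit S L.ring ≫ L.map hS L' φ = etUnit S L'.ring :=
  Frame.Hom.ext (RingHom.ext fun s =>
    mapRing_unit (L.lift hS L' φ) (L.lift_algebraMap hS L' φ) s)

theorem res_map (φ : A ⟶ B) (x : Gr S L.ring 0) :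
    L'.res hS (Frame.Hom.zero (L.map hS L' φ) x) = EtAlg.algHom φ (L.res hS x) := by
  have := zero_hom_ext S L.ring (pComplete_of_isNilpotent (EtAlg.isNilpotent_p hS B))
    (f := ((L'.res hS).comp (Frame.Hom.zero (L.map hS L' φ))).toAddMonoidHom)
    (g := ((EtAlg.algHom φ).toRingHom.comp (L.res hS)).toAddMonoidHom) (fun a => by
      change L'.res hS (Frame.Hom.zero (L.map hS L' φ) _) = EtAlg.algHom φ (L.res hS _)
      rw [res_base, ← L.res_lift hS L']
      congr 1
      exact Subtype.ext (mapRing_base _ _ a))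
  exact DFunLike.congr_fun this x

theorem hom_ext {f g : etFrame S L.ring ⟶ etFrame S L'.ring}
    (hf : etUnit S L.ring ≫ f = etUnit S L'.ring) (hg : etUnit S L.ring ≫ g = etUnit S L'.ring)
    (h : ∀ x, L'.res hS (Frame.Hom.zero f x) = L'.res hS (Frame.Hom.zero g x)) : f = g := by
  have h1 : ∀ f : etFrame S L.ring ⟶ etFrame S L'.ring, etUnit S L.ring ≫ f = etUnit S L'.ring →
      ∀ s, f.toRingHom (EtFrame.unit S L.ring s) = EtFrame.unit S L'.ring s := fun f hf s =>
    RingHom.congr_fun (congrArg Frame.Hom.toRingHom hf) s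
  have h2 : (Frame.Hom.zero f).comp (base S L.ring) = (Frame.Hom.zero g).comp (base S L.ring) := by
    have hu := existsUnique_etale_lift (RingHom.etale_algebraMap.2 L.etale)
      (pComplete_zero S L'.ring) (L'.res_surjective hS)
      (fun x hx => ⟨p, (etFrame S L'.ring).exists_pow_eq ((L'.res_eq_zero_iff hS).1 hx)⟩)
      (EtAlg.isNilpotent_p hS B)
      (((Frame.Hom.zero f).comp (base S L.ring)).comp (algebraMap (S.grading 0) L.ring))
      ((L'.res hS).comp ((Frame.Hom.zero f).comp (base S L.ring))) rfl
    refine hu.unique ⟨rfl, rfl⟩ ⟨RingHom.ext fun s => ?_, RingHom.ext fun a => (h _).symm⟩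
    rw [RingHom.comp_apply, RingHom.comp_apply, RingHom.comp_apply, RingHom.comp_apply,
      base_algebraMap]
    exact Subtype.ext ((h1 g hg s).trans (h1 f hf s).symm)
  have h3 := EtFrame.ringHom_ext S L.ring (isPCompletion S L'.ring).complete
    (f := (finRing (projH S L'.ring)).subtype.comp f.toRingHom)
    (g := (finRing (projH S L'.ring)).subtype.comp g.toRingHom)
    (fun a => congrArg (fun x : Gr S L'.ring 0 => ((x : Ring' S L'.ring) : Comp S L'.ring))
      (RingHom.congr_fun h2 a))
    (fun s => congrArg Subtype.val ((h1 f hf s).trans (h1 g hg s).symm))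
  exact Frame.Hom.ext (RingHom.ext fun x => Subtype.ext (RingHom.congr_fun h3 x))

end EtLift

variable (S) in
/-- A chosen lift of an étale `R`-algebra. -/
def etLift (A : EtAlg S.residue) : EtLift S A := (nonempty_etLift S A).some

/-- The functor of completed base changes. -/
def etFrameFunctor : EtAlg S.residue ⥤ Frame.{u} p where
  obj A := etFrame S (etLift S A).ring
  map {A B} φ := (etLift S A).map hS (etLift S B) φ
  map_id A := by
    refine (etLift S A).hom_ext hS (etLift S A) ((etLift S A).unit_map hS (etLift S A) _)
      (Category.comp_id _) fun x => ?_
    exact (EtLift.res_map _ hS _ _ x).trans rfl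
  map_comp {A B C} φ ψ := by
    refine (etLift S A).hom_ext hS (etLift S C) ((etLift S A).unit_map hS (etLift S C) _)
      (by rw [← Category.assoc, EtLift.unit_map, EtLift.unit_map]) fun x => ?_
    refine (EtLift.res_map _ hS _ _ x).trans (Eq.symm ?_)
    refine ((etLift S B).res_map hS (etLift S C) ψ
      (Frame.Hom.zero ((etLift S A).map hS (etLift S B) φ) x)).trans ?_
    exact congrArg (EtAlg.algHom ψ) (EtLift.res_map _ hS _ φ x)

/-- A `p`-adic frame has an étale base change. -/
def etaleBaseChange : EtaleBaseChange S where
  frame := etFrameFunctor hS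
  unit A := etUnit S (etLift S A).ring
  unit_map {A B} φ := (etLift S A).unit_map hS (etLift S B) φ
  residueEquiv A := (etLift S A).residueEquiv hS
  residueEquiv_unit A r := by
    obtain ⟨s, rfl⟩ := S.toResidue_surjective r
    exact (etLift S A).res_unitZero hS s
  residueEquiv_map {A B} φ r := by
    obtain ⟨s, rfl⟩ := Frame.toResidue_surjective _ r
    exact (etLift S A).res_map hS (etLift S B) φ s
  isPAdic A := (etLift S A).isPAdic hS
  etale A i := (etLift S A).etale_modPow i
  residue_pushout A := ringPushout_iff.1 ((etLift S A).residue_pushout hS)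
  mod_pushout A i := ringPushout_iff.1 ((etLift S A).mod_pushout i)

end Lift

variable {p : ℕ}

section ModPowLemmas

theorem modPow_mk_eq_zero {A : Type u} [CommRing A] {i : ℕ} {x : A} :
    Ideal.Quotient.mk (Ideal.span {(p : A) ^ i}) x = 0 ↔ ∃ y, x = p ^ i * y := by
  rw [Ideal.Quotient.eq_zero_iff_mem, Ideal.mem_span_singleton]
  rfl

theorem modPow_cast_pow {A : Type u} [CommRing A] (i : ℕ) : (p : ModPow A p i) ^ i = 0 := by
  rw [← map_natCast (Ideal.Quotient.mk (Ideal.span {(p : A) ^ i})), ← map_pow]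
  exact modPow_mk_eq_zero.2 ⟨1, by rw [mul_one]⟩

/-- A ring homomorphism factors through the reduction modulo `pⁱ` if `pⁱ = 0` in the target. -/
def ModPow.lift {A X : Type u} [CommRing A] [CommRing X] (f : A →+* X) {i : ℕ}
    (h : (p : X) ^ i = 0) : ModPow A p i →+* X :=
  Ideal.Quotient.lift _ f fun x hx => by
    obtain ⟨y, rfl⟩ := modPow_mk_eq_zero.1 (Ideal.Quotient.eq_zero_iff_mem.2 hx)
    rw [map_mul, map_pow, map_natCast, h, zero_mul]

theorem cast_pow_eq_zero_of_modPow {A X : Type u} [CommRing A] [CommRing X] {i : ℕ}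
    (f : ModPow A p i →+* X) : (p : X) ^ i = 0 := by
  have := congrArg f (modPow_cast_pow (A := A) (p := p) i)
  rwa [map_pow, map_natCast, map_zero] at this

end ModPowLemmas

/-- A ring homomorphism that vanishes on `t S₁` factors through `R`. -/
def Frame.residueLift (S : Frame.{u} p) {X : Type u} [CommRing X] (f : S.grading 0 →+* X)
    (h : ∀ x ∈ S.tIdeal, f x = 0) : S.residue →+* X := Ideal.Quotient.lift S.tIdeal f h

namespace EtaleBaseChange

variable {S : Frame.{u} p} (E : EtaleBaseChange S)

/-- The projection `𝐒(A)₀ → A`. -/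
def res (A : EtAlg S.residue) : (E.frame.obj A).grading 0 →+* A.obj :=
  (E.residueEquiv A).toRingHom.comp (E.frame.obj A).toResidue

variable {A B : EtAlg S.residue}

theorem res_surjective : Function.Surjective (E.res A) :=
  (E.residueEquiv A).surjective.comp (E.frame.obj A).toResidue_surjective

theorem res_eq_zero_iff {x : (E.frame.obj A).grading 0} :
    E.res A x = 0 ↔ x ∈ (E.frame.obj A).tIdeal := by
  rw [← Frame.toResidue_eq_zero]
  exact (E.residueEquiv A).map_eq_zero_iff

theorem res_unit (s : S.grading 0) : E.res A (Frame.Hom.zero (E.unit A) s) =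
    algebraMap S.residue A.obj (S.toResidue s) := E.residueEquiv_unit A (S.toResidue s)

theorem res_map (f : A ⟶ B) (x : (E.frame.obj A).grading 0) :
    E.res B (Frame.Hom.zero (E.frame.map f) x) = EtAlg.algHom f (E.res A x) :=
  E.residueEquiv_map f ((E.frame.obj A).toResidue x)

theorem map_unit (f : A ⟶ B) (s : S.carrier) :
    (E.frame.map f).toRingHom ((E.unit A).toRingHom s) = (E.unit B).toRingHom s :=
  RingHom.congr_fun (congrArg Frame.Hom.toRingHom (E.unit_map f)) s

theorem zero_map_unit (f : A ⟶ B) (s : S.grading 0) :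
    Frame.Hom.zero (E.frame.map f) (Frame.Hom.zero (E.unit A) s) =
      Frame.Hom.zero (E.unit B) s := Subtype.ext (E.map_unit f s)

theorem eq_zero_of_mem_tIdeal {X : Type u} [CommRing X] (v : (E.frame.obj A).grading 0 →+* X)
    (hv : ∀ s ∈ S.tIdeal, v (Frame.Hom.zero (E.unit A) s) = 0) {x : (E.frame.obj A).grading 0}
    (hx : x ∈ (E.frame.obj A).tIdeal) : v x = 0 := by
  obtain ⟨w, -, hw⟩ := (ringPushout_iff.2 (E.residue_pushout A)).exists_desc X
    (S.residueLift (v.comp (Frame.Hom.zero (E.unit A))) hv) v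
    (RingHom.ext fun s => rfl)
  rw [← hw, RingHom.comp_apply, (Frame.toResidue_eq_zero _).2 hx, map_zero]

/-- Homomorphisms `𝐒(A)₀ → X` over `S₀`, with `p` nilpotent in `X`, are the same as homomorphisms
from `A` to the reduction of `X`. -/
theorem existsUnique_lift [Fact p.Prime] {X : Type u} [CommRing X] {i : ℕ} (hX : (p : X) ^ i = 0)
    (j : S.grading 0 →+* X) (g : A.obj →+* X ⧸ S.tIdeal.map j)
    (hg : ∀ s, g (algebraMap S.residue A.obj (S.toResidue s)) = Ideal.Quotient.mk _ (j s)) :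
    ∃! G : (E.frame.obj A).grading 0 →+* X, (∀ s, G (Frame.Hom.zero (E.unit A) s) = j s) ∧
      ∀ x, Ideal.Quotient.mk (S.tIdeal.map j) (G x) = g (E.res A x) := by
  have hrad : S.tIdeal.map j ≤ (Ideal.span {(p : X)}).radical := by
    refine Ideal.map_le_iff_le_comap.2 fun s hs => ?_
    obtain ⟨y, hy⟩ := S.exists_pow_eq hs
    refine ⟨p, ?_⟩
    rw [← map_pow, hy, map_mul, map_natCast]
    exact Ideal.mul_mem_right _ _ (Ideal.mem_span_singleton_self _)
  have hX' : (p : X ⧸ S.tIdeal.map j) ^ i = 0 := by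
    rw [← map_natCast (Ideal.Quotient.mk (S.tIdeal.map j)), ← map_pow, hX, map_zero]
  obtain ⟨G, ⟨hG1, hG2⟩, hG3⟩ := existsUnique_etale_lift (E.etale A i)
    (pComplete_of_isNilpotent ⟨i, hX⟩) (π := Ideal.Quotient.mk (S.tIdeal.map j))
    Ideal.Quotient.mk_surjective (fun x hx => by
      obtain ⟨m, hm⟩ := hrad (Ideal.Quotient.eq_zero_iff_mem.1 hx)
      obtain ⟨y, hy⟩ := Ideal.mem_span_singleton.1 hm
      exact ⟨m, y, hy⟩) ⟨i, hX'⟩ (ModPow.lift j hX) (ModPow.lift (g.comp (E.res A)) hX')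
    (Ideal.Quotient.ringHom_ext (RingHom.ext fun s => by
      change g (E.res A (Frame.Hom.zero (E.unit A) s)) = Ideal.Quotient.mk _ (j s)
      rw [res_unit, hg]))
  refine ⟨G.comp (Ideal.Quotient.mk _), ⟨fun s => ?_, fun x => ?_⟩, fun G' hG' => ?_⟩
  · exact RingHom.congr_fun hG1 (Ideal.Quotient.mk _ s)
  · exact RingHom.congr_fun hG2 (Ideal.Quotient.mk _ x)
  · rw [← hG3 (ModPow.lift G' hX) ⟨Ideal.Quotient.ringHom_ext (RingHom.ext hG'.1),
      Ideal.Quotient.ringHom_ext (RingHom.ext hG'.2)⟩]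
    rfl

theorem exists_reduction {X : Type u} [CommRing X] {j : S.grading 0 →+* X}
    {G : (E.frame.obj A).grading 0 →+* X} (hG : ∀ s, G (Frame.Hom.zero (E.unit A) s) = j s) :
    ∃ g : A.obj →+* X ⧸ S.tIdeal.map j,
      ∀ x, g (E.res A x) = Ideal.Quotient.mk (S.tIdeal.map j) (G x) := by
  have hk : ∀ x ∈ (E.frame.obj A).tIdeal, ((Ideal.Quotient.mk (S.tIdeal.map j)).comp G) x = 0 :=
    fun x hx => E.eq_zero_of_mem_tIdeal _ (fun s hs => by
      rw [RingHom.comp_apply, hG]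
      exact Ideal.Quotient.eq_zero_iff_mem.2 (Ideal.mem_map_of_mem j hs)) hx
  refine ⟨((E.frame.obj A).residueLift _ hk).comp (E.residueEquiv A).symm.toRingHom, fun x => ?_⟩
  have h : (E.residueEquiv A).symm (E.res A x) = (E.frame.obj A).toResidue x :=
    (E.residueEquiv A).symm_apply_apply _
  exact congrArg ((E.frame.obj A).residueLift _ hk) h

variable [Fact p.Prime]

theorem zero_hom_ext_of_reduction {X : Type u} [CommRing X] {i : ℕ} (hX : (p : X) ^ i = 0)
    {G G' : (E.frame.obj A).grading 0 →+* X}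
    (h1 : ∀ s, G (Frame.Hom.zero (E.unit A) s) = G' (Frame.Hom.zero (E.unit A) s))
    (h2 : ∀ (Y : Type u) [CommRing Y] (π : X →+* Y) (g g' : A.obj →+* Y),
      (∀ x, g (E.res A x) = π (G x)) → (∀ x, g' (E.res A x) = π (G' x)) → g = g') :
    G = G' := by
  let j := G.comp (Frame.Hom.zero (E.unit A))
  obtain ⟨g, hg⟩ := E.exists_reduction (A := A) (j := j) (G := G) (fun s => rfl)
  obtain ⟨g', hg'⟩ := E.exists_reduction (A := A) (j := j) (G := G') (fun s => (h1 s).symm)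
  have hgg : g = g' := h2 _ _ g g' hg hg'
  have hgs : ∀ s, g (algebraMap S.residue A.obj (S.toResidue s)) = Ideal.Quotient.mk _ (j s) := by
    intro s
    rw [← E.res_unit, hg]
    rfl
  refine (E.existsUnique_lift hX j g hgs).unique ⟨fun s => rfl, fun x => (hg x).symm⟩
    ⟨fun s => (h1 s).symm, fun x => ?_⟩
  rw [hgg, hg']

/-- Homomorphisms `𝐒(P)₀ → X` over `S₀` with `p` nilpotent in `X` are determined by their
restrictions to a jointly epimorphic pair `C → P ← D`. -/
theorem zero_hom_ext {C D P : EtAlg S.residue} {c : C ⟶ P} {d : D ⟶ P}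
    (hep : ∀ (X : Type u) [CommRing X] (w w' : P.obj →+* X),
      w.comp (EtAlg.algHom c).toRingHom = w'.comp (EtAlg.algHom c).toRingHom →
      w.comp (EtAlg.algHom d).toRingHom = w'.comp (EtAlg.algHom d).toRingHom → w = w')
    {X : Type u} [CommRing X] {i : ℕ} (hX : (p : X) ^ i = 0)
    {G G' : (E.frame.obj P).grading 0 →+* X}
    (h1 : ∀ s, G (Frame.Hom.zero (E.unit P) s) = G' (Frame.Hom.zero (E.unit P) s))
    (h2 : ∀ x, G (Frame.Hom.zero (E.frame.map c) x) = G' (Frame.Hom.zero (E.frame.map c) x))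
    (h3 : ∀ x, G (Frame.Hom.zero (E.frame.map d) x) = G' (Frame.Hom.zero (E.frame.map d) x)) :
    G = G' := by
  refine E.zero_hom_ext_of_reduction hX h1 fun Y _ π g g' hg hg' => ?_
  refine hep _ g g' (RingHom.ext fun y => ?_) (RingHom.ext fun y => ?_) <;>
  obtain ⟨x, rfl⟩ := E.res_surjective y <;>
  simp only [RingHom.comp_apply, AlgHom.toRingHom_eq_coe, RingHom.coe_coe, ← E.res_map, hg, hg',
    h2, h3]

/-- The inclusion of the component of degree zero, modulo `pⁱ`. -/
def inc (A : EtAlg S.residue) (i : ℕ) :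
    ModPow ((E.frame.obj A).grading 0) p i →+* ModPow (E.frame.obj A).carrier p i :=
  ModPow.map (algebraMap ((E.frame.obj A).grading 0) (E.frame.obj A).carrier) p i

/-- The formation of `𝐒 / pⁱ` commutes with base change by étale homomorphisms. -/
theorem ringPushout_map {A C D P : EtAlg S.residue} {c : A ⟶ C} {d : A ⟶ D} {c' : C ⟶ P}
    {d' : D ⟶ P}
    (H : RingPushout (EtAlg.algHom c).toRingHom (EtAlg.algHom d).toRingHom
      (EtAlg.algHom c').toRingHom (EtAlg.algHom d').toRingHom) (i : ℕ) :
    RingPushout (ModPow.map (Frame.Hom.zero (E.frame.map c)) p i)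
      ((E.inc D i).comp (ModPow.map (Frame.Hom.zero (E.frame.map d)) p i))
      ((E.inc P i).comp (ModPow.map (Frame.Hom.zero (E.frame.map c')) p i))
      (ModPow.map (E.frame.map d').toRingHom p i) := by
  have hcd : c ≫ c' = d ≫ d' := by
    refine ObjectProperty.hom_ext _ (CommAlgCat.hom_ext (AlgHom.ext fun x => ?_))
    exact RingHom.congr_fun H.comm x
  have hcd' : ∀ x, (E.frame.map c').toRingHom ((E.frame.map c).toRingHom x) =
      (E.frame.map d').toRingHom ((E.frame.map d).toRingHom x) := by
    intro x
    have := congrArg (fun f => (E.frame.map f).toRingHom x) hcd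
    simp only [Functor.map_comp] at this
    exact this
  refine ⟨?_, fun X _ u v huv => ?_, fun X _ w w' h1 h2 => ?_⟩
  · refine Ideal.Quotient.ringHom_ext (RingHom.ext fun x => ?_)
    exact congrArg (Ideal.Quotient.mk (Ideal.span {(p : (E.frame.obj P).carrier) ^ i})) (hcd' x)
  · have hX : (p : X) ^ i = 0 := cast_pow_eq_zero_of_modPow u
    let uC : (E.frame.obj C).grading 0 →+* X := u.comp (Ideal.Quotient.mk _)
    let vD : (E.frame.obj D).carrier →+* X := v.comp (Ideal.Quotient.mk _)
    let vD0 : (E.frame.obj D).grading 0 →+* X :=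
      vD.comp (algebraMap ((E.frame.obj D).grading 0) (E.frame.obj D).carrier)
    have huv' : ∀ x, uC (Frame.Hom.zero (E.frame.map c) x) =
        vD0 (Frame.Hom.zero (E.frame.map d) x) := fun x =>
      RingHom.congr_fun huv (Ideal.Quotient.mk _ x)
    let j : S.grading 0 →+* X := uC.comp (Frame.Hom.zero (E.unit C))
    have hjD : ∀ s, vD0 (Frame.Hom.zero (E.unit D) s) = j s := fun s => by
      rw [← E.zero_map_unit d, ← huv', E.zero_map_unit]
      rfl
    obtain ⟨gC, hgC⟩ := E.exists_reduction (j := j) (G := uC) fun s => rfl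
    obtain ⟨gD, hgD⟩ := E.exists_reduction (j := j) (G := vD0) hjD
    obtain ⟨g, hg1, hg2⟩ := H.exists_desc _ gC gD (RingHom.ext fun y => by
      obtain ⟨x, rfl⟩ := E.res_surjective y
      simp only [RingHom.comp_apply, AlgHom.toRingHom_eq_coe, RingHom.coe_coe, ← E.res_map, hgC,
        hgD, huv'])
    have hg1' : ∀ y, g (EtAlg.algHom c' y) = gC y := fun y => RingHom.congr_fun hg1 y
    have hg2' : ∀ y, g (EtAlg.algHom d' y) = gD y := fun y => RingHom.congr_fun hg2 y
    obtain ⟨G, ⟨hG1, hG2⟩, -⟩ := E.existsUnique_lift hX j g fun s => by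
      rw [← (EtAlg.algHom c').commutes, hg1', ← E.res_unit, hgC]
      rfl
    have hGC : G.comp (Frame.Hom.zero (E.frame.map c')) = uC := by
      refine (E.existsUnique_lift hX j gC fun s => by rw [← E.res_unit, hgC]; rfl).unique
        ⟨fun s => ?_, fun x => ?_⟩ ⟨fun s => rfl, fun x => (hgC x).symm⟩
      · rw [RingHom.comp_apply, E.zero_map_unit, hG1]
      · rw [RingHom.comp_apply, hG2, E.res_map, hg1']
    have hGD : G.comp (Frame.Hom.zero (E.frame.map d')) = vD0 := by
      refine (E.existsUnique_lift hX j gD fun s => by rw [← E.res_unit, hgD, hjD]).unique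
        ⟨fun s => ?_, fun x => ?_⟩ ⟨hjD, fun x => (hgD x).symm⟩
      · rw [RingHom.comp_apply, E.zero_map_unit, hG1]
      · rw [RingHom.comp_apply, hG2, E.res_map, hg2']
    obtain ⟨w, hw1, hw2⟩ := (ringPushout_iff.2 (E.mod_pushout P i)).exists_desc X
      (v.comp (ModPow.map (E.unit D).toRingHom p i)) G (RingHom.ext fun s => by
        rw [RingHom.comp_apply, RingHom.comp_apply G, hG1, ← hjD]
        rfl)
    have hw2' : ∀ x : (E.frame.obj P).grading 0,
        w (Ideal.Quotient.mk _ (x : (E.frame.obj P).carrier)) = G x := fun x =>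
      RingHom.congr_fun hw2 x
    refine ⟨w, Ideal.Quotient.ringHom_ext (RingHom.ext fun x => ?_), ?_⟩
    · exact (hw2' _).trans (RingHom.congr_fun hGC x)
    · refine (ringPushout_iff.2 (E.mod_pushout D i)).hom_ext X _ _ ?_ ?_
      · rw [← hw1]
        refine Ideal.Quotient.ringHom_ext (RingHom.ext fun s => ?_)
        exact congrArg (fun y => w (Ideal.Quotient.mk _ y)) (E.map_unit d' s)
      · refine RingHom.ext fun x => ?_
        exact (hw2' (Frame.Hom.zero (E.frame.map d') x)).trans (RingHom.congr_fun hGD x)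
  · have hX : (p : X) ^ i = 0 := cast_pow_eq_zero_of_modPow w
    have h1' : ∀ x, w (Ideal.Quotient.mk _ ((E.frame.map c').toRingHom
        (x : (E.frame.obj C).grading 0))) = w' (Ideal.Quotient.mk _ ((E.frame.map c').toRingHom
        x)) := fun x => RingHom.congr_fun h1 (Ideal.Quotient.mk _ x)
    have h2' : ∀ x, w (Ideal.Quotient.mk _ ((E.frame.map d').toRingHom x)) =
        w' (Ideal.Quotient.mk _ ((E.frame.map d').toRingHom x)) := fun x =>
      RingHom.congr_fun h2 (Ideal.Quotient.mk _ x)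
    have hu : ∀ s, w (Ideal.Quotient.mk _ ((E.unit P).toRingHom s)) =
        w' (Ideal.Quotient.mk _ ((E.unit P).toRingHom s)) := fun s => by
      rw [← E.map_unit d']
      exact h2' _
    refine (ringPushout_iff.2 (E.mod_pushout P i)).hom_ext X _ _
      (Ideal.Quotient.ringHom_ext (RingHom.ext hu)) ?_
    exact E.zero_hom_ext H.hom_ext hX (fun s => hu s) (fun x => h1' x) fun x => h2' x

/-- The homomorphism `S / pⁱ → 𝐒(R) / pⁱ` is an isomorphism. -/
theorem unit_self_modPow_bijective (i : ℕ) :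
    Function.Bijective (ModPow.map (E.unit (EtAlg.self S.residue)).toRingHom p i) := by
  let A := EtAlg.self S.residue
  let X := ModPow (S.grading 0) p i
  have hX : (p : X) ^ i = 0 := modPow_cast_pow i
  let j : S.grading 0 →+* X := Ideal.Quotient.mk _
  let g : A.obj →+* X ⧸ S.tIdeal.map j := Ideal.quotientMap _ j Ideal.le_comap_map
  obtain ⟨G, ⟨hG1, -⟩, -⟩ := E.existsUnique_lift (A := A) hX j g fun s => rfl
  let z : X →+* ModPow S.carrier p i := ModPow.map (algebraMap (S.grading 0) S.carrier) p i
  obtain ⟨w, hw1, hw2⟩ := (ringPushout_iff.2 (E.mod_pushout A i)).exists_desc _ (RingHom.id _)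
    (z.comp G) (RingHom.ext fun s => by
      rw [RingHom.comp_apply, RingHom.comp_apply, RingHom.comp_apply]
      exact (congrArg z (hG1 s)).symm)
  have hw1' : ∀ x, w (ModPow.map (E.unit A).toRingHom p i x) = x := RingHom.congr_fun hw1
  have hw2' : ∀ x : (E.frame.obj A).grading 0, w (Ideal.Quotient.mk _ x.1) = z (G x) :=
    RingHom.congr_fun hw2
  refine Function.bijective_iff_has_inverse.2 ⟨w, RingHom.congr_fun hw1, RingHom.congr_fun
    (f := (ModPow.map (E.unit A).toRingHom p i).comp w) (g := RingHom.id _) ?_⟩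
  refine (ringPushout_iff.2 (E.mod_pushout A i)).hom_ext _ _ _ ?_ ?_
  · exact RingHom.ext fun x => congrArg (ModPow.map (E.unit A).toRingHom p i) (hw1' x)
  · refine E.zero_hom_ext_of_reduction (modPow_cast_pow i) (fun s => ?_) fun Y _ π g g' hg hg' => ?_
    · exact congrArg (ModPow.map (E.unit A).toRingHom p i) ((hw2' _).trans (congrArg z (hG1 s)))
    · refine RingHom.ext fun r => ?_
      obtain ⟨s, rfl⟩ := S.toResidue_surjective r
      have h1 : S.toResidue s = E.res A (Frame.Hom.zero (E.unit A) s) := (E.res_unit (A :=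
          A) s).symm
      refine (congrArg g h1).trans (((hg _).trans ?_).trans (congrArg g' h1).symm)
      rw [hg']
      exact congrArg (fun y => π (ModPow.map (E.unit A).toRingHom p i y))
        ((hw2' _).trans (congrArg z (hG1 s)))

end EtaleBaseChange

/-! ### Faithfully flat descent -/

section Descent

variable {R : Type u} [CommRing R]

section Family

variable {ι : Type} {C : ι → Type u} [∀ i, CommRing (C i)] [∀ i, Algebra R (C i)]
  [∀ i, Module.Flat R (C i)]

theorem subsingleton_of_forall_tensor
    (hC : ∀ q : PrimeSpectrum R, ∃ (i : ι) (q' : PrimeSpectrum (C i)),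
      PrimeSpectrum.comap (algebraMap R (C i)) q' = q)
    {X : Type u} [AddCommGroup X] [Module R X] (h : ∀ i, Subsingleton (C i ⊗[R] X)) :
    Subsingleton X := by
  classical
  have hff : Module.FaithfullyFlat R (DirectSum ι C) := by
    refine ⟨fun {m} hm htop => ?_⟩
    obtain ⟨i, q', hq'⟩ := hC ⟨m, hm.isPrime⟩
    have h1 : (m • ⊤ : Submodule R (C i)) = ⊤ := by
      have := congrArg (Submodule.map (DirectSum.component R ι C i)) htop
      rw [Submodule.map_smul'', Submodule.map_top, LinearMap.range_eq_top.2] at this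
      · exact this
      · intro x
        exact ⟨DirectSum.lof R ι C i x, DirectSum.component.lof_self R i x⟩
    have h2 : (1 : C i) ∈ (m • ⊤ : Submodule R (C i)) := by rw [h1]; trivial
    have h3 : (m • ⊤ : Submodule R (C i)) ≤ q'.asIdeal.restrictScalars R := by
      refine Submodule.smul_le.2 fun r hr x _ => ?_
      have h4 : algebraMap R (C i) r ∈ q'.asIdeal := by
        have h5 : r ∈ (PrimeSpectrum.comap (algebraMap R (C i)) q').asIdeal := by
          rw [hq']
          exact hr
        exact h5
      rw [Algebra.smul_def]
      exact Ideal.mul_mem_right _ _ h4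
    exact q'.isPrime.ne_top ((Ideal.eq_top_iff_one _).2 (h3 h2))
  have : Subsingleton (DirectSum ι C ⊗[R] X) :=
    (TensorProduct.directSumLeft R R C X).toEquiv.subsingleton
  exact Module.FaithfullyFlat.lTensor_reflects_triviality R (DirectSum ι C) X

variable {W : ι → Type u} [∀ i, AddCommGroup (W i)] [∀ i, Module R (W i)]
  [∀ i, Module (C i) (W i)] [∀ i, IsScalarTower R (C i) (W i)]
  {V : ι → ι → Type u} [∀ i j, AddCommGroup (V i j)] [∀ i j, Module R (V i j)]
  [∀ i j, Module (C i) (V i j)] [∀ i j, IsScalarTower R (C i) (V i j)]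
  (a : ∀ i j, W i →ₗ[C i] V i j) (b : ∀ i j, W j →ₗ[R] V i j)

/-- The module of families that satisfy a descent condition. -/
def descended : Submodule R (∀ i, W i) where
  carrier := {w | ∀ i j, a i j (w i) = b i j (w j)}
  add_mem' hx hy i j := by simp only [Pi.add_apply, map_add, hx i j, hy i j]
  zero_mem' i j := by simp only [Pi.zero_apply, map_zero]
  smul_mem' r x hx i j := by
    simp only [Pi.smul_apply, map_smul]
    rw [← hx i j, ← algebraMap_smul (C i) r (x i), map_smul, algebraMap_smul]

variable {a b}

theorem descended_injective [Finite ι] (hb : ∀ i j, Function.Injective ((b i j).liftBaseChange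
    (C i)))
    (i : ι) : Function.Injective
      (((LinearMap.proj i).comp (descended a b).subtype).liftBaseChange (C i)) := by
  classical
  cases nonempty_fintype ι
  rw [injective_iff_map_eq_zero]
  intro z hz
  have h1 := Module.Flat.lTensor_preserves_injective_linearMap (M := C i)
    (descended a b).subtype (descended a b).injective_subtype
  refine (injective_iff_map_eq_zero _).1 h1 z ?_
  refine (TensorProduct.piRight R R (C i) W).injective ?_
  rw [map_zero]
  ext j
  refine (injective_iff_map_eq_zero _).1 (hb i j) _ ?_
  have key : ∀ z : C i ⊗[R] (descended a b),
      (b i j).liftBaseChange (C i) (TensorProduct.piRight R R (C i) W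
        ((descended a b).subtype.lTensor (C i) z) j) =
      a i j (((LinearMap.proj i).comp (descended a b).subtype).liftBaseChange (C i) z) := by
    intro z
    induction z using TensorProduct.induction_on with
    | zero => simp
    | add x y hx hy => simp only [map_add, Pi.add_apply, hx, hy]
    | tmul c w =>
      simp only [LinearMap.lTensor_tmul, TensorProduct.piRight_apply,
        TensorProduct.piRightHom_tmul, LinearMap.liftBaseChange_tmul, map_smul]
      exact congrArg (c • ·) (w.2 i j).symm
  rw [key, hz, map_zero]

variable {N : Type u} [AddCommGroup N] [Module R N] {η : ∀ i, N →ₗ[R] W i}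

theorem exists_of_descent [Finite ι]
    (hC : ∀ q : PrimeSpectrum R, ∃ (i : ι) (q' : PrimeSpectrum (C i)),
      PrimeSpectrum.comap (algebraMap R (C i)) q' = q)
    (hb : ∀ i j, Function.Injective ((b i j).liftBaseChange (C i)))
    (hη : ∀ i, Function.Surjective ((η i).liftBaseChange (C i)))
    (hab : ∀ i j n, a i j (η i n) = b i j (η j n))
    {w : ∀ i, W i} (hw : ∀ i j, a i j (w i) = b i j (w j)) : ∃ n, ∀ i, η i n = w i := by
  let φ : N →ₗ[R] descended a b := (LinearMap.pi η).codRestrict _ fun n i j => hab i j n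
  have hφ : ∀ i, Function.Surjective (φ.lTensor (C i)) := by
    intro i z
    obtain ⟨z', hz'⟩ := hη i
      (((LinearMap.proj i).comp (descended a b).subtype).liftBaseChange (C i) z)
    refine ⟨z', descended_injective hb i ?_⟩
    rw [← hz']
    clear hz'
    induction z' using TensorProduct.induction_on with
    | zero => simp
    | add x y hx hy => simp only [map_add, hx, hy]
    | tmul c n => rfl
  have hsub : Subsingleton (descended a b ⧸ LinearMap.range φ) := by
    refine subsingleton_of_forall_tensor hC fun i => ⟨fun x y => ?_⟩
    have hz : ∀ x : C i ⊗[R] (descended a b ⧸ LinearMap.range φ), x = 0 := by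
      intro x
      obtain ⟨x, rfl⟩ := LinearMap.lTensor_surjective (C i)
        (LinearMap.range φ).mkQ_surjective x
      obtain ⟨x, rfl⟩ := hφ i x
      rw [← LinearMap.comp_apply, ← LinearMap.lTensor_comp, LinearMap.range_mkQ_comp,
        LinearMap.lTensor_zero, LinearMap.zero_apply]
    rw [hz x, hz y]
  have htop : LinearMap.range φ = ⊤ := Submodule.Quotient.subsingleton_iff.1 hsub
  obtain ⟨n, hn⟩ := LinearMap.range_eq_top.1 htop ⟨w, hw⟩
  exact ⟨n, fun i => congrFun (congrArg Subtype.val hn) i⟩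

theorem eq_zero_of_descent
    (hC : ∀ q : PrimeSpectrum R, ∃ (i : ι) (q' : PrimeSpectrum (C i)),
      PrimeSpectrum.comap (algebraMap R (C i)) q' = q)
    (hη : ∀ i, Function.Injective ((η i).liftBaseChange (C i)))
    {n : N} (hn : ∀ i, η i n = 0) : n = 0 := by
  have hsub : Subsingleton (Submodule.span R {n}) := by
    refine subsingleton_of_forall_tensor hC fun i => ⟨fun x y => ?_⟩
    have hz : ∀ x : C i ⊗[R] (Submodule.span R {n}), x = 0 := by
      intro x
      have h1 := Module.Flat.lTensor_preserves_injective_linearMap (M := C i)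
        (Submodule.span R {n}).subtype (Submodule.span R {n}).injective_subtype
      refine (injective_iff_map_eq_zero _).1 h1 x ((injective_iff_map_eq_zero _).1 (hη i) _ ?_)
      induction x using TensorProduct.induction_on with
      | zero => simp
      | add x y hx hy => rw [map_add, map_add, hx, hy, add_zero]
      | tmul c m =>
        obtain ⟨r, hr⟩ := Submodule.mem_span_singleton.1 m.2
        rw [LinearMap.lTensor_tmul, LinearMap.liftBaseChange_tmul, Submodule.subtype_apply, ← hr,
          map_smul, hn, smul_zero, smul_zero]
    rw [hz x, hz y]
  exact congrArg Subtype.val (hsub.elim ⟨n, Submodule.mem_span_singleton_self n⟩ 0)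

end Family

section Effective

variable {C : Type u} [CommRing C] [Algebra R C]
  {W W₂ W₃ : Type u} [AddCommGroup W] [AddCommGroup W₂] [AddCommGroup W₃] [Module R W]
  [Module R W₂] [Module R W₃] [Module C W] [Module C W₂] [Module C W₃] [IsScalarTower R C W]
  [IsScalarTower R C W₂] [IsScalarTower R C W₃] {a : W →ₗ[C] W₂} {b : W →ₗ[R] W₂}
  {β : W₂ →ₗ[R] W₃} {π₁ π₂ : W₂ →ₗ[C] W₃}

/-- Effective descent for modules: a module with a descent datum is generated by the elements that
satisfy the descent condition. -/
theorem span_eq_top_of_cocycle [Module.Flat R C] (hb : Function.Surjective (b.liftBaseChange C))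
    (hβ : Function.Injective (β.liftBaseChange C)) (ha : Function.Injective a)
    (h1 : ∀ w, π₁ (a w) = π₂ (a w)) (h2 : ∀ w, π₁ (b w) = β (a w))
    (h3 : ∀ w, π₂ (b w) = β (b w)) : Submodule.span C {w | a w = b w} = ⊤ := by
  rw [eq_top_iff]
  rintro w -
  obtain ⟨z, hz⟩ := hb (a w)
  let d : W →ₗ[R] W₂ := a.restrictScalars R - b
  have hd : d.lTensor C z = 0 := by
    refine (injective_iff_map_eq_zero _).1 hβ _ ?_
    have key : ∀ z : C ⊗[R] W, β.liftBaseChange C (d.lTensor C z) =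
        π₁ (b.liftBaseChange C z) - π₂ (b.liftBaseChange C z) := by
      intro z
      induction z using TensorProduct.induction_on with
      | zero => simp
      | add x y hx hy => simp only [map_add, hx, hy]; abel
      | tmul c w =>
        rw [LinearMap.lTensor_tmul, LinearMap.liftBaseChange_tmul, LinearMap.liftBaseChange_tmul,
          map_smul, map_smul, h2, h3, ← smul_sub, ← map_sub]
        rfl
    rw [key, hz, h1, sub_self]
  have hex := Module.Flat.lTensor_exact C (f := (LinearMap.ker d).subtype) (g := d)
    (LinearMap.exact_subtype_ker_map d)
  obtain ⟨z', rfl⟩ := (hex z).1 hd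
  have hw : w = ((LinearMap.ker d).subtype.liftBaseChange C) z' := by
    refine ha ?_
    rw [← hz]
    clear hz hd
    induction z' using TensorProduct.induction_on with
    | zero => simp
    | add x y hx hy => simp only [map_add, hx, hy]
    | tmul c m =>
      rw [LinearMap.lTensor_tmul, LinearMap.liftBaseChange_tmul, LinearMap.liftBaseChange_tmul,
        map_smul]
      exact congrArg (c • ·) (sub_eq_zero.1 m.2).symm
  rw [hw]
  clear hw hz hd
  induction z' using TensorProduct.induction_on with
  | zero => rw [map_zero]; exact zero_mem _
  | add x y hx hy => rw [map_add]; exact add_mem hx hy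
  | tmul c m =>
    rw [LinearMap.liftBaseChange_tmul]
    exact Submodule.smul_mem _ _ (Submodule.subset_span (sub_eq_zero.1 m.2))

/-- A set of elements that satisfy a descent condition and that generate the module over the
covering contains all such elements. -/
theorem mem_of_span_eq_top [Module.FaithfullyFlat R C]
    (hb : Function.Injective (b.liftBaseChange C)) (N : Submodule R W)
    (hN : ∀ w ∈ N, a w = b w) (hs : Submodule.span C (N : Set W) = ⊤) {w : W} (hw : a w = b w) :
    w ∈ N := by
  have hη : Function.Surjective (N.subtype.liftBaseChange C) := by
    intro x
    have hx : x ∈ Submodule.span C (N : Set W) := by rw [hs]; trivial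
    have hle : Submodule.span C (N : Set W) ≤ LinearMap.range (N.subtype.liftBaseChange C) :=
      Submodule.span_le.2 fun y hy => ⟨1 ⊗ₜ ⟨y, hy⟩, by
        rw [LinearMap.liftBaseChange_tmul, one_smul]; rfl⟩
    exact hle hx
  obtain ⟨n, hn⟩ := exists_of_descent (R := R) (ι := Unit) (C := fun _ => C) (W := fun _ => W)
    (V := fun _ _ => W₂) (a := fun _ _ => a) (b := fun _ _ => b) (η := fun _ => N.subtype)
    (fun q => ⟨(), PrimeSpectrum.comap_surjective_of_faithfullyFlat q⟩) (fun _ _ => hb)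
    (fun _ => hη) (fun _ _ n => hN _ n.2) (w := fun _ => w) fun _ _ => hw
  rw [← hn ()]
  exact n.2

end Effective

end Descent

section RingDescent

theorem RingPushout.liftBaseChange_bijective {A B C D : Type u} [CommRing A] [CommRing B]
    [CommRing C] [CommRing D] [Algebra A B] [Algebra A C] [Algebra B D] [Algebra A D]
    [IsScalarTower A B D] {k : C →+* D}
    (H : RingPushout (algebraMap A B) (algebraMap A C) (algebraMap B D) k) (l : C →ₗ[A] D)
    (hl : ∀ x, l x = k x) : Function.Bijective (l.liftBaseChange B) := by
  have e := ringPushout_iff.1 H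
  algebraize [k]
  have : IsScalarTower A C D := IsScalarTower.of_algebraMap_eq' (by
    rw [IsScalarTower.algebraMap_eq A B D]; exact H.comm)
  have hp : Algebra.IsPushout A B C D := CommRingCat.isPushout_iff_isPushout.1 e
  have h : ⇑(l.liftBaseChange B) = Algebra.IsPushout.equiv A B C D := by
    ext z
    induction z using TensorProduct.induction_on with
    | zero => simp
    | add x y hx hy => simp only [map_add, hx, hy]
    | tmul b c =>
      rw [LinearMap.liftBaseChange_tmul, Algebra.IsPushout.equiv_tmul, hl, Algebra.smul_def]
      rfl
  rw [h]
  exact (Algebra.IsPushout.equiv A B C D).bijective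

variable {ι : Type} [Finite ι] {R N : Type u} [CommRing R] [CommRing N] {C W : ι → Type u}
  [∀ i, CommRing (C i)] [∀ i, CommRing (W i)] {V : ι → ι → Type u} [∀ i j, CommRing (V i j)]
  {rC : ∀ i, R →+* C i} {cW : ∀ i, C i →+* W i} {rN : R →+* N} {m : ∀ i, N →+* W i}
  {l : ∀ i j, W i →+* V i j} {r : ∀ i j, W j →+* V i j}

/-- Descent for elements of rings. -/
theorem ring_descent (hflat : ∀ i, (rC i).Flat)
    (hC : ∀ q : PrimeSpectrum R, ∃ (i : ι) (q' : PrimeSpectrum (C i)),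
      PrimeSpectrum.comap (rC i) q' = q)
    (H1 : ∀ i, RingPushout (rC i) rN (cW i) (m i))
    (H2 : ∀ i j, RingPushout (rC i) ((cW j).comp (rC j)) ((l i j).comp (cW i)) (r i j))
    (hm : ∀ i j x, l i j (m i x) = r i j (m j x)) :
    (∀ w : ∀ i, W i, (∀ i j, l i j (w i) = r i j (w j)) → ∃ x, ∀ i, m i x = w i) ∧
      ∀ x, (∀ i, m i x = 0) → x = 0 := by
  let _ : ∀ i, Algebra R (C i) := fun i => (rC i).toAlgebra
  let _ : ∀ i, Algebra (C i) (W i) := fun i => (cW i).toAlgebra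
  let _ : ∀ i, Algebra R (W i) := fun i => ((cW i).comp (rC i)).toAlgebra
  let _ : Algebra R N := rN.toAlgebra
  let _ : ∀ i j, Algebra (C i) (V i j) := fun i j => ((l i j).comp (cW i)).toAlgebra
  let _ : ∀ i j, Algebra R (V i j) := fun i j => (((l i j).comp (cW i)).comp (rC i)).toAlgebra
  have _ : ∀ i, IsScalarTower R (C i) (W i) := fun i => IsScalarTower.of_algebraMap_eq' rfl
  have _ : ∀ i j, IsScalarTower R (C i) (V i j) := fun i j =>
    IsScalarTower.of_algebraMap_eq' rfl
  have _ : ∀ i, Module.Flat R (C i) := hflat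
  let η : ∀ i, N →ₗ[R] W i := fun i =>
    { toFun := m i
      map_add' := map_add (m i)
      map_smul' := fun a x => by
        change m i (rN a * x) = cW i (rC i a) * m i x
        rw [map_mul]
        exact congrArg (· * m i x) (RingHom.congr_fun (H1 i).comm a).symm }
  let a' : ∀ i j, W i →ₗ[C i] V i j := fun i j =>
    { toFun := l i j
      map_add' := map_add (l i j)
      map_smul' := fun c x => map_mul (l i j) (cW i c) x }
  let b' : ∀ i j, W j →ₗ[R] V i j := fun i j =>
    { toFun := r i j
      map_add' := map_add (r i j)
      map_smul' := fun c x => by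
        change r i j (cW j (rC j c) * x) = l i j (cW i (rC i c)) * r i j x
        rw [map_mul]
        exact congrArg (· * r i j x) (RingHom.congr_fun (H2 i j).comm c).symm }
  have hη : ∀ i, Function.Bijective ((η i).liftBaseChange (C i)) := fun i =>
    RingPushout.liftBaseChange_bijective (k := m i) (H1 i) (η i) fun _ => rfl
  have hb : ∀ i j, Function.Bijective ((b' i j).liftBaseChange (C i)) := fun i j =>
    RingPushout.liftBaseChange_bijective (k := r i j) (H2 i j) (b' i j) fun _ => rfl
  exact ⟨fun w hw => exists_of_descent (a := a') (b := b') (η := η) hC (fun i j => (hb i j).1)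
    (fun i => (hη i).2) hm hw, fun x hx => eq_zero_of_descent (η := η) hC (fun i => (hη i).1) hx⟩

end RingDescent

/-! ### Completeness of the components of a frame -/

section FrameComplete

variable {p : ℕ} {S S' : Frame.{u} p}

theorem Frame.Hom.map_proj (f : S ⟶ S') (d : ℤ) (x : S.carrier) :
    f.toRingHom (S.proj d x) = S'.proj d (f.toRingHom x) := by
  induction x using DirectSum.Decomposition.inductionOn S.grading with
  | zero => simp only [map_zero]
  | add x y hx hy => simp only [map_add, hx, hy]
  | @homogeneous e x =>
    by_cases h : e = d
    · subst h
      rw [Frame.proj_of_mem x.2, Frame.proj_of_mem (f.map_mem _ _ x.2)]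
    · rw [Frame.proj_of_mem_ne x.2 h, Frame.proj_of_mem_ne (f.map_mem _ _ x.2) h, map_zero]

theorem Frame.proj_pow_mul (d : ℤ) (k : ℕ) (x : S.carrier) :
    S.proj d (p ^ k * x) = p ^ k * S.proj d x := by
  rw [← Nat.cast_pow, ← nsmul_eq_mul, map_nsmul, nsmul_eq_mul]

theorem Frame.exists_pow_mul_of_mem {d : ℤ} {k : ℕ} {x z : S.carrier} (hx : x ∈ S.grading d)
    (h : x = p ^ k * z) : ∃ w : S.grading d, x = p ^ k * (w : S.carrier) := by
  refine ⟨⟨S.proj d z, S.proj_mem d z⟩, ?_⟩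
  rw [← Frame.proj_of_mem hx, h, Frame.proj_pow_mul]

theorem Frame.eq_sum_proj (x : S.carrier) : ∃ D : Finset ℤ, ∀ D', D ⊆ D' →
    x = ∑ d ∈ D', S.proj d x := by
  classical
  refine ⟨(DirectSum.decompose S.grading x).support, fun D' hD => ?_⟩
  conv_lhs => rw [← DirectSum.sum_support_decompose S.grading x]
  refine Finset.sum_subset hD fun d _ hd => ?_
  rw [DFinsupp.notMem_support_iff] at hd
  exact congrArg Subtype.val hd

theorem Frame.eq_zero_of_proj {x : S.carrier} (h : ∀ d, S.proj d x = 0) : x = 0 := by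
  obtain ⟨D, hD⟩ := S.eq_sum_proj x
  rw [hD D subset_rfl]
  exact Finset.sum_eq_zero fun d _ => h d

theorem Frame.mem_grading_of_proj {x : S.carrier} {d : ℤ} (h : ∀ e, e ≠ d → S.proj e x = 0) :
    x ∈ S.grading d := by
  have : x - S.proj d x = 0 := S.eq_zero_of_proj fun e => by
    rw [map_sub]
    by_cases he : e = d
    · subst he
      rw [Frame.proj_of_mem (S.proj_mem _ x), sub_self]
    · rw [h e he, Frame.proj_of_mem_ne (S.proj_mem _ x) (Ne.symm he), sub_zero]
  rw [sub_eq_zero.1 this]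
  exact S.proj_mem d x

theorem Frame.IsPAdic.eq_zero (hS : S.IsPAdic) {x : S.carrier}
    (h : ∀ k : ℕ, ∃ z, x = p ^ k * z) : x = 0 := by
  refine S.eq_zero_of_proj fun d => ?_
  have := (hS.pComplete d).sep ⟨S.proj d x, S.proj_mem d x⟩ fun k => by
    obtain ⟨z, hz⟩ := h k
    refine ⟨⟨S.proj d z, S.proj_mem d z⟩, Subtype.ext ?_⟩
    change S.proj d x = p ^ k • S.proj d z
    rw [hz, Frame.proj_pow_mul, nsmul_eq_mul, Nat.cast_pow]
  exact congrArg Subtype.val this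

theorem Frame.IsPAdic.exists_lim (hS : S.IsPAdic) {d : ℤ} {y : ℕ → S.carrier}
    (hy : ∀ k, y k ∈ S.grading d) (h : ∀ k : ℕ, ∃ z, y (k + 1) - y k = p ^ k * z) :
    ∃ L ∈ S.grading d, ∀ k : ℕ, ∃ z, L - y k = p ^ k * z := by
  obtain ⟨L, hL⟩ := (hS.pComplete d).lim (fun k => ⟨y k, hy k⟩) fun k => by
    obtain ⟨z, hz⟩ := h k
    obtain ⟨w, hw⟩ := Frame.exists_pow_mul_of_mem (sub_mem (hy (k + 1)) (hy k)) hz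
    exact ⟨w, Subtype.ext (by
      change y (k + 1) - y k = p ^ k • (w : S.carrier)
      rw [hw, nsmul_eq_mul, Nat.cast_pow])⟩
  refine ⟨L, L.2, fun k => ?_⟩
  obtain ⟨w, hw⟩ := hL k
  refine ⟨w, ?_⟩
  have := congrArg Subtype.val hw
  rw [← Nat.cast_pow, ← nsmul_eq_mul]
  exact this

end FrameComplete

/-! ### Étale descent for the sheaf of frames -/

section EtAlgPushout

variable {R : Type u} [CommRing R]

theorem EtAlg.exists_pushout {A C D : EtAlg R} (c : A ⟶ C) (d : A ⟶ D) :
    ∃ (P : EtAlg R) (c' : C ⟶ P) (d' : D ⟶ P),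
      RingPushout (EtAlg.algHom c).toRingHom (EtAlg.algHom d).toRingHom
        (EtAlg.algHom c').toRingHom (EtAlg.algHom d').toRingHom := by
  let _ : Algebra A.obj C.obj := (EtAlg.algHom c).toAlgebra
  let _ : Algebra A.obj D.obj := (EtAlg.algHom d).toAlgebra
  have : IsScalarTower R A.obj C.obj := IsScalarTower.of_algebraMap_eq fun r =>
    ((EtAlg.algHom c).commutes r).symm
  have : IsScalarTower R A.obj D.obj := IsScalarTower.of_algebraMap_eq fun r =>
    ((EtAlg.algHom d).commutes r).symm
  have := A.property
  have := C.property
  have := D.property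
  have : Algebra.Etale A.obj D.obj := Algebra.Etale.of_restrictScalars R _ _
  have : Algebra.Etale R (C.obj ⊗[A.obj] D.obj) := Algebra.Etale.comp R C.obj _
  refine ⟨⟨CommAlgCat.of R (C.obj ⊗[A.obj] D.obj), this⟩,
    ObjectProperty.homMk (CommAlgCat.ofHom Algebra.TensorProduct.includeLeft),
    ObjectProperty.homMk (CommAlgCat.ofHom
      ((Algebra.TensorProduct.includeRight (R := A.obj) (A := C.obj)
        (B := D.obj)).restrictScalars R)), ?_⟩
  exact ringPushout_iff.2 (CommRingCat.isPushout_tensorProduct A.obj C.obj D.obj)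

end EtAlgPushout

namespace EtaleBaseChange

variable {p : ℕ} {S : Frame.{u} p} (E : EtaleBaseChange S) {A B : EtAlg S.residue}

theorem etale_map (f : A ⟶ B) (i : ℕ) :
    (ModPow.map (Frame.Hom.zero (E.frame.map f)) p i).Etale := by
  have h1 := E.etale A i
  have h2 := E.etale B i
  have h3 : (ModPow.map (Frame.Hom.zero (E.frame.map f)) p i).comp
      (ModPow.map (Frame.Hom.zero (E.unit A)) p i) =
      ModPow.map (Frame.Hom.zero (E.unit B)) p i := by
    refine Ideal.Quotient.ringHom_ext (RingHom.ext fun s => ?_)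
    exact congrArg (Ideal.Quotient.mk _) (E.zero_map_unit f s)
  algebraize [ModPow.map (Frame.Hom.zero (E.unit A)) p i,
    ModPow.map (Frame.Hom.zero (E.frame.map f)) p i,
    ModPow.map (Frame.Hom.zero (E.unit B)) p i]
  have := IsScalarTower.of_algebraMap_eq' h3.symm
  exact Algebra.Etale.of_restrictScalars (ModPow (S.grading 0) p i) _ _

theorem flat_map (f : A ⟶ B) (i : ℕ) :
    (ModPow.map (Frame.Hom.zero (E.frame.map f)) p i).Flat := by
  have h := E.etale_map f i
  algebraize [ModPow.map (Frame.Hom.zero (E.frame.map f)) p i]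
  exact Algebra.Smooth.flat _ _

theorem exists_comap_eq [Fact p.Prime] {ι : Type} {B : ι → EtAlg S.residue} {f : ∀ i, A ⟶ B i}
    (hf : IsEtaleCover B f) (k : ℕ) (q : PrimeSpectrum (ModPow ((E.frame.obj A).grading 0) p k)) :
    ∃ (i : ι) (q' : PrimeSpectrum (ModPow ((E.frame.obj (B i)).grading 0) p k)),
      PrimeSpectrum.comap (ModPow.map (Frame.Hom.zero (E.frame.map (f i))) p k) q' = q := by
  let π : (E.frame.obj A).grading 0 →+* ModPow ((E.frame.obj A).grading 0) p k :=
    Ideal.Quotient.mk _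
  let P := PrimeSpectrum.comap π q
  have hp : (p : (E.frame.obj A).grading 0) ∈ P.asIdeal := by
    refine P.isPrime.mem_of_pow_mem k ?_
    change π (p ^ k) ∈ q.asIdeal
    rw [show π (p ^ k) = 0 from Ideal.Quotient.eq_zero_iff_mem.2 (Ideal.mem_span_singleton_self _)]
    exact zero_mem _
  have h1 : P ∈ Set.range (PrimeSpectrum.comap (E.res A)) := by
    rw [range_comap_of_surjective _ _ E.res_surjective]
    intro x hx
    obtain ⟨y, hy⟩ := Frame.exists_pow_eq _ (E.res_eq_zero_iff.1 hx)
    refine P.isPrime.mem_of_pow_mem p ?_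
    rw [hy]
    exact Ideal.mul_mem_right _ _ hp
  obtain ⟨P₁, hP₁⟩ := h1
  obtain ⟨i, Q₁, hQ₁⟩ := hf.2 P₁
  let Q := PrimeSpectrum.comap (E.res (B i)) Q₁
  have hQP : PrimeSpectrum.comap (Frame.Hom.zero (E.frame.map (f i))) Q = P := by
    rw [← hP₁, ← hQ₁]
    ext x
    change E.res (B i) (Frame.Hom.zero (E.frame.map (f i)) x) ∈ Q₁.asIdeal ↔
      EtAlg.algHom (f i) (E.res A x) ∈ Q₁.asIdeal
    rw [E.res_map]
  have hpQ : (p : (E.frame.obj (B i)).grading 0) ^ k ∈ Q.asIdeal := by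
    have : (p : (E.frame.obj A).grading 0) ^ k ∈ P.asIdeal := by
      change π (p ^ k) ∈ q.asIdeal
      rw [show π (p ^ k) = 0 from
        Ideal.Quotient.eq_zero_iff_mem.2 (Ideal.mem_span_singleton_self _)]
      exact zero_mem _
    rw [← hQP] at this
    change Frame.Hom.zero (E.frame.map (f i)) (p ^ k) ∈ Q.asIdeal at this
    rwa [map_pow, map_natCast] at this
  let π' : (E.frame.obj (B i)).grading 0 →+* ModPow ((E.frame.obj (B i)).grading 0) p k :=
    Ideal.Quotient.mk _
  have h2 : Q ∈ Set.range (PrimeSpectrum.comap π') := by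
    rw [range_comap_of_surjective _ _ Ideal.Quotient.mk_surjective, Ideal.mk_ker]
    intro x hx
    obtain ⟨y, rfl⟩ := Ideal.mem_span_singleton.1 hx
    exact Ideal.mul_mem_right _ _ hpQ
  obtain ⟨q', hq'⟩ := h2
  refine ⟨i, q', ?_⟩
  refine PrimeSpectrum.comap_injective_of_surjective π Ideal.Quotient.mk_surjective ?_
  change _ = P
  rw [← hQP, ← hq']
  rfl

theorem ringPushout_map_self [Fact p.Prime] {C : EtAlg S.residue} (c : A ⟶ C) (i : ℕ) :
    RingPushout (ModPow.map (Frame.Hom.zero (E.frame.map c)) p i) (E.inc A i) (E.inc C i)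
      (ModPow.map (E.frame.map c).toRingHom p i) := by
  have h := E.ringPushout_map (A := A) (C := C) (D := A) (P := C) (c := c) (d := 𝟙 A) (c' := 𝟙 C)
    (d' := c) ⟨rfl, fun X _ u v huv => ⟨u, rfl, huv⟩, fun X _ w w' h _ => h⟩ i
  have h1 : ∀ A : EtAlg S.residue, ModPow.map (Frame.Hom.zero (E.frame.map (𝟙 A))) p i =
      RingHom.id _ := fun A => by
    rw [E.frame.map_id]
    exact Ideal.Quotient.ringHom_ext rfl
  rw [h1, h1] at h
  exact h

/-- Descent modulo `pᵏ`. -/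
theorem descent_modPow [Fact p.Prime] {ι : Type} {B : ι → EtAlg S.residue} {f : ∀ i, A ⟶ B i}
    (hf : IsEtaleCover B f) (k : ℕ) :
    (∀ x : ∀ i, (E.frame.obj (B i)).carrier,
      (∀ (i j : ι) (C : EtAlg S.residue) (g : B i ⟶ C) (h : B j ⟶ C), f i ≫ g = f j ≫ h →
        (E.frame.map g).toRingHom (x i) = (E.frame.map h).toRingHom (x j)) →
      ∃ y, ∀ i, ∃ z, (E.frame.map (f i)).toRingHom y - x i = p ^ k * z) ∧
    ∀ y, (∀ i, ∃ z, (E.frame.map (f i)).toRingHom y = p ^ k * z) → ∃ z, y = p ^ k * z := by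
  have := hf.1
  choose P c d H using fun i j => EtAlg.exists_pushout (f i) (f j)
  have hcd : ∀ i j, f i ≫ c i j = f j ≫ d i j := fun i j =>
    ObjectProperty.hom_ext _ (CommAlgCat.hom_ext (AlgHom.ext fun x =>
      RingHom.congr_fun (H i j).comm x))
  have hcd' : ∀ i j x, (E.frame.map (c i j)).toRingHom ((E.frame.map (f i)).toRingHom x) =
      (E.frame.map (d i j)).toRingHom ((E.frame.map (f j)).toRingHom x) := by
    intro i j x
    have := congrArg (fun f => (E.frame.map f).toRingHom x) (hcd i j)
    simp only [Functor.map_comp] at this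
    exact this
  obtain ⟨D1, D2⟩ := ring_descent (rC := fun i => ModPow.map (Frame.Hom.zero (E.frame.map
      (f i))) p k)
    (cW := fun i => E.inc (B i) k) (rN := E.inc A k)
    (m := fun i => ModPow.map (E.frame.map (f i)).toRingHom p k)
    (l := fun i j => ModPow.map (E.frame.map (c i j)).toRingHom p k)
    (r := fun i j => ModPow.map (E.frame.map (d i j)).toRingHom p k)
    (fun i => E.flat_map (f i) k) (E.exists_comap_eq hf k)
    (fun i => E.ringPushout_map_self (f i) k)
    (fun i j => by
      have h := E.ringPushout_map (H i j) k
      have h1 : (E.inc (P i j) k).comp (ModPow.map (Frame.Hom.zero (E.frame.map (c i j))) p k) =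
          (ModPow.map (E.frame.map (c i j)).toRingHom p k).comp (E.inc (B i) k) :=
        Ideal.Quotient.ringHom_ext rfl
      rw [h1] at h
      exact h)
    (fun i j x => by
      obtain ⟨x, rfl⟩ := Ideal.Quotient.mk_surjective x
      exact congrArg (Ideal.Quotient.mk _) (hcd' i j x))
  constructor
  · intro x hx
    obtain ⟨y, hy⟩ := D1 (fun i => Ideal.Quotient.mk _ (x i)) fun i j =>
      congrArg (Ideal.Quotient.mk _) (hx i j _ (c i j) (d i j) (hcd i j))
    obtain ⟨y, rfl⟩ := Ideal.Quotient.mk_surjective y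
    refine ⟨y, fun i => ?_⟩
    rw [← modPow_mk_eq_zero, map_sub, sub_eq_zero]
    exact hy i
  · intro y hy
    rw [← modPow_mk_eq_zero]
    exact D2 _ fun i => modPow_mk_eq_zero.2 (hy i)

end EtaleBaseChange

section Self

variable {R : Type u} [CommRing R]

/-- The unique homomorphism `R → A` of étale `R`-algebras. -/
def EtAlg.fromSelf (A : EtAlg R) : EtAlg.self R ⟶ A :=
  ObjectProperty.homMk (CommAlgCat.ofHom (Algebra.ofId R A.obj))

/-- The algebra `A` defines an étale covering of `Spec R`. -/
abbrev EtAlg.IsCover (A : EtAlg R) : Prop :=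
  IsEtaleCover (fun _ : Unit => A) fun _ => EtAlg.fromSelf A

theorem EtAlg.self_hom_ext {A : EtAlg R} (f g : EtAlg.self R ⟶ A) : f = g := by
  refine ObjectProperty.hom_ext _ (CommAlgCat.hom_ext ?_)
  exact Subsingleton.elim (α := R →ₐ[R] A.obj) _ _

end Self

namespace EtaleBaseChange

variable {p : ℕ} [Fact p.Prime] {S : Frame.{u} p} (E : EtaleBaseChange S) {A : EtAlg S.residue}

section Cover

variable {ι : Type} {B : ι → EtAlg S.residue} {f : ∀ i, A ⟶ B i}

/-- The compatibility condition for families of elements of `𝐒`. -/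
def Compatible (f : ∀ i, A ⟶ B i) (x : ∀ i, (E.frame.obj (B i)).carrier) : Prop :=
  ∀ (i j : ι) (C : EtAlg S.residue) (g : B i ⟶ C) (h : B j ⟶ C), f i ≫ g = f j ≫ h →
    (E.frame.map g).toRingHom (x i) = (E.frame.map h).toRingHom (x j)

theorem Compatible.proj {x : ∀ i, (E.frame.obj (B i)).carrier} (hx : E.Compatible f x) (d : ℤ) :
    E.Compatible f fun i => (E.frame.obj (B i)).proj d (x i) := fun i j C g h hgh => by
  rw [Frame.Hom.map_proj, Frame.Hom.map_proj, hx i j C g h hgh]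

theorem eq_zero_of_cover (hf : IsEtaleCover B f) {y : (E.frame.obj A).carrier}
    (h : ∀ i, (E.frame.map (f i)).toRingHom y = 0) : y = 0 :=
  (E.isPAdic A).eq_zero fun k => (E.descent_modPow hf k).2 y fun i => ⟨0, by rw [h, mul_zero]⟩

theorem eq_of_cover (hf : IsEtaleCover B f) {y y' : (E.frame.obj A).carrier}
    (h : ∀ i, (E.frame.map (f i)).toRingHom y = (E.frame.map (f i)).toRingHom y') : y = y' :=
  sub_eq_zero.1 (E.eq_zero_of_cover hf fun i => by rw [map_sub, h, sub_self])

theorem mem_grading_of_cover (hf : IsEtaleCover B f) {y : (E.frame.obj A).carrier} {d : ℤ}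
    (h : ∀ i, (E.frame.map (f i)).toRingHom y ∈ (E.frame.obj (B i)).grading d) :
    y ∈ (E.frame.obj A).grading d :=
  Frame.mem_grading_of_proj fun e he => E.eq_zero_of_cover hf fun i => by
    rw [Frame.Hom.map_proj, Frame.proj_of_mem_ne (h i) (Ne.symm he)]

theorem exists_glue_of_mem (hf : IsEtaleCover B f) {x : ∀ i, (E.frame.obj (B i)).carrier}
    (hx : E.Compatible f x) {d : ℤ}
    (hd : ∀ i, x i ∈ (E.frame.obj (B i)).grading d) :
    ∃ y ∈ (E.frame.obj A).grading d, ∀ i, (E.frame.map (f i)).toRingHom y = x i := by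
  have h1 : ∀ k : ℕ, ∃ y ∈ (E.frame.obj A).grading d, ∀ i, ∃ z,
      (E.frame.map (f i)).toRingHom y - x i = p ^ k * z := by
    intro k
    obtain ⟨y, hy⟩ := (E.descent_modPow hf k).1 x hx
    refine ⟨(E.frame.obj A).proj d y, Frame.proj_mem _ d y, fun i => ?_⟩
    obtain ⟨z, hz⟩ := hy i
    refine ⟨(E.frame.obj (B i)).proj d z, ?_⟩
    rw [← Frame.proj_pow_mul, ← hz, map_sub, Frame.Hom.map_proj, Frame.proj_of_mem (hd i)]
  choose y hy hyx using h1
  obtain ⟨L, hL, hLy⟩ := (E.isPAdic A).exists_lim hy fun k => by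
    refine (E.descent_modPow hf k).2 _ fun i => ?_
    obtain ⟨z, hz⟩ := hyx k i
    obtain ⟨z', hz'⟩ := hyx (k + 1) i
    refine ⟨p * z' - z, ?_⟩
    rw [map_sub, ← sub_sub_sub_cancel_right _ _ (x i), hz, hz']
    ring
  refine ⟨L, hL, fun i => sub_eq_zero.1 ((E.isPAdic (B i)).eq_zero fun k => ?_)⟩
  obtain ⟨z, hz⟩ := hLy k
  obtain ⟨z', hz'⟩ := hyx k i
  refine ⟨(E.frame.map (f i)).toRingHom z + z', ?_⟩
  have h2 := congrArg (E.frame.map (f i)).toRingHom hz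
  rw [map_sub, map_mul, map_pow, map_natCast] at h2
  rw [mul_add, ← h2, ← hz']
  ring

/-- `A ↦ 𝐒(A)` is a sheaf for the étale topology. -/
theorem exists_glue (hf : IsEtaleCover B f) {x : ∀ i, (E.frame.obj (B i)).carrier}
    (hx : E.Compatible f x) :
    ∃ y, ∀ i, (E.frame.map (f i)).toRingHom y = x i := by
  classical
  have := hf.1
  cases nonempty_fintype ι
  choose y _ hy using fun d => E.exists_glue_of_mem hf (hx.proj E d) (d := d)
    fun i => Frame.proj_mem _ d _
  choose D hD using fun i => (E.frame.obj (B i)).eq_sum_proj (x i)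
  refine ⟨∑ d ∈ Finset.univ.biUnion D, y d, fun i => ?_⟩
  rw [map_sum, hD i (Finset.univ.biUnion D) (Finset.subset_biUnion_of_mem D (Finset.mem_univ i))]
  exact Finset.sum_congr rfl fun d _ => hy d i

end Cover

section SelfCover

theorem unit_self_injective (hS : S.IsPAdic) :
    Function.Injective (E.unit (EtAlg.self S.residue)).toRingHom := by
  rw [injective_iff_map_eq_zero]
  intro x hx
  refine hS.eq_zero fun k => modPow_mk_eq_zero.1 ((E.unit_self_modPow_bijective k).1 ?_)
  rw [map_zero]
  exact congrArg (Ideal.Quotient.mk _) hx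

theorem unit_self_surjective (hS : S.IsPAdic) :
    Function.Surjective (E.unit (EtAlg.self S.residue)).toRingHom := by
  let u := E.unit (EtAlg.self S.residue)
  have hk : ∀ (k : ℕ) (y : (E.frame.obj (EtAlg.self S.residue)).carrier),
      ∃ x z, u.toRingHom x - y = p ^ k * z := by
    intro k y
    obtain ⟨x, hx⟩ := (E.unit_self_modPow_bijective k).2 (Ideal.Quotient.mk _ y)
    obtain ⟨x, rfl⟩ := Ideal.Quotient.mk_surjective x
    refine ⟨x, modPow_mk_eq_zero.1 ?_⟩
    rw [map_sub, sub_eq_zero]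
    exact hx
  have h1 : ∀ (d : ℤ) (y : (E.frame.obj (EtAlg.self S.residue)).carrier),
      y ∈ (E.frame.obj (EtAlg.self S.residue)).grading d → ∃ x, u.toRingHom x = y := by
    intro d y hy
    choose x z hx using fun k => hk k y
    obtain ⟨L, -, hL⟩ := hS.exists_lim (d := d) (y := fun k => S.proj d (x k))
      (fun k => S.proj_mem d _) fun k => by
        rw [← map_sub]
        have h2 : Ideal.Quotient.mk (Ideal.span {(p : S.carrier) ^ k}) (x (k + 1) - x k) = 0 := by
          refine (E.unit_self_modPow_bijective k).1 ?_
          rw [map_zero]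
          refine modPow_mk_eq_zero.2 ⟨p * z (k + 1) - z k, ?_⟩
          rw [map_sub]
          have h3 := hx (k + 1)
          have h4 := hx k
          rw [pow_succ] at h3
          change u.toRingHom (x (k + 1)) - u.toRingHom (x k) = _
          rw [← sub_sub_sub_cancel_right _ _ y, h3, h4]
          ring
        obtain ⟨w, hw⟩ := modPow_mk_eq_zero.1 h2
        exact ⟨S.proj d w, by rw [hw, Frame.proj_pow_mul]⟩
    refine ⟨L, sub_eq_zero.1 ((E.isPAdic _).eq_zero fun k => ?_)⟩
    obtain ⟨w, hw⟩ := hL k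
    refine ⟨u.toRingHom w + (E.frame.obj (EtAlg.self S.residue)).proj d (z k), ?_⟩
    have h5 := congrArg u.toRingHom hw
    rw [map_sub, map_mul, map_pow, map_natCast, Frame.Hom.map_proj] at h5
    rw [mul_add, ← h5, ← Frame.proj_pow_mul, ← hx, map_sub, Frame.proj_of_mem hy]
    ring
  intro y
  obtain ⟨D, hD⟩ := Frame.eq_sum_proj y
  choose x hx using fun d => h1 d _ (Frame.proj_mem _ d y)
  refine ⟨∑ d ∈ D, x d, ?_⟩
  conv_rhs => rw [hD D subset_rfl]
  rw [map_sum]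
  exact Finset.sum_congr rfl fun d _ => hx d

variable {ι : Type} {B : ι → EtAlg S.residue} {f : ∀ i, EtAlg.self S.residue ⟶ B i}

theorem unit_eq_of_cover (hS : S.IsPAdic) (hf : IsEtaleCover B f)
    {s s' : S.carrier}
    (h : ∀ i, (E.unit (B i)).toRingHom s = (E.unit (B i)).toRingHom s') : s = s' :=
  E.unit_self_injective hS (E.eq_of_cover hf fun i => by rw [E.map_unit, E.map_unit, h])

theorem unit_mem_grading_of_cover (hS : S.IsPAdic) (hf : IsEtaleCover B f)
    {s : S.carrier} {d : ℤ}
    (h : ∀ i, (E.unit (B i)).toRingHom s ∈ (E.frame.obj (B i)).grading d) : s ∈ S.grading d :=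
  Frame.mem_grading_of_proj fun e he => E.unit_eq_of_cover hS hf fun i => by
    rw [Frame.Hom.map_proj, Frame.proj_of_mem_ne (h i) (Ne.symm he), map_zero]

theorem exists_unit_glue (hS : S.IsPAdic) (hf : IsEtaleCover B f)
    {x : ∀ i, (E.frame.obj (B i)).carrier} (hx : E.Compatible f x) :
    ∃ s, ∀ i, (E.unit (B i)).toRingHom s = x i := by
  obtain ⟨y, hy⟩ := E.exists_glue hf hx
  obtain ⟨s, rfl⟩ := E.unit_self_surjective hS y
  exact ⟨s, fun i => by rw [← hy, E.map_unit]⟩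

end SelfCover

end EtaleBaseChange

/-! ### The standard symmetric form and the orthogonal group -/

section Psi

variable {n : ℕ} {A : Type*} [CommRing A]

/-- The symmetric bilinear form `ψ(v, w) = vᵗ J w`. -/
def psi (v w : Fin n → A) : A := ∑ j, v j * w (Fin.rev j)

theorem psi_comm (v w : Fin n → A) : psi v w = psi w v := by
  rw [psi, psi, ← Equiv.sum_comp Fin.revPerm]
  exact Finset.sum_congr rfl fun j _ => by simp [mul_comm]

theorem psi_add_left (v v' w : Fin n → A) : psi (v + v') w = psi v w + psi v' w := by
  simp [psi, add_mul, Finset.sum_add_distrib]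

theorem psi_add_right (v w w' : Fin n → A) : psi v (w + w') = psi v w + psi v w' := by
  simp [psi, mul_add, Finset.sum_add_distrib]

theorem psi_smul_left (a : A) (v w : Fin n → A) : psi (a • v) w = a * psi v w := by
  simp [psi, Finset.mul_sum, mul_assoc]

theorem psi_smul_right (a : A) (v w : Fin n → A) : psi v (a • w) = a * psi v w := by
  rw [psi_comm, psi_smul_left, psi_comm]

/-- The form `ψ` as a bilinear form. -/
def psiBilin (n : ℕ) (A : Type*) [CommRing A] : LinearMap.BilinForm A (Fin n → A) :=
  LinearMap.mk₂ A psi psi_add_left psi_smul_left psi_add_right psi_smul_right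

theorem psiBilin_apply (v w : Fin n → A) : psiBilin n A v w = psi v w := rfl

theorem psi_map {B : Type*} [CommRing B] (f : A →+* B) (v w : Fin n → A) :
    psi (f ∘ v) (f ∘ w) = f (psi v w) := by
  simp [psi]

theorem psi_single_left (j : Fin n) (w : Fin n → A) : psi (Pi.single j 1) w = w (Fin.rev j) := by
  rw [psi, Finset.sum_eq_single j (fun i _ hi => by simp [hi]) (by simp)]
  simp

theorem psi_single_right (j : Fin n) (v : Fin n → A) : psi v (Pi.single j 1) = v (Fin.rev j) := by
  rw [psi_comm, psi_single_left]

theorem psi_right_injective {v v' : Fin n → A} (h : ∀ w, psi v w = psi v' w) : v = v' := by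
  funext j
  have := h (Pi.single (Fin.rev j) 1)
  rwa [psi_single_right, psi_single_right, Fin.rev_rev] at this

end Psi

section OrthMatrix

open Matrix

variable {n : ℕ} {A B : Type u} [CommRing A] [CommRing B]

theorem antidiag_mulVec (w : Fin n → A) (i : Fin n) : (antidiag n A *ᵥ w) i = w (Fin.rev i) := by
  simp [antidiag, Matrix.mulVec, dotProduct]

theorem psi_eq_dotProduct (v w : Fin n → A) : psi v w = v ⬝ᵥ antidiag n A *ᵥ w := by
  simp [psi, dotProduct, antidiag_mulVec]

theorem psi_mulVec (g : Matrix (Fin n) (Fin n) A) (v w : Fin n → A) :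
    psi (g *ᵥ v) (g *ᵥ w) = v ⬝ᵥ (gᵀ * antidiag n A * g) *ᵥ w := by
  rw [psi_eq_dotProduct, ← Matrix.mulVec_mulVec, ← Matrix.mulVec_mulVec, dotProduct_mulVec v,
    vecMul_transpose]

theorem antidiag_mul_self : antidiag n A * antidiag n A = 1 := by
  refine Matrix.ext_of_mulVec_single fun j => ?_
  funext i
  rw [← Matrix.mulVec_mulVec, antidiag_mulVec, antidiag_mulVec, Fin.rev_rev, Matrix.one_mulVec]

theorem matrix_ext_mulVec {g h : Matrix (Fin n) (Fin n) A} (H : ∀ v, g *ᵥ v = h *ᵥ v) : g = h :=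
  Matrix.ext_of_mulVec_single fun _ => H _

theorem transpose_mul_antidiag_mul_iff (g : Matrix (Fin n) (Fin n) A) :
    gᵀ * antidiag n A * g = antidiag n A ↔ ∀ v w, psi (g *ᵥ v) (g *ᵥ w) = psi v w := by
  constructor
  · intro h v w
    rw [psi_mulVec, h, psi_eq_dotProduct]
  · intro h
    ext i j
    have := h (Pi.single i 1) (Pi.single j 1)
    rw [psi_mulVec, psi_eq_dotProduct] at this
    simpa using this

theorem psi_orthGroup (g : orthGroup n A) (v w : Fin n → A) :
    psi ((g : GL (Fin n) A).val *ᵥ v) ((g : GL (Fin n) A).val *ᵥ w) = psi v w :=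
  (transpose_mul_antidiag_mul_iff _).1 g.2 v w

/-- An endomorphism of `Aⁿ` which preserves `ψ` is invertible. -/
def orthOfMatrix (g : Matrix (Fin n) (Fin n) A) (h : ∀ v w, psi (g *ᵥ v) (g *ᵥ w) = psi v w) :
    orthGroup n A :=
  have h1 : antidiag n A * gᵀ * antidiag n A * g = 1 := by
    rw [Matrix.mul_assoc, Matrix.mul_assoc, ← Matrix.mul_assoc gᵀ,
      (transpose_mul_antidiag_mul_iff g).2 h, antidiag_mul_self]
  ⟨⟨g, antidiag n A * gᵀ * antidiag n A, mul_eq_one_comm.1 h1, h1⟩,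
    (transpose_mul_antidiag_mul_iff g).2 h⟩

theorem comp_mulVec (f : A →+* B) (g : Matrix (Fin n) (Fin n) A) (v : Fin n → A) :
    f ∘ (g *ᵥ v) = g.map f *ᵥ (f ∘ v) := by
  funext i
  exact RingHom.map_mulVec f g v i

theorem orthGroup_map_val (f : A →+* B) (g : orthGroup n A) :
    ((orthGroup.map f g : orthGroup n B) : GL (Fin n) B).val = (g : GL (Fin n) A).val.map f := rfl

theorem orthGroup_mul_val (g h : orthGroup n A) :
    ((g * h : orthGroup n A) : GL (Fin n) A).val =
      (g : GL (Fin n) A).val * (h : GL (Fin n) A).val := rfl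

theorem orthGroup_inv_mulVec (g : orthGroup n A) (v : Fin n → A) :
    ((g⁻¹ : orthGroup n A) : GL (Fin n) A).val *ᵥ ((g : GL (Fin n) A).val *ᵥ v) = v := by
  rw [Matrix.mulVec_mulVec, ← orthGroup_mul_val, inv_mul_cancel]
  exact Matrix.one_mulVec v

theorem orthGroup_mulVec_inv (g : orthGroup n A) (v : Fin n → A) :
    (g : GL (Fin n) A).val *ᵥ (((g⁻¹ : orthGroup n A) : GL (Fin n) A).val *ᵥ v) = v := by
  rw [Matrix.mulVec_mulVec, ← orthGroup_mul_val, mul_inv_cancel]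
  exact Matrix.one_mulVec v

end OrthMatrix

/-! ### The display group -/

section DispGroup

variable {n p : ℕ} {S : Frame.{u} p} {μ : Fin n → ℤ}

theorem Frame.coaction_coeff (s : S.carrier) (d : ℤ) : (S.coaction s).coeff d = S.proj d s := by
  classical
  induction s using DirectSum.Decomposition.inductionOn S.grading with
  | zero => simp
  | @homogeneous i x =>
    rw [S.coaction_of_mem x.2, ← LaurentPolynomial.single_eq_C_mul_T]
    by_cases h : i = d
    · subst h
      rw [Frame.proj_of_mem x.2, AddMonoidAlgebra.coeff_single, Finsupp.single_eq_same]
    · rw [Frame.proj_of_mem_ne x.2 h, AddMonoidAlgebra.coeff_single,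
        Finsupp.single_eq_of_ne (Ne.symm h)]
  | add a b ha hb => simp [map_add, ha, hb]

theorem Frame.coaction_eq_iff (s : S.carrier) (d : ℤ) :
    S.coaction s = LaurentPolynomial.C s * LaurentPolynomial.T d ↔ s ∈ S.grading d := by
  refine ⟨fun h => ?_, fun h => S.coaction_of_mem h⟩
  rw [← LaurentPolynomial.single_eq_C_mul_T] at h
  have h1 := S.coaction_coeff s d
  rw [h] at h1
  have : S.proj d s = s := by
    rw [← h1, AddMonoidAlgebra.coeff_single, Finsupp.single_eq_same]
  exact this ▸ S.proj_mem d s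

theorem cochar_conj_apply (d : Fin n → ℤ) (Y : Matrix (Fin n) (Fin n) S.carrier) (i j : Fin n) :
    ((cochar d (laurentUnit S.carrier))⁻¹.val * Y.map LaurentPolynomial.C *
      (cochar d (laurentUnit S.carrier)).val) i j =
      LaurentPolynomial.C (Y i j) * LaurentPolynomial.T (d j - d i) := by
  have hT : ∀ k : ℤ, ((laurentUnit S.carrier ^ k : S.carrier[T;T⁻¹]ˣ) : S.carrier[T;T⁻¹]) =
      LaurentPolynomial.T k := by
    intro k
    induction k using Int.induction_on with
    | zero => simp
    | succ k ih => rw [zpow_add_one, Units.val_mul, ih, LaurentPolynomial.T_add]; rfl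
    | pred k ih =>
      rw [zpow_sub_one, Units.val_mul, ih, sub_eq_add_neg, LaurentPolynomial.T_add]; rfl
  have h1 : (cochar d (laurentUnit S.carrier)).val =
      Matrix.diagonal fun k => LaurentPolynomial.T (d k) := by
    change Matrix.diagonal (fun k => ((laurentUnit S.carrier ^ d k : S.carrier[T;T⁻¹]ˣ) :
      S.carrier[T;T⁻¹])) = _
    simp only [hT]
  have h2 : (cochar d (laurentUnit S.carrier))⁻¹.val =
      Matrix.diagonal fun k => LaurentPolynomial.T (-d k) := by
    change Matrix.diagonal (fun k => (((laurentUnit S.carrier ^ d k)⁻¹ : S.carrier[T;T⁻¹]ˣ) :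
      S.carrier[T;T⁻¹])) = _
    simp only [← zpow_neg, hT]
  rw [h1, h2, Matrix.mul_diagonal, Matrix.diagonal_mul, sub_eq_add_neg, LaurentPolynomial.T_add,
    Matrix.map_apply]
  ring

theorem mem_dispGroup_iff_mem_grading (g : GL (Fin n) S.carrier) :
    g ∈ dispGroup S μ ↔ g ∈ orthGroup n S.carrier ∧ ∀ i j, g.val i j ∈ S.grading (μ j - μ i) := by
  rw [mem_dispGroup_iff]
  refine and_congr Iff.rfl ?_
  constructor
  · intro h i j
    rw [← Frame.coaction_eq_iff, ← cochar_conj_apply]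
    exact congrArg (fun g : GL (Fin n) S.carrier[T;T⁻¹] => g.val i j) h
  · intro h
    refine Units.ext (Matrix.ext fun i j => ?_)
    refine Eq.trans ?_ (cochar_conj_apply μ g.val i j).symm
    exact (Frame.coaction_eq_iff _ _).2 (h i j)

/-- Matrices of degree zero with respect to the degrees `d` of the basis vectors. -/
def IsGradedMat (S : Frame.{u} p) (d : Fin n → ℤ) (Y : Matrix (Fin n) (Fin n) S.carrier) : Prop :=
  ∀ i j, Y i j ∈ S.grading (d j - d i)

theorem IsGradedMat.charpoly_coeff_mem {d : Fin n → ℤ} {Y : Matrix (Fin n) (Fin n) S.carrier}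
    (hY : IsGradedMat S d Y) (k : ℕ) : Y.charpoly.coeff k ∈ S.grading 0 := by
  rw [← Frame.coaction_eq_iff, LaurentPolynomial.T_zero, mul_one, ← Polynomial.coeff_map,
    ← Polynomial.coeff_map (LaurentPolynomial.C), ← Matrix.charpoly_map, ← Matrix.charpoly_map]
  have h : Y.map S.coaction = (cochar d (laurentUnit S.carrier))⁻¹.val *
      Y.map LaurentPolynomial.C * (cochar d (laurentUnit S.carrier)).val :=
    Matrix.ext fun i j => ((Frame.coaction_eq_iff _ _).2 (hY i j)).trans
      (cochar_conj_apply d Y i j).symm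
  refine congrArg (fun P : Polynomial S.carrier[T;T⁻¹] => P.coeff k) ?_
  refine (congrArg Matrix.charpoly h).trans ?_
  have := Matrix.charpoly_units_conj (cochar d (laurentUnit S.carrier))⁻¹
    (Y.map LaurentPolynomial.C)
  rw [← Matrix.coe_units_inv, inv_inv] at this
  exact this

theorem IsGradedMat.det_mem {d : Fin n → ℤ} {Y : Matrix (Fin n) (Fin n) S.carrier}
    (hY : IsGradedMat S d Y) : Y.det ∈ S.grading 0 := by
  rw [Matrix.det_eq_sign_charpoly_coeff]
  have h1 : ((-1 : S.carrier)) ^ Fintype.card (Fin n) ∈ S.grading 0 := by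
    rcases neg_one_pow_eq_or S.carrier (Fintype.card (Fin n)) with h | h
    · rw [h]; exact SetLike.GradedOne.one_mem
    · rw [h]; exact neg_mem SetLike.GradedOne.one_mem
  simpa using SetLike.mul_mem_graded h1 (hY.charpoly_coeff_mem 0)

theorem IsGradedMat.one (d : Fin n → ℤ) : IsGradedMat S d 1 := fun i j => by
  by_cases h : i = j
  · subst h
    rw [Matrix.one_apply_eq, sub_self]
    exact SetLike.GradedOne.one_mem
  · rw [Matrix.one_apply_ne h]
    exact zero_mem _

theorem IsGradedMat.mul {d : Fin n → ℤ} {Y Z : Matrix (Fin n) (Fin n) S.carrier}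
    (hY : IsGradedMat S d Y) (hZ : IsGradedMat S d Z) : IsGradedMat S d (Y * Z) := fun i j => by
  rw [Matrix.mul_apply]
  refine sum_mem fun k _ => ?_
  have := SetLike.mul_mem_graded (hY i k) (hZ k j)
  rwa [show d k - d i + (d j - d k) = d j - d i by ring] at this

theorem IsGradedMat.pow {d : Fin n → ℤ} {Y : Matrix (Fin n) (Fin n) S.carrier}
    (hY : IsGradedMat S d Y) (k : ℕ) : IsGradedMat S d (Y ^ k) := by
  induction k with
  | zero => rw [pow_zero]; exact IsGradedMat.one d
  | succ k ih => rw [pow_succ]; exact ih.mul hY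

theorem IsGradedMat.smul {d : Fin n → ℤ} {Y : Matrix (Fin n) (Fin n) S.carrier} {a : S.carrier}
    (hY : IsGradedMat S d Y) (ha : a ∈ S.grading 0) : IsGradedMat S d (a • Y) := fun i j => by
  simpa using SetLike.mul_mem_graded ha (hY i j)

theorem IsGradedMat.aeval {d : Fin n → ℤ} {Y : Matrix (Fin n) (Fin n) S.carrier}
    (hY : IsGradedMat S d Y) {P : Polynomial S.carrier} (hP : ∀ k, P.coeff k ∈ S.grading 0) :
    IsGradedMat S d (Polynomial.aeval Y P) := fun i j => by
  rw [Polynomial.aeval_eq_sum_range, Matrix.sum_apply]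
  exact sum_mem fun k _ => (hY.pow k).smul (hP k) i j

theorem dispGroup_val_mem (h : dispGroup S μ) (i j : Fin n) :
    (h : GL (Fin n) S.carrier).val i j ∈ S.grading (μ j - μ i) :=
  ((mem_dispGroup_iff_mem_grading _).1 h.2).2 i j

/-- The homogeneous vectors of degree `d` in the graded module `⊕ S(-μⱼ)`. -/
def homVec (S : Frame.{u} p) (μ : Fin n → ℤ) (d : ℤ) : AddSubgroup (Fin n → S.carrier) where
  carrier := {v | ∀ j, v j ∈ S.grading (d - μ j)}
  zero_mem' := fun _ => zero_mem _
  add_mem' := fun h h' j => add_mem (h j) (h' j)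
  neg_mem' := fun h j => neg_mem (h j)

theorem mulVec_mem_homVec (h : dispGroup S μ) {d : ℤ} {v : Fin n → S.carrier}
    (hv : v ∈ homVec S μ d) : (h : GL (Fin n) S.carrier).val.mulVec v ∈ homVec S μ d := by
  intro i
  change ∑ j : Fin n, (h : GL (Fin n) S.carrier).val i j * v j ∈ S.grading (d - μ i)
  refine sum_mem fun j _ => ?_
  have := SetLike.mul_mem_graded (dispGroup_val_mem h i j) (hv j)
  rwa [show μ j - μ i + (d - μ j) = d - μ i by ring] at this

theorem psi_mem_grading (hμ : ∀ i, μ i + μ (Fin.rev i) = 0) {d e : ℤ} {v w : Fin n → S.carrier}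
    (hv : v ∈ homVec S μ d) (hw : w ∈ homVec S μ e) : psi v w ∈ S.grading (d + e) := by
  refine sum_mem fun j _ => ?_
  have := SetLike.mul_mem_graded (hv j) (hw (Fin.rev j))
  rwa [show d - μ j + (e - μ (Fin.rev j)) = d + e by linarith [hμ j]] at this

theorem smul_mem_homVec {c d : ℤ} {s : S.carrier} {v : Fin n → S.carrier} (hs : s ∈ S.grading c)
    (hv : v ∈ homVec S μ d) : s • v ∈ homVec S μ (c + d) := fun j => by
  have := SetLike.mul_mem_graded hs (hv j)
  rwa [show c + (d - μ j) = c + d - μ j by ring] at this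

theorem map_mem_homVec {S' : Frame.{u} p} (f : S ⟶ S') {d : ℤ} {v : Fin n → S.carrier}
    (hv : v ∈ homVec S μ d) : f.toRingHom ∘ v ∈ homVec S' μ d :=
  fun j => f.map_mem _ _ (hv j)

end DispGroup

/-! ### Isometric coordinates -/

section Isometric

open Matrix

variable {n : ℕ} {A B : Type u} [CommRing A] [CommRing B] {M : Type u} [AddCommGroup M]
  [Module A M]

/-- A semilinear map `φ : M → Bⁿ` that is compatible with the forms and whose image generates
`Bⁿ`. -/
structure IsCoord (β : LinearMap.BilinForm A M) {v : A →+* B} (φ : M →ₛₗ[v] (Fin n → B)) :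
    Prop where
  isom : ∀ x y, psi (φ x) (φ y) = v (β x y)
  span : Submodule.span B (Set.range φ) = ⊤

/-- Dual families of vectors with respect to a bilinear form. -/
def IsDual (β : LinearMap.BilinForm A M) {N : ℕ} (x y : Fin N → M) : Prop :=
  ∀ m, m = ∑ k, β (y k) m • x k

theorem IsCoord.ext_mulVec {β : LinearMap.BilinForm A M} {v : A →+* B}
    {φ : M →ₛₗ[v] (Fin n → B)} (hφ : IsCoord β φ) {g h : Matrix (Fin n) (Fin n) B}
    (H : ∀ m, g *ᵥ φ m = h *ᵥ φ m) : g = h := by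
  refine matrix_ext_mulVec fun w => ?_
  have hw : w ∈ Submodule.span B (Set.range φ) := hφ.span ▸ Submodule.mem_top
  induction hw using Submodule.span_induction with
  | mem x hx =>
    obtain ⟨m, rfl⟩ := hx
    exact H m
  | zero => rw [mulVec_zero, mulVec_zero]
  | add x y _ _ hx hy => rw [mulVec_add, mulVec_add, hx, hy]
  | smul a x _ hx => rw [mulVec_smul, mulVec_smul, hx]

/-- The matrix `∑ₖ aₖ bₖᵗ J` of the endomorphism `w ↦ ∑ₖ ψ(bₖ, w) aₖ`. -/
def dyad {N : ℕ} (a b : Fin N → Fin n → B) : Matrix (Fin n) (Fin n) B :=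
  Matrix.of fun i j => ∑ k, a k i * b k (Fin.rev j)

theorem dyad_mulVec {N : ℕ} (a b : Fin N → Fin n → B) (w : Fin n → B) :
    dyad a b *ᵥ w = ∑ k, psi (b k) w • a k := by
  funext i
  simp only [mulVec, dotProduct, dyad, of_apply, Finset.sum_apply, Pi.smul_apply, smul_eq_mul,
    Finset.sum_mul]
  rw [Finset.sum_comm]
  refine Finset.sum_congr rfl fun k _ => ?_
  rw [psi_comm, psi, Finset.sum_mul]
  refine Finset.sum_congr rfl fun j _ => ?_
  ring

theorem IsCoord.dyad_mulVec {β : LinearMap.BilinForm A M} {v : A →+* B}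
    {φ φ' : M →ₛₗ[v] (Fin n → B)} (hφ : IsCoord β φ) {N : ℕ} {x y : Fin N → M}
    (hxy : IsDual β x y) (m : M) :
    dyad (fun k => φ' (x k)) (fun k => φ (y k)) *ᵥ φ m = φ' m := by
  rw [Displays.dyad_mulVec]
  conv_rhs => rw [hxy m, map_sum]
  exact Finset.sum_congr rfl fun k _ => by rw [hφ.isom, map_smulₛₗ]

theorem IsCoord.dyad_self {β : LinearMap.BilinForm A M} {v : A →+* B}
    {φ : M →ₛₗ[v] (Fin n → B)} (hφ : IsCoord β φ) {N : ℕ} {x y : Fin N → M}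
    (hxy : IsDual β x y) : dyad (fun k => φ (x k)) (fun k => φ (y k)) = 1 :=
  hφ.ext_mulVec fun m => by rw [hφ.dyad_mulVec hxy, one_mulVec]

theorem IsCoord.psi_dyad {β : LinearMap.BilinForm A M} {v : A →+* B}
    {φ φ' : M →ₛₗ[v] (Fin n → B)} (hφ : IsCoord β φ) (hφ' : IsCoord β φ') {N : ℕ}
    {x y : Fin N → M} (hxy : IsDual β x y) (w w' : Fin n → B) :
    psi (dyad (fun k => φ' (x k)) (fun k => φ (y k)) *ᵥ w)
      (dyad (fun k => φ' (x k)) (fun k => φ (y k)) *ᵥ w') = psi w w' := by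
  set g := dyad (fun k => φ' (x k)) (fun k => φ (y k))
  rw [psi_mulVec, psi_eq_dotProduct]
  congr 2
  have h1 : ∀ m m', psi (g *ᵥ φ m) (g *ᵥ φ m') = psi (φ m) (φ m') := fun m m' => by
    rw [hφ.dyad_mulVec hxy, hφ.dyad_mulVec hxy, hφ.isom, hφ'.isom]
  have h2 : ∀ m w', psi (g *ᵥ φ m) (g *ᵥ w') = psi (φ m) w' := by
    intro m w'
    have hw : w' ∈ Submodule.span B (Set.range φ) := hφ.span ▸ Submodule.mem_top
    induction hw using Submodule.span_induction with
    | mem x hx =>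
      obtain ⟨m, rfl⟩ := hx
      exact h1 _ m
    | zero => rw [mulVec_zero, ← psiBilin_apply, ← psiBilin_apply, map_zero, map_zero]
    | add x y _ _ hx hy => rw [mulVec_add, psi_add_right, psi_add_right, hx, hy]
    | smul a x _ hx => rw [mulVec_smul, psi_smul_right, psi_smul_right, hx]
  refine (transpose_mul_antidiag_mul_iff g).2 fun w w' => ?_
  have hw : w ∈ Submodule.span B (Set.range φ) := hφ.span ▸ Submodule.mem_top
  induction hw using Submodule.span_induction with
  | mem x hx =>
    obtain ⟨m, rfl⟩ := hx
    exact h2 m w'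
  | zero => rw [mulVec_zero, psi_comm, psi_comm 0, ← psiBilin_apply, ← psiBilin_apply, map_zero,
      map_zero]
  | add x y _ _ hx hy => rw [mulVec_add, psi_add_left, psi_add_left, hx, hy]
  | smul a x _ hx => rw [mulVec_smul, psi_smul_left, psi_smul_left, hx]

/-- The orthogonal matrix that relates two systems of isometric coordinates. -/
def transporter {β : LinearMap.BilinForm A M} {v : A →+* B} {φ φ' : M →ₛₗ[v] (Fin n → B)}
    (hφ : IsCoord β φ) (hφ' : IsCoord β φ') {N : ℕ} {x y : Fin N → M} (hxy : IsDual β x y) :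
    orthGroup n B :=
  orthOfMatrix _ (hφ.psi_dyad hφ' hxy)

theorem transporter_mulVec {β : LinearMap.BilinForm A M} {v : A →+* B}
    {φ φ' : M →ₛₗ[v] (Fin n → B)} (hφ : IsCoord β φ) (hφ' : IsCoord β φ') {N : ℕ}
    {x y : Fin N → M} (hxy : IsDual β x y) (m : M) :
    (transporter hφ hφ' hxy : GL (Fin n) B).val *ᵥ φ m = φ' m :=
  hφ.dyad_mulVec hxy m

theorem IsCoord.orthGroup_ext {β : LinearMap.BilinForm A M} {v : A →+* B}
    {φ : M →ₛₗ[v] (Fin n → B)} (hφ : IsCoord β φ) {g h : orthGroup n B}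
    (H : ∀ m, (g : GL (Fin n) B).val *ᵥ φ m = (h : GL (Fin n) B).val *ᵥ φ m) : g = h :=
  Subtype.ext (Units.ext (hφ.ext_mulVec H))

end Isometric

/-! ### Semilinear extension to a base change -/

section SemiLift

variable {A B C : Type u} [CommRing A] [CommRing B] [CommRing C] {f : A →+* B} {g : A →+* C}
  {M P : Type u} [AddCommGroup M] [Module A M] [AddCommGroup P] [Module C P]

theorem BC.induction {motive : BC f M → Prop} (x : BC f M) (mk : ∀ b m, motive (BC.mk f b m))
    (zero : motive 0) (add : ∀ x y, motive x → motive y → motive (x + y)) : motive x := by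
  let := f.toAlgebra
  exact TensorProduct.induction_on (R := A) (M := B) (N := M) x zero mk add

theorem BC.smul_mk (a b : B) (m : M) : a • BC.mk f b m = BC.mk f (a * b) m := by
  let := f.toAlgebra
  exact TensorProduct.smul_tmul' (R := A) a b m

theorem BC.mk_add (b : B) (m m' : M) : BC.mk f b (m + m') = BC.mk f b m + BC.mk f b m' := by
  let := f.toAlgebra
  exact TensorProduct.tmul_add b m m'

theorem BC.mk_smul (b : B) (a : A) (m : M) : BC.mk f b (a • m) = BC.mk f (b * f a) m := by
  let := f.toAlgebra
  rw [mul_comm]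
  exact (TensorProduct.smul_tmul (R := A) a b m).symm

/-- The map `m ↦ 1 ⊗ m` as a semilinear map. -/
def BC.mkOne (f : A →+* B) (M : Type u) [AddCommGroup M] [Module A M] : M →ₛₗ[f] BC f M where
  toFun := BC.mk f 1
  map_add' := BC.mk_add 1
  map_smul' a m := by rw [BC.mk_smul, one_mul, BC.smul_mk, mul_one]

/-- The semilinear map `B ⊗_f M → P`, `b ⊗ m ↦ h(b) φ(m)`. -/
def BC.semilift {h : B →+* C} (φ : M →ₛₗ[g] P) (hg : g = h.comp f) : BC f M →ₛₗ[h] P :=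
  letI : Module B P := Module.compHom P h
  { toFun := BC.lift (f := f) (P := P)
      { toFun := φ, map_add' := φ.map_add, map_smul' := fun a m => by
          rw [φ.map_smulₛₗ]
          exact congrArg (· • φ m) (RingHom.congr_fun hg a) }
    map_add' := fun x y => by rw [map_add]
    map_smul' := fun b x => by rw [map_smul]; rfl }

theorem BC.semilift_mk {h : B →+* C} (φ : M →ₛₗ[g] P) (hg : g = h.comp f) (b : B) (m : M) :
    BC.semilift φ hg (BC.mk f b m) = h b • φ m := by
  let : Module B P := Module.compHom P h
  exact BC.lift_mk (f := f) (P := P) _ b m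

end SemiLift

/-! ### Homogeneous dual families -/

section HomDual

variable {p : ℕ} {S : Frame.{u} p}

/-- Dual families of homogeneous elements of an orthogonal display. -/
structure HomDual (M : OrthDisplay S) where
  N : ℕ
  x : Fin N → M.carrier
  y : Fin N → M.carrier
  deg : Fin N → ℤ
  x_mem : ∀ k, x k ∈ M.grading (deg k)
  y_mem : ∀ k, y k ∈ M.grading (-deg k)
  dual : IsDual M.form x y

/-- The projection to the homogeneous elements of degree `d`. -/
def GrMod.proj (M : GrMod S) (d : ℤ) : M.carrier →+ M.carrier where
  toFun m := (DirectSum.decompose M.grading m d : M.carrier)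
  map_zero' := by simp
  map_add' x y := by simp

theorem GrMod.proj_mem (M : GrMod S) (d : ℤ) (m : M.carrier) : M.proj d m ∈ M.grading d :=
  SetLike.coe_mem _

theorem GrMod.proj_of_mem (M : GrMod S) {d : ℤ} {m : M.carrier} (hm : m ∈ M.grading d) :
    M.proj d m = m :=
  DirectSum.decompose_of_mem_same _ hm

theorem GrMod.proj_of_mem_ne (M : GrMod S) {d e : ℤ} {m : M.carrier} (hm : m ∈ M.grading e)
    (h : e ≠ d) : M.proj d m = 0 :=
  DirectSum.decompose_of_mem_ne _ hm h

theorem OrthDisplay.form_component (M : OrthDisplay S) {d : ℤ} {m : M.carrier}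
    (hm : m ∈ M.grading d) (z : M.carrier) (e : ℤ) :
    M.form (M.proj e z) m = S.proj (e + d) (M.form z m) := by
  classical
  induction z using DirectSum.Decomposition.inductionOn M.grading with
  | zero => simp
  | @homogeneous i x =>
    by_cases h : i = e
    · subst h
      rw [M.proj_of_mem x.2, Frame.proj_of_mem (M.form_mem _ _ _ _ x.2 hm)]
    · rw [M.proj_of_mem_ne x.2 h, map_zero, LinearMap.zero_apply,
        Frame.proj_of_mem_ne (M.form_mem _ _ _ _ x.2 hm) (by omega)]
  | add a b ha hb =>
    rw [map_add, map_add, LinearMap.add_apply, ha, hb, map_add, LinearMap.add_apply, map_add]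

theorem GrMod.component_smul (M : GrMod S) {d : ℤ} {x : M.carrier} (hx : x ∈ M.grading d)
    (s : S.carrier) (e : ℤ) :
    M.proj e (s • x) = S.proj (e - d) s • x := by
  classical
  induction s using DirectSum.Decomposition.inductionOn S.grading with
  | zero => simp
  | @homogeneous i s =>
    have h1 : (s : S.carrier) • x ∈ M.grading (i + d) := SetLike.GradedSMul.smul_mem s.2 hx
    by_cases h : i + d = e
    · subst h
      rw [M.proj_of_mem h1, add_sub_cancel_right, Frame.proj_of_mem s.2]
    · rw [M.proj_of_mem_ne h1 h, Frame.proj_of_mem_ne s.2 (by omega), zero_smul]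
  | add a b ha hb =>
    rw [add_smul, map_add, ha, hb, map_add, add_smul]

theorem GrMod.exists_homogeneous_generators (M : GrMod S) :
    ∃ (N : ℕ) (x : Fin N → M.carrier) (deg : Fin N → ℤ), (∀ k, x k ∈ M.grading (deg k)) ∧
      Submodule.span S.carrier (Set.range x) = ⊤ := by
  classical
  obtain ⟨s, hs⟩ := (Module.finite_def.1 M.finite)
  let T := s.sigma fun m => (DirectSum.decompose M.grading m).support
  let e := T.equivFin
  refine ⟨T.card, fun k => (DirectSum.decompose M.grading (e.symm k).1.1 (e.symm k).1.2 :
    M.carrier), fun k => (e.symm k).1.2, fun k => SetLike.coe_mem _, ?_⟩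
  rw [eq_top_iff, ← hs, Submodule.span_le]
  intro m hm
  rw [← DirectSum.sum_support_decompose M.grading m]
  refine sum_mem fun i hi => Submodule.subset_span ?_
  exact ⟨e ⟨⟨m, i⟩, Finset.mem_sigma.2 ⟨hm, hi⟩⟩, congrArg (fun t : T =>
    (DirectSum.decompose M.grading t.1.1 t.1.2 : M.carrier)) (e.symm_apply_apply _)⟩

theorem OrthDisplay.nonempty_homDual (M : OrthDisplay S) : Nonempty (HomDual M) := by
  classical
  obtain ⟨N, x, deg, hx, hspan⟩ := M.toGrMod.exists_homogeneous_generators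
  let π : (Fin N → S.carrier) →ₗ[S.carrier] M.carrier := Fintype.linearCombination S.carrier x
  have hπ : Function.Surjective π := by
    rw [← LinearMap.range_eq_top, Fintype.range_linearCombination, hspan]
  obtain ⟨s, hs⟩ := Module.projective_lifting_property π LinearMap.id hπ
  choose z hz using fun k => M.form_perfect.2 (LinearMap.proj k ∘ₗ s)
  have h1 : ∀ m, m = ∑ k, M.form (z k) m • x k := fun m => by
    have := LinearMap.congr_fun hs m
    simp only [LinearMap.comp_apply, LinearMap.id_apply, π, Fintype.linearCombination_apply] at this
    conv_lhs => rw [← this]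
    exact Finset.sum_congr rfl fun k _ => by rw [hz]; rfl
  refine ⟨⟨N, x, fun k => M.proj (-deg k) (z k), deg, hx, fun k => M.proj_mem _ _, fun m => ?_⟩⟩
  induction m using DirectSum.Decomposition.inductionOn M.grading with
  | zero => simp
  | @homogeneous d m =>
    have h2 := congrArg (M.proj d) (h1 m)
    rw [M.proj_of_mem m.2, map_sum] at h2
    conv_lhs => rw [h2]
    refine Finset.sum_congr rfl fun k _ => ?_
    rw [M.component_smul (hx k), M.form_component m.2, neg_add_eq_sub]
  | add a b ha hb =>
    conv_lhs => rw [ha, hb, ← Finset.sum_add_distrib]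
    exact Finset.sum_congr rfl fun k _ => by rw [map_add, add_smul]

/-- A choice of dual families of homogeneous elements. -/
def OrthDisplay.homDual (M : OrthDisplay S) : HomDual M := M.nonempty_homDual.some

end HomDual

section

open Matrix

variable {n : ℕ} {A B C : Type u} [CommRing A] [CommRing B] [CommRing C] {M : Type u}
  [AddCommGroup M] [Module A M]

theorem span_range_comp_eq_top {v : A →+* B} {φ : M →ₛₗ[v] (Fin n → B)}
    (h : Submodule.span B (Set.range φ) = ⊤) (w : B →+* C) :
    Submodule.span C (Set.range fun m => w ∘ φ m) = ⊤ := by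
  have key : ∀ x : Fin n → B, w ∘ x ∈ Submodule.span C (Set.range fun m => w ∘ φ m) := by
    intro x
    have hx : x ∈ Submodule.span B (Set.range φ) := h ▸ Submodule.mem_top
    induction hx using Submodule.span_induction with
    | mem x hx =>
      obtain ⟨m, rfl⟩ := hx
      exact Submodule.subset_span ⟨m, rfl⟩
    | zero =>
      rw [show w ∘ (0 : Fin n → B) = 0 from funext fun _ => map_zero w]
      exact zero_mem _
    | add x y _ _ hx hy =>
      rw [show w ∘ (x + y) = w ∘ x + w ∘ y from funext fun _ => map_add w _ _]
      exact add_mem hx hy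
    | smul a x _ hx =>
      rw [show w ∘ (a • x) = w a • w ∘ x from funext fun _ => map_mul w _ _]
      exact Submodule.smul_mem _ _ hx
  rw [eq_top_iff]
  rintro x -
  rw [pi_eq_sum_univ' x]
  refine sum_mem fun j _ => Submodule.smul_mem _ _ ?_
  have := key (Pi.single j 1)
  convert this using 1
  funext i
  rw [Function.comp_apply, Pi.apply_single (fun _ => w) (fun _ => map_zero w), map_one]

/-- A semilinear map to `Bⁿ` followed by a homomorphism of rings. -/
def compCoord {v : A →+* B} (w : B →+* C) {v' : A →+* C} (hv : v' = w.comp v)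
    (φ : M →ₛₗ[v] (Fin n → B)) : M →ₛₗ[v'] (Fin n → C) where
  toFun m := w ∘ φ m
  map_add' x y := funext fun j => by simp
  map_smul' a x := funext fun j => by simp [hv]

theorem compCoord_apply {v : A →+* B} (w : B →+* C) {v' : A →+* C} (hv : v' = w.comp v)
    (φ : M →ₛₗ[v] (Fin n → B)) (m : M) : compCoord w hv φ m = w ∘ φ m := rfl

theorem IsCoord.comp {β : LinearMap.BilinForm A M} {v : A →+* B} {φ : M →ₛₗ[v] (Fin n → B)}
    (hφ : IsCoord β φ) (w : B →+* C) {v' : A →+* C} (hv : v' = w.comp v) :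
    IsCoord β (compCoord w hv φ) where
  isom x y := by
    rw [compCoord_apply, compCoord_apply, psi_map, hφ.isom, hv, RingHom.comp_apply]
  span := span_range_comp_eq_top hφ.span w

theorem IsCoord.semilift {β : LinearMap.BilinForm A M} {v : A →+* C} {φ : M →ₛₗ[v] (Fin n → C)}
    (hφ : IsCoord β φ) {f : A →+* B} {h : B →+* C} (hv : v = h.comp f) :
    IsCoord (BC.bilin f β) (BC.semilift φ hv) where
  isom x y := by
    induction x using BC.induction with
    | mk b m =>
      induction y using BC.induction with
      | mk c m' =>
        rw [BC.semilift_mk, BC.semilift_mk, psi_smul_left, psi_smul_right, hφ.isom, BC.bilin_mk,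
          map_mul, map_mul, hv, RingHom.comp_apply]
        ring
      | zero => rw [map_zero, map_zero, map_zero, ← psiBilin_apply, map_zero]
      | add y y' hy hy' => rw [map_add, map_add, map_add, psi_add_right, hy, hy']
    | zero =>
      rw [map_zero, map_zero, LinearMap.zero_apply, map_zero, ← psiBilin_apply, map_zero,
        LinearMap.zero_apply]
    | add x x' hx hx' =>
      rw [map_add, map_add, LinearMap.add_apply, map_add, psi_add_left, hx, hx']
  span := by
    rw [eq_top_iff, ← hφ.span, Submodule.span_le]
    rintro _ ⟨m, rfl⟩
    refine Submodule.subset_span ⟨BC.mk f 1 m, ?_⟩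
    rw [BC.semilift_mk, map_one, one_smul]

theorem span_eq_top_of_dyad_eq_one {v : A →+* B} {φ : M →ₛₗ[v] (Fin n → B)} {N : ℕ}
    {x : Fin N → M} {b : Fin N → Fin n → B} (h : dyad (fun k => φ (x k)) b = 1) :
    Submodule.span B (Set.range φ) = ⊤ := by
  rw [eq_top_iff]
  rintro w -
  rw [← one_mulVec w, ← h, dyad_mulVec]
  exact sum_mem fun k _ => Submodule.smul_mem _ _ (Submodule.subset_span ⟨_, rfl⟩)

theorem map_dyad (w : B →+* C) {N : ℕ} (a b : Fin N → Fin n → B) :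
    (dyad a b).map w = dyad (fun k => w ∘ a k) fun k => w ∘ b k := by
  ext i j
  simp [dyad]

/-- A semilinear map to `Bⁿ` followed by a matrix. -/
def mulVecCoord {v : A →+* B} (g : Matrix (Fin n) (Fin n) B) (φ : M →ₛₗ[v] (Fin n → B)) :
    M →ₛₗ[v] (Fin n → B) where
  toFun m := g *ᵥ φ m
  map_add' x y := by rw [map_add, mulVec_add]
  map_smul' a x := by rw [map_smulₛₗ, mulVec_smul]

theorem IsCoord.mulVec {β : LinearMap.BilinForm A M} {v : A →+* B} {φ : M →ₛₗ[v] (Fin n → B)}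
    (hφ : IsCoord β φ) (g : orthGroup n B) :
    IsCoord β (mulVecCoord (g : GL (Fin n) B).val φ) where
  isom x y := (psi_orthGroup g _ _).trans (hφ.isom x y)
  span := by
    rw [eq_top_iff]
    rintro w -
    rw [← orthGroup_mulVec_inv g w]
    generalize ((g⁻¹ : orthGroup n B) : GL (Fin n) B).val *ᵥ w = w'
    have hw : w' ∈ Submodule.span B (Set.range φ) := hφ.span ▸ Submodule.mem_top
    induction hw using Submodule.span_induction with
    | mem x hx =>
      obtain ⟨m, rfl⟩ := hx
      exact Submodule.subset_span ⟨m, rfl⟩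
    | zero => rw [mulVec_zero]; exact zero_mem _
    | add x y _ _ hx hy => rw [mulVec_add]; exact add_mem hx hy
    | smul a x _ hx => rw [mulVec_smul]; exact Submodule.smul_mem _ _ hx

end

/-! ### Trivializations of orthogonal displays -/

section Triv

open Matrix

variable {p n : ℕ} {S S' S'' : Frame.{u} p}

theorem Frame.Hom.sigma_comp (f : S ⟶ S') :
    (Frame.Hom.zero f).comp S.sigma = S'.sigma.comp f.toRingHom :=
  RingHom.ext fun x => Subtype.ext (f.map_sigma x)

theorem Frame.Hom.tau_comp (f : S ⟶ S') :
    (Frame.Hom.zero f).comp S.tau = S'.tau.comp f.toRingHom :=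
  RingHom.ext fun x => Subtype.ext (f.map_tau x)

/-- A trivialization of the orthogonal graded module `M ⊗_S S'` by the standard orthogonal graded
module of type `μ`. -/
@[ext]
structure Triv (M : OrthDisplay S) (μ : Fin n → ℤ) (u : S ⟶ S') where
  coord : M.carrier →ₛₗ[u.toRingHom] (Fin n → S'.carrier)
  mem : ∀ (d : ℤ) (m : M.carrier), m ∈ M.grading d → coord m ∈ homVec S' μ d
  isCoord : IsCoord M.form coord

namespace Triv

variable {M : OrthDisplay S} {μ : Fin n → ℤ} {u : S ⟶ S'}

theorem ext_apply {φ φ' : Triv M μ u} (h : ∀ m, φ.coord m = φ'.coord m) : φ = φ' :=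
  Triv.ext (LinearMap.ext h)

/-- Base change of trivializations. -/
def map (φ : Triv M μ u) (f : S' ⟶ S'') {u' : S ⟶ S''} (hu : u ≫ f = u') : Triv M μ u' where
  coord := compCoord f.toRingHom (by rw [← hu]; rfl) φ.coord
  mem d m hm := map_mem_homVec f (φ.mem d m hm)
  isCoord := φ.isCoord.comp _ _

theorem map_coord (φ : Triv M μ u) (f : S' ⟶ S'') {u' : S ⟶ S''} (hu : u ≫ f = u')
    (m : M.carrier) : (φ.map f hu).coord m = f.toRingHom ∘ φ.coord m := rfl

/-- The orthogonal matrix underlying an element of the display group. -/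
def toOrth (h : dispGroup S' μ) : orthGroup n S'.carrier := ⟨h.1, h.2.1⟩

/-- The right action of the display group on trivializations. -/
def act (φ : Triv M μ u) (h : dispGroup S' μ) : Triv M μ u where
  coord := mulVecCoord (h⁻¹).1.val φ.coord
  mem d m hm := mulVec_mem_homVec h⁻¹ (φ.mem d m hm)
  isCoord := φ.isCoord.mulVec (toOrth h⁻¹)

theorem act_coord (φ : Triv M μ u) (h : dispGroup S' μ) (m : M.carrier) :
    (φ.act h).coord m = (h⁻¹).1.val *ᵥ φ.coord m := rfl

theorem act_one (φ : Triv M μ u) : φ.act 1 = φ := ext_apply fun m => by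
  rw [act_coord, inv_one]
  exact one_mulVec _

theorem act_mul (φ : Triv M μ u) (g h : dispGroup S' μ) : φ.act (g * h) = (φ.act g).act h :=
  ext_apply fun m => by
    rw [act_coord, act_coord, act_coord, _root_.mul_inv_rev, mulVec_mulVec]
    rfl

theorem act_map (φ : Triv M μ u) (f : S' ⟶ S'') {u' : S ⟶ S''} (hu : u ≫ f = u')
    (h : dispGroup S' μ) : (φ.act h).map f hu = (φ.map f hu).act (dispGroup.map f μ h) :=
  ext_apply fun m => by
    rw [map_coord, act_coord, comp_mulVec, act_coord, map_coord, ← map_inv]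
    rfl

theorem mulVec_act_coord (φ : Triv M μ u) (h : dispGroup S' μ) (m : M.carrier) :
    h.1.val *ᵥ (φ.act h).coord m = φ.coord m :=
  orthGroup_mulVec_inv (toOrth h) _

theorem simply_transitive (hμ : ∀ i, μ i + μ (Fin.rev i) = 0) (φ φ' : Triv M μ u) :
    ∃! h, φ.act h = φ' := by
  let D := M.homDual
  let g := transporter φ'.isCoord φ.isCoord D.dual
  have hg : ∀ m, (g : GL (Fin n) S'.carrier).val *ᵥ φ'.coord m = φ.coord m :=
    transporter_mulVec φ'.isCoord φ.isCoord D.dual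
  have hmem : (g : GL (Fin n) S'.carrier) ∈ dispGroup S' μ := by
    rw [mem_dispGroup_iff_mem_grading]
    refine ⟨g.2, fun i j => ?_⟩
    change ∑ k, φ.coord (D.x k) i * φ'.coord (D.y k) (Fin.rev j) ∈ _
    refine sum_mem fun k _ => ?_
    have := SetLike.mul_mem_graded (φ.mem _ _ (D.x_mem k) i) (φ'.mem _ _ (D.y_mem k) (Fin.rev j))
    rwa [show D.deg k - μ i + (-D.deg k - μ (Fin.rev j)) = μ j - μ i by linarith [hμ j]] at this
  refine ⟨⟨g, hmem⟩, ext_apply fun m => ?_, fun h hh => Subtype.ext ?_⟩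
  · rw [act_coord, ← hg]
    exact orthGroup_inv_mulVec g _
  · refine Units.ext (φ'.isCoord.ext_mulVec fun m => ?_)
    rw [hg, ← hh, mulVec_act_coord]

/-- The `σ`-twist of a trivialization. -/
def sigma (φ : Triv M μ u) :
    M.carrier →ₛₗ[(Frame.Hom.zero u).comp S.sigma] (Fin n → S'.grading 0) :=
  compCoord S'.sigma (Frame.Hom.sigma_comp u) φ.coord

theorem isCoord_sigma (φ : Triv M μ u) : IsCoord M.form φ.sigma := φ.isCoord.comp _ _

/-- The `τ`-twist of a trivialization. -/
def tau (φ : Triv M μ u) :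
    BC S.tau M.carrier →ₛₗ[Frame.Hom.zero u] (Fin n → S'.grading 0) :=
  BC.semilift (compCoord S'.tau rfl φ.coord) (Frame.Hom.tau_comp u).symm

theorem tau_mk (φ : Triv M μ u) (b : S.grading 0) (m : M.carrier) :
    φ.tau (BC.mk S.tau b m) = Frame.Hom.zero u b • (S'.tau ∘ φ.coord m) :=
  BC.semilift_mk _ _ b m

theorem isCoord_tau (φ : Triv M μ u) : IsCoord (BC.bilin S.tau M.form) φ.tau :=
  (φ.isCoord.comp _ _).semilift _

/-- The composition of the Frobenius of `M` and of the `τ`-twist of a trivialization. -/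
def tauF (φ : Triv M μ u) :
    M.carrier →ₛₗ[(Frame.Hom.zero u).comp S.sigma] (Fin n → S'.grading 0) where
  toFun m := φ.tau (M.F m)
  map_add' x y := by rw [map_add, map_add]
  map_smul' a x := by rw [map_smulₛₗ, map_smulₛₗ, RingHom.comp_apply]

theorem tauF_apply (φ : Triv M μ u) (m : M.carrier) : φ.tauF m = φ.tau (M.F m) := rfl

theorem isCoord_tauF (φ : Triv M μ u) : IsCoord M.form φ.tauF where
  isom x y := by
    rw [tauF_apply, tauF_apply, φ.isCoord_tau.isom, ← M.form_F, RingHom.comp_apply]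
  span := by
    rw [eq_top_iff, ← φ.isCoord_tau.span, Submodule.span_le]
    rintro _ ⟨z, rfl⟩
    obtain ⟨y, rfl⟩ := M.F_bijective.2 z
    induction y using BC.induction with
    | mk b m =>
      rw [BC.lift_mk, map_smulₛₗ]
      exact Submodule.smul_mem _ _ (Submodule.subset_span ⟨m, rfl⟩)
    | zero => rw [map_zero, map_zero]; exact zero_mem _
    | add x y hx hy => rw [map_add, map_add]; exact add_mem hx hy

/-- The matrix of the Frobenius of `M` with respect to a trivialization. -/
def alpha (φ : Triv M μ u) : orthGroup n (S'.grading 0) :=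
  transporter φ.isCoord_sigma φ.isCoord_tauF M.homDual.dual

theorem alpha_mulVec (φ : Triv M μ u) (m : M.carrier) :
    (φ.alpha : GL (Fin n) (S'.grading 0)).val *ᵥ (S'.sigma ∘ φ.coord m) = φ.tau (M.F m) :=
  transporter_mulVec φ.isCoord_sigma φ.isCoord_tauF M.homDual.dual m

theorem alpha_eq (φ : Triv M μ u) {g : orthGroup n (S'.grading 0)}
    (h : ∀ m, (g : GL (Fin n) (S'.grading 0)).val *ᵥ (S'.sigma ∘ φ.coord m) = φ.tau (M.F m)) :
    φ.alpha = g :=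
  φ.isCoord_sigma.orthGroup_ext fun m => (φ.alpha_mulVec m).trans (h m).symm

theorem tau_map (φ : Triv M μ u) (f : S' ⟶ S'') {u' : S ⟶ S''} (hu : u ≫ f = u')
    (z : BC S.tau M.carrier) : (φ.map f hu).tau z = Frame.Hom.zero f ∘ φ.tau z := by
  induction z using BC.induction with
  | mk b m =>
    rw [tau_mk, tau_mk]
    funext j
    rw [Function.comp_apply, Pi.smul_apply, Pi.smul_apply, smul_eq_mul, smul_eq_mul, map_mul]
    refine congrArg₂ _ ?_ ?_
    · rw [← hu]; rfl
    · exact (RingHom.congr_fun (Frame.Hom.tau_comp f) _).symm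
  | zero => rw [map_zero, map_zero]; exact funext fun j => (map_zero _).symm
  | add x y hx hy => rw [map_add, map_add, hx, hy]; exact funext fun j => (map_add _ _ _).symm

theorem alpha_map (φ : Triv M μ u) (f : S' ⟶ S'') {u' : S ⟶ S''} (hu : u ≫ f = u') :
    (φ.map f hu).alpha = orthGroup.map (Frame.Hom.zero f) φ.alpha := by
  refine alpha_eq _ fun m => ?_
  rw [tau_map, ← alpha_mulVec, comp_mulVec, orthGroup_map_val]
  congr 1
  exact funext fun j => (RingHom.congr_fun (Frame.Hom.sigma_comp f) _).symm

theorem tau_act (φ : Triv M μ u) (h : dispGroup S' μ) (z : BC S.tau M.carrier) :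
    (φ.act h).tau z = (h⁻¹).1.val.map S'.tau *ᵥ φ.tau z := by
  induction z using BC.induction with
  | mk b m => rw [tau_mk, tau_mk, act_coord, comp_mulVec, mulVec_smul]
  | zero => rw [map_zero, map_zero, mulVec_zero]
  | add x y hx hy => rw [map_add, map_add, hx, hy, mulVec_add]

theorem alpha_act (φ : Triv M μ u) (h : dispGroup S' μ) :
    (φ.act h).alpha = (dispGroup.toZero S' μ S'.tau h)⁻¹ * φ.alpha *
      dispGroup.toZero S' μ S'.sigma h := by
  refine alpha_eq _ fun m => ?_
  rw [tau_act, ← alpha_mulVec, ← map_inv, orthGroup_mul_val, orthGroup_mul_val, ← mulVec_mulVec,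
    ← mulVec_mulVec]
  refine congrArg₂ _ rfl (congrArg₂ _ rfl ?_)
  refine (comp_mulVec S'.sigma h.1.val _).symm.trans ?_
  rw [mulVec_act_coord]

end Triv

end Triv

/-! ### The torsor of trivializations -/

section TrivSheaf

open Matrix

variable {p n : ℕ} {S : Frame.{u} p} (E : EtaleBaseChange S) (μ : Fin n → ℤ)

/-- The presheaf of trivializations of an orthogonal display. -/
def trivSheaf (M : OrthDisplay S) : EtAlg S.residue ⥤ Type u where
  obj A := Triv M μ (E.unit A)
  map f := TypeCat.ofHom fun φ => φ.map (E.frame.map f) (E.unit_map f)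
  map_id A := by
    refine ConcreteCategory.hom_ext _ _ fun φ => Triv.ext_apply fun m => ?_
    change (E.frame.map (𝟙 A)).toRingHom ∘ φ.coord m = φ.coord m
    rw [E.frame.map_id]
    rfl
  map_comp f g := by
    refine ConcreteCategory.hom_ext _ _ fun φ => Triv.ext_apply fun m => ?_
    change (E.frame.map (f ≫ g)).toRingHom ∘ φ.coord m = _
    rw [E.frame.map_comp]
    rfl

variable {E μ}

theorem isEtaleSheaf_trivSheaf [Fact p.Prime] (M : OrthDisplay S) :
    IsEtaleSheaf (trivSheaf E μ M) := by
  intro A ι B f hf (φ : ∀ i, Triv M μ (E.unit (B i))) hφ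
  have hcomp : ∀ m j, E.Compatible f fun i => (φ i).coord m j := by
    intro m j i i' C g h hgh
    have := congrArg (fun ψ : Triv M μ (E.unit C) => ψ.coord m j) (hφ i i' C g h hgh)
    exact this
  choose y hy using fun m j => E.exists_glue hf (hcomp m j)
  have hy' : ∀ i m, (E.frame.map (f i)).toRingHom ∘ y m = (φ i).coord m := fun i m =>
    funext fun j => hy m j i
  let c : M.carrier →ₛₗ[(E.unit A).toRingHom] (Fin n → (E.frame.obj A).carrier) :=
    { toFun := y
      map_add' := fun m m' => funext fun j => E.eq_of_cover hf fun i => by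
        rw [hy, map_add, Pi.add_apply, Pi.add_apply, map_add, hy, hy]
      map_smul' := fun a m => funext fun j => E.eq_of_cover hf fun i => by
        rw [hy, Pi.smul_apply, smul_eq_mul, map_mul, hy, E.map_unit, map_smulₛₗ, Pi.smul_apply,
          smul_eq_mul] }
  have hD : dyad (fun k => c (M.homDual.x k)) (fun k => y (M.homDual.y k)) = 1 := by
    ext a b
    refine E.eq_of_cover hf fun i => ?_
    have h1 := map_dyad (E.frame.map (f i)).toRingHom (fun k => y (M.homDual.x k))
      (fun k => y (M.homDual.y k))
    simp only [hy'] at h1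
    rw [(φ i).isCoord.dyad_self M.homDual.dual, ← Matrix.map_one (E.frame.map (f i)).toRingHom
      (map_zero _) (map_one _)] at h1
    exact congrFun (congrFun h1 a) b
  refine ⟨⟨c, fun d m hm j => E.mem_grading_of_cover hf fun i => ?_, fun m m' =>
    E.eq_of_cover hf fun i => ?_, span_eq_top_of_dyad_eq_one hD⟩, fun i => ?_, ?_⟩
  · change (E.frame.map (f i)).toRingHom (y m j) ∈ _
    rw [hy]
    exact (φ i).mem d m hm j
  · change (E.frame.map (f i)).toRingHom (psi (y m) (y m')) = _
    rw [← psi_map, hy', hy', (φ i).isCoord.isom, E.map_unit]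
  · exact Triv.ext_apply fun m => hy' i m
  · intro (ψ : Triv M μ (E.unit A)) hψ
    refine Triv.ext_apply fun m => funext fun j => E.eq_of_cover hf fun i => ?_
    change _ = (E.frame.map (f i)).toRingHom (y m j)
    rw [hy]
    exact congrArg (fun ψ : Triv M μ (E.unit (B i)) => ψ.coord m j) (hψ i)

/-- The existence of trivializations for the étale topology. -/
def LocallyTrivial (E : EtaleBaseChange S) (μ : Fin n → ℤ) (M : OrthDisplay S) : Prop :=
  ∃ (ι : Type) (B : ι → EtAlg S.residue) (f : ∀ i, EtAlg.self S.residue ⟶ B i),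
    IsEtaleCover B f ∧ ∀ i, Nonempty (Triv M μ (E.unit (B i)))

/-- The `O(ψ)`-display of trivializations of an orthogonal display. -/
def trivDisplay [Fact p.Prime] (hμ : ∀ i, μ i + μ (Fin.rev i) = 0) (M : OrthDisplay S)
    (hM : LocallyTrivial E μ M) : OrthGroupDisplay E μ where
  sheaf := trivSheaf E μ M
  isSheaf := isEtaleSheaf_trivSheaf M
  act _ φ h := Triv.act φ h
  act_one _ φ := Triv.act_one φ
  act_mul _ φ g h := Triv.act_mul φ g h
  act_map f φ h := Triv.act_map φ (E.frame.map f) (E.unit_map f) h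
  simply_transitive _ φ φ' := Triv.simply_transitive hμ φ φ'
  locally_nonempty := hM
  alpha _ φ := Triv.alpha φ
  alpha_map f φ := Triv.alpha_map φ (E.frame.map f) (E.unit_map f)
  alpha_act _ φ h := Triv.alpha_act φ h

end TrivSheaf

/-! ### The étale algebra of inverse square roots modulo a monic polynomial -/

section InvSqrt

open Polynomial

variable {n : ℕ}

/-- The polynomial `∑ᵢ bᵢ Xⁱ` of degree less than `n`. -/
def genPoly {B : Type*} [CommRing B] (b : Fin n → B) : B[X] := ∑ i, C (b i) * X ^ (i : ℕ)

theorem genPoly_coeff {B : Type*} [CommRing B] (b : Fin n → B) (i : Fin n) :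
    (genPoly b).coeff i = b i := by
  classical
  rw [genPoly, finsetSum_coeff, Finset.sum_eq_single i]
  · simp
  · intro j _ hj
    rw [coeff_C_mul_X_pow, if_neg fun h => hj (Fin.ext h.symm)]
  · simp

theorem genPoly_degree_lt {B : Type*} [CommRing B] (b : Fin n → B) : (genPoly b).degree < n := by
  refine (degree_sum_le _ _).trans_lt ((Finset.sup_lt_iff (WithBot.bot_lt_coe n)).2 fun i _ => ?_)
  exact (degree_C_mul_X_pow_le _ _).trans_lt (Nat.cast_lt.2 i.2)

theorem genPoly_eq {B : Type*} [CommRing B] {P : B[X]} (hP : P.degree < n) :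
    genPoly (fun i : Fin n => P.coeff i) = P := by
  ext k
  by_cases hk : k < n
  · exact genPoly_coeff _ (⟨k, hk⟩ : Fin n)
  · rw [coeff_eq_zero_of_degree_lt ((genPoly_degree_lt _).trans_le (by exact_mod_cast not_lt.1 hk)),
      coeff_eq_zero_of_degree_lt (hP.trans_le (by exact_mod_cast not_lt.1 hk))]

theorem genPoly_map {B C : Type*} [CommRing B] [CommRing C] (f : B →+* C) (b : Fin n → B) :
    (genPoly b).map f = genPoly (f ∘ b) := by
  simp [genPoly, Polynomial.map_sum]

/-- `b` gives the coefficients of an inverse square root of `X` modulo `χ`. -/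
def IsInvSqrt {B : Type*} [CommRing B] (χ : B[X]) (b : Fin n → B) : Prop :=
  χ ∣ genPoly b ^ 2 * X - 1

theorem IsInvSqrt.map {B C : Type*} [CommRing B] [CommRing C] {χ : B[X]} {b : Fin n → B}
    (h : IsInvSqrt χ b) (f : B →+* C) : IsInvSqrt (χ.map f) (f ∘ b) := by
  have := Polynomial.map_dvd f h
  simpa only [IsInvSqrt, Polynomial.map_sub, Polynomial.map_mul, Polynomial.map_pow, genPoly_map,
    Polynomial.map_X, Polynomial.map_one] using this

variable {A : Type u} [CommRing A] (χ : A[X]) (n)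

/-- The universal polynomial `(∑ᵢ aᵢ Xⁱ)² X - 1` modulo `χ`. -/
def invSqrtPoly : (MvPolynomial (Fin n) A)[X] :=
  (genPoly (fun i : Fin n => MvPolynomial.X i) ^ 2 * X - 1) %ₘ χ.map MvPolynomial.C

/-- The algebra that represents the functor of inverse square roots of `X` modulo `χ`. -/
abbrev InvSqrt : Type u :=
  MvPolynomial (Fin n) A ⧸ Ideal.span (((invSqrtPoly n χ).coeffs : Finset _) : Set
    (MvPolynomial (Fin n) A))

/-- The coefficients of the universal inverse square root. -/
def InvSqrt.gen (i : Fin n) : InvSqrt n χ := Ideal.Quotient.mk _ (MvPolynomial.X i)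

variable {χ n}

theorem map_invSqrtPoly (hχ : χ.Monic) {B : Type*} [CommRing B] (f : MvPolynomial (Fin n) A →+* B) :
    (invSqrtPoly n χ).map f = (genPoly (fun i : Fin n => f (MvPolynomial.X i)) ^ 2 * X - 1) %ₘ
      χ.map (f.comp MvPolynomial.C) := by
  rw [invSqrtPoly, map_modByMonic _ (hχ.map _), Polynomial.map_map]
  simp only [Polynomial.map_sub, Polynomial.map_mul, Polynomial.map_pow, genPoly_map,
    Polynomial.map_X, Polynomial.map_one]
  rfl

theorem map_invSqrtPoly_eq_zero_iff (hχ : χ.Monic) {B : Type*} [CommRing B]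
    (f : MvPolynomial (Fin n) A →+* B) : (invSqrtPoly n χ).map f = 0 ↔
      IsInvSqrt (χ.map (f.comp MvPolynomial.C)) fun i : Fin n => f (MvPolynomial.X i) := by
  rw [map_invSqrtPoly hχ, modByMonic_eq_zero_iff_dvd (hχ.map _)]
  rfl

theorem InvSqrt.isInvSqrt (hχ : χ.Monic) :
    IsInvSqrt (χ.map (algebraMap A (InvSqrt n χ))) (InvSqrt.gen n χ) := by
  have := (map_invSqrtPoly_eq_zero_iff hχ (Ideal.Quotient.mk (Ideal.span
    (((invSqrtPoly n χ).coeffs : Finset _) : Set (MvPolynomial (Fin n) A))))).1 ?_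
  · exact this
  · ext k
    rw [coeff_map, coeff_zero, Ideal.Quotient.eq_zero_iff_mem]
    by_cases hk : (invSqrtPoly n χ).coeff k = 0
    · rw [hk]; exact zero_mem _
    · exact Ideal.subset_span (coeff_mem_coeffs hk)

theorem InvSqrt.exists_lift (hχ : χ.Monic) {B : Type*} [CommRing B] [Algebra A B] {b : Fin n → B}
    (hb : IsInvSqrt (χ.map (algebraMap A B)) b) :
    ∃ f : InvSqrt n χ →ₐ[A] B, ∀ i, f (InvSqrt.gen n χ i) = b i := by
  refine ⟨Ideal.Quotient.liftₐ _ (MvPolynomial.aeval b) fun a ha => ?_, fun i => ?_⟩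
  · have h0 : (invSqrtPoly n χ).map (MvPolynomial.aeval (R := A) b).toRingHom = 0 := by
      rw [map_invSqrtPoly_eq_zero_iff hχ]
      have e1 : (MvPolynomial.aeval (R := A) b).toRingHom.comp MvPolynomial.C = algebraMap A B :=
        RingHom.ext fun x => MvPolynomial.aeval_C b x
      rw [e1]
      convert hb with i
      exact MvPolynomial.aeval_X b i
    have : Ideal.span (((invSqrtPoly n χ).coeffs : Finset _) : Set (MvPolynomial (Fin n) A)) ≤
        RingHom.ker (MvPolynomial.aeval (R := A) b).toRingHom := by
      rw [Ideal.span_le]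
      intro c hc
      obtain ⟨k, -, rfl⟩ := mem_coeffs_iff.1 hc
      have := congrArg (fun P => P.coeff k) h0
      rwa [coeff_map, coeff_zero] at this
    exact this ha
  · exact MvPolynomial.aeval_X b i

theorem InvSqrt.hom_ext {B : Type*} [CommRing B] [Algebra A B] {f g : InvSqrt n χ →ₐ[A] B}
    (h : ∀ i, f (InvSqrt.gen n χ i) = g (InvSqrt.gen n χ i)) : f = g :=
  Ideal.Quotient.algHom_ext _ (MvPolynomial.algHom_ext h)

section Lifting

variable {B : Type u} [CommRing B] {χ : B[X]} {I : Ideal B}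

theorem mul_eq_zero_of_coeff_mem (hI : I ^ 2 = ⊥) {P Q : B[X]} (hP : ∀ k, P.coeff k ∈ I)
    (hQ : ∀ k, Q.coeff k ∈ I) : P * Q = 0 := by
  ext k
  rw [coeff_mul, coeff_zero]
  refine Finset.sum_eq_zero fun x _ => ?_
  have : P.coeff x.1 * Q.coeff x.2 ∈ I ^ 2 := by
    rw [pow_two]
    exact Ideal.mul_mem_mul (hP _) (hQ _)
  rwa [hI] at this

theorem coeff_mem_iff_map_eq_zero {P : B[X]} :
    (∀ k, P.coeff k ∈ I) ↔ P.map (Ideal.Quotient.mk I) = 0 := by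
  simp only [Polynomial.ext_iff, coeff_map, coeff_zero, Ideal.Quotient.eq_zero_iff_mem]

theorem IsInvSqrt.exists_lift (hχ : χ.Monic)
    (hn : Nontrivial B → χ.natDegree = n) (h2 : IsUnit (2 : B))
    (hI : I ^ 2 = ⊥) {b : Fin n → B ⧸ I} (hb : IsInvSqrt (χ.map (Ideal.Quotient.mk I)) b) :
    ∃ c : Fin n → B, IsInvSqrt χ c ∧ ∀ i, Ideal.Quotient.mk I (c i) = b i := by
  rcases subsingleton_or_nontrivial B with hB | hB
  · have : Subsingleton (B ⧸ I) := Ideal.Quotient.mk_surjective.subsingleton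
    exact ⟨0, ⟨0, Subsingleton.elim _ _⟩, fun i => Subsingleton.elim _ _⟩
  choose b₀ hb₀ using fun i => Ideal.Quotient.mk_surjective (b i)
  obtain ⟨h, hh⟩ := hb
  obtain ⟨h, rfl⟩ := Polynomial.map_surjective _ Ideal.Quotient.mk_surjective h
  obtain ⟨w, hw⟩ := h2.exists_right_inv
  set k := genPoly b₀ ^ 2 * X - 1 - χ * h with hk
  have hkI : ∀ j, k.coeff j ∈ I := by
    rw [coeff_mem_iff_map_eq_zero, hk]
    simp only [Polynomial.map_sub, Polynomial.map_mul, Polynomial.map_pow, genPoly_map,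
      Polynomial.map_X, Polynomial.map_one]
    rw [show (Ideal.Quotient.mk I ∘ b₀) = b from funext hb₀, hh, sub_self]
  have hk2 : k * k = 0 := mul_eq_zero_of_coeff_mem hI hkI hkI
  let e := (C w * genPoly b₀ * k) %ₘ χ
  have hdeg : (genPoly b₀ - e).degree < n := by
    refine (degree_sub_le _ _).trans_lt (max_lt (genPoly_degree_lt _) ?_)
    rw [← hn hB, ← degree_eq_natDegree hχ.ne_zero]
    exact degree_modByMonic_lt _ hχ
  refine ⟨fun i => (genPoly b₀ - e).coeff i, ?_, fun i => ?_⟩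
  · rw [IsInvSqrt, genPoly_eq hdeg]
    have he : e = C w * genPoly b₀ * k - χ * ((C w * genPoly b₀ * k) /ₘ χ) :=
      modByMonic_eq_sub_mul_div _ _
    have hw' : (2 : B[X]) * C w = 1 := by
      rw [show (2 : B[X]) = C 2 from rfl, ← C_mul, hw, C_1]
    generalize (C w * genPoly b₀ * k) /ₘ χ = d at he
    rw [he]
    have hg : genPoly b₀ ^ 2 * X = 1 + χ * h + k := by rw [hk]; ring
    generalize genPoly b₀ = g at *
    refine ⟨h * (1 - C w * k) ^ 2 + (2 * (g - C w * g * k) * d + χ * d ^ 2) * X, ?_⟩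
    have h1 : (g - (C w * g * k - χ * d)) ^ 2 * X - 1 =
        (g ^ 2 * X) * (1 - C w * k) ^ 2 - 1 + χ * ((2 * (g - C w * g * k) * d + χ * d ^ 2) * X) :=
            by
      ring
    rw [h1, hg]
    have h2 : (1 + k) * (1 - C w * k) ^ 2 - 1 = 0 := by
      linear_combination (-(1 : B[X]) - k) * k * hw' + (C w ^ 2 + k * C w ^ 2 - 1 ) * hk2
    linear_combination h2
  · change Ideal.Quotient.mk I ((genPoly b₀ - e).coeff i) = b i
    rw [coeff_sub, genPoly_coeff, map_sub, hb₀, sub_eq_self, Ideal.Quotient.eq_zero_iff_mem]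
    refine coeff_mem_iff_map_eq_zero.2 ?_ i
    rw [map_modByMonic _ hχ, Polynomial.map_mul, coeff_mem_iff_map_eq_zero.1 hkI, mul_zero,
      zero_modByMonic]

theorem IsInvSqrt.lift_unique (hχ : χ.Monic)
    (hn : Nontrivial B → χ.natDegree = n) (h2 : IsUnit (2 : B))
    (hI : I ^ 2 = ⊥) {b c : Fin n → B} (hb : IsInvSqrt χ b) (hc : IsInvSqrt χ c)
    (h : ∀ i, Ideal.Quotient.mk I (b i) = Ideal.Quotient.mk I (c i)) : b = c := by
  rcases subsingleton_or_nontrivial B with hB | hB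
  · exact Subsingleton.elim _ _
  obtain ⟨w, hw⟩ := h2.exists_right_inv
  obtain ⟨r, hr⟩ := hb
  obtain ⟨s, hs⟩ := hc
  set ε := genPoly b - genPoly c with hε
  have hεI : ∀ j, ε.coeff j ∈ I := by
    rw [coeff_mem_iff_map_eq_zero, hε, Polynomial.map_sub, genPoly_map, genPoly_map, sub_eq_zero]
    exact congrArg _ (funext h)
  have hε2 : ε * ε = 0 := mul_eq_zero_of_coeff_mem hI hεI hεI
  have hw' : (2 : B[X]) * C w = 1 := by
    rw [show (2 : B[X]) = C 2 from rfl, ← C_mul, hw, C_1]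
  have hdvd : χ ∣ ε := by
    refine ⟨C w * genPoly b * (r - s) - r * ε, ?_⟩
    have hbc : genPoly c = genPoly b - ε := by rw [hε]; ring
    rw [hbc] at hs
    clear_value ε
    linear_combination (-(genPoly b ^ 2 * X * ε)) * hw' - ε * hr + C w * genPoly b * (hr - hs) +
      C w * genPoly b * X * hε2
  have hdeg : ε.degree < χ.degree := by
    rw [degree_eq_natDegree hχ.ne_zero, hn hB]
    exact (degree_sub_le _ _).trans_lt (max_lt (genPoly_degree_lt _) (genPoly_degree_lt _))
  have h0 : ε = 0 := by
    by_contra h0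
    exact hχ.not_dvd_of_degree_lt h0 hdeg hdvd
  funext i
  rw [← genPoly_coeff b, ← genPoly_coeff c, sub_eq_zero.1 h0]

end Lifting

theorem InvSqrt.etale (hχ : χ.Monic) (hn : χ.natDegree = n) (h2 : IsUnit (2 : A)) :
    Algebra.Etale A (InvSqrt n χ) where
  formallyEtale := by
    rw [Algebra.FormallyEtale.iff_comp_bijective]
    intro B _ _ I hI
    have h2B : IsUnit (2 : B) := by
      have := h2.map (algebraMap A B)
      rwa [map_ofNat] at this
    have hχB : (χ.map (algebraMap A B)).Monic := hχ.map _
    have hnB : Nontrivial B → (χ.map (algebraMap A B)).natDegree = n := fun _ => by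
      rw [hχ.natDegree_map, hn]
    have hmap : ∀ {C : Type u} [CommRing C] [Algebra A C] (f : InvSqrt n χ →ₐ[A] C),
        IsInvSqrt (χ.map (algebraMap A C)) fun i => f (InvSqrt.gen n χ i) := by
      intro C _ _ f
      have := (InvSqrt.isInvSqrt (n := n) hχ).map f.toRingHom
      rw [Polynomial.map_map] at this
      rwa [show f.toRingHom.comp (algebraMap A (InvSqrt n χ)) = algebraMap A C from
        f.comp_algebraMap] at this
    constructor
    · intro f g hfg
      refine InvSqrt.hom_ext fun i => congrFun (IsInvSqrt.lift_unique hχB hnB h2B hI (hmap f)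
        (hmap g) fun i => ?_) i
      exact AlgHom.congr_fun hfg (InvSqrt.gen n χ i)
    · intro f
      have hf := hmap f
      rw [show algebraMap A (B ⧸ I) = (Ideal.Quotient.mk I).comp (algebraMap A B) from rfl,
        ← Polynomial.map_map] at hf
      obtain ⟨c, hc, hcf⟩ := IsInvSqrt.exists_lift hχB hnB h2B hI hf
      obtain ⟨g, hg⟩ := InvSqrt.exists_lift hχ hc
      refine ⟨g, InvSqrt.hom_ext fun i => ?_⟩
      rw [AlgHom.comp_apply, hg]
      exact hcf i
  finitePresentation := Algebra.FinitePresentation.quotient ⟨_, rfl⟩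

theorem exists_isInvSqrt {K : Type u} [Field K] [IsAlgClosed K] (h2 : (2 : K) ≠ 0) {χ : K[X]}
    (hχ : χ.Monic) (hn : χ.natDegree = n) (h0 : χ.eval 0 ≠ 0) : ∃ b : Fin n → K, IsInvSqrt χ b := by
  classical
  have hroot : ∀ r : K, ∃ s : K, r ≠ 0 → s ^ 2 * r = 1 := fun r => by
    obtain ⟨s, hs⟩ := IsAlgClosed.exists_pow_nat_eq r⁻¹ (n := 2) (by norm_num)
    exact ⟨s, fun hr => by rw [hs, inv_mul_cancel₀ hr]⟩
  choose s hs using hroot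
  let g := Lagrange.interpolate χ.roots.toFinset id s
  have hg : ∀ r ∈ χ.roots, (X - C r) ∣ g ^ 2 * X - 1 := by
    intro r hr
    rw [dvd_iff_isRoot, IsRoot, eval_sub, eval_mul, eval_pow, eval_X, eval_one]
    have h1 : eval r g = s r := Lagrange.eval_interpolate_at_node (v := id) s
      (Function.injective_id.injOn) (Multiset.mem_toFinset.2 hr)
    rw [h1, hs, sub_self]
    rintro rfl
    exact h0 (isRoot_of_mem_roots hr)
  have hdvd : ∀ m : Multiset K, (∀ r ∈ m, (X - C r) ∣ g ^ 2 * X - 1) →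
      (m.map fun r => X - C r).prod ∣ (g ^ 2 * X - 1) ^ Multiset.card m := by
    intro m
    induction m using Multiset.induction_on with
    | empty => simp
    | cons a m ih =>
      intro h
      rw [Multiset.map_cons, Multiset.prod_cons, Multiset.card_cons, pow_succ']
      exact mul_dvd_mul (h a (Multiset.mem_cons_self a m))
        (ih fun r hr => h r (Multiset.mem_cons_of_mem hr))
  have hχdvd : χ ∣ (g ^ 2 * X - 1) ^ Multiset.card χ.roots := by
    conv_lhs => rw [(IsAlgClosed.splits χ).eq_prod_roots, hχ.leadingCoeff, C_1, one_mul]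
    exact hdvd _ hg
  let P : (AdjoinRoot χ)[X] := C (AdjoinRoot.root χ) * X ^ 2 - 1
  let x := AdjoinRoot.mk χ g
  have hx : aeval x P = AdjoinRoot.mk χ (g ^ 2 * X - 1) := by
    simp only [P, x, map_sub, map_mul, map_pow, aeval_X, map_one, aeval_C, AdjoinRoot.mk_X,
      Algebra.algebraMap_self, RingHom.id_apply]
    ring
  have hnil : IsNilpotent (aeval x P) := by
    refine ⟨Multiset.card χ.roots, ?_⟩
    rw [hx, ← map_pow]
    exact AdjoinRoot.mk_eq_zero.2 hχdvd
  have h2u : IsUnit (2 : AdjoinRoot χ) := by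
    have := (IsUnit.mk0 _ h2).map (algebraMap K (AdjoinRoot χ))
    rwa [map_ofNat] at this
  have hunit : IsUnit (aeval x (derivative P)) := by
    have h3 : IsUnit (AdjoinRoot.root χ * x ^ 2) := by
      have : AdjoinRoot.root χ * x ^ 2 = 1 + aeval x P := by simp [P]
      rw [this]
      exact hnil.isUnit_one_add
    have h4 : aeval x (derivative P) = AdjoinRoot.root χ * (2 * x) := by
      simp [P, one_add_one_eq_two]
    rw [h4]
    rw [pow_two, IsUnit.mul_iff, IsUnit.mul_iff] at h3
    exact h3.1.mul (h2u.mul h3.2.1)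
  obtain ⟨r, ⟨-, hr⟩, -⟩ := existsUnique_nilpotent_sub_and_aeval_eq_zero hnil hunit
  obtain ⟨q, rfl⟩ := AdjoinRoot.mk_surjective r
  have hdeg : (q %ₘ χ).degree < n := by
    rw [← hn, ← degree_eq_natDegree hχ.ne_zero]
    exact degree_modByMonic_lt _ hχ
  refine ⟨fun i => (q %ₘ χ).coeff i, ?_⟩
  rw [IsInvSqrt, genPoly_eq hdeg, ← AdjoinRoot.mk_eq_zero]
  have hq : AdjoinRoot.mk χ (q %ₘ χ) = AdjoinRoot.mk χ q := by
    rw [modByMonic_eq_sub_mul_div, map_sub, map_mul, AdjoinRoot.mk_self, zero_mul, sub_zero]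
  simp only [map_sub, map_mul, map_pow, hq, AdjoinRoot.mk_X, map_one]
  simp only [P, map_sub, map_mul, map_pow, aeval_X, map_one, aeval_C,
    Algebra.algebraMap_self, RingHom.id_apply] at hr
  rw [mul_comm]
  exact hr

end InvSqrt

/-! ### The graded pieces of the reduction of a graded module -/

section RedPiece

variable {p : ℕ} {S : Frame.{u} p} (M : GrMod S)

instance {A B : Type u} [CommRing A] [CommRing B] (f : A →+* B) (M : Type u) [AddCommGroup M]
    [Module A M] [Module.Finite A M] : Module.Finite B (BC f M) :=
  letI := f.toAlgebra
  inferInstanceAs (Module.Finite B (B ⊗[A] M))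

instance {A B : Type u} [CommRing A] [CommRing B] (f : A →+* B) (M : Type u) [AddCommGroup M]
    [Module A M] [Module.Projective A M] : Module.Projective B (BC f M) :=
  letI := f.toAlgebra
  inferInstanceAs (Module.Projective B (B ⊗[A] M))

theorem mk_rho_smul_of_mem_ne {e : ℤ} (he : e ≠ 0) {s : S.carrier} (hs : s ∈ S.grading e)
    (m : M.carrier) : BC.mk S.rho 1 (s • m) = 0 := by
  rw [BC.mk_smul, S.rho_of_mem_ne he hs, mul_zero, ← mul_zero (0 : S.residue), ← BC.smul_mk,
    zero_smul]

/-- The class of a homogeneous element in the graded piece of the reduction. -/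
def GrMod.redMk {i : ℤ} (m : M.grading i) : M.redPiece i :=
  ⟨BC.mk S.rho 1 (m : M.carrier), Submodule.subset_span ⟨m, m.2, rfl⟩⟩

theorem mk_rho_proj_smul (i : ℤ) (s : S.carrier) (m : M.carrier) :
    BC.mk S.rho 1 (M.proj i (s • m)) = S.rho s • BC.mk S.rho 1 (M.proj i m) := by
  classical
  induction m using DirectSum.Decomposition.inductionOn M.grading with
  | zero =>
    rw [smul_zero, map_zero]
    exact ((BC.mkOne S.rho M.carrier).map_zero).trans (by
      rw [show BC.mk S.rho 1 (0 : M.carrier) = 0 from (BC.mkOne S.rho M.carrier).map_zero,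
        smul_zero])
  | @homogeneous d m =>
    rw [M.component_smul m.2]
    by_cases h : d = i
    · subst h
      rw [sub_self, M.proj_of_mem m.2]
      induction s using DirectSum.Decomposition.inductionOn S.grading with
      | zero =>
        rw [map_zero, map_zero, zero_smul, zero_smul]
        exact (BC.mkOne S.rho M.carrier).map_zero
      | @homogeneous e s =>
        by_cases he : e = 0
        · subst he
          rw [Frame.proj_of_mem s.2]
          exact (BC.mkOne S.rho M.carrier).map_smulₛₗ _ _
        · rw [Frame.proj_of_mem_ne s.2 he, S.rho_of_mem_ne he s.2, zero_smul, zero_smul]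
          exact (BC.mkOne S.rho M.carrier).map_zero
      | add a b ha hb => rw [map_add, add_smul, BC.mk_add, ha, hb, map_add, add_smul]
    · rw [M.proj_of_mem_ne m.2 h,
        mk_rho_smul_of_mem_ne M (by omega : i - d ≠ 0) (S.proj_mem _ s),
        show BC.mk S.rho 1 (0 : M.carrier) = 0 from (BC.mkOne S.rho M.carrier).map_zero, smul_zero]
  | add a b ha hb =>
    rw [smul_add, map_add, BC.mk_add, ha, hb, map_add, BC.mk_add, smul_add]

/-- The projection of the reduction of a graded module to its graded piece of degree `i`. -/
def GrMod.redProj (i : ℤ) : BC S.rho M.carrier →ₗ[S.residue] M.redPiece i :=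
  BC.lift (f := S.rho) (P := M.redPiece i)
    { toFun := fun m => M.redMk ⟨M.proj i m, M.proj_mem i m⟩
      map_add' := fun x y => Subtype.ext (by
        change BC.mk S.rho 1 (M.proj i (x + y)) = _
        rw [map_add, BC.mk_add]
        rfl)
      map_smul' := fun s m => Subtype.ext (mk_rho_proj_smul M i s m) }

theorem GrMod.redProj_mk {i : ℤ} (m : M.grading i) :
    M.redProj i (BC.mk S.rho 1 (m : M.carrier)) = M.redMk m := by
  rw [redProj, BC.lift_mk, one_smul]
  exact Subtype.ext (congrArg (BC.mk S.rho 1) (M.proj_of_mem m.2))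

theorem GrMod.redPiece_induction {i : ℤ} {motive : M.redPiece i → Prop}
    (mk : ∀ m : M.grading i, motive (M.redMk m)) (zero : motive 0)
    (add : ∀ x y, motive x → motive y → motive (x + y))
    (smul : ∀ (r : S.residue) x, motive x → motive (r • x)) (x : M.redPiece i) : motive x := by
  obtain ⟨x, hx⟩ := x
  induction hx using Submodule.span_induction with
  | mem x hx =>
    obtain ⟨m, hm, rfl⟩ := hx
    exact mk ⟨m, hm⟩
  | zero => exact zero
  | add x y hx hy h h' => exact add ⟨x, hx⟩ ⟨y, hy⟩ h h'
  | smul r x hx h => exact smul r ⟨x, hx⟩ h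

theorem GrMod.redProj_subtype {i : ℤ} (x : M.redPiece i) : M.redProj i x = x := by
  induction x using M.redPiece_induction with
  | mk m => exact M.redProj_mk m
  | zero => exact map_zero _
  | add x y hx hy => rw [Submodule.coe_add, map_add, hx, hy]
  | smul r x hx => rw [Submodule.coe_smul, map_smul, hx]

instance (i : ℤ) : Module.Projective S.residue (M.redPiece i) :=
  Module.Projective.of_split (M.redPiece i).subtype (M.redProj i)
    (LinearMap.ext fun x => M.redProj_subtype x)

instance (i : ℤ) : Module.Finite S.residue (M.redPiece i) :=
  Module.Finite.of_surjective (M.redProj i) fun x => ⟨x, M.redProj_subtype x⟩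

/-- The linear map on a graded piece of the reduction induced by a semilinear map. -/
def GrMod.redLift (i : ℤ) {P : Type u} [AddCommGroup P] [Module S.residue P]
    (g : M.carrier →ₛₗ[S.rho] P) : M.redPiece i →ₗ[S.residue] P :=
  BC.lift g ∘ₗ (M.redPiece i).subtype

theorem GrMod.redLift_mk {i : ℤ} {P : Type u} [AddCommGroup P] [Module S.residue P]
    (g : M.carrier →ₛₗ[S.rho] P) (m : M.grading i) : M.redLift i g (M.redMk m) = g m :=
  (BC.lift_mk g 1 (m : M.carrier)).trans (one_smul _ _)

end RedPiece

section ResidueBasis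

variable {p n : ℕ} {S : Frame.{u} p} {μ : Fin n → ℤ}

/-- The expansion of the class of a homogeneous element with respect to dual families. -/
theorem OrthDisplay.redMk_eq_sum (M : OrthDisplay S) (D : HomDual M) {i : ℤ} (m : M.grading i) :
    M.redMk m = ∑ k, S.rho (M.form (D.y k) m) •
      if h : D.deg k = i then M.redMk ⟨D.x k, h ▸ D.x_mem k⟩ else 0 := by
  refine Subtype.ext ?_
  change BC.mkOne S.rho M.carrier m = _
  rw [AddSubmonoidClass.coe_finsetSum]
  conv_lhs => rw [D.dual m, map_sum]
  refine Finset.sum_congr rfl fun k _ => ?_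
  rw [map_smulₛₗ]
  by_cases h : D.deg k = i
  · rw [dif_pos h]; rfl
  · rw [dif_neg h, S.rho_of_mem_ne _ (M.form_mem _ _ _ _ (D.y_mem k) m.2), zero_smul, zero_smul]
    · rfl
    · omega

/-- The semilinear functional `m ↦ ρ(β(y, m))`. -/
def OrthDisplay.rhoForm (M : OrthDisplay S) (y : M.carrier) :
    M.carrier →ₛₗ[S.rho] S.residue where
  toFun m := S.rho (M.form y m)
  map_add' a b := by rw [map_add, map_add]
  map_smul' a b := by rw [map_smul, smul_eq_mul, map_mul, smul_eq_mul]

variable (M : OrthDisplay S) (q : PrimeSpectrum S.residue)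

/-- The homomorphism from `S` to the residue field of a point of `Spec R`. -/
def Frame.toField (S : Frame.{u} p) (q : PrimeSpectrum S.residue) :
    S.carrier →+* q.asIdeal.ResidueField :=
  (algebraMap S.residue q.asIdeal.ResidueField).comp S.rho

theorem exists_residue_basis_piece (hM : M.HasType μ) (i : ℤ) :
    ∃ e : {j // μ j = i} → M.carrier, (∀ j, e j ∈ M.grading i) ∧
      (∀ m ∈ M.grading i, ∃ c : {j // μ j = i} → q.asIdeal.ResidueField, ∀ y,
        S.toField q (M.form y m) = ∑ j, c j * S.toField q (M.form y (e j))) ∧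
      ∀ v : {j // μ j = i} → q.asIdeal.ResidueField,
        (∀ y, ∑ j, v j * S.toField q (M.form y (e j)) = 0) → v = 0 := by
  classical
  let κ := q.asIdeal.ResidueField
  let V := q.asIdeal.Fiber (M.redPiece i)
  let cls : M.grading i → V := fun m => (1 : κ) ⊗ₜ[S.residue] M.redMk m
  let L : M.carrier → V →ₗ[κ] κ := fun y =>
    LinearMap.liftBaseChange κ (Algebra.linearMap S.residue κ ∘ₗ M.redLift i (M.rhoForm y))
  have hL : ∀ y m, L y (cls m) = S.toField q (M.form y m) := fun y m => by
    refine (LinearMap.liftBaseChange_tmul ..).trans ?_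
    rw [one_smul, LinearMap.comp_apply, GrMod.redLift_mk]
    rfl
  have hspan : Submodule.span κ (Set.range cls) = ⊤ := by
    rw [eq_top_iff]
    rintro z -
    induction z using TensorProduct.induction_on with
    | zero => exact zero_mem _
    | add x y hx hy => exact add_mem hx hy
    | tmul a x =>
      have : ∀ x : M.redPiece i, (1 : κ) ⊗ₜ[S.residue] x ∈ Submodule.span κ (Set.range cls) := by
        intro x
        induction x using M.redPiece_induction with
        | mk m => exact Submodule.subset_span ⟨m, rfl⟩
        | zero => rw [tmul_zero]; exact zero_mem _
        | add x y hx hy => rw [tmul_add]; exact add_mem hx hy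
        | smul r x hx =>
          rw [tmul_smul, ← algebraMap_smul κ r]
          exact Submodule.smul_mem _ _ hx
      have h2 := Submodule.smul_mem _ a (this x)
      rwa [smul_tmul', smul_eq_mul, mul_one] at h2
  let D := M.homDual
  have hexp : ∀ z : V, z = ∑ k, L (D.y k) z •
      if h : D.deg k = i then cls ⟨D.x k, h ▸ D.x_mem k⟩ else 0 := by
    intro z
    have hz : z ∈ Submodule.span κ (Set.range cls) := hspan ▸ Submodule.mem_top
    induction hz using Submodule.span_induction with
    | mem z hz =>
      obtain ⟨m, rfl⟩ := hz
      change (1 : κ) ⊗ₜ[S.residue] M.redMk m = _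
      rw [M.redMk_eq_sum D m, tmul_sum]
      refine Finset.sum_congr rfl fun k _ => ?_
      rw [hL, tmul_smul, ← algebraMap_smul κ]
      refine congrArg _ ?_
      split_ifs
      · rfl
      · exact tmul_zero _ _
    | zero => simp
    | add x y _ _ hx hy =>
      conv_lhs => rw [hx, hy, ← Finset.sum_add_distrib]
      exact Finset.sum_congr rfl fun k _ => by rw [map_add, add_smul]
    | smul a x _ hx =>
      conv_lhs => rw [hx, Finset.smul_sum]
      exact Finset.sum_congr rfl fun k _ => by rw [map_smul, smul_eq_mul, mul_smul]
  have hinj : ∀ z : V, (∀ y, L y z = 0) → z = 0 := fun z hz => by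
    rw [hexp z]
    exact Finset.sum_eq_zero fun k _ => by rw [hz, zero_smul]
  obtain ⟨b, hbt, hbspan, hblin⟩ := exists_linearIndependent κ (Set.range cls)
  rw [hspan] at hbspan
  let bas : Module.Basis b κ V := Module.Basis.mk hblin (by
    rw [Subtype.range_coe_subtype, Set.ofPred_mem_eq, hbspan])
  have : Finite b := Module.Finite.finite_basis bas
  cases nonempty_fintype b
  have hcard : Fintype.card {j // μ j = i} = Fintype.card b := by
    rw [← Module.finrank_eq_card_basis bas, ← hM i q, Module.rankAtStalk_eq]
  let eqv : {j // μ j = i} ≃ b := Fintype.equivOfCardEq hcard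
  let bas' := bas.reindex eqv.symm
  choose e he using fun j : {j // μ j = i} => hbt (eqv j).2
  have hbas : ∀ j, bas' j = cls (e j) := fun j => by
    rw [he]
    simp [bas', bas]
  refine ⟨fun j => e j, fun j => (e j).2, fun m hm => ⟨bas'.repr (cls ⟨m, hm⟩), fun y => ?_⟩,
    fun v hv => ?_⟩
  · rw [← hL y ⟨m, hm⟩]
    conv_lhs => rw [← bas'.sum_repr (cls ⟨m, hm⟩), map_sum]
    exact Finset.sum_congr rfl fun j _ => by rw [map_smul, hbas, hL, smul_eq_mul]
  · have h0 : ∑ j, v j • bas' j = 0 := hinj _ fun y => by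
      rw [map_sum, ← hv y]
      exact Finset.sum_congr rfl fun j _ => by rw [map_smul, hbas, hL, smul_eq_mul]
    exact funext (Fintype.linearIndependent_iff.1 bas'.linearIndependent v h0)

theorem Frame.toField_of_mem_ne (q : PrimeSpectrum S.residue) {d : ℤ} (hd : d ≠ 0) {s : S.carrier}
    (hs : s ∈ S.grading d) : S.toField q s = 0 := by
  rw [Frame.toField, RingHom.comp_apply, S.rho_of_mem_ne hd hs, map_zero]

/-- A homogeneous family of elements of `M` which gives a basis of the fibre of `M` at a point of
`Spec R`. -/
theorem exists_residue_basis (hM : M.HasType μ) :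
    ∃ e : Fin n → M.carrier, (∀ j, e j ∈ M.grading (μ j)) ∧
      (∀ m, ∃ c : Fin n → q.asIdeal.ResidueField, ∀ y,
        S.toField q (M.form y m) = ∑ j, c j * S.toField q (M.form y (e j))) ∧
      ∀ v : Fin n → q.asIdeal.ResidueField,
        (∀ y, ∑ j, v j * S.toField q (M.form y (e j)) = 0) → v = 0 := by
  classical
  choose e he hc hv using exists_residue_basis_piece M q hM
  have hsum : ∀ (i : ℤ) (f : Fin n → q.asIdeal.ResidueField), (∀ j, μ j ≠ i → f j = 0) →
      ∑ j, f j = ∑ j : {j // μ j = i}, f j := by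
    intro i f hf
    rw [← Finset.sum_subtype (Finset.univ.filter (μ · = i)) (by simp) f]
    refine (Finset.sum_filter_of_ne fun j _ h => ?_).symm
    by_contra h'
    exact h (hf j h')
  refine ⟨fun j => e (μ j) ⟨j, rfl⟩, fun j => he _ _, fun m => ?_, fun v h => ?_⟩
  · induction m using DirectSum.Decomposition.inductionOn M.grading with
    | zero => exact ⟨0, fun y => by simp⟩
    | @homogeneous i m =>
      obtain ⟨c, h⟩ := hc i m m.2
      refine ⟨fun j => if hj : μ j = i then c ⟨j, hj⟩ else 0, fun y => ?_⟩
      rw [h, hsum i]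
      · refine Finset.sum_congr rfl fun j _ => ?_
        obtain ⟨j, rfl⟩ := j
        simp
      · intro j hj
        simp only [dif_neg hj, zero_mul]
    | add a b ha hb =>
      obtain ⟨c, hc⟩ := ha
      obtain ⟨c', hc'⟩ := hb
      refine ⟨c + c', fun y => ?_⟩
      rw [map_add, map_add, hc, hc', ← Finset.sum_add_distrib]
      exact Finset.sum_congr rfl fun j _ => by rw [Pi.add_apply, add_mul]
  · have key : ∀ i, (fun j : {j // μ j = i} => v j) = 0 := fun i => hv i _ fun y => by
      induction y using DirectSum.Decomposition.inductionOn M.grading with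
      | zero => simp
      | @homogeneous d y =>
        by_cases hd : d + i = 0
        · rw [← h y, hsum i]
          · refine Finset.sum_congr rfl fun j _ => ?_
            obtain ⟨j, rfl⟩ := j
            rfl
          · intro j hj
            rw [S.toField_of_mem_ne q _ (M.form_mem _ _ _ _ y.2 (he (μ j) ⟨j, rfl⟩)), mul_zero]
            omega
        · refine Finset.sum_eq_zero fun j _ => ?_
          rw [S.toField_of_mem_ne q hd (M.form_mem _ _ _ _ y.2 (he i j)), mul_zero]
      | add a b ha hb =>
        simp only [map_add, LinearMap.add_apply, mul_add, Finset.sum_add_distrib, ha, hb, add_zero]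
    funext j
    exact congrFun (key (μ j)) ⟨j, rfl⟩

end ResidueBasis

/-! ### Étale neighbourhoods -/

section Neighbourhoods

variable {R : Type u} [CommRing R]

theorem exists_etale_neighbourhood {R₀ T K : Type u} [CommRing R₀] [CommRing T] [Field K]
    {π : R₀ →+* R} {f : R₀ →+* T} (hf : f.Etale) (v : R →+* K) (w : T →+* K)
    (h : w.comp f = v.comp π) :
    ∃ (A : EtAlg R) (j : T →+* A.obj), j.comp f = (algebraMap R A.obj).comp π ∧
      ∃ Q : PrimeSpectrum A.obj,
        (PrimeSpectrum.comap (algebraMap R A.obj) Q).asIdeal = RingHom.ker v := by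
  let := π.toAlgebra
  let := f.toAlgebra
  have : Algebra.Etale R₀ T := hf
  let A : EtAlg R := ⟨CommAlgCat.of R (R ⊗[R₀] T), inferInstanceAs (Algebra.Etale R (R ⊗[R₀] T))⟩
  let j : T →+* A.obj := (Algebra.TensorProduct.includeRight (R := R₀) (A := R) (B := T)).toRingHom
  let := (v.comp π).toAlgebra
  let v' : R →ₐ[R₀] K := { v with commutes' := fun r => rfl }
  let w' : T →ₐ[R₀] K := { w with commutes' := fun r => RingHom.congr_fun h r }
  let V : R ⊗[R₀] T →ₐ[R₀] K := Algebra.TensorProduct.lift v' w' fun _ _ => mul_comm _ _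
  refine ⟨A, j, RingHom.ext fun r => ?_, ⟨RingHom.ker V.toRingHom, RingHom.ker_isPrime _⟩, ?_⟩
  · exact ((Algebra.TensorProduct.includeRight (R := R₀) (A := R) (B := T)).commutes r).trans
      (Algebra.TensorProduct.algebraMap_apply (R := R₀) (S := R₀) (A := R) (B := T) r)
  · ext x
    have hV : V (x ⊗ₜ 1) = v x :=
      (Algebra.TensorProduct.lift_tmul v' w' _ x 1).trans (by rw [map_one, mul_one]; rfl)
    change V (x ⊗ₜ 1) = 0 ↔ v x = 0
    rw [hV]

/-- A property that holds in an étale neighbourhood of every point holds on an étale covering. -/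
theorem exists_etale_cover (P : EtAlg R → Prop)
    (h : ∀ q : PrimeSpectrum R, ∃ A : EtAlg R, P A ∧ ∃ Q : PrimeSpectrum A.obj,
      PrimeSpectrum.comap (algebraMap R A.obj) Q = q) :
    ∃ (ι : Type) (B : ι → EtAlg R) (f : ∀ i, EtAlg.self R ⟶ B i),
      IsEtaleCover B f ∧ ∀ i, P (B i) := by
  choose A hA Q hQ using h
  have hopen : ∀ q, IsOpen (Set.range (PrimeSpectrum.comap (algebraMap R (A q).obj))) := by
    intro q
    have : Algebra.Etale R (A q).obj := (A q).property
    have : Module.Flat R (A q).obj := inferInstance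
    exact (PrimeSpectrum.isOpenMap_comap_of_hasGoingDown_of_finitePresentation
      (R := R) (S := (A q).obj)).isOpen_range
  obtain ⟨t, ht⟩ := CompactSpace.elim_nhds_subcover
    (fun q => Set.range (PrimeSpectrum.comap (algebraMap R (A q).obj)))
    fun q => (hopen q).mem_nhds ⟨Q q, hQ q⟩
  refine ⟨Fin t.card, fun i => A (t.equivFin.symm i), fun i => EtAlg.fromSelf _,
    ⟨inferInstance, fun q => ?_⟩, fun i => hA _⟩
  have hq : (q : PrimeSpectrum R) ∈ (⊤ : Set (PrimeSpectrum R)) := trivial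
  rw [← ht] at hq
  obtain ⟨x, hx, Q', hQ'⟩ := Set.mem_iUnion₂.1 hq
  have key : ∃ Q' : PrimeSpectrum (A (t.equivFin.symm (t.equivFin ⟨x, hx⟩))).obj,
      PrimeSpectrum.comap (algebraMap R _) Q' = q := by
    rw [Equiv.symm_apply_apply]
    exact ⟨Q', hQ'⟩
  obtain ⟨Q'', hQ''⟩ := key
  exact ⟨t.equivFin ⟨x, hx⟩, Q'', hQ''⟩

end Neighbourhoods

/-! ### Orthogonalization -/

section Gram

open Matrix Polynomial

variable {n N : ℕ} {B : Type u} [CommRing B]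

theorem transpose_aeval_mul_antidiag {X Y : Matrix (Fin n) (Fin n) B} (hX : Xᵀ = X)
    (hY : Y = antidiag n B * X) (g : B[X]) :
    (aeval Y g)ᵀ * antidiag n B = antidiag n B * aeval Y g := by
  have hJ : (antidiag n B)ᵀ = antidiag n B := by
    ext i j
    simp only [antidiag, transpose_apply, of_apply]
    exact if_congr ⟨fun h => by rw [h, Fin.rev_rev], fun h => by rw [h, Fin.rev_rev]⟩ rfl rfl
  have h1 : Yᵀ * antidiag n B = antidiag n B * Y := by
    rw [hY, transpose_mul, hX, hJ, Matrix.mul_assoc, antidiag_mul_self, ← Matrix.mul_assoc,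
      antidiag_mul_self, Matrix.mul_one, Matrix.one_mul]
  have h2 : ∀ k : ℕ, (Y ^ k)ᵀ * antidiag n B = antidiag n B * Y ^ k := by
    intro k
    induction k with
    | zero => simp
    | succ k ih =>
      rw [pow_succ, transpose_mul, Matrix.mul_assoc, ih, ← Matrix.mul_assoc, h1, Matrix.mul_assoc,
        ← pow_succ', ← pow_succ]
  induction g using Polynomial.induction_on' with
  | add p q hp hq => rw [map_add, transpose_add, Matrix.add_mul, hp, hq, Matrix.mul_add]
  | monomial k a =>
    rw [aeval_monomial, ← Algebra.smul_def, transpose_smul, smul_mul, h2, Matrix.mul_smul]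

theorem sq_mul_eq_one_of_dvd {Y : Matrix (Fin n) (Fin n) B} {g : B[X]}
    (hg : Y.charpoly ∣ g ^ 2 * X - 1) : aeval Y g * aeval Y g * Y = 1 := by
  obtain ⟨h, hh⟩ := hg
  have := congrArg (aeval Y) hh
  rw [map_mul, aeval_self_charpoly, zero_mul, map_sub, map_mul, map_pow, aeval_X, map_one,
    sub_eq_zero, pow_two] at this
  exact this

theorem transpose_mul_gram_mul {X Y : Matrix (Fin n) (Fin n) B} (hX : Xᵀ = X)
    (hY : Y = antidiag n B * X) {g : B[X]} (hg : aeval Y g * aeval Y g * Y = 1) :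
    (aeval Y g)ᵀ * X * aeval Y g = antidiag n B := by
  have h1 : X = antidiag n B * Y := by
    rw [hY, ← Matrix.mul_assoc, antidiag_mul_self, Matrix.one_mul]
  have h2 : Y * aeval Y g = aeval Y g * Y := by
    have := congrArg (aeval Y) (mul_comm (Polynomial.X : B[X]) g)
    rwa [map_mul, map_mul, aeval_X] at this
  rw [h1, ← Matrix.mul_assoc, transpose_aeval_mul_antidiag hX hY, Matrix.mul_assoc, h2,
    Matrix.mul_assoc, ← Matrix.mul_assoc (aeval Y g), hg, Matrix.mul_one]

theorem aeval_divX_mul (Y : Matrix (Fin n) (Fin n) B) :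
    aeval Y Y.charpoly.divX * Y = (-Y.charpoly.coeff 0) • 1 := by
  have h := congrArg (aeval Y) (divX_mul_X_add Y.charpoly)
  rw [map_add, map_mul, aeval_X, aeval_C, aeval_self_charpoly] at h
  rw [neg_smul, ← Algebra.algebraMap_eq_smul_one]
  exact eq_neg_of_add_eq_zero_left h

variable {P : Matrix (Fin N) (Fin N) B} {E : Matrix (Fin N) (Fin n) B}
  {Z : Matrix (Fin n) (Fin N) B} {X Xi : Matrix (Fin n) (Fin n) B}

theorem eq_mul_of_isUnit_det (hPP : P * P = P) (hPE : P * E = E) (hZP : Z * P = Z)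
    (hZE : Z * E = X) (hX : Xi * X = 1) (hu : IsUnit (1 - P + E * Xi * Z).det) :
    P = E * Xi * Z := by
  set Q := E * Xi * Z with hQ
  have h1 : Q * Q = Q := by
    calc Q * Q = E * Xi * (Z * E) * Xi * Z := by rw [hQ]; simp only [Matrix.mul_assoc]
      _ = E * (Xi * X) * Xi * Z := by rw [hZE]; simp only [Matrix.mul_assoc]
      _ = Q := by rw [hX, Matrix.mul_one]
  have h2 : P * Q = Q := by rw [hQ, ← Matrix.mul_assoc, ← Matrix.mul_assoc, hPE]
  have h3 : Q * P = Q := by rw [hQ, Matrix.mul_assoc, hZP]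
  have h4 : (P - Q) * (1 - P + Q) = 0 := by
    simp only [Matrix.sub_mul, Matrix.mul_add, Matrix.mul_sub, Matrix.mul_one, hPP, h1, h2, h3]
    abel
  have h5 := (Matrix.isUnit_iff_isUnit_det _).2 hu
  exact sub_eq_zero.1 ((h5.mul_left_eq_zero).1 h4)

/-- The determinant of `1 - P + E X⁻¹ Z` for `Y = J X`, up to a power of the determinant of `Y`. -/
def gramDet (P : Matrix (Fin N) (Fin N) B) (E : Matrix (Fin N) (Fin n) B)
    (Z : Matrix (Fin n) (Fin N) B) (Y : Matrix (Fin n) (Fin n) B) : B :=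
  ((-Y.charpoly.coeff 0) • (1 - P) + E * (aeval Y Y.charpoly.divX * antidiag n B) * Z).det

theorem map_aeval_matrix {C : Type u} [CommRing C] (w : B →+* C) (Y : Matrix (Fin n) (Fin n) B)
    (g : B[X]) : (aeval Y g).map w = aeval (Y.map w) (g.map w) := by
  induction g using Polynomial.induction_on' with
  | add p q hp hq =>
    rw [map_add, Polynomial.map_add, map_add, ← hp, ← hq]
    exact map_add w.mapMatrix _ _
  | monomial k a =>
    rw [aeval_monomial, map_monomial, aeval_monomial, ← Algebra.smul_def, ← Algebra.smul_def]
    have := map_pow w.mapMatrix Y k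
    rw [RingHom.mapMatrix_apply, RingHom.mapMatrix_apply] at this
    rw [← this]
    ext i j
    simp

theorem map_gramDet {C : Type u} [CommRing C] (w : B →+* C) (P : Matrix (Fin N) (Fin N) B)
    (E : Matrix (Fin N) (Fin n) B) (Z : Matrix (Fin n) (Fin N) B)
    (Y : Matrix (Fin n) (Fin n) B) :
    w (gramDet P E Z Y) = gramDet (P.map w) (E.map w) (Z.map w) (Y.map w) := by
  have h1 : (aeval Y Y.charpoly.divX).map w =
      aeval (Y.map w) (Y.map w).charpoly.divX := by
    have hdiv : (Y.charpoly.map w).divX = Y.charpoly.divX.map w := by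
      ext k
      rw [coeff_divX, coeff_map, coeff_map, coeff_divX]
    rw [charpoly_map, hdiv]
    exact map_aeval_matrix w Y _
  rw [gramDet, RingHom.map_det, gramDet]
  congr 1
  rw [map_add, ← antidiag_map w, ← h1, charpoly_map, coeff_map, ← Matrix.map_mul,
    RingHom.mapMatrix_apply, RingHom.mapMatrix_apply, Matrix.map_mul, Matrix.map_mul]
  congr 1
  ext i j
  simp [Matrix.one_apply, apply_ite w]

theorem gramDet_eq {Y : Matrix (Fin n) (Fin n) B} (hY : Y = antidiag n B * X) (hX : X * Xi = 1) :
    gramDet P E Z Y = (-Y.charpoly.coeff 0) ^ N * (1 - P + E * Xi * Z).det := by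
  have h1 : aeval Y Y.charpoly.divX * antidiag n B = (-Y.charpoly.coeff 0) • Xi := by
    calc _ = aeval Y Y.charpoly.divX * antidiag n B * (X * Xi) := by rw [hX, Matrix.mul_one]
      _ = aeval Y Y.charpoly.divX * Y * Xi := by
        rw [hY]; simp only [Matrix.mul_assoc]
      _ = _ := by rw [aeval_divX_mul, smul_mul, Matrix.one_mul]
  rw [gramDet, h1, Matrix.mul_smul, smul_mul, ← smul_add, det_smul, Fintype.card_fin]

end Gram

section

variable {A M : Type u} [CommRing A] [AddCommGroup M] [Module A M]

theorem IsDual.sum_mul {β : LinearMap.BilinForm A M} {N : ℕ} {x y : Fin N → M} (h : IsDual β x y)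
    (m m' : M) : ∑ k, β m (x k) * β (y k) m' = β m m' := by
  conv_rhs => rw [h m', map_sum]
  exact Finset.sum_congr rfl fun k _ => by rw [map_smul, smul_eq_mul, mul_comm]

end

section GramTriv

open Matrix

variable {p n : ℕ} {S S' : Frame.{u} p} {μ : Fin n → ℤ} {M : OrthDisplay S}

/-- The Gram matrix of two families of elements of an orthogonal display. -/
def OrthDisplay.gram (M : OrthDisplay S) {k l : ℕ} (a : Fin k → M.carrier)
    (b : Fin l → M.carrier) : Matrix (Fin k) (Fin l) S.carrier := of fun i j => M.form (a i) (b j)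

theorem OrthDisplay.gram_mul_gram (D : HomDual M) {k l : ℕ} (a : Fin k → M.carrier)
    (b : Fin l → M.carrier) : M.gram a D.x * M.gram D.y b = M.gram a b := by
  ext i j
  exact D.dual.sum_mul (a i) (b j)

theorem OrthDisplay.gram_transpose {k l : ℕ} (a : Fin k → M.carrier)
    (b : Fin l → M.carrier) : (M.gram a b)ᵀ = M.gram b a := by
  ext i j
  exact M.form_symm _ _

theorem antidiag_mul_apply {A : Type u} [CommRing A] {l : ℕ} (X : Matrix (Fin n) (Fin l) A)
    (i : Fin n) (j : Fin l) : (antidiag n A * X) i j = X (Fin.rev i) j := by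
  simp [antidiag, Matrix.mul_apply]

theorem isGradedMat_antidiag_mul_gram (hμ : ∀ i, μ i + μ (Fin.rev i) = 0) {e : Fin n → M.carrier}
    (he : ∀ j, e j ∈ M.grading (μ j)) :
    IsGradedMat S μ (antidiag n S.carrier * M.gram e e) := fun i j => by
  rw [antidiag_mul_apply]
  have := M.form_mem _ _ _ _ (he (Fin.rev i)) (he j)
  rwa [show μ (Fin.rev i) + μ j = μ j - μ i by linarith [hμ i]] at this

theorem gramDet_mem (hμ : ∀ i, μ i + μ (Fin.rev i) = 0) (D : HomDual M) {e : Fin n → M.carrier}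
    (he : ∀ j, e j ∈ M.grading (μ j)) :
    gramDet (M.gram D.y D.x) (M.gram D.y e) (M.gram e D.x) (antidiag n S.carrier * M.gram e e) ∈
      S.grading 0 := by
  have hY := isGradedMat_antidiag_mul_gram hμ he
  refine IsGradedMat.det_mem (d := D.deg) fun k l => add_mem ?_ ?_
  · refine IsGradedMat.smul (fun k l => ?_) (neg_mem (hY.charpoly_coeff_mem 0)) k l
    refine sub_mem (IsGradedMat.one _ k l) ?_
    have := M.form_mem _ _ _ _ (D.y_mem k) (D.x_mem l)
    rwa [neg_add_eq_sub] at this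
  · rw [Matrix.mul_assoc, Matrix.mul_assoc, Matrix.mul_apply]
    refine sum_mem fun i _ => ?_
    rw [Matrix.mul_apply, Finset.mul_sum]
    refine sum_mem fun j _ => ?_
    rw [antidiag_mul_apply]
    have h1 := M.form_mem _ _ _ _ (D.y_mem k) (he i)
    have h2 := hY.aeval (P := (antidiag n S.carrier * M.gram e e).charpoly.divX)
      (fun k => by rw [Polynomial.coeff_divX]; exact hY.charpoly_coeff_mem _) i j
    have h3 := M.form_mem _ _ _ _ (he (Fin.rev j)) (D.x_mem l)
    have := SetLike.mul_mem_graded h1 (SetLike.mul_mem_graded h2 h3)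
    rwa [show -D.deg k + μ i + (μ j - μ i + (μ (Fin.rev j) + D.deg l)) = D.deg l - D.deg k by
      linarith [hμ j]] at this

/-- The trivialization given by a homogeneous basis with Gram matrix `J`. -/
theorem exists_triv_of_gram (hμ : ∀ i, μ i + μ (Fin.rev i) = 0) (u : S ⟶ S') (D : HomDual M)
    {e : Fin n → M.carrier} (he : ∀ j, e j ∈ M.grading (μ j))
    {γ : Matrix (Fin n) (Fin n) S'.carrier} (hγ : IsGradedMat S' μ γ)
    (hX : γᵀ * (M.gram e e).map u.toRingHom * γ = antidiag n S'.carrier)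
    (hP : (M.gram D.y D.x).map u.toRingHom = (M.gram D.y e).map u.toRingHom *
      (γ * antidiag n S'.carrier * γᵀ) * (M.gram e D.x).map u.toRingHom) :
    Nonempty (Triv M μ u) := by
  let b : M.carrier → Fin n → S'.carrier := fun m l => u.toRingHom (M.form (e l) m)
  have hb : ∀ m m', u.toRingHom (M.form m m') =
      b m ⬝ᵥ (γ * antidiag n S'.carrier * γᵀ) *ᵥ b m' := by
    intro m m'
    have h1 : ∀ k (l : Fin D.N), u.toRingHom (M.form (D.y k) (D.x l)) =
        b (D.y k) ⬝ᵥ (γ * antidiag n S'.carrier * γᵀ) *ᵥ b (D.x l) := by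
      intro k l
      have := congrFun (congrFun hP k) l
      rw [Matrix.map_apply, Matrix.mul_assoc, Matrix.mul_apply] at this
      refine this.trans ?_
      change _ = ∑ i, b (D.y k) i * ((γ * antidiag n S'.carrier * γᵀ) *ᵥ b (D.x l)) i
      refine Finset.sum_congr rfl fun i _ => ?_
      refine congrArg₂ _ ?_ rfl
      exact congrArg u.toRingHom (M.form_symm _ _)
    have h2 : ∀ m', b m' = ∑ l, u.toRingHom (M.form (D.y l) m') • b (D.x l) := by
      intro m'
      funext i
      rw [Finset.sum_apply]
      refine (congrArg u.toRingHom (D.dual.sum_mul (e i) m')).symm.trans ?_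
      rw [map_sum]
      exact Finset.sum_congr rfl fun l _ => by rw [map_mul, mul_comm]; rfl
    have h3 : ∀ k m', u.toRingHom (M.form (D.y k) m') =
        b (D.y k) ⬝ᵥ (γ * antidiag n S'.carrier * γᵀ) *ᵥ b m' := by
      intro k m'
      rw [h2 m', mulVec_sum, dotProduct_sum, ← D.dual.sum_mul, map_sum]
      refine Finset.sum_congr rfl fun l _ => ?_
      rw [mulVec_smul, dotProduct_smul, ← h1, map_mul, smul_eq_mul, mul_comm]
    have h4 : ∀ m, b m = ∑ k, u.toRingHom (M.form m (D.x k)) • b (D.y k) := by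
      intro m
      funext i
      rw [Finset.sum_apply]
      change u.toRingHom (M.form (e i) m) = _
      rw [M.form_symm, ← D.dual.sum_mul, map_sum]
      exact Finset.sum_congr rfl fun l _ => by
        rw [map_mul, Pi.smul_apply, smul_eq_mul, M.form_symm (D.y l)]
    rw [h4 m, sum_dotProduct, ← D.dual.sum_mul, map_sum]
    refine Finset.sum_congr rfl fun l _ => ?_
    rw [smul_dotProduct, ← h3, map_mul, smul_eq_mul]
  let φ : M.carrier →ₛₗ[u.toRingHom] (Fin n → S'.carrier) :=
    { toFun := fun m => (antidiag n S'.carrier * γᵀ) *ᵥ b m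
      map_add' := fun m m' => by
        rw [← mulVec_add]
        exact congrArg _ (funext fun i => by
          change u.toRingHom (M.form (e i) (m + m')) = _
          rw [map_add, map_add]; rfl)
      map_smul' := fun a m => by
        rw [← mulVec_smul]
        exact congrArg _ (funext fun i => by
          change u.toRingHom (M.form (e i) (a • m)) = _
          rw [map_smul, smul_eq_mul, map_mul]; rfl) }
  refine ⟨φ, fun d m hm j => ?_, fun m m' => ?_, ?_⟩
  · change ((antidiag n S'.carrier * γᵀ) *ᵥ b m) j ∈ _
    rw [← mulVec_mulVec, antidiag_mulVec]
    change ∑ l, γ l (Fin.rev j) * b m l ∈ S'.grading (d - μ j)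
    refine sum_mem fun l _ => ?_
    have h1 := SetLike.mul_mem_graded (hγ l (Fin.rev j)) (u.map_mem _ _ (M.form_mem _ _ _ _
        (he l) hm))
    rwa [show μ (Fin.rev j) - μ l + (μ l + d) = d - μ j by linarith [hμ j]] at h1
  · change psi ((antidiag n S'.carrier * γᵀ) *ᵥ b m) ((antidiag n S'.carrier * γᵀ) *ᵥ b m') = _
    rw [hb, psi_mulVec]
    congr 2
    have hJ : (antidiag n S'.carrier)ᵀ = antidiag n S'.carrier := by
      ext i j
      simp only [antidiag, transpose_apply, of_apply]
      exact if_congr ⟨fun h => by rw [h, Fin.rev_rev], fun h => by rw [h, Fin.rev_rev]⟩ rfl rfl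
    rw [transpose_mul, transpose_transpose, hJ, Matrix.mul_assoc γ, antidiag_mul_self,
      Matrix.mul_one, Matrix.mul_assoc]
  · rw [eq_top_iff]
    rintro w -
    have h1 : w = ∑ k, (γ *ᵥ w) k • φ (e k) := by
      have h2 : ∑ k, (γ *ᵥ w) k • φ (e k) = (antidiag n S'.carrier * γᵀ) *ᵥ
          ((M.gram e e).map u.toRingHom *ᵥ (γ *ᵥ w)) := by
        change ∑ k, (γ *ᵥ w) k • ((antidiag n S'.carrier * γᵀ) *ᵥ b (e k)) = _
        simp only [← mulVec_smul, ← mulVec_sum]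
        refine congrArg _ (funext fun i => ?_)
        rw [Finset.sum_apply]
        exact Finset.sum_congr rfl fun k _ => mul_comm _ _
      rw [h2, mulVec_mulVec, mulVec_mulVec, Matrix.mul_assoc, Matrix.mul_assoc,
        ← Matrix.mul_assoc γᵀ,
        hX, antidiag_mul_self, one_mulVec]
    rw [h1]
    exact sum_mem fun k _ => Submodule.smul_mem _ _ (Submodule.subset_span ⟨_, rfl⟩)

theorem gram_residue_ne_zero (q : PrimeSpectrum S.residue) (D : HomDual M) {e : Fin n → M.carrier}
    (hgen : ∀ m, ∃ c : Fin n → q.asIdeal.ResidueField, ∀ y,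
        S.toField q (M.form y m) = ∑ j, c j * S.toField q (M.form y (e j)))
    (hind : ∀ v : Fin n → q.asIdeal.ResidueField,
        (∀ y, ∑ j, v j * S.toField q (M.form y (e j)) = 0) → v = 0) :
    S.toField q ((antidiag n S.carrier * M.gram e e).charpoly.coeff 0) ≠ 0 ∧
    S.toField q (gramDet (M.gram D.y D.x) (M.gram D.y e) (M.gram e D.x)
      (antidiag n S.carrier * M.gram e e)) ≠ 0 := by
  set w := S.toField q
  have hdet : ((M.gram e e).map w).det ≠ 0 := by
    intro h0
    obtain ⟨v, hv0, hv⟩ := Matrix.exists_mulVec_eq_zero_iff.2 h0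
    refine hv0 (hind v fun y => ?_)
    obtain ⟨c, hc⟩ := hgen y
    calc ∑ j, v j * w (M.form y (e j)) = ∑ j, v j * ∑ l, c l * w (M.form (e j) (e l)) :=
          Finset.sum_congr rfl fun j _ => by rw [M.form_symm, hc]
      _ = ∑ l, c l * ∑ j, w (M.form (e l) (e j)) * v j := by
          simp only [Finset.mul_sum]
          rw [Finset.sum_comm]
          refine Finset.sum_congr rfl fun l _ => Finset.sum_congr rfl fun j _ => ?_
          rw [M.form_symm (e j)]
          ring
      _ = 0 := Finset.sum_eq_zero fun l _ => by
          have := congrFun hv l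
          change ∑ j, w (M.form (e l) (e j)) * v j = 0 at this
          rw [this, mul_zero]
  have hY : (antidiag n S.carrier * M.gram e e).map w =
      antidiag n q.asIdeal.ResidueField * (M.gram e e).map w := by
    rw [Matrix.map_mul, antidiag_map]
  have hJ : (antidiag n q.asIdeal.ResidueField).det ≠ 0 := by
    intro h
    have := congrArg Matrix.det (antidiag_mul_self (n := n) (A := q.asIdeal.ResidueField))
    rw [det_mul, h, zero_mul, det_one] at this
    exact zero_ne_one this
  have h0 : w ((antidiag n S.carrier * M.gram e e).charpoly.coeff 0) ≠ 0 := by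
    intro h
    rw [← Polynomial.coeff_map, ← charpoly_map, hY] at h
    have h1 := Matrix.det_eq_sign_charpoly_coeff
      (antidiag n q.asIdeal.ResidueField * (M.gram e e).map w)
    rw [h, mul_zero, det_mul] at h1
    exact mul_ne_zero hJ hdet h1
  refine ⟨h0, ?_⟩
  have hXi : (M.gram e e).map w * ((M.gram e e).map w)⁻¹ = 1 :=
    Matrix.mul_nonsing_inv _ (IsUnit.mk0 _ hdet)
  choose c hc using fun k => hgen (D.x k)
  let C : Matrix (Fin n) (Fin D.N) q.asIdeal.ResidueField := of fun j k => c k j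
  have h1 : (M.gram D.y D.x).map w = (M.gram D.y e).map w * C := by
    ext k l
    refine (hc l (D.y k)).trans ?_
    exact Finset.sum_congr rfl fun j _ => mul_comm _ _
  have h2 : (M.gram e D.x).map w = (M.gram e e).map w * C := by
    ext k l
    refine (hc l (e k)).trans ?_
    exact Finset.sum_congr rfl fun j _ => mul_comm _ _
  have h3 : 1 - (M.gram D.y D.x).map w + (M.gram D.y e).map w * ((M.gram e e).map w)⁻¹ *
      (M.gram e D.x).map w = 1 := by
    rw [h1, h2, Matrix.mul_assoc, ← Matrix.mul_assoc ((M.gram e e).map w)⁻¹,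
      Matrix.nonsing_inv_mul _ (IsUnit.mk0 _ hdet), Matrix.one_mul, sub_add_cancel]
  rw [map_gramDet, gramDet_eq hY hXi, h3, det_one, mul_one]
  refine pow_ne_zero _ (neg_ne_zero.2 ?_)
  rwa [charpoly_map, Polynomial.coeff_map]

theorem Frame.isUnit_two [Fact p.Prime] (hp : 3 ≤ p) (S : Frame.{u} p) :
    IsUnit (2 : S.grading 0) := by
  have h1 := Ideal.mem_jacobson_bot.1 S.p_mem_jacobson (-1)
  obtain ⟨k, hk⟩ := ((Fact.out : p.Prime).odd_of_ne_two (by omega))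
  have h2 : (p : S.grading 0) = 2 * k + 1 := by
    have := congrArg (Nat.cast : ℕ → S.grading 0) hk
    push_cast at this
    exact this
  have h3 : (p : S.grading 0) * -1 + 1 = 2 * -(k : S.grading 0) := by rw [h2]; ring
  rw [h3] at h1
  exact isUnit_of_mul_isUnit_left h1

end GramTriv

section LocalTriviality

open Matrix Polynomial

variable {p n : ℕ} [Fact p.Prime] {S : Frame.{u} p} {μ : Fin n → ℤ}

theorem exists_triv_neighbourhood (hp : 3 ≤ p) (E : EtaleBaseChange S)
    (hμ : ∀ i, μ i + μ (Fin.rev i) = 0) (M : OrthDisplay S) (hM : M.HasType μ)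
    (q : PrimeSpectrum S.residue) :
    ∃ A : EtAlg S.residue, Nonempty (Triv M μ (E.unit A)) ∧ ∃ Q : PrimeSpectrum A.obj,
      PrimeSpectrum.comap (algebraMap S.residue A.obj) Q = q := by
  obtain ⟨e, he, hgen, hind⟩ := exists_residue_basis M q hM
  let D := M.homDual
  let κ := q.asIdeal.ResidueField
  let K := AlgebraicClosure κ
  obtain ⟨hχ0, hδ0⟩ := gram_residue_ne_zero q D hgen hind
  let Y := antidiag n S.carrier * M.gram e e
  have hY : IsGradedMat S μ Y := isGradedMat_antidiag_mul_gram hμ he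
  let δ : S.grading 0 := ⟨_, gramDet_mem hμ D he⟩
  let ι₀ : S.grading 0 →+* S.carrier := algebraMap (S.grading 0) S.carrier
  have hq : Nontrivial S.residue := (algebraMap S.residue κ).domain_nontrivial
  have : Nontrivial S.carrier := (S.rho).domain_nontrivial
  obtain ⟨χ, hχ, hχdeg, hχm⟩ := lifts_and_natDegree_eq_and_monic (f := ι₀) (p := Y.charpoly)
    ((lifts_iff_coeff_lifts _).2 fun k => ⟨⟨_, hY.charpoly_coeff_mem k⟩, rfl⟩) (charpoly_monic Y)
  have hn : χ.natDegree = n := by rw [hχdeg, charpoly_natDegree_eq_dim, Fintype.card_fin]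
  have h2 := S.isUnit_two hp
  have hI : Algebra.Etale (S.grading 0) (InvSqrt n χ) := InvSqrt.etale hχm hn h2
  let T := Localization.Away (algebraMap (S.grading 0) (InvSqrt n χ) δ)
  have hT : Algebra.Etale (InvSqrt n χ) T :=
    Algebra.Etale.of_isLocalizationAway (algebraMap (S.grading 0) (InvSqrt n χ) δ)
  have hT' : Algebra.Etale (S.grading 0) T := Algebra.Etale.comp _ (InvSqrt n χ) _
  let f : S.grading 0 →+* T := algebraMap _ _
  have hf : f.Etale := (RingHom.etale_algebraMap).2 hT'
  let v : S.residue →+* K := (algebraMap κ K).comp (algebraMap S.residue κ)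
  let v₀ : S.grading 0 →+* K := v.comp S.toResidue
  have hv₀ : ∀ x : S.grading 0, v₀ x = algebraMap κ K (S.toField q x) := fun x => by
    exact congrArg (fun r => algebraMap κ K (algebraMap S.residue κ r)) (S.rho_of_mem_zero x).symm
  obtain ⟨b, hb⟩ : ∃ b : Fin n → K, IsInvSqrt (χ.map v₀) b := by
    refine exists_isInvSqrt ?_ (hχm.map _) (by rw [hχm.natDegree_map, hn]) ?_
    · have := (h2.map v₀).ne_zero
      rwa [map_ofNat] at this
    · rw [← coeff_zero_eq_eval_zero, coeff_map, hv₀]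
      have h3 : ((χ.coeff 0 : S.grading 0) : S.carrier) = Y.charpoly.coeff 0 := by
        rw [← hχ, coeff_map]; rfl
      rw [h3]
      exact (_root_.map_ne_zero _).2 hχ0
  obtain ⟨w, hw⟩ : ∃ w : T →+* K, w.comp f = v.comp S.toResidue := by
    let _ : Algebra (S.grading 0) K := v₀.toAlgebra
    obtain ⟨g, hg⟩ := InvSqrt.exists_lift (B := K) hχm hb
    have hu : IsUnit (g.toRingHom (algebraMap (S.grading 0) (InvSqrt n χ) δ)) := by
      have h4 : g.toRingHom (algebraMap (S.grading 0) (InvSqrt n χ) δ) = v₀ δ := g.commutes δ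
      rw [h4, hv₀]
      exact ((_root_.map_ne_zero _).2 hδ0).isUnit
    refine ⟨IsLocalization.Away.lift _ hu, RingHom.ext fun x => ?_⟩
    have h5 : f x = algebraMap (InvSqrt n χ) T (algebraMap (S.grading 0) (InvSqrt n χ) x) :=
      IsScalarTower.algebraMap_apply _ _ _ x
    rw [RingHom.comp_apply, h5, IsLocalization.Away.lift_eq]
    exact g.commutes x
  obtain ⟨A, j, hj, Q, hQ⟩ := exists_etale_neighbourhood hf v w hw
  refine ⟨A, ?_, Q, PrimeSpectrum.ext ?_⟩
  swap
  · rw [hQ]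
    ext x
    change algebraMap κ K (algebraMap S.residue κ x) = 0 ↔ _
    rw [map_eq_zero, Ideal.algebraMap_residueField_eq_zero]
  have hpA : IsNilpotent (p : A.obj) := by
    have := (E.isPAdic A).nilpotent.map (E.residueEquiv A)
    rwa [map_natCast] at this
  obtain ⟨G, ⟨hG, -⟩, -⟩ := existsUnique_etale_lift hf ((E.isPAdic A).pComplete 0)
    (E.res_surjective (A := A)) (fun x hx => ⟨p, Frame.exists_pow_eq _
        (E.res_eq_zero_iff.1 hx)⟩) hpA
    (Frame.Hom.zero (E.unit A)) j (by
      rw [hj]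
      exact RingHom.ext fun s => (E.res_unit s).symm)
  let u := E.unit A
  let S' := E.frame.obj A
  let θ : InvSqrt n χ →+* S'.carrier :=
    (algebraMap (S'.grading 0) S'.carrier).comp (G.comp (algebraMap (InvSqrt n χ) T))
  have hθ : θ.comp (algebraMap (S.grading 0) (InvSqrt n χ)) = u.toRingHom.comp ι₀ := by
    refine RingHom.ext fun x => ?_
    have h5 : f x = algebraMap (InvSqrt n χ) T (algebraMap (S.grading 0) (InvSqrt n χ) x) :=
      IsScalarTower.algebraMap_apply _ _ _ x
    have h6 := RingHom.congr_fun hG x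
    rw [RingHom.comp_apply, h5] at h6
    exact congrArg (algebraMap (S'.grading 0) S'.carrier) h6
  have ha := (InvSqrt.isInvSqrt (n := n) hχm).map θ
  rw [Polynomial.map_map, hθ, ← Polynomial.map_map, hχ, ← charpoly_map] at ha
  let X' := (M.gram e e).map u.toRingHom
  let Y' := Y.map u.toRingHom
  have hY' : Y' = antidiag n S'.carrier * X' := by
    change (antidiag n S.carrier * M.gram e e).map u.toRingHom = _
    rw [Matrix.map_mul, antidiag_map]
  have hX't : X'ᵀ = X' := by
    change ((M.gram e e).map u.toRingHom)ᵀ = _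
    rw [← transpose_map, OrthDisplay.gram_transpose]
  let γ := aeval Y' (genPoly (θ ∘ InvSqrt.gen n χ))
  have hγ1 : γ * γ * Y' = 1 := sq_mul_eq_one_of_dvd ha
  have hγ2 : γᵀ * antidiag n S'.carrier = antidiag n S'.carrier * γ :=
    transpose_aeval_mul_antidiag hX't hY' _
  have hXi : γ * antidiag n S'.carrier * γᵀ = γ * γ * antidiag n S'.carrier := by
    have h7 : antidiag n S'.carrier * γᵀ = γ * antidiag n S'.carrier := by
      calc _ = antidiag n S'.carrier * (γᵀ * antidiag n S'.carrier) * antidiag n S'.carrier := by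
            rw [Matrix.mul_assoc, Matrix.mul_assoc, antidiag_mul_self, Matrix.mul_one]
        _ = _ := by rw [hγ2, ← Matrix.mul_assoc, antidiag_mul_self, Matrix.one_mul]
    rw [Matrix.mul_assoc, h7, Matrix.mul_assoc]
  have hXi1 : γ * antidiag n S'.carrier * γᵀ * X' = 1 := by
    rw [hXi, Matrix.mul_assoc, ← hY', hγ1]
  refine exists_triv_of_gram hμ u D he (γ := γ) ?_ (transpose_mul_gram_mul hX't hY' hγ1) ?_
  · refine IsGradedMat.aeval (fun i j => u.map_mem _ _ (hY i j)) fun k => ?_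
    by_cases hk : k < n
    · have := genPoly_coeff (θ ∘ InvSqrt.gen n χ) ⟨k, hk⟩
      rw [show (genPoly (θ ∘ InvSqrt.gen n χ)).coeff k = _ from this]
      exact SetLike.coe_mem (G (algebraMap (InvSqrt n χ) T (InvSqrt.gen n χ ⟨k, hk⟩)))
    · rw [coeff_eq_zero_of_degree_lt ((genPoly_degree_lt _).trans_le
        (by exact_mod_cast not_lt.1 hk))]
      exact zero_mem _
  · have hδu : IsUnit (u.toRingHom δ) := by
      have h8 : IsUnit (algebraMap (InvSqrt n χ) T (algebraMap (S.grading 0) (InvSqrt n χ) δ)) :=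
        IsLocalization.Away.algebraMap_isUnit _
      have h9 := h8.map ((algebraMap (S'.grading 0) S'.carrier).comp G)
      have h10 : θ (algebraMap (S.grading 0) (InvSqrt n χ) δ) = u.toRingHom δ :=
        RingHom.congr_fun hθ δ
      rw [← h10]
      exact h9
    have h11 := map_gramDet u.toRingHom (M.gram D.y D.x) (M.gram D.y e) (M.gram e D.x) Y
    rw [gramDet_eq hY' (mul_eq_one_comm.1 hXi1)] at h11
    change IsUnit (u.toRingHom (gramDet (M.gram D.y D.x) (M.gram D.y e) (M.gram e D.x) Y)) at hδu
    rw [h11] at hδu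
    refine eq_mul_of_isUnit_det ?_ ?_ ?_ ?_ hXi1 (isUnit_of_mul_isUnit_right hδu)
    all_goals rw [← Matrix.map_mul, OrthDisplay.gram_mul_gram]

theorem locallyTrivial_of_hasType (hp : 3 ≤ p) (E : EtaleBaseChange S)
    (hμ : ∀ i, μ i + μ (Fin.rev i) = 0) (M : OrthDisplay S) (hM : M.HasType μ) :
    LocallyTrivial E μ M :=
  exists_etale_cover (fun A => Nonempty (Triv M μ (E.unit A)))
    (exists_triv_neighbourhood hp E hμ M hM)

end LocalTriviality

/-! ### Base change of étale coverings -/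

section CoverBaseChange

theorem RingPushout.exists_prime {R A B C : Type u} [CommRing R] [CommRing A] [CommRing B]
    [CommRing C] {f : R →+* A} {g : R →+* B} {h : A →+* C} {k : B →+* C}
    (H : RingPushout f g h k) (qA : PrimeSpectrum A) (qB : PrimeSpectrum B)
    (hq : PrimeSpectrum.comap f qA = PrimeSpectrum.comap g qB) :
    ∃ Q : PrimeSpectrum C, PrimeSpectrum.comap h Q = qA := by
  let q := PrimeSpectrum.comap f qA
  let κ := q.asIdeal.ResidueField
  let a : κ →+* qA.asIdeal.ResidueField := Ideal.ResidueField.map _ _ f rfl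
  let b : κ →+* qB.asIdeal.ResidueField := Ideal.ResidueField.map _ _ g
    (congrArg PrimeSpectrum.asIdeal hq)
  let _ := a.toAlgebra
  let _ := b.toAlgebra
  have : Nontrivial (qA.asIdeal.ResidueField ⊗[κ] qB.asIdeal.ResidueField) := inferInstance
  obtain ⟨m, hm⟩ := Ideal.exists_maximal (qA.asIdeal.ResidueField ⊗[κ] qB.asIdeal.ResidueField)
  let L := (qA.asIdeal.ResidueField ⊗[κ] qB.asIdeal.ResidueField) ⧸ m
  let _ : Field L := Ideal.Quotient.field m
  let vA : qA.asIdeal.ResidueField →+* L := (Ideal.Quotient.mk m).comp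
    (Algebra.TensorProduct.includeLeftRingHom)
  let vB : qB.asIdeal.ResidueField →+* L := (Ideal.Quotient.mk m).comp
    (Algebra.TensorProduct.includeRight (R := κ) (A := qA.asIdeal.ResidueField)
      (B := qB.asIdeal.ResidueField)).toRingHom
  have hv : vA.comp a = vB.comp b := RingHom.ext fun x => congrArg (Ideal.Quotient.mk m)
    ((Algebra.TensorProduct.includeRight (R := κ) (A := qA.asIdeal.ResidueField)
      (B := qB.asIdeal.ResidueField)).commutes x).symm
  obtain ⟨w, hw, -⟩ := H.exists_desc L (vA.comp (algebraMap A _)) (vB.comp (algebraMap B _)) (by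
    ext r
    have h1 := RingHom.congr_fun hv (algebraMap R κ r)
    have h2 : a (algebraMap R κ r) = algebraMap A _ (f r) := Ideal.ResidueField.map_algebraMap ..
    have h3 : b (algebraMap R κ r) = algebraMap B _ (g r) := Ideal.ResidueField.map_algebraMap ..
    exact (congrArg vA h2).symm.trans (h1.trans (congrArg vB h3)))
  refine ⟨⟨RingHom.ker w, RingHom.ker_isPrime w⟩, PrimeSpectrum.ext (Ideal.ext fun x => ?_)⟩
  change w (h x) = 0 ↔ _
  have h4 := RingHom.congr_fun hw x
  rw [RingHom.comp_apply] at h4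
  rw [h4, RingHom.comp_apply, map_eq_zero, Ideal.algebraMap_residueField_eq_zero]

variable {R : Type u} [CommRing R]

theorem IsEtaleCover.exists_baseChange {A A' : EtAlg R} {ι : Type} {B : ι → EtAlg R}
    {f : ∀ i, A ⟶ B i} (hf : IsEtaleCover B f) (a : A ⟶ A') :
    ∃ (B' : ι → EtAlg R) (f' : ∀ i, A' ⟶ B' i) (b : ∀ i, B i ⟶ B' i), IsEtaleCover B' f' ∧
      ∀ i, f i ≫ b i = a ≫ f' i := by
  choose B' f' b H using fun i => EtAlg.exists_pushout a (f i)
  refine ⟨B', f', b, ⟨hf.1, fun q => ?_⟩, fun i => ?_⟩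
  · obtain ⟨i, Q, hQ⟩ := hf.2 (PrimeSpectrum.comap (EtAlg.algHom a).toRingHom q)
    obtain ⟨Q', hQ'⟩ := (H i).exists_prime q Q hQ.symm
    exact ⟨i, Q', hQ'⟩
  · refine ObjectProperty.hom_ext _ (CommAlgCat.hom_ext (AlgHom.ext fun x => ?_))
    exact (RingHom.congr_fun (H i).comm x).symm

theorem IsEtaleCover.exists_baseChange_self {ι : Type} {B : ι → EtAlg R}
    {f : ∀ i, EtAlg.self R ⟶ B i} (hf : IsEtaleCover B f) (A : EtAlg R) :
    ∃ (B' : ι → EtAlg R) (f' : ∀ i, A ⟶ B' i) (_ : ∀ i, B i ⟶ B' i), IsEtaleCover B' f' := by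
  obtain ⟨B', f', b, h, -⟩ := hf.exists_baseChange (EtAlg.fromSelf A)
  exact ⟨B', f', b, h⟩

end CoverBaseChange

/-! ### Morphisms of `O(ψ)`-displays -/

section GroupDisplayHom

variable {p n : ℕ} {S : Frame.{u} p} {E : EtaleBaseChange S} {μ : Fin n → ℤ}
  {P Q : OrthGroupDisplay E μ}

namespace OrthGroupDisplay

theorem exists_act_eq (P : OrthGroupDisplay E μ) {A : EtAlg S.residue} (q q' : P.sheaf.obj A) :
    ∃ h : dispGroup (E.frame.obj A) μ, P.act A q h = q' :=
  (P.simply_transitive A q q').exists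

theorem sheaf_ext (P : OrthGroupDisplay E μ) {A : EtAlg S.residue} {ι : Type}
    {B : ι → EtAlg S.residue} {f : ∀ i, A ⟶ B i} (hf : IsEtaleCover B f) {q q' : P.sheaf.obj A}
    (h : ∀ i, P.sheaf.map (f i) q = P.sheaf.map (f i) q') : q = q' := by
  obtain ⟨y, -, hy⟩ := P.isSheaf B f hf (fun i => P.sheaf.map (f i) q) fun i j C g g' hg => by
    rw [← Functor.map_comp_apply, ← Functor.map_comp_apply, hg]
  rw [hy q fun i => rfl, hy q' fun i => (h i).symm]

/-- Two morphisms that agree on local sections are equal. -/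
theorem hom_ext_of_cover {ω ω' : P ⟶ Q} {ι : Type} {B : ι → EtAlg S.residue}
    {f : ∀ i, EtAlg.self S.residue ⟶ B i} (hf : IsEtaleCover B f) (q : ∀ i, P.sheaf.obj (B i))
    (h : ∀ i, ω.hom.app (B i) (q i) = ω'.hom.app (B i) (q i)) : ω = ω' := by
  refine OrthGroupDisplay.Hom.ext (NatTrans.ext (funext fun A =>
    ConcreteCategory.hom_ext _ _ fun x => ?_))
  obtain ⟨B', f', b, hf'⟩ := hf.exists_baseChange_self A
  refine Q.sheaf_ext hf' fun i => ?_
  obtain ⟨g, hg⟩ := P.exists_act_eq (P.sheaf.map (b i) (q i)) (P.sheaf.map (f' i) x)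
  have h1 : ∀ ω : P ⟶ Q, Q.sheaf.map (f' i) (ω.hom.app A x) =
      Q.act _ (Q.sheaf.map (b i) (ω.hom.app (B i) (q i))) g := fun ω => by
    rw [← NatTrans.naturality_apply, ← hg, ω.hom_act, NatTrans.naturality_apply]
  rw [h1, h1, h]

theorem hom_app_injective (ω : P ⟶ Q) (A : EtAlg S.residue) :
    Function.Injective (ω.hom.app A) := by
  intro x y hxy
  obtain ⟨h, rfl⟩ := P.exists_act_eq x y
  rw [ω.hom_act] at hxy
  have h1 := (Q.simply_transitive A (ω.hom.app A x) (ω.hom.app A x)).unique hxy.symm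
    (Q.act_one A _)
  rw [h1]
  exact (P.act_one A x).symm

theorem hom_app_surjective (ω : P ⟶ Q) (A : EtAlg S.residue) :
    Function.Surjective (ω.hom.app A) := by
  intro y
  obtain ⟨ι, B, f, hf, hP⟩ := P.locally_nonempty
  obtain ⟨B', f', b, hf'⟩ := hf.exists_baseChange_self A
  have hx : ∀ i, ∃ x, ω.hom.app (B' i) x = Q.sheaf.map (f' i) y := fun i => by
    let q := P.sheaf.map (b i) (hP i).some
    obtain ⟨h, hh⟩ := Q.exists_act_eq (ω.hom.app (B' i) q) (Q.sheaf.map (f' i) y)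
    exact ⟨P.act _ q h, by rw [ω.hom_act, hh]⟩
  choose x hx using hx
  obtain ⟨z, hz, -⟩ := P.isSheaf B' f' hf' x fun i j C g h hgh => by
    refine hom_app_injective ω C ?_
    rw [NatTrans.naturality_apply, NatTrans.naturality_apply, hx, hx,
      ← Functor.map_comp_apply, ← Functor.map_comp_apply, hgh]
  refine ⟨z, Q.sheaf_ext hf' fun i => ?_⟩
  rw [← NatTrans.naturality_apply, hz, hx]

/-- The inverse of a morphism of `O(ψ)`-displays. -/
def invHom (ω : P ⟶ Q) : Q ⟶ P :=
  let e (A : EtAlg S.residue) := Equiv.ofBijective (ω.hom.app A)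
    ⟨hom_app_injective ω A, hom_app_surjective ω A⟩
  have he : ∀ A x, ω.hom.app A ((e A).symm x) = x := fun A x => (e A).apply_symm_apply x
  { hom :=
      { app := fun A => TypeCat.ofHom (e A).symm
        naturality := fun A B f => ConcreteCategory.hom_ext _ _ fun x => by
          refine hom_app_injective ω B ?_
          change ω.hom.app B ((e B).symm (Q.sheaf.map f x)) =
            ω.hom.app B (P.sheaf.map f ((e A).symm x))
          rw [NatTrans.naturality_apply, he, he] }
    hom_act := fun A q h => by
      refine hom_app_injective ω A ?_
      change ω.hom.app A ((e A).symm (Q.act A q h)) = ω.hom.app A (P.act A ((e A).symm q) h)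
      rw [ω.hom_act, he, he]
    hom_alpha := fun A q => by
      change P.alpha A ((e A).symm q) = _
      rw [← ω.hom_alpha, he] }

theorem isIso_hom (ω : P ⟶ Q) : IsIso ω := by
  refine ⟨⟨invHom ω, ?_, ?_⟩⟩
  · refine OrthGroupDisplay.Hom.ext (NatTrans.ext (funext fun A =>
      ConcreteCategory.hom_ext _ _ fun x => ?_))
    exact (Equiv.ofBijective (ω.hom.app A) _).symm_apply_apply x
  · refine OrthGroupDisplay.Hom.ext (NatTrans.ext (funext fun A =>
      ConcreteCategory.hom_ext _ _ fun x => ?_))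
    exact (Equiv.ofBijective (ω.hom.app A) _).apply_symm_apply x

end OrthGroupDisplay

end GroupDisplayHom

section JointInjectivity

open Matrix

variable {p n : ℕ} {S : Frame.{u} p} {E : EtaleBaseChange S} {μ : Fin n → ℤ}
  {M N : OrthDisplay S} {ι : Type} {B : ι → EtAlg S.residue}
  {f : ∀ i, EtAlg.self S.residue ⟶ B i}

theorem OrthDisplay.eq_zero_of_form (M : OrthDisplay S) {m : M.carrier}
    (h : ∀ m', M.form m m' = 0) : m = 0 :=
  M.form_perfect.1 (by rw [map_zero]; exact LinearMap.ext h)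

/-- Trivializations on a covering are jointly injective. -/
theorem eq_of_coord_eq [Fact p.Prime] (hS : S.IsPAdic) (hf : IsEtaleCover B f)
    (φ : ∀ i, Triv M μ (E.unit (B i))) {m m' : M.carrier}
    (h : ∀ i, (φ i).coord m = (φ i).coord m') : m = m' := by
  refine sub_eq_zero.1 (M.eq_zero_of_form fun x => E.unit_eq_of_cover hS hf fun i => ?_)
  rw [← (φ i).isCoord.isom, map_sub, h, sub_self, map_zero, ← psiBilin_apply, map_zero,
    LinearMap.zero_apply]

theorem BC.eq_sum_of_isDual {A B M : Type u} [CommRing A] [CommRing B] [AddCommGroup M] [Module A M]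
    (g : A →+* B) {β : LinearMap.BilinForm A M} {N : ℕ} {x y : Fin N → M} (h : IsDual β x y)
    (z : BC g M) : z = ∑ k, BC.bilin g β (BC.mk g 1 (y k)) z • BC.mk g 1 (x k) := by
  induction z using BC.induction with
  | mk b m =>
    conv_lhs => rw [← mul_one b, ← BC.smul_mk, h m, show BC.mk g 1 (∑ k, β (y k) m • x k) =
      ∑ k, BC.mk g 1 (β (y k) m • x k) from map_sum (BC.mkOne g M) _ _, Finset.smul_sum]
    refine Finset.sum_congr rfl fun k _ => ?_
    rw [BC.bilin_mk, BC.mk_smul, BC.smul_mk, BC.smul_mk]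
    congr 1
    ring
  | zero => simp
  | add z z' hz hz' =>
    conv_lhs => rw [hz, hz', ← Finset.sum_add_distrib]
    exact Finset.sum_congr rfl fun k _ => by rw [map_add, add_smul]

theorem eq_of_tau_eq [Fact p.Prime] (hS : S.IsPAdic) (hf : IsEtaleCover B f)
    (φ : ∀ i, Triv M μ (E.unit (B i))) {z z' : BC S.tau M.carrier}
    (h : ∀ i, (φ i).tau z = (φ i).tau z') : z = z' := by
  rw [BC.eq_sum_of_isDual S.tau M.homDual.dual z, BC.eq_sum_of_isDual S.tau M.homDual.dual z']
  refine Finset.sum_congr rfl fun k _ => congrArg (· • _) (Subtype.ext ?_)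
  refine E.unit_eq_of_cover hS hf fun i => ?_
  have h1 := (φ i).isCoord_tau.isom (BC.mk S.tau 1 (M.homDual.y k)) z
  rw [h, (φ i).isCoord_tau.isom] at h1
  exact congrArg Subtype.val h1.symm

theorem OrthDisplay.Hom.proj (T : M ⟶ N) (d : ℤ) (m : M.carrier) :
    T.toLinearMap (M.proj d m) = N.proj d (T.toLinearMap m) := by
  classical
  induction m using DirectSum.Decomposition.inductionOn M.grading with
  | zero => simp
  | @homogeneous i m =>
    by_cases h : i = d
    · subst h
      rw [M.proj_of_mem m.2, N.proj_of_mem (T.map_mem _ _ m.2)]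
    · rw [M.proj_of_mem_ne m.2 h, N.proj_of_mem_ne (T.map_mem _ _ m.2) h, map_zero]
  | add a b ha hb => simp only [map_add, ha, hb]

theorem OrthDisplay.Hom.injective (T : M ⟶ N) : Function.Injective T.toLinearMap := by
  rw [injective_iff_map_eq_zero]
  intro m hm
  refine M.eq_zero_of_form fun m' => ?_
  rw [← T.map_form, hm, map_zero, LinearMap.zero_apply]

/-- The coordinates of the source of a morphism given by a trivialization of the target. -/
theorem isCoord_comp_hom {S' : Frame.{u} p} {u : S ⟶ S'} (T : M ⟶ N) (φ : Triv M μ u)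
    (φ' : Triv N μ u) : Submodule.span S'.carrier
      (Set.range fun m => φ'.coord (T.toLinearMap m)) = ⊤ := by
  let ψ : M.carrier →ₛₗ[u.toRingHom] (Fin n → S'.carrier) :=
    { toFun := fun m => φ'.coord (T.toLinearMap m)
      map_add' := fun x y => by rw [map_add, map_add]
      map_smul' := fun a x => by rw [map_smul, map_smulₛₗ] }
  let D := M.homDual
  let g := dyad (fun k => ψ (D.x k)) (fun k => φ.coord (D.y k))
  have hg : ∀ m, g *ᵥ φ.coord m = ψ m := φ.isCoord.dyad_mulVec D.dual
  have hψ : ∀ m m', psi (ψ m) (ψ m') = u.toRingHom (M.form m m') := fun m m' => by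
    rw [← T.map_form]
    exact φ'.isCoord.isom _ _
  have h1 : gᵀ * antidiag n S'.carrier * g = antidiag n S'.carrier := by
    have h2 : ∀ m w, psi (φ.coord m) ((antidiag n S'.carrier *
        (gᵀ * antidiag n S'.carrier * g)) *ᵥ w) =
        psi (φ.coord m) w := by
      intro m w
      have hw : w ∈ Submodule.span _ (Set.range φ.coord) := φ.isCoord.span ▸ Submodule.mem_top
      induction hw using Submodule.span_induction with
      | mem x hx =>
        obtain ⟨m', rfl⟩ := hx
        rw [psi_eq_dotProduct, mulVec_mulVec, ← Matrix.mul_assoc, antidiag_mul_self, Matrix.one_mul,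
          ← psi_mulVec, hg, hg, hψ, φ.isCoord.isom]
      | zero => rw [mulVec_zero]
      | add x y _ _ hx hy => rw [mulVec_add, psi_add_right, psi_add_right, hx, hy]
      | smul a x _ hx => rw [mulVec_smul, psi_smul_right, psi_smul_right, hx]
    have h3 : antidiag n S'.carrier * (gᵀ * antidiag n S'.carrier * g) = 1 := by
      refine matrix_ext_mulVec fun w => psi_right_injective fun w' => ?_
      rw [one_mulVec]
      have hw : w' ∈ Submodule.span _ (Set.range φ.coord) := φ.isCoord.span ▸ Submodule.mem_top
      rw [psi_comm, psi_comm w]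
      induction hw using Submodule.span_induction with
      | mem x hx =>
        obtain ⟨m', rfl⟩ := hx
        exact h2 m' w
      | zero => rw [psi_comm, psi_comm 0, ← psiBilin_apply, ← psiBilin_apply, map_zero, map_zero]
      | add x y _ _ hx hy => rw [psi_add_left, psi_add_left, hx, hy]
      | smul a x _ hx => rw [psi_smul_left, psi_smul_left, hx]
    calc _ = antidiag n S'.carrier * (antidiag n S'.carrier *
          (gᵀ * antidiag n S'.carrier * g)) := by
          rw [← Matrix.mul_assoc (antidiag n S'.carrier) (antidiag n S'.carrier),
            antidiag_mul_self, Matrix.one_mul]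
      _ = _ := by rw [h3, Matrix.mul_one]
  let g' := orthOfMatrix g ((transpose_mul_antidiag_mul_iff g).1 h1)
  have h4 := (φ.isCoord.mulVec g').span
  have h5 : (fun m => φ'.coord (T.toLinearMap m)) =
      mulVecCoord (g' : GL (Fin n) S'.carrier).val φ.coord := funext fun m => (hg m).symm
  rw [h5]
  exact h4

theorem OrthDisplay.Hom.surjective [Fact p.Prime] (hS : S.IsPAdic) (T : M ⟶ N)
    (hf : IsEtaleCover B f)
    (φ : ∀ i, Triv M μ (E.unit (B i))) (φ' : ∀ i, Triv N μ (E.unit (B i))) :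
    Function.Surjective T.toLinearMap := by
  intro z
  obtain ⟨m, hm⟩ := M.form_perfect.2 (N.form z ∘ₗ T.toLinearMap)
  refine ⟨m, eq_of_coord_eq hS hf φ' fun i => psi_right_injective fun w => ?_⟩
  have hw : w ∈ Submodule.span _ (Set.range fun m => (φ' i).coord (T.toLinearMap m)) :=
    isCoord_comp_hom T (φ i) (φ' i) ▸ Submodule.mem_top
  induction hw using Submodule.span_induction with
  | mem x hx =>
    obtain ⟨m', rfl⟩ := hx
    have h1 := LinearMap.congr_fun hm m'
    rw [LinearMap.comp_apply] at h1
    change psi ((φ' i).coord (T.toLinearMap m)) ((φ' i).coord (T.toLinearMap m')) =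
      psi ((φ' i).coord z) ((φ' i).coord (T.toLinearMap m'))
    rw [(φ' i).isCoord.isom, (φ' i).isCoord.isom, T.map_form, h1]
  | zero => rw [← psiBilin_apply, ← psiBilin_apply, map_zero, map_zero]
  | add x y _ _ hx hy => rw [psi_add_right, psi_add_right, hx, hy]
  | smul a x _ hx => rw [psi_smul_right, psi_smul_right, hx]

end JointInjectivity

/-! ### Transport of trivializations -/

section Transport

variable {p n : ℕ} {S S' S'' : Frame.{u} p} {μ : Fin n → ℤ} {M N : OrthDisplay S} {u : S ⟶ S'}

/-- The trivialization of the target of an isomorphism given by a trivialization of the source. -/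
def Triv.transport (T : M ⟶ N) (hT : Function.Bijective T.toLinearMap) (φ : Triv M μ u) :
    Triv N μ u :=
  let e := LinearEquiv.ofBijective T.toLinearMap hT
  have he : ∀ z, T.toLinearMap (e.symm z) = z := fun z => e.apply_symm_apply z
  { coord :=
      { toFun := fun z => φ.coord (e.symm z)
        map_add' := fun x y => by rw [map_add, map_add]
        map_smul' := fun a x => by rw [map_smul, map_smulₛₗ] }
    mem := fun d z hz => by
      refine φ.mem d _ ?_
      have : M.proj d (e.symm z) = e.symm z := hT.1 (by
        rw [OrthDisplay.Hom.proj T, he, N.proj_of_mem hz])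
      rw [← this]
      exact M.proj_mem d _
    isCoord :=
      { isom := fun x y => by
          change psi (φ.coord (e.symm x)) (φ.coord (e.symm y)) = _
          rw [φ.isCoord.isom, ← T.map_form, he, he]
        span := by
          rw [← φ.isCoord.span]
          congr 1
          ext w
          constructor
          · rintro ⟨z, rfl⟩
            exact ⟨e.symm z, rfl⟩
          · rintro ⟨m, rfl⟩
            exact ⟨e m, congrArg φ.coord (e.symm_apply_apply m)⟩ } }

variable {T : M ⟶ N} {hT : Function.Bijective T.toLinearMap}

theorem Triv.transport_coord (φ : Triv M μ u) (m : M.carrier) :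
    (φ.transport T hT).coord (T.toLinearMap m) = φ.coord m :=
  congrArg φ.coord ((LinearEquiv.ofBijective T.toLinearMap hT).symm_apply_apply m)

theorem Triv.eq_transport (φ : Triv M μ u) (φ' : Triv N μ u)
    (h : ∀ m, φ'.coord (T.toLinearMap m) = φ.coord m) : φ' = φ.transport T hT :=
  Triv.ext_apply fun z => by
    obtain ⟨m, rfl⟩ := hT.2 z
    rw [h, Triv.transport_coord]

/-- Compatible trivializations of the source and of the target of a homomorphism. -/
theorem Triv.tau_comp {T : M.carrier →ₗ[S.carrier] N.carrier} {φ : Triv M μ u} {φ' : Triv N μ u}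
    (h : ∀ m, φ'.coord (T m) = φ.coord m) (z : BC S.tau M.carrier) :
    φ'.tau (BC.map S.tau T z) = φ.tau z := by
  induction z using BC.induction with
  | mk b m => rw [BC.map_mk, Triv.tau_mk, Triv.tau_mk, h]
  | zero => rw [map_zero, map_zero, map_zero]
  | add x y hx hy => rw [map_add, map_add, map_add, hx, hy]

theorem Triv.alpha_transport (φ : Triv M μ u) : (φ.transport T hT).alpha = φ.alpha := by
  refine Triv.alpha_eq _ fun z => ?_
  obtain ⟨m, rfl⟩ := hT.2 z
  rw [Triv.transport_coord, Triv.alpha_mulVec, T.map_F, Triv.tau_comp (φ := φ)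
    (fun m => Triv.transport_coord φ m)]

end Transport

/-! ### The functor from orthogonal displays to `O(ψ)`-displays -/

section Functor

open Matrix

variable {p n : ℕ} [Fact p.Prime] {S : Frame.{u} p} (E : EtaleBaseChange S) {μ : Fin n → ℤ}

theorem OrthDisplay.Hom.bijective (hp : 3 ≤ p) (hS : S.IsPAdic) (hμ : ∀ i, μ i + μ (Fin.rev i) = 0)
    {M N : OrthDisplayOfType S μ} (T : M ⟶ N) : Function.Bijective T.hom.toLinearMap := by
  refine ⟨OrthDisplay.Hom.injective T.hom, ?_⟩
  let E := etaleBaseChange hS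
  have h := exists_etale_cover (fun A => Nonempty (Triv M.obj μ (E.unit A)) ∧
    Nonempty (Triv N.obj μ (E.unit A))) fun q => by
      obtain ⟨A, ⟨φ⟩, Q, hQ⟩ := exists_triv_neighbourhood hp E hμ M.obj M.property q
      obtain ⟨A', ⟨φ'⟩, Q', hQ'⟩ := exists_triv_neighbourhood hp E hμ N.obj N.property q
      obtain ⟨C, c, c', H⟩ := EtAlg.exists_pushout (EtAlg.fromSelf A) (EtAlg.fromSelf A')
      obtain ⟨P, hP⟩ := H.exists_prime Q Q' (hQ.trans hQ'.symm)
      refine ⟨C, ⟨⟨φ.map (E.frame.map c) (E.unit_map c)⟩, ⟨φ'.map (E.frame.map c')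
          (E.unit_map c')⟩⟩,
        P, ?_⟩
      rw [← hQ, ← hP]
      have h1 : algebraMap S.residue C.obj = (EtAlg.algHom c).toRingHom.comp
          (algebraMap S.residue A.obj) := (EtAlg.algHom c).comp_algebraMap.symm
      rw [h1]
      rfl
  obtain ⟨ι, B, f, hf, hB⟩ := h
  exact OrthDisplay.Hom.surjective hS T.hom hf (fun i => (hB i).1.some) fun i => (hB i).2.some

/-- The functor which sends an orthogonal display to the torsor of its trivializations. -/
def trivFunctor (hp : 3 ≤ p) (hS : S.IsPAdic) (hμ : ∀ i, μ i + μ (Fin.rev i) = 0) :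
    OrthDisplayOfType S μ ⥤ OrthGroupDisplay E μ where
  obj M := trivDisplay hμ M.obj (locallyTrivial_of_hasType hp E hμ M.obj M.property)
  map {M N} T :=
    { hom :=
        { app := fun A => TypeCat.ofHom fun φ : Triv M.obj μ (E.unit A) =>
            φ.transport T.hom (OrthDisplay.Hom.bijective hp hS hμ T)
          naturality := fun A B f => ConcreteCategory.hom_ext _ _ fun φ => rfl }
      hom_act := fun A φ h => rfl
      hom_alpha := fun A φ => Triv.alpha_transport φ }
  map_id M := by
    refine OrthGroupDisplay.Hom.ext (NatTrans.ext (funext fun A =>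
      ConcreteCategory.hom_ext _ _ fun φ => ?_))
    exact (Triv.eq_transport _ _ fun m => rfl).symm
  map_comp T T' := by
    refine OrthGroupDisplay.Hom.ext (NatTrans.ext (funext fun A =>
      ConcreteCategory.hom_ext _ _ fun φ => ?_))
    refine (Triv.eq_transport _ _ fun m => ?_).symm
    exact (Triv.transport_coord _ _).trans (Triv.transport_coord _ _)

theorem trivFunctor_map_coord (hp : 3 ≤ p) (hS : S.IsPAdic) (hμ : ∀ i, μ i + μ (Fin.rev i) = 0)
    {M N : OrthDisplayOfType S μ} (T : M ⟶ N) {A : EtAlg S.residue} (φ : Triv M.obj μ (E.unit A))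
    (m : M.obj.carrier) :
    Triv.coord (((trivFunctor E hp hS hμ).map T).hom.app A φ) (T.hom.toLinearMap m) = φ.coord m :=
  Triv.transport_coord φ m

theorem faithful_trivFunctor (hp : 3 ≤ p) (hS : S.IsPAdic) (hμ : ∀ i, μ i + μ (Fin.rev i) = 0) :
    (trivFunctor E hp hS hμ).Faithful where
  map_injective {M N} T T' h := by
    obtain ⟨ι, B, f, hf, hB⟩ := locallyTrivial_of_hasType hp E hμ M.obj M.property
    refine ObjectProperty.hom_ext _ (OrthDisplay.Hom.ext (LinearMap.ext fun m => ?_))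
    refine eq_of_coord_eq (μ := μ) hS hf (fun i =>
      ((trivFunctor E hp hS hμ).map T).hom.app (B i) (hB i).some) fun i => ?_
    refine (trivFunctor_map_coord E hp hS hμ T (hB i).some m).trans ?_
    rw [h]
    exact (trivFunctor_map_coord E hp hS hμ T' (hB i).some m).symm

end Functor

/-! ### Descent of homomorphisms of orthogonal displays -/

section HomDescent

open Matrix

variable {p n : ℕ} [Fact p.Prime] {S : Frame.{u} p} {E : EtaleBaseChange S} {μ : Fin n → ℤ}
  {M N : OrthDisplay S} {ι : Type} {B : ι → EtAlg S.residue}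
  {f : ∀ i, EtAlg.self S.residue ⟶ B i}

theorem exists_hom_of_triv (hS : S.IsPAdic) (hμ : ∀ i, μ i + μ (Fin.rev i) = 0)
    (hf : IsEtaleCover B f)
    (φ : ∀ i, Triv M μ (E.unit (B i))) (φ' : ∀ i, Triv N μ (E.unit (B i)))
    (hα : ∀ i, (φ' i).alpha = (φ i).alpha)
    (hφ : ∀ m m', E.Compatible f fun i => psi ((φ' i).coord m') ((φ i).coord m)) :
    ∃ T : M ⟶ N, ∀ i m, (φ' i).coord (T.toLinearMap m) = (φ i).coord m := by
  let D := N.homDual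
  choose s hs using fun m k => E.exists_unit_glue hS hf (hφ m (D.y k))
  have hT : ∀ i m, (φ' i).coord (∑ k, s m k • D.x k) = (φ i).coord m := fun i m => by
    conv_rhs => rw [← one_mulVec ((φ i).coord m), ← (φ' i).isCoord.dyad_self D.dual, dyad_mulVec]
    rw [map_sum]
    exact Finset.sum_congr rfl fun k _ => by rw [map_smulₛₗ, hs]
  let T : M.carrier →ₗ[S.carrier] N.carrier :=
    { toFun := fun m => ∑ k, s m k • D.x k
      map_add' := fun m m' => eq_of_coord_eq hS hf φ' fun i => by
        rw [hT, map_add, map_add, hT, hT]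
      map_smul' := fun a m => eq_of_coord_eq hS hf φ' fun i => by
        rw [hT, map_smulₛₗ, map_smulₛₗ, hT, RingHom.id_apply] }
  have hT' : ∀ i m, (φ' i).coord (T m) = (φ i).coord m := hT
  refine ⟨⟨T, fun d m hm => ?_, fun m => ?_, fun m m' => ?_⟩, hT'⟩
  · change ∑ k, s m k • D.x k ∈ N.grading d
    refine sum_mem fun k _ => ?_
    have h1 : s m k ∈ S.grading (d - D.deg k) := by
      refine E.unit_mem_grading_of_cover hS hf fun i => ?_
      rw [hs]
      have := psi_mem_grading hμ ((φ' i).mem _ _ (D.y_mem k)) ((φ i).mem _ _ hm)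
      rwa [neg_add_eq_sub] at this
    have h2 := SetLike.GradedSMul.smul_mem h1 (D.x_mem k)
    rwa [vadd_eq_add, sub_add_cancel] at h2
  · refine eq_of_tau_eq hS hf φ' fun i => ?_
    rw [← Triv.alpha_mulVec, hT', Triv.tau_comp (hT' i), ← Triv.alpha_mulVec, hα]
  · refine E.unit_eq_of_cover hS hf fun i => ?_
    rw [← (φ' i).isCoord.isom, ← (φ i).isCoord.isom, hT', hT']

end HomDescent

section Full

open Matrix

variable {p n : ℕ} [Fact p.Prime] {S : Frame.{u} p} (E : EtaleBaseChange S) {μ : Fin n → ℤ}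

theorem full_trivFunctor (hp : 3 ≤ p) (hS : S.IsPAdic) (hμ : ∀ i, μ i + μ (Fin.rev i) = 0) :
    (trivFunctor E hp hS hμ).Full where
  map_surjective {M N} ω := by
    obtain ⟨ι, B, f, hf, hB⟩ := locallyTrivial_of_hasType hp E hμ M.obj M.property
    let P := (trivFunctor E hp hS hμ).obj M
    let q (i : ι) : P.sheaf.obj (B i) := (hB i).some
    let φ (i : ι) : Triv M.obj μ (E.unit (B i)) := q i
    let φ' (i : ι) : Triv N.obj μ (E.unit (B i)) := ω.hom.app (B i) (q i)
    have h : ∀ m m', E.Compatible f fun i => psi ((φ' i).coord m') ((φ i).coord m) := by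
      intro m m' i j C g h hgh
      obtain ⟨a, ha⟩ := P.exists_act_eq (P.sheaf.map g (q i)) (P.sheaf.map h (q j))
      have ha' := ω.hom_act C (P.sheaf.map g (q i)) a
      rw [ha, NatTrans.naturality_apply, NatTrans.naturality_apply] at ha'
      have h1 : (E.frame.map h).toRingHom ∘ (φ j).coord m =
          (a⁻¹).1.val *ᵥ ((E.frame.map g).toRingHom ∘ (φ i).coord m) :=
        (congrArg (fun φ : Triv M.obj μ (E.unit C) => φ.coord m) ha).symm
      have h2 : (E.frame.map h).toRingHom ∘ (φ' j).coord m' =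
          (a⁻¹).1.val *ᵥ ((E.frame.map g).toRingHom ∘ (φ' i).coord m') :=
        congrArg (fun φ : Triv N.obj μ (E.unit C) => φ.coord m') ha'
      rw [← psi_map, ← psi_map, h1, h2]
      exact (psi_orthGroup (Triv.toOrth a⁻¹) _ _).symm
    obtain ⟨T, hT⟩ := exists_hom_of_triv hS hμ hf φ φ' (fun i => ω.hom_alpha (B i) (φ i)) h
    refine ⟨ObjectProperty.homMk T, OrthGroupDisplay.hom_ext_of_cover hf φ fun i => ?_⟩
    exact (Triv.eq_transport (φ i) (φ' i) (hT i)).symm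

end Full

/-! ### Sections over a single covering algebra -/

section SingleCover

variable {R : Type u} [CommRing R]

theorem EtAlg.exists_desc {A C D P : EtAlg R} {c : A ⟶ C} {d : A ⟶ D} {c' : C ⟶ P} {d' : D ⟶ P}
    (H : RingPushout (EtAlg.algHom c).toRingHom (EtAlg.algHom d).toRingHom
      (EtAlg.algHom c').toRingHom (EtAlg.algHom d').toRingHom) {X : EtAlg R} (a : C ⟶ X) (b : D ⟶ X)
    (hab : c ≫ a = d ≫ b) : ∃ w : P ⟶ X, c' ≫ w = a ∧ d' ≫ w = b := by
  obtain ⟨w, hw, hw'⟩ := H.exists_desc X.obj (EtAlg.algHom a).toRingHom (EtAlg.algHom b).toRingHom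
    (congrArg (fun f => (EtAlg.algHom f).toRingHom) hab)
  let w' : P.obj →ₐ[R] X.obj :=
    { w with
      commutes' := fun r => by
        have h1 := (EtAlg.algHom c').commutes r
        have h2 := (EtAlg.algHom a).commutes r
        rw [← h1, ← h2]
        exact RingHom.congr_fun hw _ }
  refine ⟨ObjectProperty.homMk (CommAlgCat.ofHom w'), ?_, ?_⟩
  · exact ObjectProperty.hom_ext _ (CommAlgCat.hom_ext (AlgHom.ext fun x => RingHom.congr_fun hw x))
  · exact ObjectProperty.hom_ext _ (CommAlgCat.hom_ext (AlgHom.ext fun x => RingHom.congr_fun hw'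
    x))

theorem IsEtaleSheaf.subsingleton {Q : EtAlg R ⥤ Type u} (hQ : IsEtaleSheaf Q) {C : EtAlg R}
    (hC : Subsingleton C.obj) (x y : Q.obj C) : x = y := by
  obtain ⟨z, -, hz⟩ := hQ (A := C) (ι := Empty) Empty.elim (fun i => i.elim)
    ⟨inferInstance, fun q => (q.isPrime.ne_top (Ideal.ext fun a => by
      rw [Subsingleton.elim a 0]; simp)).elim⟩ (fun i => i.elim) fun i => i.elim
  rw [hz x fun i => i.elim, hz y fun i => i.elim]

/-- The product of a finite family of étale algebras. -/
def EtAlg.pi {ι : Type} [Finite ι] (B : ι → EtAlg R) : EtAlg R :=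
  have := fun i => (B i).property
  ⟨CommAlgCat.of R ((i : ι) → (B i).obj), inferInstanceAs (Algebra.Etale R ((i : ι) → (B i).obj))⟩

/-- The projections of the product of a finite family of étale algebras. -/
def EtAlg.piProj {ι : Type} [Finite ι] (B : ι → EtAlg R) (i : ι) : EtAlg.pi B ⟶ B i :=
  ObjectProperty.homMk (CommAlgCat.ofHom (Pi.evalAlgHom R (fun i => (B i).obj) i))

theorem EtAlg.isEtaleCover_piProj {ι : Type} [Finite ι] (B : ι → EtAlg R) :
    IsEtaleCover B (EtAlg.piProj B) := by
  refine ⟨inferInstance, fun q => ?_⟩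
  obtain ⟨⟨i, q'⟩, h⟩ := (PrimeSpectrum.sigmaToPi_bijective fun i => (B i).obj).2 q
  exact ⟨i, q', h⟩

theorem IsEtaleCover.pi {ι : Type} {B : ι → EtAlg R} {f : ∀ i, EtAlg.self R ⟶ B i} [Finite ι]
    (hf : IsEtaleCover B f) :
    IsEtaleCover (fun _ : Unit => EtAlg.pi B) (fun _ => EtAlg.fromSelf (EtAlg.pi B)) := by
  refine ⟨inferInstance, fun q => ?_⟩
  obtain ⟨i, q', h⟩ := hf.2 q
  refine ⟨(), PrimeSpectrum.comap (EtAlg.algHom (EtAlg.piProj B i)).toRingHom q', ?_⟩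
  rw [← h, EtAlg.self_hom_ext (f i) (EtAlg.fromSelf (EtAlg.pi B) ≫ EtAlg.piProj B i)]
  rfl

theorem IsEtaleSheaf.nonempty_pi {Q : EtAlg R ⥤ Type u} (hQ : IsEtaleSheaf Q) {ι : Type} [Finite ι]
    {B : ι → EtAlg R} (hB : ∀ i, Nonempty (Q.obj (B i))) : Nonempty (Q.obj (EtAlg.pi B)) := by
  classical
  obtain ⟨y, -, -⟩ := hQ B (EtAlg.piProj B) (EtAlg.isEtaleCover_piProj B) (fun i => (hB i).some)
    fun i j C g h hgh => by
      have h1 : ∀ x : ∀ i, (B i).obj, EtAlg.algHom g (x i) = EtAlg.algHom h (x j) := fun x =>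
        congrArg (fun f : EtAlg.pi B ⟶ C => EtAlg.algHom f x) hgh
      by_cases hij : i = j
      · subst hij
        have h2 : g = h := ObjectProperty.hom_ext _ (CommAlgCat.hom_ext (AlgHom.ext fun x => by
          have := h1 (Pi.single i x)
          rwa [Pi.single_eq_same] at this))
        rw [h2]
      · refine hQ.subsingleton (subsingleton_of_zero_eq_one ?_) _ _
        have := h1 (Pi.single i 1)
        rw [Pi.single_eq_same, Pi.single_eq_of_ne (Ne.symm hij), map_one, map_zero] at this
        exact this.symm
  exact ⟨y⟩

theorem EtaleTorsor.exists_section {H : EtAlg R ⥤ GrpCat.{u}} (Q : EtaleTorsor H) :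
    ∃ B : EtAlg R, B.IsCover ∧
      Nonempty (Q.sheaf.obj B) := by
  obtain ⟨ι, B, f, hf, hB⟩ := Q.locally_nonempty
  have := hf.1
  exact ⟨EtAlg.pi B, hf.pi, Q.isSheaf.nonempty_pi hB⟩

end SingleCover

/-! ### Descent of vectors and matrices -/

section VectorDescent

open Matrix

variable {R C : Type u} [CommRing R] [CommRing C] [Algebra R C]

theorem liftBaseChange_compLeft_bijective {X Y : Type u} [AddCommGroup X] [AddCommGroup Y]
    [Module R X] [Module R Y] [Module C Y] [IsScalarTower R C Y] {l : X →ₗ[R] Y}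
    (hl : Function.Bijective (l.liftBaseChange C)) (ι : Type) [Finite ι] :
    Function.Bijective ((l.compLeft ι).liftBaseChange C) := by
  classical
  cases nonempty_fintype ι
  have h : ((l.compLeft ι).liftBaseChange C : C ⊗[R] (ι → X) → (ι → Y)) =
      (fun z i => l.liftBaseChange C (z i)) ∘ TensorProduct.piRight R C C (fun _ : ι => X) := by
    funext z
    induction z using TensorProduct.induction_on with
    | zero => funext i; simp
    | add x y hx hy =>
      rw [map_add, hx, hy]
      funext i
      simp only [Function.comp_apply, map_add, Pi.add_apply]
    | tmul c x =>
      funext i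
      simp [TensorProduct.piRight_apply, TensorProduct.piRightHom_tmul]
  rw [h]
  refine Function.Bijective.comp ?_ (LinearEquiv.bijective _)
  exact ⟨fun z z' hz => funext fun i => hl.1 (congrFun hz i), fun y => by
    choose x hx using fun i => hl.2 (y i)
    exact ⟨x, funext hx⟩⟩

theorem liftBaseChange_comp_bijective {X Y Z : Type u} [AddCommGroup X] [AddCommGroup Y]
    [Module R X] [Module R Y] [Module C Y] [IsScalarTower R C Y] {l : X →ₗ[R] Y}
    [AddCommGroup Z] [Module R Z] [Module C Z] [IsScalarTower R C Z]
    (hl : Function.Bijective (l.liftBaseChange C)) (e : Y ≃ₗ[C] Z) {l' : X →ₗ[R] Z}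
    (hl' : ∀ x, l' x = e (l x)) : Function.Bijective (l'.liftBaseChange C) := by
  have h : l'.liftBaseChange C = e.toLinearMap ∘ₗ l.liftBaseChange C := by
    ext x
    simp [hl']
  rw [h]
  exact e.bijective.comp hl

end VectorDescent

section OrthDescent

open Matrix

variable {R C : Type u} [CommRing R] [CommRing C] [Algebra R C] {n : ℕ}
  {W W₂ W₃ : Type u} [CommRing W] [CommRing W₂] [CommRing W₃] [Algebra R W] [Algebra C W]
  [IsScalarTower R C W] [Algebra R W₂] [Algebra C W₂] [IsScalarTower R C W₂] [Algebra R W₃]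
  [Algebra C W₃] [IsScalarTower R C W₃] {l : W →ₐ[C] W₂} {r : W →ₐ[R] W₂} {r' : W₂ →ₐ[R] W₃}
  {π₁ π₂ : W₂ →ₐ[C] W₃}

/-- The vectors that satisfy the descent condition given by an orthogonal matrix. -/
def descVec (l r : W →+* W₂) (g : orthGroup n W₂) : Set (Fin n → W) :=
  {w | l ∘ w = (g : GL (Fin n) W₂).val *ᵥ (r ∘ w)}

/-- The map `w ↦ g r(w)`. -/
def twistVec (r : W →ₐ[R] W₂) (g : orthGroup n W₂) : (Fin n → W) →ₗ[R] (Fin n → W₂) where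
  toFun w := (g : GL (Fin n) W₂).val *ᵥ (r ∘ w)
  map_add' w w' := by
    rw [← mulVec_add]
    exact congrArg _ (funext fun j => map_add r _ _)
  map_smul' a w := by
    rw [RingHom.id_apply, ← mulVec_smul]
    exact congrArg _ (funext fun j => map_smul r _ _)

variable (C) in
/-- The linear automorphism given by an orthogonal matrix. -/
def mulVecEquiv (g : orthGroup n W₂) : (Fin n → W₂) ≃ₗ[C] (Fin n → W₂) where
  toFun w := (g : GL (Fin n) W₂).val *ᵥ w
  map_add' _ _ := mulVec_add _ _ _
  map_smul' _ _ := mulVec_smul _ _ _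
  invFun w := ((g⁻¹ : orthGroup n W₂) : GL (Fin n) W₂).val *ᵥ w
  left_inv w := orthGroup_inv_mulVec g w
  right_inv w := orthGroup_mulVec_inv g w

theorem twistVec_bijective (hr : Function.Bijective (r.toLinearMap.liftBaseChange C))
    (g : orthGroup n W₂) : Function.Bijective ((twistVec r g).liftBaseChange C) :=
  liftBaseChange_comp_bijective (liftBaseChange_compLeft_bijective hr (Fin n)) (mulVecEquiv C g)
    fun _ => rfl

theorem span_descVec [Module.Flat R C] (hr : Function.Bijective (r.toLinearMap.liftBaseChange C))
    (hr' : Function.Bijective (r'.toLinearMap.liftBaseChange C)) (hl : Function.Injective l)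
    (h1 : ∀ w, π₁ (l w) = π₂ (l w)) (h2 : ∀ w, π₁ (r w) = r' (l w))
    (h3 : ∀ w, π₂ (r w) = r' (r w)) (g : orthGroup n W₂)
    (hg : orthGroup.map π₂.toRingHom g = orthGroup.map π₁.toRingHom g *
      orthGroup.map r'.toRingHom g) :
    Submodule.span C (descVec l.toRingHom r.toRingHom g) = ⊤ := by
  refine span_eq_top_of_cocycle (a := l.toLinearMap.compLeft (Fin n)) (b := twistVec r g)
    (β := twistVec r' (orthGroup.map π₁.toRingHom g)) (π₁ := π₁.toLinearMap.compLeft (Fin n))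
    (π₂ := π₂.toLinearMap.compLeft (Fin n)) (twistVec_bijective hr g).2
    (twistVec_bijective hr' _).1 (fun v w h => funext fun j => hl (congrFun h j))
    (fun w => funext fun j => h1 _) (fun w => ?_) fun w => ?_
  · refine (comp_mulVec π₁.toRingHom _ _).trans ?_
    change _ = ((orthGroup.map π₁.toRingHom g : GL (Fin n) W₃).val) *ᵥ (r' ∘ l ∘ w)
    rw [orthGroup_map_val]
    exact congrArg _ (funext fun j => h2 _)
  · refine (comp_mulVec π₂.toRingHom _ _).trans ?_
    change _ = ((orthGroup.map π₁.toRingHom g : GL (Fin n) W₃).val) *ᵥ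
      (r'.toRingHom ∘ ((g : GL (Fin n) W₂).val *ᵥ (r ∘ w)))
    rw [comp_mulVec, ← orthGroup_map_val, ← orthGroup_map_val, mulVec_mulVec, hg, orthGroup_mul_val]
    exact congrArg _ (funext fun j => h3 _)

theorem mem_of_span_descVec [Module.FaithfullyFlat R C]
    (hr : Function.Bijective (r.toLinearMap.liftBaseChange C)) (g : orthGroup n W₂)
    (N : Submodule R (Fin n → W)) (hN : (N : Set (Fin n → W)) ⊆ descVec l.toRingHom r.toRingHom g)
    (hs : Submodule.span C (N : Set (Fin n → W)) = ⊤) {w : Fin n → W}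
    (hw : w ∈ descVec l.toRingHom r.toRingHom g) : w ∈ N :=
  mem_of_span_eq_top (a := l.toLinearMap.compLeft (Fin n)) (twistVec_bijective hr g).1 N
    (fun _ h => hN h) hs hw

/-- The endomorphism `z ↦ ψ(w, z) v`. -/
def dyadOne (v w : Fin n → W) : Matrix (Fin n) (Fin n) W := Matrix.of fun i j => v i * w (Fin.rev j)

theorem dyadOne_mulVec (v w z : Fin n → W) : dyadOne v w *ᵥ z = psi w z • v := by
  have h : dyadOne v w = dyad (fun _ : Fin 1 => v) fun _ => w := by
    ext i j
    simp [dyadOne, dyad]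
  rw [h, dyad_mulVec, Fin.sum_univ_one]

theorem map_dyadOne (f : W →+* W₂) (v w : Fin n → W) :
    (dyadOne v w).map f = dyadOne (f ∘ v) (f ∘ w) := by
  ext i j
  simp [dyadOne]

/-- The map `X ↦ g r(X) g⁻¹`. -/
def twistMat (r : W →ₐ[R] W₂) (g : orthGroup n W₂) :
    Matrix (Fin n) (Fin n) W →ₗ[R] Matrix (Fin n) (Fin n) W₂ where
  toFun X := (g : GL (Fin n) W₂).val * X.map r * ((g⁻¹ : orthGroup n W₂) : GL (Fin n) W₂).val
  map_add' X Y := by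
    rw [← Matrix.add_mul, ← Matrix.mul_add, Matrix.map_add _ (map_add r)]
  map_smul' a X := by
    rw [RingHom.id_apply, ← Matrix.smul_mul, ← Matrix.mul_smul]
    congr 2
    ext i j
    exact map_smul r _ _

variable (C) in
/-- The linear automorphism of the space of matrices given by conjugation. -/
def conjEquiv (g : orthGroup n W₂) : Matrix (Fin n) (Fin n) W₂ ≃ₗ[C] Matrix (Fin n) (Fin n) W₂ where
  toFun X := (g : GL (Fin n) W₂).val * X * ((g⁻¹ : orthGroup n W₂) : GL (Fin n) W₂).val
  map_add' X Y := by rw [← Matrix.add_mul, ← Matrix.mul_add]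
  map_smul' a X := by rw [RingHom.id_apply, ← Matrix.smul_mul, ← Matrix.mul_smul]
  invFun X := ((g⁻¹ : orthGroup n W₂) : GL (Fin n) W₂).val * X * (g : GL (Fin n) W₂).val
  left_inv X := by
    have h : ((g⁻¹ : orthGroup n W₂) : GL (Fin n) W₂).val * (g : GL (Fin n) W₂).val = 1 :=
      (g : GL (Fin n) W₂).inv_mul
    beta_reduce
    rw [Matrix.mul_assoc, Matrix.mul_assoc, h, Matrix.mul_one, ← Matrix.mul_assoc, h,
      Matrix.one_mul]
  right_inv X := by
    have h : (g : GL (Fin n) W₂).val * ((g⁻¹ : orthGroup n W₂) : GL (Fin n) W₂).val = 1 :=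
      (g : GL (Fin n) W₂).mul_inv
    beta_reduce
    rw [Matrix.mul_assoc, Matrix.mul_assoc, h, Matrix.mul_one, ← Matrix.mul_assoc, h,
      Matrix.one_mul]

theorem twistMat_bijective (hr : Function.Bijective (r.toLinearMap.liftBaseChange C))
    (g : orthGroup n W₂) : Function.Bijective ((twistMat r g).liftBaseChange C) :=
  liftBaseChange_comp_bijective (l := (r.toLinearMap.compLeft (Fin n)).compLeft (Fin n))
    (liftBaseChange_compLeft_bijective (liftBaseChange_compLeft_bijective hr (Fin n)) (Fin n))
    (conjEquiv C g) fun _ => rfl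

theorem one_mem_span_dyadOne [Module.FaithfullyFlat R C]
    (hr : Function.Bijective (r.toLinearMap.liftBaseChange C)) (g : orthGroup n W₂)
    {H : Set (Fin n → W)} (hH : H ⊆ descVec l.toRingHom r.toRingHom g)
    (hs : Submodule.span C H = ⊤) :
    (1 : Matrix (Fin n) (Fin n) W) ∈ Submodule.span R (Set.image2 dyadOne H H) := by
  refine mem_of_span_eq_top (a := l.toLinearMap.mapMatrix)
    (b := twistMat r g) (twistMat_bijective hr g).1 _ (fun X hX => ?_) ?_ ?_
  · induction hX using Submodule.span_induction with
    | mem X hX =>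
      obtain ⟨v, hv, w, hw, rfl⟩ := hX
      refine matrix_ext_mulVec fun z => ?_
      change (dyadOne v w).map l.toRingHom *ᵥ z = ((g : GL (Fin n) W₂).val *
        (dyadOne v w).map r.toRingHom * ((g⁻¹ : orthGroup n W₂) : GL (Fin n) W₂).val) *ᵥ z
      rw [map_dyadOne, map_dyadOne, dyadOne_mulVec, ← mulVec_mulVec, ← mulVec_mulVec,
        dyadOne_mulVec, mulVec_smul, ← psi_orthGroup g (r.toRingHom ∘ w), orthGroup_mulVec_inv,
          ← hH hw, ← hH hv]
    | zero => rw [map_zero, map_zero]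
    | add X Y _ _ hX hY => rw [map_add, map_add, hX, hY]
    | smul a X _ hX =>
      rw [(twistMat r g).map_smul, ← hX]
      exact (l.toLinearMap.mapMatrix.restrictScalars R).map_smul a X
  · rw [eq_top_iff]
    rintro X -
    let D : (Fin n → W) →ₗ[C] (Fin n → W) →ₗ[C] Matrix (Fin n) (Fin n) W :=
      LinearMap.mk₂ C dyadOne (fun v v' w => by ext i j; simp [dyadOne, add_mul])
        (fun c v w => by ext i j; simp [dyadOne])
        (fun v w w' => by ext i j; simp [dyadOne, mul_add])
        (fun c v w => by ext i j; simp [dyadOne])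
    have h1 : ∀ v w, dyadOne v w ∈ Submodule.span C (Set.image2 dyadOne H H) := fun v w => by
      have h2 := Submodule.map₂_span_span C D H H
      have h3 : D v w ∈ Submodule.map₂ D (Submodule.span C H) (Submodule.span C H) :=
        Submodule.apply_mem_map₂ D (hs ▸ Submodule.mem_top) (hs ▸ Submodule.mem_top)
      rw [h2] at h3
      exact h3
    have h2 : X = ∑ j, dyadOne (fun i => X i j) (Pi.single (Fin.rev j) 1) := by
      ext i j
      rw [Matrix.sum_apply, Finset.sum_eq_single j]
      · simp [dyadOne]
      · intro k _ hk
        have : Fin.rev j ≠ Fin.rev k := fun h => hk (Fin.rev_injective h).symm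
        simp [dyadOne, Pi.single_eq_of_ne this]
      · simp
    rw [h2]
    exact sum_mem fun j _ => Submodule.span_mono Submodule.subset_span (h1 _ _)
  · change (1 : Matrix (Fin n) (Fin n) W).map l = (g : GL (Fin n) W₂).val *
      (1 : Matrix (Fin n) (Fin n) W).map r * ((g⁻¹ : orthGroup n W₂) : GL (Fin n) W₂).val
    rw [Matrix.map_one _ (map_zero l) (map_one l), Matrix.map_one _ (map_zero r) (map_one r),
      Matrix.mul_one]
    exact (g : GL (Fin n) W₂).mul_inv.symm

end OrthDescent

section RingDescent

open Matrix

variable {R C W W₂ W₃ : Type u} [CommRing R] [CommRing C] [CommRing W] [CommRing W₂] [CommRing W₃]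
  {n : ℕ} {rC : R →+* C} {cW : C →+* W} {l r : W →+* W₂} {l' : W →+* W₃} {r' π₁ π₂ : W₂ →+* W₃}

theorem comp_add (f : W →+* W₂) (v w : Fin n → W) : f ∘ (v + w) = f ∘ v + f ∘ w :=
  funext fun _ => map_add f _ _

theorem comp_smul (f : W →+* W₂) (a : W) (v : Fin n → W) : f ∘ (a • v) = f a • (f ∘ v) :=
  funext fun _ => map_mul f _ _

theorem zero_mem_descVec (g : orthGroup n W₂) : (0 : Fin n → W) ∈ descVec l r g := by
  have h : ∀ f : W →+* W₂, f ∘ (0 : Fin n → W) = 0 := fun f => funext fun _ => map_zero f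
  change l ∘ (0 : Fin n → W) = _ *ᵥ (r ∘ (0 : Fin n → W))
  rw [h, h, mulVec_zero]

theorem add_mem_descVec {g : orthGroup n W₂} {v w : Fin n → W} (hv : v ∈ descVec l r g)
    (hw : w ∈ descVec l r g) : v + w ∈ descVec l r g := by
  change l ∘ (v + w) = _ *ᵥ (r ∘ (v + w))
  rw [comp_add, comp_add, mulVec_add, hv, hw]

theorem smul_mem_descVec {g : orthGroup n W₂} {a : W} (ha : l a = r a) {v : Fin n → W}
    (hv : v ∈ descVec l r g) : a • v ∈ descVec l r g := by
  change l ∘ (a • v) = _ *ᵥ (r ∘ (a • v))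
  rw [comp_smul, comp_smul, mulVec_smul, hv, ha]

/-- The vectors over `W` are generated by a set of vectors under addition and under multiplication
by elements of `C`. -/
def GeneratedBy (cW : C →+* W) (H : Set (Fin n → W)) : Prop :=
  AddSubgroup.closure {v | ∃ c, ∃ w ∈ H, v = cW c • w} = ⊤

theorem GeneratedBy.of_subset {H H' : Set (Fin n → W)} (hH : GeneratedBy cW H)
    (h : ∀ w ∈ H, w ∈ AddSubgroup.closure H') : GeneratedBy cW H' := by
  rw [GeneratedBy, eq_top_iff, ← hH, AddSubgroup.closure_le]
  rintro _ ⟨c, w, hw, rfl⟩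
  have hw' := h w hw
  clear hw
  induction hw' using AddSubgroup.closure_induction with
  | mem x hx => exact AddSubgroup.subset_closure ⟨c, x, hx, rfl⟩
  | zero => rw [smul_zero]; exact zero_mem _
  | add x y _ _ hx hy => rw [smul_add]; exact add_mem hx hy
  | neg x _ hx => rw [smul_neg]; exact neg_mem hx

theorem generatedBy_iff (H : Set (Fin n → W)) : GeneratedBy cW H ↔
    letI := cW.toAlgebra
    Submodule.span C H = ⊤ := by
  let _ := cW.toAlgebra
  constructor
  · intro h
    have h1 : (⊤ : AddSubgroup (Fin n → W)) ≤ (Submodule.span C H).toAddSubgroup := by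
      rw [← show _ = (⊤ : AddSubgroup (Fin n → W)) from h, AddSubgroup.closure_le]
      rintro _ ⟨c, w, hw, rfl⟩
      exact Submodule.smul_mem _ c (Submodule.subset_span hw)
    exact eq_top_iff.2 fun v _ => h1 (AddSubgroup.mem_top v)
  · intro h
    rw [GeneratedBy, eq_top_iff]
    rintro v -
    have hv : v ∈ Submodule.span C H := by rw [h]; trivial
    rw [Submodule.mem_span_set'] at hv
    obtain ⟨N, c, x, rfl⟩ := hv
    exact sum_mem fun i _ => AddSubgroup.subset_closure ⟨c i, x i, (x i).2, rfl⟩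

theorem generatedBy_descVec (hflat : rC.Flat) (H₂ : RingPushout rC (cW.comp rC) (l.comp cW) r)
    (H₃ : RingPushout rC ((l.comp cW).comp rC) (l'.comp cW) r') (hl : Function.Injective l)
    (e₁ : π₁.comp l = l') (e₂ : π₂.comp l = l') (e₃ : π₁.comp r = r'.comp l)
    (e₄ : π₂.comp r = r'.comp r) (g : orthGroup n W₂)
    (hg : orthGroup.map π₂ g = orthGroup.map π₁ g * orthGroup.map r' g) :
    GeneratedBy cW (descVec l r g) := by
  let _ := rC.toAlgebra
  let _ := cW.toAlgebra
  let _ := (cW.comp rC).toAlgebra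
  let _ := (l.comp cW).toAlgebra
  let _ := ((l.comp cW).comp rC).toAlgebra
  let _ := (l'.comp cW).toAlgebra
  let _ := ((l'.comp cW).comp rC).toAlgebra
  have : IsScalarTower R C W := IsScalarTower.of_algebraMap_eq fun _ => rfl
  have : IsScalarTower R C W₂ := IsScalarTower.of_algebraMap_eq fun _ => rfl
  have : IsScalarTower R C W₃ := IsScalarTower.of_algebraMap_eq fun _ => rfl
  have : Module.Flat R C := hflat
  let aℓ : W →ₐ[C] W₂ := { l with commutes' := fun _ => rfl }
  let ar : W →ₐ[R] W₂ := { r with commutes' := fun a => (RingHom.congr_fun H₂.comm a).symm }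
  let ar' : W₂ →ₐ[R] W₃ := { r' with commutes' := fun a => (RingHom.congr_fun H₃.comm a).symm }
  let aπ₁ : W₂ →ₐ[C] W₃ := { π₁ with commutes' := fun a => RingHom.congr_fun e₁ _ }
  let aπ₂ : W₂ →ₐ[C] W₃ := { π₂ with commutes' := fun a => RingHom.congr_fun e₂ _ }
  rw [generatedBy_iff]
  exact span_descVec (l := aℓ) (r := ar) (r' := ar') (π₁ := aπ₁) (π₂ := aπ₂)
    (RingPushout.liftBaseChange_bijective (k := r) H₂ _ fun _ => rfl)
    (RingPushout.liftBaseChange_bijective (k := r') H₃ _ fun _ => rfl) hl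
    (fun w => (RingHom.congr_fun e₁ w).trans (RingHom.congr_fun e₂ w).symm)
    (fun w => RingHom.congr_fun e₃ w) (fun w => RingHom.congr_fun e₄ w) g hg

theorem mem_of_generatedBy (hff : rC.FaithfullyFlat)
    (H₂ : RingPushout rC (cW.comp rC) (l.comp cW) r) (g : orthGroup n W₂)
    (N : AddSubgroup (Fin n → W)) (hsmul : ∀ a, ∀ v ∈ N, cW (rC a) • v ∈ N)
    (hN : (N : Set (Fin n → W)) ⊆ descVec l r g) (hs : GeneratedBy cW (N : Set (Fin n → W)))
    {w : Fin n → W} (hw : w ∈ descVec l r g) : w ∈ N := by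
  let _ := rC.toAlgebra
  let _ := cW.toAlgebra
  let _ := (cW.comp rC).toAlgebra
  let _ := (l.comp cW).toAlgebra
  let _ := ((l.comp cW).comp rC).toAlgebra
  have : IsScalarTower R C W := IsScalarTower.of_algebraMap_eq fun _ => rfl
  have : IsScalarTower R C W₂ := IsScalarTower.of_algebraMap_eq fun _ => rfl
  have : Module.FaithfullyFlat R C := hff
  let aℓ : W →ₐ[C] W₂ := { l with commutes' := fun _ => rfl }
  let ar : W →ₐ[R] W₂ := { r with commutes' := fun a => (RingHom.congr_fun H₂.comm a).symm }
  exact mem_of_span_descVec (l := aℓ) (r := ar)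
    (RingPushout.liftBaseChange_bijective (k := r) H₂ _ fun _ => rfl) g
    { N with smul_mem' := hsmul } hN ((generatedBy_iff _).1 hs) hw

theorem one_mem_closure_dyadOne (hff : rC.FaithfullyFlat)
    (H₂ : RingPushout rC (cW.comp rC) (l.comp cW) r) (g : orthGroup n W₂)
    {H : Set (Fin n → W)} (hH : H ⊆ descVec l r g) (hsmul : ∀ a, ∀ v ∈ H, cW (rC a) • v ∈ H)
    (hs : GeneratedBy cW H) :
    (1 : Matrix (Fin n) (Fin n) W) ∈ AddSubgroup.closure (Set.image2 dyadOne H H) := by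
  let _ := rC.toAlgebra
  let _ := cW.toAlgebra
  let _ := (cW.comp rC).toAlgebra
  let _ := (l.comp cW).toAlgebra
  let _ := ((l.comp cW).comp rC).toAlgebra
  have : IsScalarTower R C W := IsScalarTower.of_algebraMap_eq fun _ => rfl
  have : IsScalarTower R C W₂ := IsScalarTower.of_algebraMap_eq fun _ => rfl
  have : Module.FaithfullyFlat R C := hff
  let aℓ : W →ₐ[C] W₂ := { l with commutes' := fun _ => rfl }
  let ar : W →ₐ[R] W₂ := { r with commutes' := fun a => (RingHom.congr_fun H₂.comm a).symm }
  have h := one_mem_span_dyadOne (l := aℓ) (r := ar)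
    (RingPushout.liftBaseChange_bijective (k := r) H₂ _ fun _ => rfl) g hH
    ((generatedBy_iff _).1 hs)
  rw [Submodule.mem_span_set'] at h
  obtain ⟨N, c, x, hx⟩ := h
  rw [← hx]
  refine sum_mem fun i _ => AddSubgroup.subset_closure ?_
  obtain ⟨v, hv, w, hw, hvw⟩ := (x i).2
  refine ⟨cW (rC (c i)) • v, hsmul _ _ hv, w, hw, ?_⟩
  rw [← hvw]
  ext a b
  exact mul_assoc _ _ _

/-- The lifting of vectors that satisfy a descent condition. -/
theorem exists_descVec_lift {C' W' W₂' : Type u} [CommRing C'] [CommRing W'] [CommRing W₂']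
    {cW' : C' →+* W'} {l' r' : W' →+* W₂'} (hff : rC.FaithfullyFlat)
    (H₂ : RingPushout rC (cW.comp rC) (l.comp cW) r) {g' : orthGroup n W₂'}
    (hs : GeneratedBy cW' (descVec l' r' g')) {eC : C' →+* C} {eW : W' →+* W} {e₂ : W₂' →+* W₂}
    (heW : Function.Surjective eW) (hc : eW.comp cW' = cW.comp eC) (hl : e₂.comp l' = l.comp eW)
    (hr : e₂.comp r' = r.comp eW) {R' : Type u} [CommRing R'] {rC' : R' →+* C'} {eR : R' →+* R}
    (heR : Function.Surjective eR) (hR : eC.comp rC' = rC.comp eR)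
    (hR' : (l'.comp cW').comp rC' = (r'.comp cW').comp rC')
    {w : Fin n → W} (hw : w ∈ descVec l r (orthGroup.map e₂ g')) :
    ∃ w' ∈ descVec l' r' g', eW ∘ w' = w := by
  let N : AddSubgroup (Fin n → W) :=
    { carrier := (fun w => eW ∘ w) '' descVec l' r' g'
      add_mem' := by
        rintro _ _ ⟨v, hv, rfl⟩ ⟨w, hw, rfl⟩
        exact ⟨v + w, add_mem_descVec hv hw, comp_add _ _ _⟩
      zero_mem' := ⟨0, zero_mem_descVec _, funext fun _ => map_zero _⟩
      neg_mem' := by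
        rintro _ ⟨v, hv, rfl⟩
        refine ⟨-v, ?_, funext fun _ => map_neg _ _⟩
        rw [← neg_one_smul W' v]
        exact smul_mem_descVec (by rw [map_neg, map_neg, map_one, map_one]) hv }
  refine mem_of_generatedBy hff H₂ (orthGroup.map e₂ g') N ?_ ?_ ?_ hw
  · rintro a _ ⟨v, hv, rfl⟩
    obtain ⟨a, rfl⟩ := heR a
    refine ⟨cW' (rC' a) • v, smul_mem_descVec (l := l') (r := r') (RingHom.congr_fun hR' a) hv, ?_⟩
    change eW ∘ _ = _
    rw [comp_smul]
    congr 1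
    exact (RingHom.congr_fun hc _).trans (congrArg cW (RingHom.congr_fun hR a))
  · rintro _ ⟨v, hv, rfl⟩
    change l ∘ eW ∘ v = _ *ᵥ (r ∘ eW ∘ v)
    have h1 : l ∘ eW ∘ v = e₂ ∘ l' ∘ v := funext fun j => (RingHom.congr_fun hl _).symm
    have h2 : r ∘ eW ∘ v = e₂ ∘ r' ∘ v := funext fun j => (RingHom.congr_fun hr _).symm
    have h3 : l' ∘ v = (g' : GL (Fin n) W₂').val *ᵥ (r' ∘ v) := hv
    rw [h1, h2, h3, comp_mulVec, orthGroup_map_val]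
  · rw [GeneratedBy, eq_top_iff]
    rintro v -
    choose v' hv' using fun j => heW (v j)
    obtain rfl : eW ∘ v' = v := funext hv'
    have h : v' ∈ AddSubgroup.closure {v | ∃ c, ∃ w ∈ descVec l' r' g', v = cW' c • w} := by
      rw [hs]; trivial
    clear hv'
    induction h using AddSubgroup.closure_induction with
    | mem x hx =>
      obtain ⟨c, w, hw, rfl⟩ := hx
      refine AddSubgroup.subset_closure ⟨eC c, eW ∘ w, ⟨w, hw, rfl⟩, ?_⟩
      rw [comp_smul]
      congr 1
      exact RingHom.congr_fun hc c
    | zero =>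
      rw [show eW ∘ (0 : Fin n → W') = 0 from funext fun _ => map_zero _]
      exact zero_mem _
    | add x y _ _ hx hy => rw [comp_add]; exact add_mem hx hy
    | neg x _ hx =>
      rw [show eW ∘ (-x) = -(eW ∘ x) from funext fun _ => map_neg _ _]
      exact neg_mem hx

end RingDescent

/-! ### Homogeneous components of vectors -/

section VecProj

open Matrix

variable {p n : ℕ} {S S' : Frame.{u} p} {μ : Fin n → ℤ}

theorem Frame.proj_mul_of_mem {c : ℤ} {a : S.carrier} (ha : a ∈ S.grading c) (e : ℤ)
    (b : S.carrier) : S.proj e (a * b) = a * S.proj (e - c) b := by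
  induction b using DirectSum.Decomposition.inductionOn S.grading with
  | zero => simp only [mul_zero, map_zero]
  | add x y hx hy => simp only [mul_add, map_add, hx, hy]
  | @homogeneous d x =>
    by_cases h : d = e - c
    · subst h
      rw [Frame.proj_of_mem x.2, Frame.proj_of_mem]
      have := SetLike.mul_mem_graded ha x.2
      rwa [add_sub_cancel] at this
    · rw [Frame.proj_of_mem_ne x.2 h, mul_zero]
      exact Frame.proj_of_mem_ne (SetLike.mul_mem_graded ha x.2) fun h' => h (by omega)

variable (S μ) in
/-- The component of degree `d` of a vector. -/
def vecProj (d : ℤ) : (Fin n → S.carrier) →+ (Fin n → S.carrier) where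
  toFun v j := S.proj (d - μ j) (v j)
  map_zero' := funext fun _ => map_zero _
  map_add' _ _ := funext fun _ => map_add _ _ _

theorem vecProj_mem (d : ℤ) (v : Fin n → S.carrier) : vecProj S μ d v ∈ homVec S μ d :=
  fun _ => S.proj_mem _ _

theorem vecProj_of_mem {d : ℤ} {v : Fin n → S.carrier} (hv : v ∈ homVec S μ d) :
    vecProj S μ d v = v :=
  funext fun j => Frame.proj_of_mem (hv j)

theorem vecProj_of_mem_ne {d e : ℤ} {v : Fin n → S.carrier} (hv : v ∈ homVec S μ d) (h : d ≠ e) :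
    vecProj S μ e v = 0 :=
  funext fun j => Frame.proj_of_mem_ne (hv j) fun h' => h (by omega)

theorem vecProj_map (f : S ⟶ S') (d : ℤ) (v : Fin n → S.carrier) :
    f.toRingHom ∘ vecProj S μ d v = vecProj S' μ d (f.toRingHom ∘ v) :=
  funext fun _ => Frame.Hom.map_proj f _ _

theorem vecProj_mulVec {g : Matrix (Fin n) (Fin n) S.carrier} (hg : IsGradedMat S μ g) (d : ℤ)
    (v : Fin n → S.carrier) : vecProj S μ d (g *ᵥ v) = g *ᵥ vecProj S μ d v := by
  funext i
  change S.proj (d - μ i) (∑ j, g i j * v j) = ∑ j, g i j * S.proj (d - μ j) (v j)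
  rw [map_sum]
  refine Finset.sum_congr rfl fun j _ => ?_
  rw [Frame.proj_mul_of_mem (hg i j), show d - μ i - (μ j - μ i) = d - μ j by ring]

theorem vecProj_pow_smul (d : ℤ) (k : ℕ) (v : Fin n → S.carrier) :
    vecProj S μ d ((p : S.carrier) ^ k • v) = (p : S.carrier) ^ k • vecProj S μ d v :=
  funext fun _ => Frame.proj_pow_mul _ _ _

theorem eq_sum_vecProj (μ : Fin n → ℤ) (v : Fin n → S.carrier) :
    ∃ D : Finset ℤ, v = ∑ d ∈ D, vecProj S μ d v := by
  classical
  choose D hD using fun j => S.eq_sum_proj (v j)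
  refine ⟨Finset.univ.biUnion fun j => (D j).map (addRightEmbedding (μ j)), funext fun j => ?_⟩
  rw [Finset.sum_apply]
  refine (hD j ((Finset.univ.biUnion fun j => (D j).map (addRightEmbedding (μ j))).map
    (addRightEmbedding (-μ j))) fun d hd => ?_).trans ?_
  · rw [Finset.mem_map]
    refine ⟨d + μ j, Finset.mem_biUnion.2 ⟨j, Finset.mem_univ _, Finset.mem_map.2 ⟨d, hd, rfl⟩⟩, ?_⟩
    simp
  · rw [Finset.sum_map]
    rfl

theorem dispGroup_isGradedMat (h : dispGroup S μ) : IsGradedMat S μ (h : GL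
    (Fin n) S.carrier).val :=
  dispGroup_val_mem h

/-- The component of degree zero of a matrix. -/
def matProj (μ : Fin n → ℤ) : Matrix (Fin n) (Fin n) S.carrier →+ Matrix (Fin n)
    (Fin n) S.carrier where
  toFun X := Matrix.of fun i j => S.proj (μ j - μ i) (X i j)
  map_zero' := by ext i j; exact map_zero (S.proj (μ j - μ i))
  map_add' X Y := by ext i j; exact map_add (S.proj (μ j - μ i)) _ _

theorem matProj_of_isGradedMat {X : Matrix (Fin n) (Fin n) S.carrier} (hX : IsGradedMat S μ X) :
    matProj μ X = X := by
  ext i j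
  exact Frame.proj_of_mem (hX i j)

theorem matProj_pow_smul (k : ℕ) (X : Matrix (Fin n) (Fin n) S.carrier) :
    matProj μ ((p : S.carrier) ^ k • X) = (p : S.carrier) ^ k • matProj μ X := by
  ext i j
  exact Frame.proj_pow_mul _ _ _

theorem dyadOne_mem (hμ : ∀ i, μ i + μ (Fin.rev i) = 0) {d e : ℤ} {v w : Fin n → S.carrier}
    (hv : v ∈ homVec S μ d) (hw : w ∈ homVec S μ e) (i j : Fin n) :
    dyadOne v w i j ∈ S.grading (d + e + (μ j - μ i)) := by
  have := SetLike.mul_mem_graded (hv i) (hw (Fin.rev j))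
  rwa [show d - μ i + (e - μ (Fin.rev j)) = d + e + (μ j - μ i) by linarith [hμ j]] at this

end VecProj

/-! ### Descent data -/

section DescentDatum

open Matrix

variable {p n : ℕ} {S : Frame.{u} p}

/-- A descent datum for the standard orthogonal graded module with respect to `R → B`. -/
structure DescentDatum (E : EtaleBaseChange S) (μ : Fin n → ℤ) (B : EtAlg S.residue) where
  g : ∀ {C : EtAlg S.residue} (_ _ : B ⟶ C), dispGroup (E.frame.obj C) μ
  g_map : ∀ {C C' : EtAlg S.residue} (f : C ⟶ C') (a b : B ⟶ C),
    dispGroup.map (E.frame.map f) μ (g a b) = g (a ≫ f) (b ≫ f)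
  g_mul : ∀ {C : EtAlg S.residue} (a b c : B ⟶ C), g a b * g b c = g a c

namespace DescentDatum

variable {E : EtaleBaseChange S} {μ : Fin n → ℤ} {B : EtAlg S.residue} (D : DescentDatum E μ B)

/-- The vectors that satisfy the descent condition. -/
def Desc (v : Fin n → (E.frame.obj B).carrier) : Prop :=
  ∀ {C : EtAlg S.residue} (a b : B ⟶ C),
    (E.frame.map a).toRingHom ∘ v = (D.g a b).1.val *ᵥ ((E.frame.map b).toRingHom ∘ v)

variable {B₂ : EtAlg S.residue} {p₁ p₂ : B ⟶ B₂}

variable (p₁ p₂) in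
/-- The vectors that satisfy the descent condition modulo `pᵏ`. -/
def DescMod (k : ℕ) (v : Fin n → (E.frame.obj B).carrier) : Prop :=
  ∃ z, (E.frame.map p₁).toRingHom ∘ v - (D.g p₁ p₂).1.val *ᵥ ((E.frame.map p₂).toRingHom ∘ v) =
    (p : (E.frame.obj B₂).carrier) ^ k • z

variable (p₁ p₂) in
/-- The descent condition modulo `pᵏ`, as a condition on vectors modulo `pᵏ`. -/
def descSet (k : ℕ) : Set (Fin n → ModPow (E.frame.obj B).carrier p k) :=
  descVec (ModPow.map (E.frame.map p₁).toRingHom p k) (ModPow.map (E.frame.map p₂).toRingHom p k)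
    (orthGroup.map (Ideal.Quotient.mk _) (Triv.toOrth (D.g p₁ p₂)))

theorem mk_mem_descSet {k : ℕ} {v : Fin n → (E.frame.obj B).carrier} :
    Ideal.Quotient.mk _ ∘ v ∈ D.descSet p₁ p₂ k ↔ D.DescMod p₁ p₂ k v := by
  have h1 : ∀ f : B ⟶ B₂, ModPow.map (E.frame.map f).toRingHom p k ∘ Ideal.Quotient.mk _ ∘ v =
      Ideal.Quotient.mk _ ∘ (E.frame.map f).toRingHom ∘ v := fun f => rfl
  change ModPow.map (E.frame.map p₁).toRingHom p k ∘ Ideal.Quotient.mk _ ∘ v =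
    _ *ᵥ (ModPow.map (E.frame.map p₂).toRingHom p k ∘ Ideal.Quotient.mk _ ∘ v) ↔ _
  rw [h1, h1, orthGroup_map_val, ← comp_mulVec, funext_iff]
  change (∀ i, Ideal.Quotient.mk _ (((E.frame.map p₁).toRingHom ∘ v) i) =
    Ideal.Quotient.mk _ (((D.g p₁ p₂).1.val *ᵥ ((E.frame.map p₂).toRingHom ∘ v)) i)) ↔ _
  simp_rw [← sub_eq_zero (b := Ideal.Quotient.mk _ (((D.g p₁ p₂).1.val *ᵥ _) _)), ← map_sub,
    modPow_mk_eq_zero]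
  constructor
  · intro h
    choose z hz using h
    exact ⟨z, funext hz⟩
  · rintro ⟨z, hz⟩ i
    exact ⟨z i, congrFun hz i⟩

theorem DescMod.vecProj {D : DescentDatum E μ B} {k : ℕ} {v : Fin n → (E.frame.obj B).carrier}
    (h : D.DescMod p₁ p₂ k v) (d : ℤ) :
    D.DescMod p₁ p₂ k (Displays.vecProj (E.frame.obj B) μ d v) := by
  obtain ⟨z, hz⟩ := h
  refine ⟨Displays.vecProj _ μ d z, ?_⟩
  rw [← vecProj_pow_smul, ← hz, map_sub, vecProj_mulVec (dispGroup_isGradedMat _), vecProj_map,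
    vecProj_map]

theorem faithfullyFlat_modPow [Fact p.Prime]
    (hB : B.IsCover) (k : ℕ) :
    (ModPow.map (Frame.Hom.zero (E.frame.map (EtAlg.fromSelf B))) p k).FaithfullyFlat := by
  rw [RingHom.FaithfullyFlat.iff_flat_and_comap_surjective]
  refine ⟨E.flat_map _ k, fun q => ?_⟩
  obtain ⟨-, q', hq'⟩ := E.exists_comap_eq hB k q
  exact ⟨q', hq'⟩

variable (p₁ p₂) in
/-- `B₂` is the tensor product `B ⊗_R B`, with the two inclusions. -/
abbrev IsSquare : Prop :=
  RingPushout (EtAlg.algHom (EtAlg.fromSelf B)).toRingHom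
    (EtAlg.algHom (EtAlg.fromSelf B)).toRingHom (EtAlg.algHom p₁).toRingHom
    (EtAlg.algHom p₂).toRingHom

theorem ringPushout_modPow [Fact p.Prime] (H : IsSquare p₁ p₂) (k : ℕ) :
    RingPushout (ModPow.map (Frame.Hom.zero (E.frame.map (EtAlg.fromSelf B))) p k)
      ((E.inc B k).comp (ModPow.map (Frame.Hom.zero (E.frame.map (EtAlg.fromSelf B))) p k))
      ((ModPow.map (E.frame.map p₁).toRingHom p k).comp (E.inc B k))
      (ModPow.map (E.frame.map p₂).toRingHom p k) := by
  have h := E.ringPushout_map H k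
  have h1 : (E.inc B₂ k).comp (ModPow.map (Frame.Hom.zero (E.frame.map p₁)) p k) =
      (ModPow.map (E.frame.map p₁).toRingHom p k).comp (E.inc B k) :=
    Ideal.Quotient.ringHom_ext rfl
  rwa [h1] at h

theorem modPow_map_comp {A B C : EtAlg S.residue} (a : A ⟶ B) (b : B ⟶ C) (k : ℕ) :
    (ModPow.map (E.frame.map b).toRingHom p k).comp (ModPow.map (E.frame.map a).toRingHom p k) =
      ModPow.map (E.frame.map (a ≫ b)).toRingHom p k := by
  rw [E.frame.map_comp]
  exact Ideal.Quotient.ringHom_ext rfl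

theorem orthGroup_map_modPow {C : EtAlg S.residue} (f : B₂ ⟶ C) (a b : B ⟶ B₂) (k : ℕ) :
    orthGroup.map (ModPow.map (E.frame.map f).toRingHom p k)
        (orthGroup.map (Ideal.Quotient.mk _) (Triv.toOrth (D.g a b))) =
      orthGroup.map (Ideal.Quotient.mk _) (Triv.toOrth (D.g (a ≫ f) (b ≫ f))) := by
  rw [← D.g_map]
  rfl

theorem generatedBy_descSet [Fact p.Prime] (H : IsSquare p₁ p₂) (k : ℕ) :
    GeneratedBy (E.inc B k) (D.descSet p₁ p₂ k) := by
  obtain ⟨B₃, q₁, p₂₃, H₃⟩ := EtAlg.exists_pushout (EtAlg.fromSelf B) (EtAlg.fromSelf B₂)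
  obtain ⟨p₁₂, h₁₂, h₁₂'⟩ := EtAlg.exists_desc H q₁ (p₁ ≫ p₂₃) (EtAlg.self_hom_ext _ _)
  obtain ⟨p₁₃, h₁₃, h₁₃'⟩ := EtAlg.exists_desc H q₁ (p₂ ≫ p₂₃) (EtAlg.self_hom_ext _ _)
  obtain ⟨m, hm, -⟩ := EtAlg.exists_desc H (𝟙 B) (𝟙 B) (EtAlg.self_hom_ext _ _)
  have K := E.ringPushout_map H₃ k
  have h1 : (E.inc B₃ k).comp (ModPow.map (Frame.Hom.zero (E.frame.map q₁)) p k) =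
      (ModPow.map (E.frame.map q₁).toRingHom p k).comp (E.inc B k) :=
    Ideal.Quotient.ringHom_ext rfl
  have h2 : (E.inc B₂ k).comp (ModPow.map (Frame.Hom.zero (E.frame.map (EtAlg.fromSelf B₂))) p k) =
      ((ModPow.map (E.frame.map p₁).toRingHom p k).comp (E.inc B k)).comp
        (ModPow.map (Frame.Hom.zero (E.frame.map (EtAlg.fromSelf B))) p k) := by
    rw [EtAlg.self_hom_ext (EtAlg.fromSelf B₂) (EtAlg.fromSelf B ≫ p₁), E.frame.map_comp]
    exact Ideal.Quotient.ringHom_ext rfl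
  rw [h1, h2] at K
  refine generatedBy_descVec (E.flat_map _ k) (ringPushout_modPow H k) K
    (π₁ := ModPow.map (E.frame.map p₁₂).toRingHom p k)
    (π₂ := ModPow.map (E.frame.map p₁₃).toRingHom p k) ?_ ?_ ?_ ?_ ?_ _ ?_
  · refine Function.LeftInverse.injective (g := ModPow.map (E.frame.map m).toRingHom p k) fun x =>
    ?_
    rw [← RingHom.comp_apply, modPow_map_comp, hm, E.frame.map_id]
    obtain ⟨x, rfl⟩ := Ideal.Quotient.mk_surjective x
    rfl
  · rw [modPow_map_comp, h₁₂]
  · rw [modPow_map_comp, h₁₃]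
  · rw [modPow_map_comp, modPow_map_comp, h₁₂']
  · rw [modPow_map_comp, modPow_map_comp, h₁₃']
  · rw [orthGroup_map_modPow, orthGroup_map_modPow, orthGroup_map_modPow, h₁₂, h₁₂', h₁₃, h₁₃',
      ← D.g_mul q₁ (p₁ ≫ p₂₃), ← map_mul]
    rfl

theorem exists_lift_step [Fact p.Prime]
    (hB : B.IsCover) (H : IsSquare p₁ p₂) {k : ℕ}
    {d : ℤ} {v : Fin n → (E.frame.obj B).carrier} (hv : v ∈ homVec _ μ d)
    (h : D.DescMod p₁ p₂ k v) : ∃ w ∈ homVec (E.frame.obj B) μ d, D.DescMod p₁ p₂ (k + 1) w ∧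
      ∃ z, w - v = (p : (E.frame.obj B).carrier) ^ k • z := by
  let e (A : Type u) [CommRing A] : ModPow A p (k + 1) →+* ModPow A p k :=
    Ideal.Quotient.factor (by
      rw [Ideal.span_singleton_le_span_singleton]
      exact pow_dvd_pow _ (Nat.le_succ k))
  have hw := exists_descVec_lift (faithfullyFlat_modPow hB k) (ringPushout_modPow H k)
    (D.generatedBy_descSet H (k + 1)) (eC := e _) (eW := e _) (e₂ := e _)
    (Ideal.Quotient.factor_surjective _) (Ideal.Quotient.ringHom_ext rfl)
    (Ideal.Quotient.ringHom_ext rfl) (Ideal.Quotient.ringHom_ext rfl)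
    (rC' := ModPow.map (Frame.Hom.zero (E.frame.map (EtAlg.fromSelf B))) p (k + 1)) (eR := e _)
    (Ideal.Quotient.factor_surjective _) (Ideal.Quotient.ringHom_ext rfl)
    (ringPushout_modPow H (k + 1)).comm (w := Ideal.Quotient.mk _ ∘ v) ((mk_mem_descSet D).2 h)
  obtain ⟨w', hw', hwv⟩ := hw
  choose w hww using fun j => Ideal.Quotient.mk_surjective (w' j)
  obtain rfl : Ideal.Quotient.mk _ ∘ w = w' := funext hww
  have hw := (mk_mem_descSet D).1 hw'
  refine ⟨vecProj _ μ d w, vecProj_mem d w, hw.vecProj d, ?_⟩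
  have h1 : ∀ j, ∃ z, w j - v j = (p : (E.frame.obj B).carrier) ^ k * z := fun j => by
    rw [← modPow_mk_eq_zero, map_sub, sub_eq_zero]
    exact congrFun hwv j
  choose z hz using h1
  refine ⟨vecProj _ μ d z, ?_⟩
  rw [← vecProj_pow_smul, ← show w - v = (p : (E.frame.obj B).carrier) ^ k • z from funext hz,
    map_sub, vecProj_of_mem hv]

/-- The vectors that satisfy the descent condition modulo `p` lift to vectors that satisfy the
descent condition. -/
theorem exists_lift [Fact p.Prime]
    (hB : B.IsCover) (H : IsSquare p₁ p₂)
    {d : ℤ} {v : Fin n → (E.frame.obj B).carrier} (hv : v ∈ homVec _ μ d)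
    (h : D.DescMod p₁ p₂ 1 v) : ∃ w ∈ homVec (E.frame.obj B) μ d, D.Desc w ∧
      ∃ z, w - v = (p : (E.frame.obj B).carrier) • z := by
  choose F hF hF' hF'' using fun (k : ℕ)
    (x : {w // w ∈ homVec (E.frame.obj B) μ d ∧ D.DescMod p₁ p₂ (k + 1) w}) =>
    D.exists_lift_step hB H x.2.1 x.2.2
  let y (k : ℕ) : {w // w ∈ homVec (E.frame.obj B) μ d ∧ D.DescMod p₁ p₂ (k + 1) w} :=
    Nat.rec ⟨v, hv, h⟩ (fun k x => ⟨F k x, hF k x, hF' k x⟩) k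
  have hy : ∀ k, ∃ z, (y (k + 1)).1 - (y k).1 = (p : (E.frame.obj B).carrier) ^ (k + 1) • z :=
    fun k => hF'' k (y k)
  have hL : ∀ j, ∃ L ∈ (E.frame.obj B).grading (d - μ j), ∀ k : ℕ, ∃ z,
      L - (y k).1 j = p ^ k * z := fun j =>
    (E.isPAdic B).exists_lim (fun k => (y k).2.1 j) fun k => by
      obtain ⟨z, hz⟩ := hy k
      refine ⟨p * z j, ?_⟩
      rw [← mul_assoc, ← pow_succ]
      exact congrFun hz j
  choose L hL hL' using hL
  have hL'' : ∀ k, ∃ z, L - (y k).1 = (p : (E.frame.obj B).carrier) ^ k • z := fun k => by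
    choose z hz using fun j => hL' j k
    exact ⟨z, funext hz⟩
  have h1 : (E.frame.map p₁).toRingHom ∘ L =
      (D.g p₁ p₂).1.val *ᵥ ((E.frame.map p₂).toRingHom ∘ L) := by
    funext i
    refine sub_eq_zero.1 ((E.isPAdic B₂).eq_zero fun k => ?_)
    have h2 : D.DescMod p₁ p₂ k L := by
      obtain ⟨z, hz⟩ := hL'' k
      obtain ⟨z', hz'⟩ := (y k).2.2
      refine ⟨(p : (E.frame.obj B₂).carrier) • z' + ((E.frame.map p₁).toRingHom ∘ z -
        (D.g p₁ p₂).1.val *ᵥ ((E.frame.map p₂).toRingHom ∘ z)), ?_⟩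
      rw [sub_eq_iff_eq_add] at hz
      rw [hz, comp_add, comp_add, comp_smul, comp_smul, mulVec_add, mulVec_smul, map_pow, map_pow,
        map_natCast, map_natCast, smul_add, ← mul_smul, ← pow_succ, ← hz', smul_sub]
      abel
    obtain ⟨z, hz⟩ := h2
    exact ⟨z i, congrFun hz i⟩
  refine ⟨L, hL, fun a b => ?_, ?_⟩
  · obtain ⟨f, rfl, rfl⟩ := EtAlg.exists_desc H a b (EtAlg.self_hom_ext _ _)
    rw [← D.g_map]
    have h2 := congrArg (fun v => (E.frame.map f).toRingHom ∘ v) h1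
    rw [comp_mulVec] at h2
    rw [E.frame.map_comp, E.frame.map_comp]
    exact h2
  · obtain ⟨z, hz⟩ := hL'' 1
    obtain ⟨z', hz'⟩ := hy 0
    refine ⟨z + z', ?_⟩
    rw [smul_add, ← pow_one (p : (E.frame.obj B).carrier), ← hz, ← hz']
    exact (sub_add_sub_cancel _ _ _).symm

end DescentDatum

end DescentDatum

/-! ### Generators of the descended module -/

section DescGenerators

open Matrix

variable {p n : ℕ} {S : Frame.{u} p} {E : EtaleBaseChange S} {μ : Fin n → ℤ} {B : EtAlg S.residue}

theorem dyad_eq_sum {A : Type u} [CommRing A] {N : ℕ} (x y : Fin N → Fin n → A) :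
    dyad x y = ∑ k, dyadOne (x k) (y k) := by
  ext i j
  rw [Matrix.sum_apply]
  rfl

/-- A graded matrix that is congruent to `1` modulo `p` is invertible. -/
theorem IsGradedMat.isUnit_of_eq_one_add {S : Frame.{u} p} {P Z : Matrix (Fin n) (Fin n) S.carrier}
    (hP : IsGradedMat S μ P) (h : P = 1 + (p : S.carrier) • Z) : IsUnit P := by
  rw [Matrix.isUnit_iff_isUnit_det]
  have h1 : ∃ z, P.det - 1 = (p : S.carrier) ^ 1 * z := by
    rw [← modPow_mk_eq_zero, map_sub, sub_eq_zero, map_one, RingHom.map_det]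
    have h2 : (Ideal.Quotient.mk (Ideal.span {(p : S.carrier) ^ 1})).mapMatrix P = 1 := by
      rw [h, map_add, map_one, add_eq_left]
      ext i j
      exact modPow_mk_eq_zero.2 ⟨Z i j, by rw [pow_one]; rfl⟩
    rw [h2, det_one]
  obtain ⟨z, hz⟩ := h1
  have h3 : P.det - 1 ∈ S.grading 0 := sub_mem hP.det_mem SetLike.GradedOne.one_mem
  obtain ⟨w, hw⟩ := Frame.exists_pow_mul_of_mem h3 hz
  have h4 := Ideal.mem_jacobson_bot.1 S.p_mem_jacobson w
  have h5 := h4.map (algebraMap (S.grading 0) S.carrier)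
  convert h5 using 1
  rw [map_add, map_mul, map_one, map_natCast, ← sub_eq_iff_eq_add, hw, pow_one]
  rfl

namespace DescentDatum

variable (D : DescentDatum E μ B) {B₂ : EtAlg S.residue} {p₁ p₂ : B ⟶ B₂}

variable (p₁ p₂) in
/-- The dyads of degree zero that satisfy the descent condition modulo `p`. -/
def dyadSet : Set (Matrix (Fin n) (Fin n) (E.frame.obj B).carrier) :=
  {X | ∃ d, ∃ v ∈ homVec (E.frame.obj B) μ d, ∃ w ∈ homVec (E.frame.obj B) μ (-d),
    D.DescMod p₁ p₂ 1 v ∧ D.DescMod p₁ p₂ 1 w ∧ X = dyadOne v w}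

theorem exists_matProj_mem [Fact p.Prime] (hμ : ∀ i, μ i + μ (Fin.rev i) = 0)
    (hB : B.IsCover) (H : IsSquare p₁ p₂) :
    ∃ X : Matrix (Fin n) (Fin n) (E.frame.obj B).carrier,
      (X.map (Ideal.Quotient.mk (Ideal.span {(p : (E.frame.obj B).carrier) ^ 1})) = 1) ∧
      matProj μ X ∈ AddSubgroup.closure (D.dyadSet p₁ p₂) := by
  let π := Ideal.Quotient.mk (Ideal.span {(p : (E.frame.obj B).carrier) ^ 1})
  let K : Set (Fin n → ModPow (E.frame.obj B).carrier p 1) :=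
    {v' | ∃ d, ∃ v ∈ homVec (E.frame.obj B) μ d, D.DescMod p₁ p₂ 1 v ∧ v' = π ∘ v}
  have hK : K ⊆ D.descSet p₁ p₂ 1 := by
    rintro _ ⟨d, v, -, hv, rfl⟩
    exact D.mk_mem_descSet.2 hv
  have hs : GeneratedBy (E.inc B 1) K := by
    refine (D.generatedBy_descSet H 1).of_subset fun w' hw' => ?_
    choose w hww using fun j => Ideal.Quotient.mk_surjective (w' j)
    obtain rfl : π ∘ w = w' := funext hww
    obtain ⟨T, hT⟩ := eq_sum_vecProj μ w
    have h1 : π ∘ w = ∑ d ∈ T, π ∘ vecProj _ μ d w := by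
      conv_lhs => rw [hT]
      funext j
      simp [Finset.sum_apply]
    rw [h1]
    exact sum_mem fun d _ => AddSubgroup.subset_closure
      ⟨d, _, vecProj_mem d w, ((D.mk_mem_descSet).1 hw').vecProj d, rfl⟩
  have hsmul : ∀ a, ∀ v ∈ K, E.inc B 1 (ModPow.map (Frame.Hom.zero
      (E.frame.map (EtAlg.fromSelf B))) p 1 a) • v ∈ K := by
    rintro a _ ⟨d, v, hv, hv', rfl⟩
    obtain ⟨a, rfl⟩ := Ideal.Quotient.mk_surjective a
    let a' := (E.frame.map (EtAlg.fromSelf B)).toRingHom a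
    have ha' : a' ∈ (E.frame.obj B).grading 0 := (E.frame.map (EtAlg.fromSelf B)).map_mem 0 a a.2
    have h1 : E.inc B 1 (ModPow.map (Frame.Hom.zero (E.frame.map (EtAlg.fromSelf B))) p 1
        (Ideal.Quotient.mk _ a)) • (π ∘ v) = π ∘ (a' • v) := (comp_smul π a' v).symm
    rw [h1]
    refine ⟨d, a' • v, ?_, ?_, rfl⟩
    · have := smul_mem_homVec ha' hv
      rwa [zero_add] at this
    · rw [← mk_mem_descSet] at hv' ⊢
      rw [comp_smul]
      refine smul_mem_descVec ?_ hv'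
      exact RingHom.congr_fun (ringPushout_modPow (E := E) H 1).comm (Ideal.Quotient.mk _ a)
  have h1 := one_mem_closure_dyadOne (faithfullyFlat_modPow hB 1) (ringPushout_modPow H 1) _ hK
    hsmul hs
  have key : ∀ X' ∈ AddSubgroup.closure (Set.image2 dyadOne K K), ∃ X, X.map π = X' ∧
      matProj μ X ∈ AddSubgroup.closure (D.dyadSet p₁ p₂) := by
    intro X' hX'
    induction hX' using AddSubgroup.closure_induction with
    | mem X' hX' =>
      obtain ⟨_, ⟨d, v, hv, hv', rfl⟩, _, ⟨e, w, hw, hw', rfl⟩, rfl⟩ := hX'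
      refine ⟨dyadOne v w, map_dyadOne _ _ _, ?_⟩
      by_cases hde : d + e = 0
      · obtain rfl : e = -d := by omega
        rw [matProj_of_isGradedMat fun i j => by
          have := dyadOne_mem hμ hv hw i j
          rwa [hde, zero_add] at this]
        exact AddSubgroup.subset_closure ⟨d, v, hv, w, hw, hv', hw', rfl⟩
      · have : matProj μ (dyadOne v w) = 0 := by
          ext i j
          exact Frame.proj_of_mem_ne (dyadOne_mem hμ hv hw i j) (by omega)
        rw [this]
        exact zero_mem _
    | zero => exact ⟨0, Matrix.map_zero _ (map_zero π), by rw [map_zero]; exact zero_mem _⟩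
    | add X' Y' _ _ hX hY =>
      obtain ⟨X, rfl, hX⟩ := hX
      obtain ⟨Y, rfl, hY⟩ := hY
      exact ⟨X + Y, Matrix.map_add _ (map_add π) _ _, by rw [map_add]; exact add_mem hX hY⟩
    | neg X' _ hX =>
      obtain ⟨X, rfl, hX⟩ := hX
      exact ⟨-X, by ext i j; exact map_neg π _, by rw [map_neg]; exact neg_mem hX⟩
  exact key 1 h1

theorem exists_approx_dual [Fact p.Prime] (hμ : ∀ i, μ i + μ (Fin.rev i) = 0)
    (hB : B.IsCover) (H : IsSquare p₁ p₂) :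
    ∃ (N : ℕ) (d : Fin N → ℤ) (x y : Fin N → Fin n → (E.frame.obj B).carrier),
      (∀ k, x k ∈ homVec _ μ (d k) ∧ y k ∈ homVec _ μ (-d k) ∧ D.Desc (x k) ∧ D.Desc (y k)) ∧
      ∃ Z, dyad x y = 1 + (p : (E.frame.obj B).carrier) • Z := by
  obtain ⟨X, hX, hX'⟩ := D.exists_matProj_mem hμ hB H
  have h1 : ∀ i j, ∃ z, X i j - (1 : Matrix (Fin n) (Fin n) (E.frame.obj B).carrier) i j =
      (p : (E.frame.obj B).carrier) ^ 1 * z := fun i j => by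
    rw [← modPow_mk_eq_zero, map_sub, sub_eq_zero]
    have h2 := congrFun (congrFun hX i) j
    rw [← Matrix.map_one (Ideal.Quotient.mk (Ideal.span {(p : (E.frame.obj B).carrier) ^ 1}))
      (map_zero _) (map_one _)] at h2
    exact h2
  choose Z hZ using h1
  have h2 : X = 1 + (p : (E.frame.obj B).carrier) ^ 1 • Matrix.of Z := by
    ext i j
    exact sub_eq_iff_eq_add'.1 (hZ i j)
  rw [h2, map_add, matProj_pow_smul, matProj_of_isGradedMat (IsGradedMat.one μ), pow_one,
    ← Submodule.span_int_eq_addSubgroupClosure, Submodule.mem_toAddSubgroup,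
    Submodule.mem_span_set'] at hX'
  obtain ⟨N, c, Y, hY⟩ := hX'
  choose d v hv w hw hv' hw' hvw using fun k => (Y k).2
  choose x hx hx' zx hzx using fun k => D.exists_lift hB H (hv k) (hv' k)
  choose y hy hy' zy hzy using fun k => D.exists_lift hB H (hw k) (hw' k)
  refine ⟨N, d, fun k => (c k : (E.frame.obj B).carrier) • x k, y, fun k => ⟨?_, hy k, ?_, hy' k⟩,
      ?_⟩
  · beta_reduce
    rw [Int.cast_smul_eq_zsmul]
    exact AddSubgroup.zsmul_mem _ (hx k) _
  · intro C a b
    rw [comp_smul, comp_smul, map_intCast, map_intCast, mulVec_smul, hx' k a b]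
  · refine ⟨matProj μ (Matrix.of Z) + ∑ k, c k • (dyadOne (zx k) (y k) + dyadOne (v k) (zy k)), ?_⟩
    rw [smul_add, ← add_assoc, ← hY, dyad_eq_sum, Finset.smul_sum, ← Finset.sum_add_distrib]
    refine Finset.sum_congr rfl fun k _ => ?_
    rw [hvw, ← Int.cast_smul_eq_zsmul (E.frame.obj B).carrier,
      ← Int.cast_smul_eq_zsmul (E.frame.obj B).carrier]
    ext i j
    have e1 := congrFun (hzx k) i
    have e2 := congrFun (hzy k) (Fin.rev j)
    simp only [Pi.sub_apply, Pi.smul_apply, smul_eq_mul] at e1 e2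
    simp only [dyadOne, Matrix.add_apply, Matrix.smul_apply, Matrix.of_apply, Pi.smul_apply,
      smul_eq_mul]
    linear_combination (c k : (E.frame.obj B).carrier) * (y k (Fin.rev j)) * e1 +
      (c k : (E.frame.obj B).carrier) * v k i * e2

/-- The descended module is generated by finitely many homogeneous elements. -/
theorem exists_dual [Fact p.Prime] (hμ : ∀ i, μ i + μ (Fin.rev i) = 0)
    (hB : B.IsCover) :
    ∃ (N : ℕ) (d : Fin N → ℤ) (x y : Fin N → Fin n → (E.frame.obj B).carrier),
      (∀ k, x k ∈ homVec _ μ (d k) ∧ y k ∈ homVec _ μ (-d k) ∧ D.Desc (x k) ∧ D.Desc (y k)) ∧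
      dyad x y = 1 := by
  obtain ⟨B₂, p₁, p₂, H⟩ := EtAlg.exists_pushout (EtAlg.fromSelf B) (EtAlg.fromSelf B)
  obtain ⟨N, d, x, y, hxy, Z, hZ⟩ := D.exists_approx_dual hμ hB H
  let P := dyad x y
  have hP : IsGradedMat (E.frame.obj B) μ P := fun i j => by
    change dyad x y i j ∈ _
    rw [dyad_eq_sum, Matrix.sum_apply]
    refine sum_mem fun k _ => ?_
    have := dyadOne_mem hμ (hxy k).1 (hxy k).2.1 i j
    rwa [add_neg_cancel, zero_add] at this
  obtain ⟨U, hU⟩ := hP.isUnit_of_eq_one_add hZ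
  have hUP : ∀ v, U.inv *ᵥ (P *ᵥ v) = v := fun v => by
    rw [mulVec_mulVec, ← show U.val = P from hU, U.inv_val, one_mulVec]
  have hPU : ∀ v, P *ᵥ (U.inv *ᵥ v) = v := fun v => by
    rw [mulVec_mulVec, ← show U.val = P from hU, U.val_inv, one_mulVec]
  refine ⟨N, d, fun k => U.inv *ᵥ x k, y, fun k => ⟨?_, (hxy k).2.1, ?_, (hxy k).2.2.2⟩, ?_⟩
  · have h1 : vecProj _ μ (d k) (U.inv *ᵥ x k) = U.inv *ᵥ x k := by
      rw [← hUP (vecProj _ μ (d k) _), ← vecProj_mulVec hP, hPU, vecProj_of_mem (hxy k).1]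
    beta_reduce
    rw [← h1]
    exact vecProj_mem _ _
  · intro C a b
    have h1 : ∀ z, P.map (E.frame.map a).toRingHom *ᵥ ((D.g a b).1.val *ᵥ z) =
        (D.g a b).1.val *ᵥ (P.map (E.frame.map b).toRingHom *ᵥ z) := fun z => by
      change (dyad x y).map _ *ᵥ _ = _ *ᵥ ((dyad x y).map _ *ᵥ _)
      rw [map_dyad, map_dyad, dyad_mulVec, dyad_mulVec, mulVec_sum]
      refine Finset.sum_congr rfl fun k _ => ?_
      rw [mulVec_smul, ← (hxy k).2.2.1 a b, (hxy k).2.2.2 a b]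
      exact congrArg (· • _) (psi_orthGroup (Triv.toOrth (D.g a b)) _ _)
    have h2 : ∀ z, U.inv.map (E.frame.map a).toRingHom *ᵥ
        (P.map (E.frame.map a).toRingHom *ᵥ z) = z := fun z => by
      rw [mulVec_mulVec, ← Matrix.map_mul, ← show U.val = P from hU, U.inv_val,
        Matrix.map_one _ (map_zero _) (map_one _), one_mulVec]
    have h3 : ∀ {C : EtAlg S.residue} (a : B ⟶ C), P.map (E.frame.map a).toRingHom *ᵥ
        ((E.frame.map a).toRingHom ∘ (U.inv *ᵥ x k)) = (E.frame.map a).toRingHom ∘ x k :=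
      fun a => by rw [← comp_mulVec, hPU]
    rw [← h2 ((E.frame.map a).toRingHom ∘ _), h3, (hxy k).2.2.1 a b, ← h3 b, ← h1, h2]
  · refine matrix_ext_mulVec fun v => ?_
    rw [dyad_mulVec, one_mulVec]
    have := hUP v
    change U.inv *ᵥ (dyad x y *ᵥ v) = v at this
    rw [dyad_mulVec, mulVec_sum] at this
    conv_rhs => rw [← this]
    exact Finset.sum_congr rfl fun k _ => (mulVec_smul _ _ _).symm

end DescentDatum

end DescGenerators

/-! ### The orthogonal display defined by a descent datum -/

section DescDisplay

open Matrix

variable {p n : ℕ} {S : Frame.{u} p} {E : EtaleBaseChange S} {μ : Fin n → ℤ} {B : EtAlg S.residue}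

/-- Dual families of vectors that satisfy the descent condition. -/
structure DescentDatum.Dual (D : DescentDatum E μ B) where
  N : ℕ
  x : Fin N → Fin n → (E.frame.obj B).carrier
  y : Fin N → Fin n → (E.frame.obj B).carrier
  x_desc : ∀ k, D.Desc (x k)
  y_desc : ∀ k, D.Desc (y k)
  dyad_eq_one : dyad x y = 1

theorem DescentDatum.nonempty_dual [Fact p.Prime] (D : DescentDatum E μ B)
    (hμ : ∀ i, μ i + μ (Fin.rev i) = 0)
    (hB : B.IsCover) : Nonempty D.Dual := by
  obtain ⟨N, _, x, y, h, h1⟩ := D.exists_dual hμ hB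
  exact ⟨⟨N, x, y, fun k => (h k).2.2.1, fun k => (h k).2.2.2, h1⟩⟩

namespace DescentDatum

variable (D : DescentDatum E μ B)

/-- The group of vectors that satisfy the descent condition. -/
def descGroup : AddSubgroup (Fin n → (E.frame.obj B).carrier) where
  carrier := {v | D.Desc v}
  zero_mem' := fun a b => by
    have h : ∀ {C : EtAlg S.residue} (a : B ⟶ C), (E.frame.map a).toRingHom ∘
        (0 : Fin n → (E.frame.obj B).carrier) = 0 := fun a => funext fun _ => map_zero _
    rw [h, h, mulVec_zero]
  add_mem' := fun {v w} hv hw C a b => by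
    rw [comp_add, comp_add, mulVec_add, hv a b, hw a b]
  neg_mem' := fun {v} hv C a b => by
    have h : ∀ a : B ⟶ C, (E.frame.map a).toRingHom ∘ (-v) = -((E.frame.map a).toRingHom ∘ v) :=
      fun a => funext fun _ => map_neg _ _
    rw [h, h, mulVec_neg, hv a b]

/-- The descended module. -/
def Carrier : Type u := D.descGroup

instance : AddCommGroup D.Carrier := inferInstanceAs (AddCommGroup D.descGroup)

/-- The vector underlying an element of the descended module. -/
def val : D.Carrier →+ (Fin n → (E.frame.obj B).carrier) := D.descGroup.subtype

variable {D}

theorem val_desc (v : D.Carrier) : D.Desc (D.val v) := Subtype.prop (p := D.Desc) v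

theorem val_injective : Function.Injective D.val := Subtype.val_injective

theorem smul_desc {v : Fin n → (E.frame.obj B).carrier} (h : D.Desc v) (s : S.carrier) :
    D.Desc ((E.unit B).toRingHom s • v) := fun a b => by
  rw [comp_smul, comp_smul, E.map_unit, E.map_unit, mulVec_smul, h a b]

instance : SMul S.carrier D.Carrier := ⟨fun s v => ⟨_, smul_desc (val_desc v) s⟩⟩

theorem val_smul (s : S.carrier) (v : D.Carrier) :
    D.val (s • v) = (E.unit B).toRingHom s • D.val v := rfl

instance : Module S.carrier D.Carrier where
  one_smul v := val_injective (by rw [val_smul, map_one, one_smul])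
  mul_smul s t v := val_injective (by simp only [val_smul, map_mul, mul_smul])
  smul_zero s := val_injective (by simp only [val_smul, map_zero, smul_zero])
  smul_add s v w := val_injective (by simp only [val_smul, map_add, smul_add])
  add_smul s t v := val_injective (by simp only [val_smul, map_add, add_smul])
  zero_smul v := val_injective (by simp only [val_smul, map_zero, zero_smul])

variable (D) in
/-- The inclusion of the descended module. -/
def coord : D.Carrier →ₛₗ[(E.unit B).toRingHom] (Fin n → (E.frame.obj B).carrier) where
  toFun := D.val
  map_add' := map_add D.val
  map_smul' := val_smul

theorem coord_desc (v : D.Carrier) : D.Desc (D.coord v) := val_desc v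

theorem coord_injective : Function.Injective D.coord := val_injective

theorem psi_desc {v w : Fin n → (E.frame.obj B).carrier} (hv : D.Desc v) (hw : D.Desc w)
    {C : EtAlg S.residue} (a b : B ⟶ C) :
    (E.frame.map a).toRingHom (psi v w) = (E.frame.map b).toRingHom (psi v w) := by
  rw [← psi_map, ← psi_map, hv a b, hw a b]
  exact psi_orthGroup (Triv.toOrth (D.g a b)) _ _

section Form

variable [Fact p.Prime] (hS : S.IsPAdic)
  (hB : B.IsCover)

theorem unit_injective (hS : S.IsPAdic)
    (hB : B.IsCover) :
    Function.Injective (E.unit B).toRingHom := fun _ _ h => E.unit_eq_of_cover hS hB fun _ => h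

theorem exists_unit_eq (hS : S.IsPAdic)
    (hB : B.IsCover)
    {x : (E.frame.obj B).carrier} (hx : ∀ {C : EtAlg S.residue} (a b : B ⟶ C),
      (E.frame.map a).toRingHom x = (E.frame.map b).toRingHom x) :
    ∃ s, (E.unit B).toRingHom s = x := by
  obtain ⟨s, hs⟩ := E.exists_unit_glue hS hB (x := fun _ => x) fun _ _ C a b _ => hx a b
  exact ⟨s, hs ()⟩

/-- The value of the bilinear form on the descended module. -/
def formVal (v w : D.Carrier) : S.carrier :=
  (exists_unit_eq hS hB (psi_desc (coord_desc v) (coord_desc w))).choose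

theorem unit_formVal (v w : D.Carrier) :
    (E.unit B).toRingHom (formVal hS hB v w) = psi (D.coord v) (D.coord w) :=
  (exists_unit_eq hS hB (psi_desc (coord_desc v) (coord_desc w))).choose_spec

/-- The bilinear form on the descended module. -/
def form : LinearMap.BilinForm S.carrier D.Carrier :=
  LinearMap.mk₂ S.carrier (formVal hS hB)
    (fun v v' w => unit_injective (E := E) hS hB (by simp only [map_add, unit_formVal,
        psi_add_left]))
    (fun s v w => unit_injective (E := E) hS hB (by
      simp only [smul_eq_mul, map_mul, unit_formVal, map_smulₛₗ, psi_smul_left]))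
    (fun v w w' => unit_injective (E := E) hS hB (by simp only [map_add, unit_formVal,
        psi_add_right]))
    (fun s v w => unit_injective (E := E) hS hB (by
      simp only [smul_eq_mul, map_mul, unit_formVal, map_smulₛₗ, psi_smul_right]))

theorem unit_form (v w : D.Carrier) :
    (E.unit B).toRingHom (form hS hB v w) = psi (D.coord v) (D.coord w) :=
  unit_formVal hS hB v w

theorem form_symm (v w : D.Carrier) : form hS hB v w = form hS hB w v :=
  unit_injective hS hB (by rw [unit_form, unit_form, psi_comm])

variable (G : D.Dual)

/-- The elements of the descended module given by the first dual family. -/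
def Dual.elemX (k : Fin G.N) : D.Carrier := ⟨G.x k, G.x_desc k⟩

/-- The elements of the descended module given by the second dual family. -/
def Dual.elemY (k : Fin G.N) : D.Carrier := ⟨G.y k, G.y_desc k⟩

theorem Dual.isDual : IsDual (form hS hB) G.elemX G.elemY := fun v => coord_injective (by
  rw [map_sum]
  conv_lhs => rw [← one_mulVec (D.coord v), ← G.dyad_eq_one, dyad_mulVec]
  exact Finset.sum_congr rfl fun k _ => by rw [map_smulₛₗ, unit_form]; rfl)

theorem Dual.isCoord (hS : S.IsPAdic)
    (hB : B.IsCover) (G : D.Dual) : IsCoord (form hS hB) D.coord where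
  isom v w := (unit_form hS hB v w).symm
  span := span_eq_top_of_dyad_eq_one (x := G.elemX) (b := G.y) G.dyad_eq_one

theorem Dual.projective (hS : S.IsPAdic)
    (hB : B.IsCover) (G : D.Dual) : Module.Projective S.carrier D.Carrier :=
  Module.Projective.of_split (LinearMap.pi fun k => form hS hB (G.elemY k))
    (Fintype.linearCombination S.carrier G.elemX)
    (LinearMap.ext fun v => (Fintype.linearCombination_apply _ _ _).trans (G.isDual hS hB v).symm)

theorem Dual.finite (hS : S.IsPAdic)
    (hB : B.IsCover) (G : D.Dual) : Module.Finite S.carrier D.Carrier :=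
  Module.Finite.of_surjective (Fintype.linearCombination S.carrier G.elemX) fun v =>
    ⟨fun k => form hS hB (G.elemY k) v,
      (Fintype.linearCombination_apply _ _ _).trans (G.isDual hS hB v).symm⟩

theorem Dual.form_bijective (hS : S.IsPAdic)
    (hB : B.IsCover) (G : D.Dual) :
    Function.Bijective (form hS hB : D.Carrier →ₗ[S.carrier] _) := by
  constructor
  · rw [injective_iff_map_eq_zero]
    intro v hv
    rw [G.isDual hS hB v]
    refine Finset.sum_eq_zero fun k _ => ?_
    rw [form_symm, hv, LinearMap.zero_apply, zero_smul]
  · intro l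
    refine ⟨∑ k, l (G.elemX k) • G.elemY k, LinearMap.ext fun v => ?_⟩
    conv_rhs => rw [G.isDual hS hB v, map_sum]
    rw [map_sum, LinearMap.sum_apply]
    refine Finset.sum_congr rfl fun k _ => ?_
    rw [map_smul, map_smul, LinearMap.smul_apply, smul_eq_mul, smul_eq_mul, mul_comm]

end Form

/-! The grading of the descended module. -/

variable (D) in
/-- The homogeneous elements of the descended module. -/
def grading (d : ℤ) : AddSubgroup D.Carrier := (homVec (E.frame.obj B) μ d).comap D.val

variable (D) in
/-- The projection of the descended module onto its component of degree `d`. -/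
def proj (d : ℤ) : D.Carrier →+ D.Carrier :=
  ((vecProj (E.frame.obj B) μ d).comp D.val).codRestrict D.descGroup fun v {C} a b => by
    rw [AddMonoidHom.comp_apply, vecProj_map, vecProj_map, val_desc v a b,
      vecProj_mulVec (dispGroup_isGradedMat _)]

theorem val_proj (d : ℤ) (v : D.Carrier) : D.val (D.proj d v) = vecProj _ μ d (D.val v) := rfl

theorem isInternal_grading : DirectSum.IsInternal D.grading := by
  classical
  constructor
  · rw [injective_iff_map_eq_zero]
    intro x hx
    have h : ∀ (d : ℤ) (x : DirectSum ℤ fun d => D.grading d),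
        D.proj d (DirectSum.coeAddMonoidHom D.grading x) = x d := by
      intro d x
      induction x using DirectSum.induction_on with
      | zero => simp
      | of e x =>
        rw [DirectSum.coeAddMonoidHom_of]
        refine val_injective ?_
        rw [val_proj]
        by_cases hde : e = d
        · subst hde
          rw [DirectSum.of_eq_same, vecProj_of_mem x.2]
        · rw [DirectSum.of_eq_of_ne _ _ _ (Ne.symm hde), vecProj_of_mem_ne x.2 hde]
          rfl
      | add x y hx hy => rw [map_add, map_add, hx, hy]; rfl
    ext d : 1
    refine Subtype.ext ?_
    rw [← h, hx, map_zero]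
    rfl
  · intro v
    obtain ⟨T, hT⟩ := eq_sum_vecProj μ (D.val v)
    refine ⟨∑ d ∈ T, DirectSum.of (fun d => D.grading d) d ⟨D.proj d v, vecProj_mem _ _⟩, ?_⟩
    rw [map_sum]
    simp only [DirectSum.coeAddMonoidHom_of]
    refine val_injective ?_
    rw [map_sum]
    exact hT.symm

instance : DirectSum.Decomposition D.grading := isInternal_grading.chooseDecomposition

instance : SetLike.GradedSMul S.grading D.grading where
  smul_mem {_ _} _ _ hs hv := smul_mem_homVec ((E.unit B).map_mem _ _ hs) hv

variable (D) in
/-- The descended module as a graded module. -/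
def grMod [Fact p.Prime] (hS : S.IsPAdic)
    (hB : B.IsCover) (G : D.Dual) : GrMod S :=
  letI := G.finite hS hB
  letI := G.projective hS hB
  { carrier := D.Carrier, grading := D.grading }

end DescentDatum

end DescDisplay

/-! ### The Frobenius of the descended module -/

section DescFrobenius

open Matrix

variable {p n : ℕ} {S : Frame.{u} p} {E : EtaleBaseChange S} {μ : Fin n → ℤ} {B : EtAlg S.residue}

namespace DescentDatum

section Twist

variable {D : DescentDatum E μ B} {θ : ∀ S : Frame.{u} p, S.carrier →+* S.grading 0}
  (hθ : ∀ {S S' : Frame.{u} p} (f : S ⟶ S'),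
    (Frame.Hom.zero f).comp (θ S) = (θ S').comp f.toRingHom)

variable (D) in
/-- The inclusion of the base change of the descended module under `θ = σ` or `θ = τ`. -/
def twist : BC (θ S) D.Carrier →ₛₗ[Frame.Hom.zero (E.unit B)]
    (Fin n → (E.frame.obj B).grading 0) :=
  BC.semilift (compCoord (θ (E.frame.obj B)) rfl D.coord) (hθ (E.unit B)).symm

theorem twist_mk (b : S.grading 0) (v : D.Carrier) : D.twist hθ (BC.mk (θ S) b v) =
    Frame.Hom.zero (E.unit B) b • (θ (E.frame.obj B) ∘ D.coord v) :=
  BC.semilift_mk _ _ b v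

variable (D θ) in
/-- The descent condition for vectors of degree zero, twisted by `θ = σ` or `θ = τ`. -/
def TwistDesc (w : Fin n → (E.frame.obj B).grading 0) : Prop :=
  ∀ {C : EtAlg S.residue} (a b : B ⟶ C), Frame.Hom.zero (E.frame.map a) ∘ w =
    (D.g a b).1.val.map (θ (E.frame.obj C)) *ᵥ (Frame.Hom.zero (E.frame.map b) ∘ w)

theorem twistDesc_comp (hθ : ∀ {S S' : Frame.{u} p} (f : S ⟶ S'),
      (Frame.Hom.zero f).comp (θ S) = (θ S').comp f.toRingHom)
    {v : Fin n → (E.frame.obj B).carrier} (hv : D.Desc v) :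
    D.TwistDesc θ (θ (E.frame.obj B) ∘ v) := fun {C} a b => by
  have h : ∀ a : B ⟶ C, Frame.Hom.zero (E.frame.map a) ∘ θ (E.frame.obj B) ∘ v =
      θ (E.frame.obj C) ∘ (E.frame.map a).toRingHom ∘ v := fun a =>
    funext fun j => RingHom.congr_fun (hθ (E.frame.map a)) (v j)
  rw [h, h, hv a b, comp_mulVec]

theorem zero_unit_map (b : S.grading 0) {C : EtAlg S.residue} (a : B ⟶ C) :
    Frame.Hom.zero (E.frame.map a) (Frame.Hom.zero (E.unit B) b) = Frame.Hom.zero (E.unit C) b :=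
  Subtype.ext (E.map_unit a b)

theorem twistDesc_twist (z : BC (θ S) D.Carrier) : D.TwistDesc θ (D.twist hθ z) := by
  intro C a b
  induction z using BC.induction with
  | mk c v =>
    rw [twist_mk, comp_smul, comp_smul, zero_unit_map, zero_unit_map, mulVec_smul,
      twistDesc_comp hθ (coord_desc v) a b]
  | zero =>
    have h : ∀ a : B ⟶ C, Frame.Hom.zero (E.frame.map a) ∘
        (0 : Fin n → (E.frame.obj B).grading 0) = 0 := fun a => funext fun _ => map_zero _
    rw [map_zero, h, h, mulVec_zero]
  | add z z' hz hz' => rw [map_add, comp_add, comp_add, mulVec_add, hz, hz']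

variable [Fact p.Prime] (hS : S.IsPAdic)
  (hB : B.IsCover) (G : D.Dual)

theorem zero_unit_injective (hS : S.IsPAdic)
    (hB : B.IsCover) :
    Function.Injective (Frame.Hom.zero (E.unit B)) := fun _ _ h =>
  Subtype.ext (unit_injective (E := E) hS hB (congrArg Subtype.val h))

theorem isCoord_twist (hS : S.IsPAdic)
    (hB : B.IsCover) (G : D.Dual) : IsCoord (BC.bilin (θ S) (form hS hB)) (D.twist hθ) :=
  ((G.isCoord hS hB).comp _ _).semilift _

theorem twist_injective (hS : S.IsPAdic)
    (hB : B.IsCover) (G : D.Dual) :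
    Function.Injective (D.twist hθ) := by
  intro z z' h
  rw [BC.eq_sum_of_isDual (θ S) (G.isDual hS hB) z, BC.eq_sum_of_isDual (θ S) (G.isDual hS hB) z']
  refine Finset.sum_congr rfl fun k _ => congrArg (· • _)
    (zero_unit_injective (E := E) hS hB ?_)
  rw [← (isCoord_twist hθ hS hB G).isom, ← (isCoord_twist hθ hS hB G).isom, h]

theorem exists_twist_eq (hS : S.IsPAdic)
    (hB : B.IsCover) (G : D.Dual)
    {w : Fin n → (E.frame.obj B).grading 0} (hw : D.TwistDesc θ w) :
    ∃ z, D.twist hθ z = w := by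
  have h1 : ∀ k, ∃ s : S.grading 0, Frame.Hom.zero (E.unit B) s =
      psi (θ (E.frame.obj B) ∘ G.y k) w := by
    intro k
    obtain ⟨s, hs⟩ := exists_unit_eq (E := E) hS hB
      (x := (psi (θ (E.frame.obj B) ∘ G.y k) w : (E.frame.obj B).grading 0)) fun {C} a b => by
        refine congrArg Subtype.val (?_ : Frame.Hom.zero (E.frame.map a) _ =
          Frame.Hom.zero (E.frame.map b) _)
        rw [← psi_map, ← psi_map, hw a b, twistDesc_comp hθ (G.y_desc k) a b]
        exact psi_orthGroup (orthGroup.map (θ (E.frame.obj C)) (Triv.toOrth (D.g a b))) _ _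
    refine ⟨⟨s, E.unit_mem_grading_of_cover hS hB fun _ => ?_⟩, Subtype.ext hs⟩
    rw [hs]
    exact Subtype.prop _
  choose s hs using h1
  refine ⟨∑ k, BC.mk (θ S) (s k) (G.elemX k), ?_⟩
  have h2 := congrArg (fun X => X.map (θ (E.frame.obj B)) *ᵥ w) G.dyad_eq_one
  rw [map_dyad, dyad_mulVec, Matrix.map_one _ (map_zero _) (map_one _), one_mulVec] at h2
  rw [map_sum, ← h2]
  exact Finset.sum_congr rfl fun k _ => by rw [twist_mk, hs]; rfl

end Twist

end DescentDatum

/-- A descent datum for the standard orthogonal graded module, together with a Frobenius. -/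
structure DisplayDatum (E : EtaleBaseChange S) (μ : Fin n → ℤ) (B : EtAlg S.residue) extends
    DescentDatum E μ B where
  alpha : orthGroup n ((E.frame.obj B).grading 0)
  alpha_map : ∀ {C : EtAlg S.residue} (a b : B ⟶ C),
    orthGroup.map (Frame.Hom.zero (E.frame.map b)) alpha =
      (dispGroup.toZero (E.frame.obj C) μ (E.frame.obj C).tau (g a b))⁻¹ *
        orthGroup.map (Frame.Hom.zero (E.frame.map a)) alpha *
          dispGroup.toZero (E.frame.obj C) μ (E.frame.obj C).sigma (g a b)

namespace DisplayDatum

variable (D : DisplayDatum E μ B)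

theorem alpha_desc {w : Fin n → (E.frame.obj B).grading 0} (hw : D.TwistDesc Frame.sigma w) :
    D.TwistDesc Frame.tau ((D.alpha : GL (Fin n) _).val *ᵥ w) := by
  intro C a b
  let gτ := dispGroup.toZero (E.frame.obj C) μ (E.frame.obj C).tau (D.g a b)
  let gσ := dispGroup.toZero (E.frame.obj C) μ (E.frame.obj C).sigma (D.g a b)
  have h : gτ * orthGroup.map (Frame.Hom.zero (E.frame.map b)) D.alpha =
      orthGroup.map (Frame.Hom.zero (E.frame.map a)) D.alpha * gσ := by
    rw [D.alpha_map a b, ← mul_assoc, ← mul_assoc, mul_inv_cancel, one_mul]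
  have h1 := congrArg (fun x : orthGroup n _ => (x : GL (Fin n) _).val *ᵥ
    (Frame.Hom.zero (E.frame.map b) ∘ w)) h
  rw [comp_mulVec, comp_mulVec, hw a b, mulVec_mulVec, mulVec_mulVec]
  exact h1.symm

theorem alpha_inv_desc {w : Fin n → (E.frame.obj B).grading 0} (hw : D.TwistDesc Frame.tau w) :
    D.TwistDesc Frame.sigma (((D.alpha⁻¹ : orthGroup n _) : GL (Fin n) _).val *ᵥ w) := by
  intro C a b
  let gτ := dispGroup.toZero (E.frame.obj C) μ (E.frame.obj C).tau (D.g a b)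
  let gσ := dispGroup.toZero (E.frame.obj C) μ (E.frame.obj C).sigma (D.g a b)
  have h : (orthGroup.map (Frame.Hom.zero (E.frame.map a)) D.alpha⁻¹) * gτ =
      gσ * orthGroup.map (Frame.Hom.zero (E.frame.map b)) D.alpha⁻¹ := by
    rw [map_inv, map_inv, D.alpha_map a b]
    change _ * gτ = gσ * (gτ⁻¹ * _ * gσ)⁻¹
    group
  have h1 := congrArg (fun x : orthGroup n _ => (x : GL (Fin n) _).val *ᵥ
    (Frame.Hom.zero (E.frame.map b) ∘ w)) h
  rw [comp_mulVec, comp_mulVec, hw a b, mulVec_mulVec, mulVec_mulVec]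
  exact h1

open DescentDatum

variable [Fact p.Prime] (hS : S.IsPAdic)
  (hB : B.IsCover) (G : D.Dual)

/-- The Frobenius of the descended module. -/
def frobFun (v : D.Carrier) : BC S.tau D.Carrier :=
  (exists_twist_eq Frame.Hom.tau_comp hS hB G
    (D.alpha_desc (twistDesc_comp Frame.Hom.sigma_comp (coord_desc v)))).choose

theorem twist_frobFun (v : D.Carrier) : D.twist Frame.Hom.tau_comp (D.frobFun hS hB G v) =
    (D.alpha : GL (Fin n) _).val *ᵥ ((E.frame.obj B).sigma ∘ D.coord v) :=
  (exists_twist_eq Frame.Hom.tau_comp hS hB G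
    (D.alpha_desc (twistDesc_comp Frame.Hom.sigma_comp (coord_desc v)))).choose_spec

/-- The Frobenius of the descended module as a semilinear map. -/
def frob : D.Carrier →ₛₗ[S.sigma] BC S.tau D.Carrier where
  toFun := D.frobFun hS hB G
  map_add' v w := twist_injective Frame.Hom.tau_comp hS hB G (by
    rw [map_add, twist_frobFun, twist_frobFun, twist_frobFun, map_add, comp_add, mulVec_add])
  map_smul' s v := twist_injective Frame.Hom.tau_comp hS hB G (by
    rw [map_smulₛₗ, twist_frobFun, twist_frobFun, map_smulₛₗ, comp_smul, mulVec_smul]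
    exact congrArg (· • _) (RingHom.congr_fun (Frame.Hom.sigma_comp (E.unit B)) s).symm)

theorem twist_frob (v : D.Carrier) : D.twist Frame.Hom.tau_comp (D.frob hS hB G v) =
    (D.alpha : GL (Fin n) _).val *ᵥ ((E.frame.obj B).sigma ∘ D.coord v) :=
  D.twist_frobFun hS hB G v

theorem twist_lift_frob (z : BC S.sigma D.Carrier) :
    D.twist Frame.Hom.tau_comp (BC.lift (D.frob hS hB G) z) =
      (D.alpha : GL (Fin n) _).val *ᵥ D.twist Frame.Hom.sigma_comp z := by
  induction z using BC.induction with
  | mk b v => rw [BC.lift_mk, map_smulₛₗ, twist_frob, twist_mk, mulVec_smul]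
  | zero => rw [map_zero, map_zero, map_zero, mulVec_zero]
  | add z z' hz hz' => rw [map_add, map_add, map_add, mulVec_add, hz, hz']

theorem frob_bijective : Function.Bijective (BC.lift (D.frob hS hB G)) := by
  constructor
  · intro z z' h
    refine twist_injective Frame.Hom.sigma_comp hS hB G ?_
    rw [← orthGroup_inv_mulVec D.alpha (D.twist Frame.Hom.sigma_comp z),
      ← twist_lift_frob D hS hB G, h, twist_lift_frob, orthGroup_inv_mulVec]
  · intro z
    obtain ⟨z', hz'⟩ := exists_twist_eq Frame.Hom.sigma_comp hS hB G
      (D.alpha_inv_desc (twistDesc_twist Frame.Hom.tau_comp z))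
    refine ⟨z', twist_injective Frame.Hom.tau_comp hS hB G ?_⟩
    rw [twist_lift_frob, hz', orthGroup_mulVec_inv]

theorem form_frob (v w : D.Carrier) : S.sigma (DescentDatum.form hS hB v w) =
    BC.bilin S.tau (DescentDatum.form hS hB) (D.frob hS hB G v) (D.frob hS hB G w) := by
  refine zero_unit_injective (E := E) hS hB ?_
  rw [← (isCoord_twist (D := D.toDescentDatum) Frame.Hom.tau_comp hS hB G).isom, twist_frob,
    twist_frob, psi_orthGroup, psi_map, ← unit_form hS hB]
  exact RingHom.congr_fun (Frame.Hom.sigma_comp (E.unit B)) _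

/-- The orthogonal display defined by a descent datum. -/
def display (hμ : ∀ i, μ i + μ (Fin.rev i) = 0) : OrthDisplay S where
  toGrMod := D.grMod hS hB G
  F := D.frob hS hB G
  F_bijective := D.frob_bijective hS hB G
  form := DescentDatum.form (D := D.toDescentDatum) hS hB
  form_symm := DescentDatum.form_symm hS hB
  form_mem i j v w hv hw := E.unit_mem_grading_of_cover hS hB fun _ => by
    have h := psi_mem_grading hμ (S := E.frame.obj B) hv hw
    exact (unit_form (D := D.toDescentDatum) hS hB v w).symm ▸ h
  form_perfect := G.form_bijective hS hB
  form_F := D.form_frob hS hB G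

variable (hμ : ∀ i, μ i + μ (Fin.rev i) = 0)

/-- The tautological trivialization of the descended display. -/
def triv : Triv (D.display hS hB G hμ) μ (E.unit B) where
  coord := D.coord
  mem _ _ hv := hv
  isCoord := G.isCoord hS hB

theorem triv_desc {C : EtAlg S.residue} (a b : B ⟶ C) (m : (D.display hS hB G hμ).carrier) :
    (E.frame.map a).toRingHom ∘ (D.triv hS hB G hμ).coord m =
      (D.g a b).1.val *ᵥ ((E.frame.map b).toRingHom ∘ (D.triv hS hB G hμ).coord m) :=
  coord_desc (D := D.toDescentDatum) m a b

theorem alpha_triv : (D.triv hS hB G hμ).alpha = D.alpha :=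
  Triv.alpha_eq _ fun m => (D.twist_frob hS hB G m).symm

theorem locallyTrivial_display : LocallyTrivial E μ (D.display hS hB G hμ) :=
  ⟨Unit, fun _ => B, fun _ => EtAlg.fromSelf B, hB, fun _ => ⟨D.triv hS hB G hμ⟩⟩

end DisplayDatum

end DescFrobenius

/-! ### The type of a locally trivial orthogonal display -/

section TypeOfTriv

variable {p n : ℕ} {S : Frame.{u} p} {μ : Fin n → ℤ}

theorem Frame.Hom.rho_apply {S' : Frame.{u} p} (f : S ⟶ S') (s : S.carrier) :
    S'.rho (f.toRingHom s) = Frame.Hom.residue f (S.rho s) := by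
  induction s using DirectSum.Decomposition.inductionOn S.grading with
  | zero => simp only [map_zero]
  | @homogeneous d s =>
    by_cases hd : d = 0
    · subst hd
      rw [S.rho_of_mem_zero]
      exact S'.rho_of_mem_zero (Frame.Hom.zero f s)
    · rw [S.rho_of_mem_ne hd s.2, S'.rho_of_mem_ne hd (f.map_mem d s s.2), map_zero]
  | add a b ha hb => simp only [map_add, ha, hb]

variable {E : EtaleBaseChange S}

/-- The reduction map from the graded ring `𝐒(A)` to `A`. -/
def EtaleBaseChange.toAlg (E : EtaleBaseChange S) (A : EtAlg S.residue) :
    (E.frame.obj A).carrier →+* A.obj :=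
  (E.residueEquiv A).toRingHom.comp (E.frame.obj A).rho

theorem EtaleBaseChange.toAlg_unit (A : EtAlg S.residue) (s : S.carrier) :
    E.toAlg A ((E.unit A).toRingHom s) = algebraMap S.residue A.obj (S.rho s) := by
  rw [← E.residueEquiv_unit, ← Frame.Hom.rho_apply]
  rfl

theorem EtaleBaseChange.toAlg_of_mem_ne {A : EtAlg S.residue} {d : ℤ} (hd : d ≠ 0)
    {s : (E.frame.obj A).carrier} (hs : s ∈ (E.frame.obj A).grading d) : E.toAlg A s = 0 :=
  (congrArg (E.residueEquiv A) ((E.frame.obj A).rho_of_mem_ne hd hs)).trans (map_zero _)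

variable {M : OrthDisplay S} {A : EtAlg S.residue} (φ : Triv M μ (E.unit A)) (i : ℤ)

namespace Triv

/-- The reduction of a trivialization in degree `i`, as a semilinear map. -/
def redCoord : M.carrier →ₛₗ[S.rho] ({j // μ j = i} → A.obj) where
  toFun m j := E.toAlg A (φ.coord m j)
  map_add' x y := funext fun j => by rw [map_add, Pi.add_apply, map_add]; rfl
  map_smul' s x := funext fun j => by
    rw [map_smulₛₗ, Pi.smul_apply, smul_eq_mul, map_mul, E.toAlg_unit, Pi.smul_apply,
      Algebra.smul_def]

/-- The reduction of a trivialization in degree `i`. -/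
def redHom : A.obj ⊗[S.residue] M.redPiece i →ₗ[A.obj] ({j // μ j = i} → A.obj) :=
  LinearMap.liftBaseChange A.obj (M.redLift i (φ.redCoord i))

theorem redHom_tmul_mk (m : M.grading i) (j : {j // μ j = i}) :
    φ.redHom i (1 ⊗ₜ M.redMk m) j = E.toAlg A (φ.coord m j) := by
  rw [redHom, LinearMap.liftBaseChange_tmul, one_smul, GrMod.redLift_mk]
  rfl

/-- The classes of degree `i` of a homogeneous dual family. -/
def redFamily (D : HomDual M) (k : Fin D.N) : M.redPiece i :=
  if h : D.deg k = i then M.redMk ⟨D.x k, h ▸ D.x_mem k⟩ else 0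

theorem redHom_redFamily (D : HomDual M) (k : Fin D.N) (j : {j // μ j = i}) :
    φ.redHom i (1 ⊗ₜ redFamily i D k) j = E.toAlg A (φ.coord (D.x k) j) := by
  rw [redFamily]
  split_ifs with h
  · exact φ.redHom_tmul_mk i _ j
  · have h' : D.deg k - μ j ≠ 0 := by rw [j.2]; omega
    rw [tmul_zero, map_zero, E.toAlg_of_mem_ne h' (φ.mem _ _ (D.x_mem k) j)]
    rfl

/-- The inverse of the reduction of a trivialization in degree `i`. -/
def redInv (D : HomDual M) :
    ({j // μ j = i} → A.obj) →ₗ[A.obj] A.obj ⊗[S.residue] M.redPiece i :=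
  Fintype.linearCombination A.obj fun j =>
    ∑ k, E.toAlg A (φ.coord (D.y k) (Fin.rev j)) • ((1 : A.obj) ⊗ₜ[S.residue] redFamily i D k)

theorem redHom_redInv (D : HomDual M) : φ.redHom i ∘ₗ φ.redInv i D = LinearMap.id := by
  classical
  refine LinearMap.pi_ext' fun j => LinearMap.ext_ring (funext fun a => ?_)
  rw [LinearMap.comp_apply, LinearMap.comp_apply, LinearMap.single_apply, redInv,
    Fintype.linearCombination_apply_single, one_smul, map_sum, Finset.sum_apply]
  have h := congrArg (E.toAlg A) (congrFun (congrFun (φ.isCoord.dyad_self D.dual) a) j)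
  rw [dyad, Matrix.of_apply, map_sum] at h
  refine (Finset.sum_congr rfl fun k _ => ?_).trans (h.trans ?_)
  · rw [map_smul, Pi.smul_apply, redHom_redFamily, smul_eq_mul, map_mul, mul_comm]
  · rw [LinearMap.comp_apply, LinearMap.id_apply, LinearMap.single_apply, Matrix.one_apply,
      Pi.single_apply, apply_ite (E.toAlg A), map_one, map_zero]
    simp only [Subtype.ext_iff]

theorem redInv_redHom_mk (D : HomDual M) (m : M.grading i) :
    φ.redInv i D (φ.redHom i (1 ⊗ₜ M.redMk m)) = 1 ⊗ₜ M.redMk m := by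
  classical
  have h : ∀ k, S.rho (M.form (D.y k) m) • ((1 : A.obj) ⊗ₜ[S.residue] redFamily i D k) =
      ∑ j : {j // μ j = i}, (E.toAlg A (φ.coord m j) * E.toAlg A (φ.coord (D.y k) (Fin.rev j))) •
        ((1 : A.obj) ⊗ₜ[S.residue] redFamily i D k) := fun k => by
    rw [← Finset.sum_smul, ← algebraMap_smul A.obj, ← E.toAlg_unit, ← φ.isCoord.isom, psi_comm, psi,
      map_sum, ← Finset.sum_subtype (Finset.univ.filter (μ · = i)) (by simp)
        fun j => E.toAlg A (φ.coord m j) * E.toAlg A (φ.coord (D.y k) (Fin.rev j))]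
    refine congrArg (· • _) ?_
    rw [Finset.sum_filter_of_ne]
    · exact Finset.sum_congr rfl fun j _ => map_mul _ _ _
    · intro j _ hj
      by_contra hji
      refine hj ?_
      rw [E.toAlg_of_mem_ne (by omega : i - μ j ≠ 0) (φ.mem _ _ m.2 j), zero_mul]
  conv_rhs => rw [M.redMk_eq_sum D m, tmul_sum]
  rw [redInv, Fintype.linearCombination_apply]
  simp only [redHom_tmul_mk, Finset.smul_sum, smul_smul]
  rw [Finset.sum_comm]
  exact Finset.sum_congr rfl fun k _ => by rw [tmul_smul]; exact (h k).symm

theorem redInv_redHom (D : HomDual M) : φ.redInv i D ∘ₗ φ.redHom i = LinearMap.id := by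
  refine TensorProduct.AlgebraTensorModule.curry_injective (LinearMap.ext_ring (LinearMap.ext ?_))
  intro x
  change φ.redInv i D (φ.redHom i (1 ⊗ₜ x)) = 1 ⊗ₜ x
  induction x using M.redPiece_induction with
  | mk m => exact φ.redInv_redHom_mk i D m
  | zero => rw [tmul_zero, map_zero, map_zero]
  | add x y hx hy => rw [tmul_add, map_add, map_add, hx, hy]
  | smul r x hx => rw [tmul_smul, ← algebraMap_smul A.obj r, map_smul, map_smul, hx]

/-- The graded piece of degree `i` of the reduction of a trivialized display. -/
def redEquiv : (A.obj ⊗[S.residue] M.redPiece i) ≃ₗ[A.obj] ({j // μ j = i} → A.obj) :=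
  LinearEquiv.ofLinearMap (φ.redHom i) (φ.redInv i M.homDual) (φ.redHom_redInv i _)
    (φ.redInv_redHom i _)

end Triv

theorem LocallyTrivial.hasType (hM : LocallyTrivial E μ M) : M.HasType μ := by
  intro i q
  obtain ⟨ι, B, f, hf, hB⟩ := hM
  obtain ⟨b, q', rfl⟩ := hf.2 q
  obtain ⟨φ⟩ := hB b
  have : Nontrivial (B b).obj := q'.nontrivial
  have h : (EtAlg.algHom (f b)).toRingHom = algebraMap S.residue (B b).obj :=
    (EtAlg.algHom (f b)).comp_algebraMap
  refine (congrArg (Module.rankAtStalk (R := S.residue) (M.redPiece i))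
    (congrArg (fun g : S.residue →+* (B b).obj => PrimeSpectrum.comap g q') h)).trans ?_
  rw [← Module.rankAtStalk_baseChange, Module.rankAtStalk_eq_of_equiv (φ.redEquiv i),
    Module.rankAtStalk_eq_finrank_of_free, Module.finrank_pi]
  rfl

end TypeOfTriv

/-! ### Morphisms of `O(ψ)`-displays given by local sections -/

section SectionHom

variable {p n : ℕ} {S : Frame.{u} p} {E : EtaleBaseChange S} {μ : Fin n → ℤ}

namespace OrthGroupDisplay

theorem act_injective (P : OrthGroupDisplay E μ) {A : EtAlg S.residue} (q : P.sheaf.obj A)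
    {h h' : dispGroup (E.frame.obj A) μ} (hh : P.act A q h = P.act A q h') : h = h' :=
  (P.simply_transitive A q (P.act A q h')).unique hh rfl

theorem map_act (P : OrthGroupDisplay E μ) {A B : EtAlg S.residue} (f : A ⟶ B)
    (q : P.sheaf.obj A) (h : dispGroup (E.frame.obj A) μ) :
    P.sheaf.map f (P.act A q h) =
      P.act B (P.sheaf.map f q) (dispGroup.map (E.frame.map f) μ h) :=
  P.act_map f q h

theorem act_act (P : OrthGroupDisplay E μ) {A : EtAlg S.residue} (q : P.sheaf.obj A)
    (g h : dispGroup (E.frame.obj A) μ) : P.act A (P.act A q g) h = P.act A q (g * h) :=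
  (P.act_mul A q g h).symm

variable (P Q : OrthGroupDisplay E μ) {B : EtAlg S.residue}

/-- Sections `q` of `P` and `q'` of `Q` over `B` correspond if their descent data agree. -/
def Matches (q : P.sheaf.obj B) (q' : Q.sheaf.obj B) : Prop :=
  ∀ ⦃C : EtAlg S.residue⦄ (a b : B ⟶ C) (k : dispGroup (E.frame.obj C) μ),
    P.act C (P.sheaf.map a q) k = P.sheaf.map b q → Q.act C (Q.sheaf.map a q') k = Q.sheaf.map b q'

variable {P Q} {q : P.sheaf.obj B} {q' : Q.sheaf.obj B}

theorem Matches.act_eq (hq : Matches P Q q q') {C : EtAlg S.residue} (a b : B ⟶ C)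
    {k k' : dispGroup (E.frame.obj C) μ}
    (h : P.act C (P.sheaf.map a q) k = P.act C (P.sheaf.map b q) k') :
    Q.act C (Q.sheaf.map a q') k = Q.act C (Q.sheaf.map b q') k' := by
  have h1 : P.act C (P.sheaf.map a q) (k * k'⁻¹) = P.sheaf.map b q := by
    rw [← act_act, h, act_act, mul_inv_cancel]
    exact P.act_one C _
  rw [← hq a b _ h1, act_act, inv_mul_cancel_right]

/-- The correspondence between the sections of `P` and of `Q` defined by matching sections over a
covering. -/
def Corr (q : P.sheaf.obj B) (q' : Q.sheaf.obj B) {A : EtAlg S.residue} (x : P.sheaf.obj A)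
    (y : Q.sheaf.obj A) : Prop :=
  ∀ ⦃C : EtAlg S.residue⦄ (f : A ⟶ C) (a : B ⟶ C) (k : dispGroup (E.frame.obj C) μ),
    P.act C (P.sheaf.map a q) k = P.sheaf.map f x → Q.act C (Q.sheaf.map a q') k = Q.sheaf.map f y

theorem Corr.map {A A' : EtAlg S.residue} {x : P.sheaf.obj A} {y : Q.sheaf.obj A}
    (h : Corr q q' x y) (g : A ⟶ A') : Corr q q' (P.sheaf.map g x) (Q.sheaf.map g y) := by
  intro C f a k hk
  rw [← Functor.map_comp_apply] at hk ⊢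
  exact h _ a k hk

theorem Corr.act {A : EtAlg S.residue} {x : P.sheaf.obj A} {y : Q.sheaf.obj A}
    (h : Corr q q' x y) (g : dispGroup (E.frame.obj A) μ) :
    Corr q q' (P.act A x g) (Q.act A y g) := by
  intro C f a k hk
  rw [map_act] at hk ⊢
  rw [← h f a (k * (dispGroup.map (E.frame.map f) μ g)⁻¹), act_act, inv_mul_cancel_right]
  rw [← act_act, hk, act_act, mul_inv_cancel]
  exact P.act_one C _

theorem Corr.unique (hB : B.IsCover)
    {A : EtAlg S.residue} {x : P.sheaf.obj A} {y y' : Q.sheaf.obj A}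
    (h : Corr q q' x y) (h' : Corr q q' x y') : y = y' := by
  obtain ⟨B', f', b, hf'⟩ := hB.exists_baseChange_self A
  refine Q.sheaf_ext hf' fun i => ?_
  obtain ⟨k, hk⟩ := P.exists_act_eq (P.sheaf.map (b i) q) (P.sheaf.map (f' i) x)
  rw [← h (f' i) (b i) k hk, ← h' (f' i) (b i) k hk]

theorem Matches.exists_corr (hq : Matches P Q q q')
    (hB : B.IsCover) {A : EtAlg S.residue}
    (x : P.sheaf.obj A) : ∃ y, Corr q q' x y := by
  obtain ⟨B', f', b, hf'⟩ := hB.exists_baseChange_self A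
  choose k hk using fun i => P.exists_act_eq (P.sheaf.map (b i) q) (P.sheaf.map (f' i) x)
  have key : ∀ (i : Unit) {C : EtAlg S.residue} (g : B' i ⟶ C) (a : B ⟶ C)
      (l : dispGroup (E.frame.obj C) μ),
      P.act C (P.sheaf.map a q) l = P.sheaf.map (f' i ≫ g) x →
      Q.act C (Q.sheaf.map a q') l =
        Q.sheaf.map g (Q.act (B' i) (Q.sheaf.map (b i) q') (k i)) := by
    intro i C g a l hl
    rw [map_act, ← Functor.map_comp_apply]
    refine hq.act_eq _ _ ?_
    rw [hl, Functor.map_comp_apply, ← hk i, map_act, ← Functor.map_comp_apply]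
  obtain ⟨y, hy, -⟩ := Q.isSheaf B' f' hf' (fun i => Q.act (B' i) (Q.sheaf.map (b i) q') (k i))
    (fun i j C g h hgh => by
      obtain ⟨l, hl⟩ := P.exists_act_eq (P.sheaf.map (b i ≫ g) q) (P.sheaf.map (f' i ≫ g) x)
      rw [← key i g _ l hl, ← key j h _ l (hgh ▸ hl)])
  refine ⟨y, fun C f a l hl => ?_⟩
  obtain ⟨B'', f'', b'', hf'', hb⟩ := hf'.exists_baseChange f
  refine Q.sheaf_ext hf'' fun i => ?_
  rw [map_act, ← Functor.map_comp_apply, ← Functor.map_comp_apply, ← hb,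
    Functor.map_comp_apply _ (f' i), hy]
  refine key i (b'' i) _ _ ?_
  rw [hb, P.sheaf.map_comp_apply f, ← hl, map_act, ← Functor.map_comp_apply]

theorem Corr.alpha_eq [Fact p.Prime]
    (hB : B.IsCover)
    (hα : Q.alpha B q' = P.alpha B q) {A : EtAlg S.residue} {x : P.sheaf.obj A}
    {y : Q.sheaf.obj A} (h : Corr q q' x y) : Q.alpha A y = P.alpha A x := by
  obtain ⟨B', f', b, hf'⟩ := hB.exists_baseChange_self A
  have h1 : ∀ i, orthGroup.map (Frame.Hom.zero (E.frame.map (f' i))) (Q.alpha A y) =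
      orthGroup.map (Frame.Hom.zero (E.frame.map (f' i))) (P.alpha A x) := fun i => by
    obtain ⟨k, hk⟩ := P.exists_act_eq (P.sheaf.map (b i) q) (P.sheaf.map (f' i) x)
    have h2 : Q.alpha (B' i) (Q.sheaf.map (b i) q') = P.alpha (B' i) (P.sheaf.map (b i) q) := by
      rw [Q.alpha_map, P.alpha_map, hα]
    refine (Q.alpha_map (f' i) y).symm.trans (Eq.trans ?_ (P.alpha_map (f' i) x))
    refine (congrArg _ (h (f' i) (b i) k hk)).symm.trans (Eq.trans ?_ (congrArg _ hk))
    exact (Q.alpha_act _ _ k).trans (by rw [h2, ← P.alpha_act])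
  refine Subtype.ext (Units.ext (Matrix.ext fun r s => Subtype.ext (E.eq_of_cover hf' fun i => ?_)))
  exact congrArg (fun g : orthGroup n ((E.frame.obj (B' i)).grading 0) =>
    ((g : GL (Fin n) ((E.frame.obj (B' i)).grading 0)).val r s).1) (h1 i)

theorem Matches.nonempty_hom [Fact p.Prime] (hq : Matches P Q q q')
    (hB : B.IsCover)
    (hα : Q.alpha B q' = P.alpha B q) : Nonempty (P ⟶ Q) := by
  choose y hy using fun (A : EtAlg S.residue) (x : P.sheaf.obj A) => hq.exists_corr hB x
  exact ⟨{
    hom :=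
      { app := fun A => TypeCat.ofHom (y A)
        naturality := fun A A' f => ConcreteCategory.hom_ext _ _ fun x =>
          Corr.unique hB (hy A' (P.sheaf.map f x)) ((hy A x).map f) }
    hom_act := fun A x g => Corr.unique hB (hy A (P.act A x g)) ((hy A x).act g)
    hom_alpha := fun A x => (hy A x).alpha_eq hB hα }⟩

end OrthGroupDisplay

end SectionHom

/-! ### Essential surjectivity -/

section EssSurj

open Matrix

variable {p n : ℕ} {S : Frame.{u} p} {E : EtaleBaseChange S} {μ : Fin n → ℤ} {B : EtAlg S.residue}

/-- The descent datum defined by a local section of an `O(ψ)`-display. -/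
def OrthGroupDisplay.datum (Q : OrthGroupDisplay E μ) (q : Q.sheaf.obj B) : DisplayDatum E μ B where
  g a b := (Q.exists_act_eq (Q.sheaf.map a q) (Q.sheaf.map b q)).choose
  g_map f a b := by
    refine Q.act_injective (Q.sheaf.map (a ≫ f) q) ?_
    rw [(Q.exists_act_eq _ _).choose_spec, Functor.map_comp_apply, ← map_act,
      (Q.exists_act_eq _ _).choose_spec, Functor.map_comp_apply]
  g_mul a b c := by
    refine Q.act_injective (Q.sheaf.map a q) ?_
    rw [← act_act, (Q.exists_act_eq _ _).choose_spec, (Q.exists_act_eq _ _).choose_spec,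
      (Q.exists_act_eq _ _).choose_spec]
  alpha := Q.alpha B q
  alpha_map a b := by
    rw [← Q.alpha_map, ← Q.alpha_map, ← Q.alpha_act, (Q.exists_act_eq _ _).choose_spec]

theorem OrthGroupDisplay.act_datum (Q : OrthGroupDisplay E μ) (q : Q.sheaf.obj B)
    {C : EtAlg S.residue} (a b : B ⟶ C) :
    Q.act C (Q.sheaf.map a q) ((Q.datum q).g a b) = Q.sheaf.map b q :=
  (Q.exists_act_eq (Q.sheaf.map a q) (Q.sheaf.map b q)).choose_spec

theorem essSurj_trivFunctor [Fact p.Prime] (E : EtaleBaseChange S) (hp : 3 ≤ p) (hS : S.IsPAdic)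
    (hμ : ∀ i, μ i + μ (Fin.rev i) = 0) : (trivFunctor E hp hS hμ).EssSurj where
  mem_essImage Q := by
    obtain ⟨B, hB, ⟨q⟩⟩ := Q.toEtaleTorsor.exists_section
    let D := Q.datum q
    obtain ⟨G⟩ := D.toDescentDatum.nonempty_dual hμ hB
    let M : OrthDisplayOfType S μ :=
      ⟨D.display hS hB G hμ, (D.locallyTrivial_display hS hB G hμ).hasType⟩
    let P := (trivFunctor E hp hS hμ).obj M
    let φ : P.sheaf.obj B := D.triv hS hB G hμ
    have h : P.Matches Q φ q := by
      intro C a b k hk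
      have h1 : P.act C (P.sheaf.map a φ) (D.g a b) = P.sheaf.map b φ :=
        Triv.ext_apply fun m => by
          refine (Triv.act_coord _ _ m).trans ?_
          refine (congrArg _ (D.triv_desc hS hB G hμ a b m)).trans ?_
          exact orthGroup_inv_mulVec (Triv.toOrth (D.g a b)) _
      rw [P.act_injective _ (hk.trans h1.symm)]
      exact Q.act_datum q a b
    obtain ⟨ω⟩ := h.nonempty_hom hB (D.alpha_triv hS hB G hμ).symm
    have := OrthGroupDisplay.isIso_hom ω
    exact ⟨M, ⟨asIso ω⟩⟩

end EssSurj

end Displays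

end

theorem proposition4 {p : ℕ} [Fact p.Prime] (hp : 3 ≤ p) (S : Displays.Frame.{u} p)
    (hS : S.IsPAdic) {n : ℕ} (μ : Fin n → ℤ) (hμ : Displays.IsOrthogonalType μ) :
    Nonempty (Displays.EtaleBaseChange S) ∧
      ∀ E : Displays.EtaleBaseChange S,
        Nonempty (CategoryTheory.Equivalence (Displays.OrthDisplayOfType S μ)
          (Displays.OrthGroupDisplay E μ)) := by
  refine ⟨⟨Displays.etaleBaseChange hS⟩, fun E => ?_⟩
  have := Displays.faithful_trivFunctor E hp hS hμ.2
  have := Displays.full_trivFunctor E hp hS hμ.2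
  have := Displays.essSurj_trivFunctor E hp hS hμ.2
  have : (Displays.trivFunctor E hp hS hμ.2).IsEquivalence := {}
  exact ⟨(Displays.trivFunctor E hp hS hμ.2).asEquivalence⟩
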